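/- **Setting.** Let $0<A_1<A_2$ and let $u_0\in C^4(\mathbb R)$ be real valued with $u_0(x)\to A_1$ as $x\to-\infty$ and $u_0(x)\to A_2$ as $x\to+\infty$. Put $m_0=u_0-u_0''$ and assume that $m_0>0$, that $x^n(m_0-A_1)\in L^1(-\infty,0)$ and $x^n(m_0-A_2)\in L^1(0,\infty)$ for $n=0,1,2$, and that $x^n\,m_0^{(l)}\in L^1(\mathbb R)$ for $n=0,1,2$, $l=1,2$. For $j=1,2$ let $l_j(\lambda)=\sqrt{\lambda^2-A_j^{-2}}$ with branch cut $[-\frac1{A_j},\frac1{A_j}]$ and $l_j(\lambda)\sim\lambda$ at infinity; for real $\lambda$ all quantities below are taken as boundary values from the upper half-plane $\mathbb C_+$. Let $\sigma_1=\begin{pmatrix}0&1\\1&0\end{pmatrix}$, $\sigma_2=\begin{pmatrix}0&-\mathrm i\\ \mathrm i&0\end{pmatrix}$, $\sigma_3=\begin{pmatrix}1&0\\0&-1\end{pmatrix}$, and $$H_j^{-1}(\lambda)=\sqrt{\tfrac12}\sqrt{\tfrac1{\mathrm iA_jl_j(\lambda)}-1}\begin{pmatrix}\frac{\lambda A_j}{1-\mathrm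 iA_jl_j(\lambda)}&1\\1&\frac{\lambda A_j}{1-\mathrm iA_jl_j(\lambda)}\end{pmatrix},$$ where the square root of $\frac1{\mathrm iA_jl_j}-1$ has branch cut $[0,\infty)$ and $\sqrt{-1}=\mathrm i$. Let $$f_j(x,\lambda)=\mathrm iA_jl_j(\lambda)\Big(\tfrac1{2A_j}\int_{(-1)^j\infty}^x(m_0-A_j)\,d\xi+\tfrac x2\Big).$$ The columns $\widetilde\Psi_j^{(k)}$ of the Jost solutions are the solutions, bounded near $(-1)^j\infty$, of the corresponding columns of $$\widetilde\Psi_j(x)=I+\int_{(-1)^j\infty}^x e^{\frac{\mathrm il_j}2\int_x^\xi m_0\,d\tau\,\sigma_3}\Big(\tfrac{\lambda(m_0(\xi)-A_j)}{2A_jl_j}\sigma_2+\tfrac{m_0(\xi)-A_j}{2\mathrm iA_j^2l_j}\sigma_3\Big)\widetilde\Psi_j(\xi)\,e^{-\frac{\mathrm il_j}2\int_x^\xi m_0\,d\tau\,\sigma_3}\,d\xi ,$$ and $\Psi_j=H_j^{-1}\widetilde\Psi_je^{-f_j\sigma_3}$. The scattering coefficients are $c_{11}=\det(\Psi_1^{(1)},\Psi_2^{(2)})$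 and $c_{21}=\det(\Psi_2^{(1)},\Psi_1^{(1)})$, which do not depend on $x$, and the reflection coefficient is $r(\lambda)=c_{21}(\lambda)/c_{11}(\lambda)$ for real $\lambda$ with $|\lambda|>\frac1{A_2}$, $|\lambda|\ne\frac1{A_1}$. Assume that there are no solitons: $c_{11}(\lambda)\ne0$ for real $\lambda$ with $|\lambda|<\frac1{A_2}$. **Riemann–Hilbert problem at $t=0$.** For $y\in\mathbb R$, find a $2\times2$ matrix function $\hat N(y,0,\lambda)$, analytic in $\lambda\in\mathbb C\setminus\mathbb R$, such that * it has limits $\hat N_\pm$ from $\mathbb C_\pm$ at every real $\lambda\ne\pm\frac1{A_1},\pm\frac1{A_2}$, and $\hat N_+=\hat N_-\hat G$ there. Here $\hat G=-\mathrm i\sigma_1$ for $|\lambda|<\frac1{A_2}$ and $\hat G=e^{-\hat f_2\sigma_3}G_0\,e^{\hat f_2\sigma_3}$ with $\hat f_2=\frac{\mathrm iA_2l_2(\lambda)}2y$ for $|\lambda|>\frac1{A_2}$, where $G_0=\begin{pmatrix}1-|r|^2&-\bar r\\r&1\end{pmatrix}$ for $|\lambda|>\frac1{A_1}$ and $G_0=\begin{pmatrix}0&-\frac1r\\r&1\end{pmatrix}$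 for $\frac1{A_2}<|\lambda|<\frac1{A_1}$; * $\hat N=O(|\lambda-p|^{-1/4})$ as $\lambda\to p$, for each $p\in\{\pm\frac1{A_1},\pm\frac1{A_2}\}$; * $\hat N=I+O(\frac1\lambda)$ as $\lambda\to\infty$. **Proposition.** For every $y\in\mathbb R$ this problem has a solution, and every solution $\hat N(y,0,\lambda)$ has, as $\lambda\to0$ in $\mathbb C_+$, an expansion $$\hat N(y,0,\lambda)=-\sqrt{\tfrac12}\left(\mathrm i\begin{pmatrix}\mathrm i\hat a_1^{-1}&\hat a_1\\\hat a_1^{-1}&\mathrm i\hat a_1\end{pmatrix}+\mathrm i\lambda\begin{pmatrix}\hat a_2&\mathrm i\hat a_3\\\mathrm i\hat a_2&\hat a_3\end{pmatrix}\right)+O(\lambda^2)$$ with real coefficients $\hat a_j=\hat a_j(y,0)$, $\hat a_1\ne0$. For any such coefficients $$\hat a_1(y,0)\,\hat a_2(y,0)+\hat a_1^{-1}(y,0)\,\hat a_3(y,0)=u_0(x(y,0)),$$ where $y\mapsto x(y,0)$ is the inverse of $x\mapsto y(x,0)=x-\frac1{A_2}\int_x^{+\infty}(m_0(\xi)-A_2)\,d\xi$.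 -/

import Mathlib

open Filter Topology Set MeasureTheory Asymptotics
open scoped Matrix

noncomputable section

namespace MCH

/-- The Pauli matrices. -/
def sigma1 : Matrix (Fin 2) (Fin 2) ℂ := !![0, 1; 1, 0]

def sigma2 : Matrix (Fin 2) (Fin 2) ℂ := !![0, -Complex.I; Complex.I, 0]

def sigma3 : Matrix (Fin 2) (Fin 2) ℂ := !![1, 0; 0, -1]

/-- `e^{θ σ₃}`. -/
def expSigma3 (θ : ℂ) : Matrix (Fin 2) (Fin 2) ℂ :=
  !![Complex.exp θ, 0; 0, Complex.exp (-θ)]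

/-- The open upper half-plane `ℂ₊`. -/
def upper : Set ℂ := {z | 0 < z.im}

/-- The open lower half-plane `ℂ₋`. -/
def lower : Set ℂ := {z | z.im < 0}

/-- The momentum `m = u - u_xx`. -/
def momentum (u : ℝ → ℝ) (x : ℝ) : ℝ := u x - iteratedDeriv 2 u x

/-- The root `l(z) = √(z² - 1/A²)` with branch cut `[-1/A, 1/A]` and `l(z) ~ z` at infinity.
With principal square roots, the value at a real point of the cut is the boundary value
`l(z₊)` from the upper half-plane. -/
def lRoot (A : ℝ) (z : ℂ) : ℂ :=
  (z - 1 / (A : ℂ)) ^ (1 / 2 : ℂ) * (z + 1 / (A : ℂ)) ^ (1 / 2 : ℂ)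

/-- The square root with branch cut `[0, ∞)` and value `i` at `-1`. -/
def cutSqrt (w : ℂ) : ℂ := Complex.I * (-w) ^ (1 / 2 : ℂ)

/-- The matrix `H⁻¹(z)` of eigenvectors of the Lax matrix of the constant background `A`. -/
def Hinv (A : ℝ) (z : ℂ) : Matrix (Fin 2) (Fin 2) ℂ :=
  ((Real.sqrt (1 / 2) : ℂ) * cutSqrt (1 / (Complex.I * A * lRoot A z) - 1)) •
    !![z * A / (1 - Complex.I * A * lRoot A z), 1;
       1, z * A / (1 - Complex.I * A * lRoot A z)]

/-- The end of the real line at which a Jost solution is normalized: `left` is `-∞`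
(background `A₁`), `right` is `+∞` (background `A₂`). -/
inductive Side where
  | left : Side
  | right : Side

/-- The half-line next to the given end. -/
def Side.halfLine : Side → Set ℝ
  | .left => Iic 0
  | .right => Ici 0

/-- `∫_{∓∞}^x F(ξ) dξ`, the integral from the given end to `x`. -/
def intFrom {E : Type*} [NormedAddCommGroup E] [NormedSpace ℝ E] :
    Side → (ℝ → E) → ℝ → E
  | .left, F, x => ∫ ξ in Iic x, F ξ
  | .right, F, x => -∫ ξ in Ioi x, F ξ

/-- The phase `f(x, 0, z) = i A l(z) ((1 / 2A) ∫_{∓∞}^x (m - A) dξ + x / 2)` at time zero. -/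
def phase (s : Side) (A : ℝ) (m : ℝ → ℝ) (x : ℝ) (z : ℂ) : ℂ :=
  Complex.I * A * lRoot A z *
    ((1 / (2 * A) * intFrom s (fun ξ => m ξ - A) x + x / 2 : ℝ) : ℂ)

/-- The coefficient matrix
`Ŵ = (z (m - A) / (2 A l)) σ₂ + ((m - A) / (2 i A² l)) σ₃`. -/
def What (A : ℝ) (m : ℝ → ℝ) (z : ℂ) (ξ : ℝ) : Matrix (Fin 2) (Fin 2) ℂ :=
  (z * ((m ξ - A : ℝ) : ℂ) / (2 * A * lRoot A z)) • sigma2 +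
    (((m ξ - A : ℝ) : ℂ) / (2 * Complex.I * A ^ 2 * lRoot A z)) • sigma3

/-- The exponent `(i l(z) / 2) ∫_x^ξ m(τ) dτ`. -/
def theta (A : ℝ) (m : ℝ → ℝ) (z : ℂ) (x ξ : ℝ) : ℂ :=
  Complex.I * lRoot A z / 2 * ((∫ τ in x..ξ, m τ : ℝ) : ℂ)

/-- `φ` is the `k`-th column of the Jost solution `Ψ̃(·, 0, z)` normalized at the end `s`: the
solution, bounded near that end, of the `k`-th column of the Volterra equation
`Ψ̃(x) = I + ∫_{∓∞}^x e^{θ(x,ξ) σ₃} Ŵ(ξ) Ψ̃(ξ) e^{-θ(x,ξ) σ₃} dξ`. -/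
def IsJostColumn (s : Side) (A : ℝ) (m : ℝ → ℝ) (z : ℂ) (k : Fin 2)
    (φ : ℝ → Fin 2 → ℂ) : Prop :=
  Continuous φ ∧ (∃ C : ℝ, ∀ x ∈ s.halfLine, ‖φ x‖ ≤ C) ∧
    ∀ x : ℝ, φ x = Pi.single k 1 +
      intFrom s (fun ξ => Complex.exp (-(theta A m z x ξ * sigma3 k k)) •
        ((expSigma3 (theta A m z x ξ) * What A m z ξ) *ᵥ φ ξ)) x

/-- The `k`-th column of `Ψ̃(·, 0, z)`. -/
def jostTilde (s : Side) (A : ℝ) (m : ℝ → ℝ) (z : ℂ) (k : Fin 2) : ℝ → Fin 2 → ℂ :=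
  Classical.epsilon (IsJostColumn s A m z k)

/-- The `k`-th column of the Jost solution `Ψ = H⁻¹ Ψ̃ e^{-f σ₃}` of `Ψ_x = U Ψ` at time zero. -/
def jost (s : Side) (A : ℝ) (m : ℝ → ℝ) (z : ℂ) (k : Fin 2) (x : ℝ) : Fin 2 → ℂ :=
  Complex.exp (-(phase s A m x z * sigma3 k k)) • (Hinv A z *ᵥ jostTilde s A m z k x)

/-- `det (ψ, χ)` for two columns. -/
def colDet (ψ χ : Fin 2 → ℂ) : ℂ := ψ 0 * χ 1 - χ 0 * ψ 1

/-- The scattering coefficient `c₁₁ = det (Ψ₁⁽¹⁾, Ψ₂⁽²⁾)`. The determinant of two solutions of the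
(traceless) Lax equation does not depend on `x`, so it is evaluated at `x = 0`. At a real `z`
this is the boundary value from the upper half-plane. -/
def c11 (A₁ A₂ : ℝ) (m : ℝ → ℝ) (z : ℂ) : ℂ :=
  colDet (jost .left A₁ m z 0 0) (jost .right A₂ m z 1 0)

/-- The scattering coefficient `c₂₁ = det (Ψ₂⁽¹⁾, Ψ₁⁽¹⁾)`. -/
def c21 (A₁ A₂ : ℝ) (m : ℝ → ℝ) (z : ℂ) : ℂ :=
  colDet (jost .right A₂ m z 0 0) (jost .left A₁ m z 0 0)

/-- The reflection coefficient `r = c₂₁ / c₁₁` on `|k| > 1/A₂`, `|k| ≠ 1/A₁` (upper side of the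
cut where there is one). -/
def reflection (A₁ A₂ : ℝ) (m : ℝ → ℝ) (k : ℝ) : ℂ := c21 A₁ A₂ m k / c11 A₁ A₂ m k

/-- The phase `f̂₂(y, t, z) = (i A₂ l₂(z) / 2) (y - 2 t / z²)`. -/
def fHat (A₂ y t : ℝ) (z : ℂ) : ℂ :=
  Complex.I * A₂ * lRoot A₂ z / 2 * (y - 2 * t / z ^ 2)

/-- The matrix `G₀` for `|k| > 1/A₁` (first case) and for `1/A₂ < |k| < 1/A₁` (second case). -/
def G0 (A₁ : ℝ) (r : ℝ → ℂ) (k : ℝ) : Matrix (Fin 2) (Fin 2) ℂ :=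
  if 1 / A₁ < |k| then
    !![1 - (‖r k‖ : ℂ) ^ 2, -(starRingEnd ℂ) (r k); r k, 1]
  else
    !![0, -(1 / r k); r k, 1]

/-- The jump matrix `Ĝ(y, t, k)`; it is `-i σ₁` on the gap `|k| < 1/A₂`. -/
def jumpMatrix (A₁ A₂ : ℝ) (r : ℝ → ℂ) (y t k : ℝ) : Matrix (Fin 2) (Fin 2) ℂ :=
  if 1 / A₂ < |k| then
    expSigma3 (-fHat A₂ y t k) * G0 A₁ r k * expSigma3 (fHat A₂ y t k)
  else
    (-Complex.I) • sigma1

/-- `N` solves the right Riemann–Hilbert problem (without residue conditions) with parameters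
`(y, t)` and reflection coefficient `r`. The values of `N` on the real line play no role. -/
structure IsRightRHSolution (A₁ A₂ : ℝ) (r : ℝ → ℂ) (y t : ℝ)
    (N : ℂ → Matrix (Fin 2) (Fin 2) ℂ) : Prop where
  analytic : ∀ i j, DifferentiableOn ℂ (fun z => N z i j) (upper ∪ lower)
  jump : ∀ k : ℝ, |k| ≠ 1 / A₁ → |k| ≠ 1 / A₂ →
    ∃ Nplus Nminus : Matrix (Fin 2) (Fin 2) ℂ,
      Tendsto N (𝓝[upper] (k : ℂ)) (𝓝 Nplus) ∧ Tendsto N (𝓝[lower] (k : ℂ)) (𝓝 Nminus) ∧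
        Nplus = Nminus * jumpMatrix A₁ A₂ r y t k
  singularity : ∀ p : ℝ, (|p| = 1 / A₁ ∨ |p| = 1 / A₂) → ∀ i j,
    (fun z => N z i j) =O[𝓝[upper ∪ lower] (p : ℂ)] fun z => ‖z - p‖ ^ (-(1 / 4) : ℝ)
  normalization : ∀ i j,
    (fun z => N z i j - (1 : Matrix (Fin 2) (Fin 2) ℂ) i j)
      =O[Bornology.cobounded ℂ ⊓ 𝓟 (upper ∪ lower)] fun z => z⁻¹

/-- The expansion
`N(z) = -√(1/2) (i (i a₁⁻¹, a₁; a₁⁻¹, i a₁) + i z (a₂, i a₃; i a₂, a₃)) + O(z²)`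
as `z → 0` in the upper half-plane. -/
def HasExpansionAtZero (N : ℂ → Matrix (Fin 2) (Fin 2) ℂ) (a₁ a₂ a₃ : ℝ) : Prop :=
  ∀ i j, (fun z : ℂ => N z i j -
      ((-(Real.sqrt (1 / 2) : ℂ)) •
        (Complex.I • !![Complex.I * (a₁ : ℂ)⁻¹, (a₁ : ℂ); (a₁ : ℂ)⁻¹, Complex.I * a₁] +
          (Complex.I * z) • !![(a₂ : ℂ), Complex.I * a₃; Complex.I * a₂, (a₃ : ℂ)])) i j)
    =O[𝓝[upper] (0 : ℂ)] fun z => z ^ 2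

/-- The change of variable `y(x, 0) = x - (1 / A₂) ∫_x^∞ (m(ξ) - A₂) dξ`. -/
def yOfX (A₂ : ℝ) (m : ℝ → ℝ) (x : ℝ) : ℝ := x - 1 / A₂ * ∫ ξ in Ioi x, (m ξ - A₂)

/-- The inverse change of variable `x(y, 0)`. -/
def xOfY (A₂ : ℝ) (m : ℝ → ℝ) : ℝ → ℝ := Function.invFun (yOfX A₂ m)

end MCH

end

/-! ### Volterra equations on half-lines: weighted tails, Gronwall, Neumann series. -/

noncomputable section

namespace MCH

section Volterra

variable {E : Type*} [NormedAddCommGroup E] [NormedSpace ℂ E]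

/-! The solution of the Riemann–Hilbert problem is written down from the Jost solutions that define
the reflection coefficient. Uniqueness then transfers its expansion at zero to every other solution.

Jost solutions. The Lax equation is Ψ_x = UΨ with U = ½((-1, zm), (-zm, 1)). On a constant
background A the eigenvalues of U are ±ik with 4k² + 1 = A²z² (`wave`), with eigenvector (1, β) for
ik. The right Jost solution `jostR` behaves like e^{ikx}(1, β) at +∞. It is built from a Volterra
equation whose kernel contains no division by k, so it is continuous on the whole closed upper
half-plane, branch points included, and holomorphic inside. The left solution comes from the
reflection x ↦ -x with exchanged components. Uniqueness for the Volterra equations of the statement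
identifies these solutions, up to the scalar α, with the prescribed columns (`jost_right_one`,
`jost_left_zero`, `jost_right_zero`).

The matrix. For fixed x and y = y(x), `rhCore` is (Ψ₁⁽¹⁾/c₁₁, Ψ₂⁽²⁾)e^{fσ₃} in the upper half-plane;
its boundary values satisfy the jump relation by the scattering relation (`rhCore_jump`). It has no
poles: since m > 0, the form Im(w₀w̄₁) increases along solutions when Im z > 0. It is negative on
the right Jost solution and nonnegative on the left one, so the two are independent. The same form
works on |λ| > 1/A₂, and in the gap independence is the no-soliton hypothesis. At ±1/A₂ the
Wronskian may vanish, but not faster than k (`isBigO_wave_wronskian`), so only fourth-root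
singularities occur. For large z, diagonalization along the local eigenvectors (1, β(m(x), z))
replaces the phase by k·y(x) up to O(1/z); this normalizes the matrix at infinity and explains the
variable y. A constant factor and the symmetry σ₁ conj N(z̄) σ₁ extend the matrix to the lower
half-plane (`isRightRHSolution_rhExtend`).

Uniqueness. For two solutions, N adj(N') has no jump because the jump matrices have determinant one.
Its singularities are weaker than poles and it tends to 1 at infinity, so it is 1 by Morera, Riemann
and Liouville (`eq_const_of_no_jump`).

Recovery of u. At z = 0 the matrix U is diagonal and k = i/2. First-order perturbation in z gives a₁
= e^{(y-x)/2}, while a₂ and a₃ are multiples of ∫_{-∞}^x m e^ξ and ∫_x^∞ m e^{-ξ}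
(`hasExpansionAtZero_rhExtend`). The combination a₁a₂ + a₃/a₁ is then ½∫ e^{-|x-ξ|} m(ξ) dξ, the
bounded solution u of u - u'' = m (`expTail_add_expTail`). -/

theorem hasDerivAt_integral_Ioi {F : Type*} [NormedAddCommGroup F] [NormedSpace ℝ F]
    [CompleteSpace F] {f : ℝ → F} (hf : Continuous f) (hi : ∀ x, IntegrableOn f (Ioi x)) (x : ℝ) :
    HasDerivAt (fun y => ∫ ξ in Ioi y, f ξ) (-f x) x := by
  have h : (fun y => ∫ ξ in Ioi y, f ξ) = fun y => (∫ ξ in Ioi x, f ξ) - ∫ ξ in x..y, f ξ := by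
    ext y
    rw [eq_sub_iff_add_eq, add_comm]
    exact intervalIntegral.integral_interval_add_Ioi (hi x) (hi y)
  rw [h]
  have := (intervalIntegral.integral_hasDerivAt_right (hf.intervalIntegrable x x)
    (hf.stronglyMeasurableAtFilter _ _) hf.continuousAt).const_sub (∫ ξ in Ioi x, f ξ)
  simpa using this

theorem tendsto_integral_Ioi_atTop {F : Type*} [NormedAddCommGroup F] [NormedSpace ℝ F]
    [CompleteSpace F] {f : ℝ → F} (hi : ∀ x, IntegrableOn f (Ioi x)) :
    Tendsto (fun y => ∫ ξ in Ioi y, f ξ) atTop (𝓝 0) := by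
  have h : (fun y => ∫ ξ in Ioi y, f ξ) =
      fun y => (∫ ξ in Ioi (0 : ℝ), f ξ) - ∫ ξ in (0 : ℝ)..y, f ξ := by
    ext y
    rw [eq_sub_iff_add_eq, add_comm]
    exact intervalIntegral.integral_interval_add_Ioi (hi 0) (hi y)
  rw [h]
  have := (intervalIntegral_tendsto_integral_Ioi 0 (hi 0) tendsto_id).const_sub
    (∫ ξ in Ioi (0 : ℝ), f ξ)
  simpa using this

/-- The exponential weight `exp (2 ∫_x^∞ ρ)`. -/
def tailWeight (ρ : ℝ → ℝ) (x : ℝ) : ℝ := Real.exp (2 * ∫ ξ in Ioi x, ρ ξ)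

section Weight

variable {ρ : ℝ → ℝ}

theorem one_le_tailWeight (h0 : ∀ x, 0 ≤ ρ x) (x : ℝ) : 1 ≤ tailWeight ρ x := by
  rw [tailWeight, Real.one_le_exp_iff]
  exact mul_nonneg zero_le_two (integral_nonneg h0)

theorem hasDerivAt_tailWeight (hc : Continuous ρ) (hi : ∀ x, IntegrableOn ρ (Ioi x)) (x : ℝ) :
    HasDerivAt (tailWeight ρ) (-(2 * (ρ x * tailWeight ρ x))) x := by
  have := ((hasDerivAt_integral_Ioi hc hi x).const_mul 2).exp
  refine this.congr_deriv ?_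
  simp only [tailWeight]; ring

theorem continuous_tailWeight (hc : Continuous ρ) (hi : ∀ x, IntegrableOn ρ (Ioi x)) :
    Continuous (tailWeight ρ) :=
  continuous_iff_continuousAt.2 fun x => (hasDerivAt_tailWeight hc hi x).continuousAt

theorem tailWeight_anti (h0 : ∀ x, 0 ≤ ρ x) (hi : ∀ x, IntegrableOn ρ (Ioi x)) :
    Antitone (tailWeight ρ) := by
  intro x y hxy
  refine Real.exp_le_exp.2 (mul_le_mul_of_nonneg_left ?_ zero_le_two)
  exact setIntegral_mono_set (hi x) (ae_of_all _ h0) (Ioi_subset_Ioi hxy).eventuallyLE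

theorem tendsto_tailWeight (hi : ∀ x, IntegrableOn ρ (Ioi x)) :
    Tendsto (tailWeight ρ) atTop (𝓝 1) := by
  have h := ((tendsto_integral_Ioi_atTop hi).const_mul 2)
  rw [mul_zero] at h
  have := (Real.continuous_exp.tendsto 0).comp h
  rwa [Real.exp_zero] at this

theorem integrableOn_mul_tailWeight (h0 : ∀ x, 0 ≤ ρ x) (hc : Continuous ρ)
    (hi : ∀ x, IntegrableOn ρ (Ioi x)) (x : ℝ) :
    IntegrableOn (fun ξ => ρ ξ * tailWeight ρ ξ) (Ioi x) := by
  refine Integrable.mono' ((hi x).mul_const (tailWeight ρ x)) ?_ ?_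
  · exact (hc.mul (continuous_tailWeight hc hi)).aestronglyMeasurable
  · refine (ae_restrict_iff' measurableSet_Ioi).2 (ae_of_all _ fun ξ hξ => ?_)
    have h1 := one_le_tailWeight h0 ξ
    rw [Real.norm_of_nonneg (mul_nonneg (h0 ξ) (by linarith))]
    exact mul_le_mul_of_nonneg_left (tailWeight_anti h0 hi (le_of_lt hξ)) (h0 ξ)

/-- The integrand is -1/2 times the derivative of the weight. The factor 2 in the exponent of
`tailWeight` is there for this: integration against ρ halves the weight, so that Volterra iterations
contract by 1/2. -/
theorem integral_mul_tailWeight (h0 : ∀ x, 0 ≤ ρ x) (hc : Continuous ρ)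
    (hi : ∀ x, IntegrableOn ρ (Ioi x)) (x : ℝ) :
    ∫ ξ in Ioi x, ρ ξ * tailWeight ρ ξ = (tailWeight ρ x - 1) / 2 := by
  have := integral_Ioi_of_hasDerivAt_of_tendsto' (a := x)
    (fun y _ => (hasDerivAt_tailWeight hc hi y).div_const (-2))
    (by
      convert integrableOn_mul_tailWeight h0 hc hi x using 2
      ring) ((tendsto_tailWeight hi).div_const (-2))
  calc _ = ∫ ξ in Ioi x, -(2 * (ρ ξ * tailWeight ρ ξ)) / -2 := by
        congr 1; ext ξ; ring
    _ = _ := by rw [this]; ring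

/-- A Gronwall inequality on a half-line, with the data given at `+∞`. -/
theorem gronwall_Ioi (h0 : ∀ x, 0 ≤ ρ x) (hc : Continuous ρ) (hi : ∀ x, IntegrableOn ρ (Ioi x))
    {f : ℝ → ℝ} (hf : Continuous f) (hf0 : ∀ x, 0 ≤ f x) {x₀ a C : ℝ} (ha : 0 ≤ a)
    (hC : ∀ x, x₀ ≤ x → f x ≤ C)
    (hle : ∀ x, x₀ ≤ x → f x ≤ a + ∫ ξ in Ioi x, ρ ξ * f ξ) (x : ℝ) (hx : x₀ ≤ x) :
    f x ≤ 2 * a * tailWeight ρ x := by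
  have hC0 : 0 ≤ C := (hf0 x).trans (hC x hx)
  -- Inserting the n-th bound into the integral inequality halves the a priori part C, by
  -- `integral_mul_tailWeight`; in the limit only the multiple of a survives.
  have key : ∀ n : ℕ, ∀ x, x₀ ≤ x → f x ≤ (2 * a + C * (1 / 2) ^ n) * tailWeight ρ x := by
    intro n
    induction n with
    | zero =>
      intro x hx
      have h1 := one_le_tailWeight h0 x
      have := hC x hx
      nlinarith
    | succ n ih =>
      intro x hx
      refine (hle x hx).trans ?_
      have hI : ∫ ξ in Ioi x, ρ ξ * f ξ ≤
          ∫ ξ in Ioi x, (2 * a + C * (1 / 2) ^ n) * (ρ ξ * tailWeight ρ ξ) := by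
        refine setIntegral_mono_on ?_ ((integrableOn_mul_tailWeight h0 hc hi x).const_mul _)
          measurableSet_Ioi fun ξ hξ => ?_
        · refine Integrable.mono' ((hi x).mul_const C) (hc.mul hf).aestronglyMeasurable ?_
          refine (ae_restrict_iff' measurableSet_Ioi).2 (ae_of_all _ fun ξ hξ => ?_)
          rw [Real.norm_of_nonneg (mul_nonneg (h0 ξ) (hf0 ξ))]
          exact mul_le_mul_of_nonneg_left (hC ξ (hx.trans (le_of_lt hξ))) (h0 ξ)
        · have := mul_le_mul_of_nonneg_left (ih ξ (hx.trans (le_of_lt hξ))) (h0 ξ)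
          linarith
      rw [integral_const_mul, integral_mul_tailWeight h0 hc hi] at hI
      have h1 := one_le_tailWeight h0 x
      have hp : 0 ≤ C * (1 / 2) ^ n := by positivity
      rw [pow_succ]
      nlinarith
  have ht : Tendsto (fun n : ℕ => (2 * a + C * (1 / 2) ^ n) * tailWeight ρ x) atTop
      (𝓝 ((2 * a + C * 0) * tailWeight ρ x)) :=
    (((tendsto_pow_atTop_nhds_zero_of_lt_one (by norm_num) (by norm_num)).const_mul C).const_add
      (2 * a)).mul_const _
  simpa using ge_of_tendsto' ht fun n => key n x hx

end Weight

/-- A Volterra kernel on the half-lines `(x, ∞)`, depending on a parameter in `S`, with a weight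
`κ` and an integrable majorant `ρ`. -/
structure IsVolterraKernel (K : ℝ → ℝ → ℂ → E →L[ℂ] E) (S : Set ℂ) (κ ρ : ℝ → ℝ) : Prop where
  weight_continuous : Continuous κ
  one_le_weight : ∀ x, 1 ≤ κ x
  majorant_continuous : Continuous ρ
  majorant_nonneg : ∀ x, 0 ≤ ρ x
  majorant_integrable : ∀ x, IntegrableOn ρ (Ioi x)
  bound : ∀ z ∈ S, ∀ x ξ, x ≤ ξ → ‖K x ξ z‖ * κ ξ ≤ κ x * ρ ξ
  continuousOn : ContinuousOn (fun p : ℝ × ℝ × ℂ => K p.1 p.2.1 p.2.2) (univ ×ˢ univ ×ˢ S)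

/-- The terms of the Neumann series of `h(x) = g + ∫_x^∞ K(x,ξ) h(ξ) dξ`. -/
def volterraTerm (K : ℝ → ℝ → ℂ → E →L[ℂ] E) (g : ℂ → E) : ℕ → ℝ → ℂ → E
  | 0, _, z => g z
  | n + 1, x, z => ∫ ξ in Ioi x, K x ξ z (volterraTerm K g n ξ z)

/-- The solution of `h(x) = g + ∫_x^∞ K(x,ξ) h(ξ) dξ` as a Neumann series. -/
def volterraSol (K : ℝ → ℝ → ℂ → E →L[ℂ] E) (g : ℂ → E) (x : ℝ) (z : ℂ) : E :=
  ∑' n, volterraTerm K g n x z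

/-- Holomorphy of an integral depending holomorphically on a parameter. -/
theorem differentiableOn_integral_of_dominated [CompleteSpace E] {α : Type*} [MeasurableSpace α]
    {μ : Measure α} {F : ℂ → α → E} {U : Set ℂ} (hU : IsOpen U) {b : α → ℝ}
    (hm : ∀ z ∈ U, AEStronglyMeasurable (F z) μ)
    (hd : ∀ᵐ a ∂μ, DifferentiableOn ℂ (fun z => F z a) U)
    (hb : ∀ᵐ a ∂μ, ∀ z ∈ U, ‖F z a‖ ≤ b a) (hbi : Integrable b μ) :
    DifferentiableOn ℂ (fun z => ∫ a, F z a ∂μ) U := by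
  intro z₀ hz₀
  obtain ⟨r, hr, hball⟩ := Metric.isOpen_iff.1 hU z₀ hz₀
  have hr2 : 0 < r / 2 := by positivity
  -- Closed discs of radius r/4 about points of the half-size ball stay in U, so Cauchy's estimate
  -- on their boundary bounds the derivative by b/(r/4).
  have hsub : ∀ w ∈ Metric.ball z₀ (r / 2), Metric.closedBall w (r / 4) ⊆ U := by
    intro w hw y hy
    apply hball
    rw [Metric.mem_ball] at hw ⊢
    rw [Metric.mem_closedBall] at hy
    have := dist_triangle y w z₀
    linarith
  -- The derivative is measurable as a limit of difference quotients along a sequence of increments.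
  have hderiv : AEStronglyMeasurable (fun a => deriv (fun z => F z a) z₀) μ := by
    have hseq : Tendsto (fun n : ℕ => (r / 2) / ((n : ℝ) + 1)) atTop (𝓝 0) :=
      tendsto_const_nhds.div_atTop (tendsto_atTop_add_const_right _ _ tendsto_natCast_atTop_atTop)
    have hlt : ∀ n : ℕ, (r / 2) / ((n : ℝ) + 1) < r := fun n => by
      rw [div_lt_iff₀ (by positivity)]
      nlinarith [(Nat.cast_nonneg n : (0 : ℝ) ≤ n)]
    have hpos : ∀ n : ℕ, 0 < (r / 2) / ((n : ℝ) + 1) := fun n => by positivity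
    refine aestronglyMeasurable_of_tendsto_ae atTop
      (f := fun (n : ℕ) a => (((r / 2) / ((n : ℝ) + 1) : ℝ) : ℂ)⁻¹ •
        (F (z₀ + (((r / 2) / ((n : ℝ) + 1) : ℝ) : ℂ)) a - F z₀ a)) (fun n => ?_) ?_
    · refine AEStronglyMeasurable.const_smul (AEStronglyMeasurable.sub (hm _ ?_) (hm _ hz₀)) _
      apply hball
      rw [Metric.mem_ball, dist_eq_norm, add_sub_cancel_left, Complex.norm_real,
        Real.norm_of_nonneg (hpos n).le]
      exact hlt n
    · filter_upwards [hd] with a ha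
      have h1 := ((ha z₀ hz₀).differentiableAt (hU.mem_nhds hz₀)).hasDerivAt.tendsto_slope_zero
      refine h1.comp (tendsto_nhdsWithin_iff.2 ⟨?_, Eventually.of_forall fun n => ?_⟩)
      · have := (Complex.continuous_ofReal.tendsto 0).comp hseq
        simpa [Function.comp_def] using this
      · have := (hpos n).ne'
        rw [mem_compl_singleton_iff]
        exact Complex.ofReal_ne_zero.2 this
  refine (hasDerivAt_integral_of_dominated_loc_of_deriv_le (μ := μ) (F := F)
    (F' := fun z a => deriv (fun z => F z a) z) (x₀ := z₀) (s := Metric.ball z₀ (r / 2))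
    (bound := fun a => b a / (r / 4)) (Metric.ball_mem_nhds _ hr2) ?_ ?_ hderiv ?_
    (hbi.div_const _) ?_).2.differentiableAt.differentiableWithinAt
  · filter_upwards [hU.mem_nhds hz₀] with z hz using hm z hz
  · exact hbi.mono' (hm _ hz₀) (by filter_upwards [hb] with a ha using ha _ hz₀)
  · filter_upwards [hd, hb] with a ha hba w hw
    refine Complex.norm_deriv_le_of_forall_mem_sphere_norm_le (by positivity) ?_ ?_
    · refine DifferentiableOn.diffContOnCl (ha.mono ?_)
      exact (closure_mono (Metric.ball_subset_closedBall)).trans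
        (by rw [Metric.isClosed_closedBall.closure_eq]; exact hsub w hw)
    · exact fun y hy => hba y (hsub w hw (Metric.sphere_subset_closedBall hy))
  · filter_upwards [hd] with a ha w hw
    have hwU : w ∈ U := hsub w hw (Metric.mem_closedBall_self (by positivity))
    exact ((ha w hwU).differentiableAt (hU.mem_nhds hwU)).hasDerivAt

namespace IsVolterraKernel

variable {K : ℝ → ℝ → ℂ → E →L[ℂ] E} {S : Set ℂ} {κ ρ : ℝ → ℝ} {g : ℂ → E} {B : ℝ}

theorem weight_pos (hK : IsVolterraKernel K S κ ρ) (x : ℝ) : 0 < κ x :=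
  one_pos.trans_le (hK.one_le_weight x)

theorem norm_apply_le (hK : IsVolterraKernel K S κ ρ) {z : ℂ} (hz : z ∈ S) {x ξ : ℝ} (hx : x ≤ ξ)
    {u : E} {C : ℝ} (hu : ‖u‖ ≤ C * (κ ξ * tailWeight ρ ξ)) :
    ‖K x ξ z u‖ ≤ C * κ x * (ρ ξ * tailWeight ρ ξ) := by
  have hC : 0 ≤ C * tailWeight ρ ξ := by
    have h1 := (norm_nonneg u).trans hu
    have h2 := hK.weight_pos ξ
    have h3 : 0 ≤ (C * tailWeight ρ ξ) * κ ξ := by linarith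
    exact nonneg_of_mul_nonneg_left h3 h2
  calc ‖K x ξ z u‖ ≤ ‖K x ξ z‖ * (C * (κ ξ * tailWeight ρ ξ)) :=
        (K x ξ z).le_opNorm_of_le hu
    _ = (‖K x ξ z‖ * κ ξ) * (C * tailWeight ρ ξ) := by ring
    _ ≤ (κ x * ρ ξ) * (C * tailWeight ρ ξ) :=
        mul_le_mul_of_nonneg_right (hK.bound z hz x ξ hx) hC
    _ = _ := by ring

theorem continuous_apply (hK : IsVolterraKernel K S κ ρ) {z : ℂ} (hz : z ∈ S) (x : ℝ)
    {u : ℝ → E} (hu : Continuous u) : Continuous fun ξ => K x ξ z (u ξ) := by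
  have h : Continuous fun ξ => K x ξ z := by
    have := hK.continuousOn.comp_continuous (f := fun ξ : ℝ => (x, ξ, z)) (by fun_prop)
      (fun ξ => ⟨trivial, trivial, hz⟩)
    exact this
  exact h.clm_apply hu

theorem integrableOn_apply (hK : IsVolterraKernel K S κ ρ) {z : ℂ} (hz : z ∈ S) (x : ℝ)
    {u : ℝ → E} (hu : Continuous u) {C : ℝ}
    (hb : ∀ ξ, ‖u ξ‖ ≤ C * (κ ξ * tailWeight ρ ξ)) :
    IntegrableOn (fun ξ => K x ξ z (u ξ)) (Ioi x) := by
  refine Integrable.mono' ((integrableOn_mul_tailWeight hK.majorant_nonneg hK.majorant_continuous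
    hK.majorant_integrable x).const_mul (C * κ x)) (hK.continuous_apply hz x hu).aestronglyMeasurable
    ((ae_restrict_iff' measurableSet_Ioi).2 (ae_of_all _ fun ξ hξ => ?_))
  exact hK.norm_apply_le hz (le_of_lt hξ) (hb ξ)

theorem norm_integral_apply_le (hK : IsVolterraKernel K S κ ρ) {z : ℂ} (hz : z ∈ S) (x : ℝ)
    {u : ℝ → E} {C : ℝ} (hb : ∀ ξ, ‖u ξ‖ ≤ C * (κ ξ * tailWeight ρ ξ)) :
    ‖∫ ξ in Ioi x, K x ξ z (u ξ)‖ ≤ C / 2 * κ x * (tailWeight ρ x - 1) := by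
  calc ‖∫ ξ in Ioi x, K x ξ z (u ξ)‖ ≤
      ∫ ξ in Ioi x, C * κ x * (ρ ξ * tailWeight ρ ξ) := by
        refine norm_integral_le_of_norm_le ((integrableOn_mul_tailWeight hK.majorant_nonneg
          hK.majorant_continuous hK.majorant_integrable x).const_mul (C * κ x))
          ((ae_restrict_iff' measurableSet_Ioi).2 (ae_of_all _ fun ξ hξ => ?_))
        exact hK.norm_apply_le hz (le_of_lt hξ) (hb ξ)
    _ = _ := by
        rw [integral_const_mul, integral_mul_tailWeight hK.majorant_nonneg
          hK.majorant_continuous hK.majorant_integrable]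
        ring

/-- In the norm weighted by κ and `tailWeight` each application of the kernel halves the bound,
uniformly in the parameter. Everything about the Neumann series rests on this geometric decay. -/
theorem norm_term_le (hK : IsVolterraKernel K S κ ρ) (hg : ∀ z ∈ S, ‖g z‖ ≤ B) (n : ℕ) :
    ∀ z ∈ S, ∀ x, ‖volterraTerm K g n x z‖ ≤ (B * (1 / 2) ^ n) * (κ x * tailWeight ρ x) := by
  induction n with
  | zero =>
    intro z hz x
    have h1 := one_le_tailWeight hK.majorant_nonneg x
    have h2 := hK.one_le_weight x
    have h3 := hg z hz
    have h4 : (1 : ℝ) ≤ κ x * tailWeight ρ x := by nlinarith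
    have h5 : 0 ≤ B := (norm_nonneg _).trans h3
    simp only [volterraTerm, pow_zero, mul_one]
    nlinarith
  | succ n ih =>
    intro z hz x
    refine (hK.norm_integral_apply_le hz x (ih z hz)).trans ?_
    have h5 : 0 ≤ B := (norm_nonneg _).trans (hg z hz)
    have h6 : 0 ≤ B * (1 / 2) ^ n / 2 * κ x :=
      mul_nonneg (by positivity) (hK.weight_pos x).le
    rw [pow_succ]
    nlinarith

/-- Dominated convergence, with the moving lower limit written as an indicator function. The
integrand is continuous at (x₀, z₀) for every ξ except ξ = x₀, a null set. -/
theorem continuousOn_integral_apply (hK : IsVolterraKernel K S κ ρ) {u : ℝ → ℂ → E} {C : ℝ}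
    (hu : ContinuousOn (fun p : ℝ × ℂ => u p.1 p.2) (univ ×ˢ S))
    (hb : ∀ z ∈ S, ∀ ξ, ‖u ξ z‖ ≤ C * (κ ξ * tailWeight ρ ξ)) :
    ContinuousOn (fun p : ℝ × ℂ => ∫ ξ in Ioi p.1, K p.1 ξ p.2 (u ξ p.2)) (univ ×ˢ S) := by
  have huc : ∀ z ∈ S, Continuous fun ξ => u ξ z := fun z hz =>
    hu.comp_continuous (f := fun ξ : ℝ => (ξ, z)) (by fun_prop) (fun ξ => ⟨trivial, hz⟩)
  rintro ⟨x₀, z₀⟩ ⟨-, hz₀⟩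
  simp_rw [← integral_indicator measurableSet_Ioi]
  have hC : 0 ≤ C := by
    have h1 := (norm_nonneg _).trans (hb z₀ hz₀ 0)
    have h2 : 0 < κ 0 * tailWeight ρ 0 :=
      mul_pos (hK.weight_pos 0) (one_pos.trans_le (one_le_tailWeight hK.majorant_nonneg 0))
    exact nonneg_of_mul_nonneg_left h1 h2
  have hnear : ∀ᶠ p : ℝ × ℂ in 𝓝[univ ×ˢ S] (x₀, z₀),
      x₀ - 1 < p.1 ∧ κ p.1 < κ x₀ + 1 ∧ p.2 ∈ S := by
    have h1 : ∀ᶠ p : ℝ × ℂ in 𝓝 (x₀, z₀), x₀ - 1 < p.1 ∧ κ p.1 < κ x₀ + 1 :=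
      (continuous_fst.continuousAt.eventually (lt_mem_nhds (by simp))).and
        ((hK.weight_continuous.comp continuous_fst).continuousAt.eventually
          (gt_mem_nhds (by simp)))
    filter_upwards [nhdsWithin_le_nhds h1, self_mem_nhdsWithin] with p hp hp'
    exact ⟨hp.1, hp.2, hp'.2⟩
  refine continuousWithinAt_of_dominated
    (bound := (Ioi (x₀ - 1)).indicator fun ξ => C * (κ x₀ + 1) * (ρ ξ * tailWeight ρ ξ))
    ?_ ?_ ?_ ?_
  · filter_upwards [hnear] with p hp
    exact ((hK.continuous_apply hp.2.2 p.1 (huc p.2 hp.2.2)).aestronglyMeasurable).indicator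
      measurableSet_Ioi
  · filter_upwards [hnear] with p hp
    refine ae_of_all _ fun ξ => ?_
    have hnn : 0 ≤ ρ ξ * tailWeight ρ ξ := mul_nonneg (hK.majorant_nonneg ξ)
      (zero_le_one.trans (one_le_tailWeight hK.majorant_nonneg ξ))
    have hk : 0 ≤ κ x₀ + 1 := by linarith [hK.weight_pos x₀]
    by_cases hξ : p.1 < ξ
    · rw [indicator_of_mem (show ξ ∈ Ioi p.1 from hξ),
        indicator_of_mem (show ξ ∈ Ioi (x₀ - 1) from hp.1.trans hξ)]
      refine (hK.norm_apply_le hp.2.2 hξ.le (hb p.2 hp.2.2 ξ)).trans ?_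
      exact mul_le_mul_of_nonneg_right (mul_le_mul_of_nonneg_left hp.2.1.le hC) hnn
    · rw [indicator_of_notMem (show ξ ∉ Ioi p.1 from hξ), norm_zero]
      exact indicator_nonneg (fun ξ _ => mul_nonneg (mul_nonneg hC hk) (mul_nonneg
        (hK.majorant_nonneg ξ) (zero_le_one.trans (one_le_tailWeight hK.majorant_nonneg ξ)))) ξ
  · exact (integrable_indicator_iff measurableSet_Ioi).2
      ((integrableOn_mul_tailWeight hK.majorant_nonneg hK.majorant_continuous
        hK.majorant_integrable _).const_mul _)
  · have hne : ∀ᵐ ξ : ℝ, ξ ≠ x₀ := by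
      simp [ae_iff]
    filter_upwards [hne] with ξ hξ
    have hlim : Tendsto (fun p : ℝ × ℂ => p.1) (𝓝[univ ×ˢ S] (x₀, z₀)) (𝓝 x₀) :=
      continuous_fst.continuousWithinAt
    rcases lt_or_gt_of_ne hξ with h | h
    · refine ContinuousWithinAt.congr_of_eventuallyEq
        (f := fun _ : ℝ × ℂ => (0 : E)) continuousWithinAt_const ?_ ?_
      · filter_upwards [hlim.eventually (lt_mem_nhds h)] with p hp
        exact indicator_of_notMem (by simpa using hp.le) _
      · exact indicator_of_notMem (by simpa using h.le) _
    · refine ContinuousWithinAt.congr_of_eventuallyEq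
        (f := fun p : ℝ × ℂ => K p.1 ξ p.2 (u ξ p.2)) ?_ ?_ ?_
      · refine ContinuousWithinAt.clm_apply ?_ ?_
        · have hmap : MapsTo (fun p : ℝ × ℂ => ((p.1, ξ, p.2) : ℝ × ℝ × ℂ)) (univ ×ˢ S)
              (univ ×ˢ univ ×ˢ S) := fun p hp => ⟨trivial, trivial, hp.2⟩
          have hcm : Continuous fun p : ℝ × ℂ => ((p.1, ξ, p.2) : ℝ × ℝ × ℂ) := by fun_prop
          exact (hK.continuousOn.comp hcm.continuousOn hmap) _ ⟨trivial, hz₀⟩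
        · have hmap : MapsTo (fun p : ℝ × ℂ => ((ξ, p.2) : ℝ × ℂ)) (univ ×ˢ S)
              (univ ×ˢ S) := fun p hp => ⟨trivial, hp.2⟩
          have hcm : Continuous fun p : ℝ × ℂ => ((ξ, p.2) : ℝ × ℂ) := by fun_prop
          exact (hu.comp hcm.continuousOn hmap) _ ⟨trivial, hz₀⟩
      · filter_upwards [hlim.eventually (gt_mem_nhds h)] with p hp
        exact indicator_of_mem (show ξ ∈ Ioi p.1 from hp) _
      · exact indicator_of_mem (show ξ ∈ Ioi x₀ from h) _

theorem continuousOn_term (hK : IsVolterraKernel K S κ ρ) (hg : ∀ z ∈ S, ‖g z‖ ≤ B)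
    (hgc : ContinuousOn g S) (n : ℕ) :
    ContinuousOn (fun p : ℝ × ℂ => volterraTerm K g n p.1 p.2) (univ ×ˢ S) := by
  induction n with
  | zero => exact hgc.comp continuous_snd.continuousOn fun p hp => hp.2
  | succ n ih => exact hK.continuousOn_integral_apply ih (hK.norm_term_le hg n)

theorem continuous_term (hK : IsVolterraKernel K S κ ρ) (hg : ∀ z ∈ S, ‖g z‖ ≤ B)
    (hgc : ContinuousOn g S) (n : ℕ) {z : ℂ} (hz : z ∈ S) :
    Continuous fun x => volterraTerm K g n x z :=
  (hK.continuousOn_term hg hgc n).comp_continuous (f := fun ξ : ℝ => (ξ, z)) (by fun_prop)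
    (fun ξ => ⟨trivial, hz⟩)

theorem norm_sol_le (hK : IsVolterraKernel K S κ ρ) (hg : ∀ z ∈ S, ‖g z‖ ≤ B) {z : ℂ}
    (hz : z ∈ S) (x : ℝ) : ‖volterraSol K g x z‖ ≤ 2 * B * (κ x * tailWeight ρ x) := by
  refine (tsum_of_norm_bounded (g := fun n => (B * (1 / 2) ^ n) * (κ x * tailWeight ρ x)) ?_
    fun n => hK.norm_term_le hg n z hz x)
  have := (hasSum_geometric_two.mul_left B).mul_right (κ x * tailWeight ρ x)
  rwa [mul_comm B 2] at this

variable [CompleteSpace E]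

theorem summable_term (hK : IsVolterraKernel K S κ ρ) (hg : ∀ z ∈ S, ‖g z‖ ≤ B) {z : ℂ}
    (hz : z ∈ S) (x : ℝ) : Summable fun n => volterraTerm K g n x z := by
  refine Summable.of_norm_bounded (g := fun n => (B * (1 / 2) ^ n) * (κ x * tailWeight ρ x)) ?_
    fun n => hK.norm_term_le hg n z hz x
  exact (summable_geometric_two.mul_left B).mul_right _

theorem continuousOn_sol (hK : IsVolterraKernel K S κ ρ) (hg : ∀ z ∈ S, ‖g z‖ ≤ B)
    (hgc : ContinuousOn g S) :
    ContinuousOn (fun p : ℝ × ℂ => volterraSol K g p.1 p.2) (univ ×ˢ S) := by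
  rintro ⟨x₀, z₀⟩ ⟨-, hz₀⟩
  have hB : 0 ≤ B := (norm_nonneg _).trans (hg z₀ hz₀)
  have hw : Continuous fun x => κ x * tailWeight ρ x :=
    hK.weight_continuous.mul (continuous_tailWeight hK.majorant_continuous hK.majorant_integrable)
  have hnear : ∀ᶠ p : ℝ × ℂ in 𝓝 (x₀, z₀),
      κ p.1 * tailWeight ρ p.1 < κ x₀ * tailWeight ρ x₀ + 1 :=
    (hw.comp continuous_fst).continuousAt.eventually (gt_mem_nhds (by simp))
  obtain ⟨V, hV, hVo, hmem⟩ := eventually_nhds_iff.1 hnear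
  have : ContinuousOn (fun p : ℝ × ℂ => volterraSol K g p.1 p.2) (univ ×ˢ S ∩ V) := by
    refine continuousOn_tsum (u := fun n => (B * (1 / 2) ^ n) * (κ x₀ * tailWeight ρ x₀ + 1))
      (fun n => (hK.continuousOn_term hg hgc n).mono inter_subset_left)
      ((summable_geometric_two.mul_left B).mul_right _) fun n p hp => ?_
    refine (hK.norm_term_le hg n p.2 hp.1.2 p.1).trans ?_
    exact mul_le_mul_of_nonneg_left (hV p hp.2).le (by positivity)
  exact (this _ ⟨⟨trivial, hz₀⟩, hmem⟩).mono_of_mem_nhdsWithin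
    (inter_mem self_mem_nhdsWithin (mem_nhdsWithin_of_mem_nhds (hVo.mem_nhds hmem)))

theorem continuous_sol (hK : IsVolterraKernel K S κ ρ) (hg : ∀ z ∈ S, ‖g z‖ ≤ B)
    (hgc : ContinuousOn g S) {z : ℂ} (hz : z ∈ S) : Continuous fun x => volterraSol K g x z :=
  (hK.continuousOn_sol hg hgc).comp_continuous (f := fun ξ : ℝ => (ξ, z)) (by fun_prop)
    (fun ξ => ⟨trivial, hz⟩)

theorem sol_eq (hK : IsVolterraKernel K S κ ρ) (hg : ∀ z ∈ S, ‖g z‖ ≤ B)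
    (hgc : ContinuousOn g S) {z : ℂ} (hz : z ∈ S) (x : ℝ) :
    volterraSol K g x z = g z + ∫ ξ in Ioi x, K x ξ z (volterraSol K g ξ z) := by
  have hB : 0 ≤ B := (norm_nonneg _).trans (hg z hz)
  have hsum : Summable fun n => ∫ ξ in Ioi x, ‖K x ξ z (volterraTerm K g n ξ z)‖ := by
    refine Summable.of_nonneg_of_le (fun n => integral_nonneg fun ξ => norm_nonneg _)
      (fun n => ?_) ((summable_geometric_two.mul_left (B / 2 * κ x)).mul_right
        (tailWeight ρ x - 1))
    have h1 : ∫ ξ in Ioi x, ‖K x ξ z (volterraTerm K g n ξ z)‖ ≤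
        ∫ ξ in Ioi x, (B * (1 / 2) ^ n) * κ x * (ρ ξ * tailWeight ρ ξ) := by
      refine setIntegral_mono_on (hK.integrableOn_apply hz x (hK.continuous_term hg hgc n hz)
        (hK.norm_term_le hg n z hz)).norm ((integrableOn_mul_tailWeight hK.majorant_nonneg
        hK.majorant_continuous hK.majorant_integrable x).const_mul _) measurableSet_Ioi
        fun ξ hξ => ?_
      exact hK.norm_apply_le hz (le_of_lt hξ) (hK.norm_term_le hg n z hz ξ)
    rw [integral_const_mul, integral_mul_tailWeight hK.majorant_nonneg
          hK.majorant_continuous hK.majorant_integrable] at h1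
    refine h1.trans (le_of_eq ?_)
    ring
  have h := hasSum_integral_of_summable_integral_norm
    (F := fun n ξ => K x ξ z (volterraTerm K g n ξ z)) (μ := volume.restrict (Ioi x))
    (fun n => hK.integrableOn_apply hz x (hK.continuous_term hg hgc n hz)
      (hK.norm_term_le hg n z hz)) hsum
  have h2 : ∀ ξ, ∑' n, K x ξ z (volterraTerm K g n ξ z) = K x ξ z (volterraSol K g ξ z) :=
    fun ξ => ((K x ξ z).map_tsum (hK.summable_term hg hz ξ)).symm
  simp_rw [h2] at h
  rw [volterraSol, (hK.summable_term hg hz x).tsum_eq_zero_add, ← h.tsum_eq]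
  rfl

/-- The factor `tailWeight` - 1 is what makes this useful: it tends to 0 as x → +∞, and it is small
when the majorant is small, as it is near z = 0. -/
theorem norm_sol_sub_le (hK : IsVolterraKernel K S κ ρ) (hg : ∀ z ∈ S, ‖g z‖ ≤ B)
    (hgc : ContinuousOn g S) {z : ℂ} (hz : z ∈ S) (x : ℝ) :
    ‖volterraSol K g x z - g z‖ ≤ B * κ x * (tailWeight ρ x - 1) := by
  rw [hK.sol_eq hg hgc hz, add_sub_cancel_left]
  refine (hK.norm_integral_apply_le hz x (hK.norm_sol_le hg hz)).trans (le_of_eq ?_)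
  ring

theorem differentiableOn_term (hK : IsVolterraKernel K S κ ρ) (hg : ∀ z ∈ S, ‖g z‖ ≤ B)
    (hgc : ContinuousOn g S) {U : Set ℂ} (hU : IsOpen U) (hUS : U ⊆ S)
    (hgd : DifferentiableOn ℂ g U) (hKd : ∀ x ξ, DifferentiableOn ℂ (K x ξ) U) (n : ℕ) :
    ∀ x, DifferentiableOn ℂ (volterraTerm K g n x) U := by
  induction n with
  | zero => exact fun x => hgd
  | succ n ih =>
    intro x
    refine differentiableOn_integral_of_dominated hU
      (b := fun ξ => (B * (1 / 2) ^ n) * κ x * (ρ ξ * tailWeight ρ ξ))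
      (fun z hz => (hK.continuous_apply (hUS hz) x
        (hK.continuous_term hg hgc n (hUS hz))).aestronglyMeasurable)
      (ae_of_all _ fun ξ => (hKd x ξ).clm_apply (ih ξ)) ?_
      ((integrableOn_mul_tailWeight hK.majorant_nonneg
        hK.majorant_continuous hK.majorant_integrable x).const_mul _)
    refine (ae_restrict_iff' measurableSet_Ioi).2 (ae_of_all _ fun ξ hξ z hz => ?_)
    exact hK.norm_apply_le (hUS hz) (le_of_lt hξ) (hK.norm_term_le hg n z (hUS hz) ξ)

theorem differentiableOn_sol (hK : IsVolterraKernel K S κ ρ) (hg : ∀ z ∈ S, ‖g z‖ ≤ B)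
    (hgc : ContinuousOn g S) {U : Set ℂ} (hU : IsOpen U) (hUS : U ⊆ S)
    (hgd : DifferentiableOn ℂ g U) (hKd : ∀ x ξ, DifferentiableOn ℂ (K x ξ) U) (x : ℝ) :
    DifferentiableOn ℂ (volterraSol K g x) U :=
  Complex.differentiableOn_tsum_of_summable_norm
    ((summable_geometric_two.mul_left B).mul_right (κ x * tailWeight ρ x))
    (fun n => hK.differentiableOn_term hg hgc hU hUS hgd hKd n x) hU
    fun n z hz => hK.norm_term_le hg n z (hUS hz) x

end IsVolterraKernel

end Volterra

end MCH

end

/-! ### The wave number k, the eigenvector component β and the factor α on the closed upper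
half-plane. -/

noncomputable section

namespace MCH

/-- The closed upper half-plane. -/
def closedUpper : Set ℂ := {z | 0 ≤ z.im}

theorem upper_subset_closedUpper : upper ⊆ closedUpper := fun _ hz => le_of_lt (α := ℝ) hz

theorem isOpen_upper : IsOpen upper := isOpen_lt continuous_const Complex.continuous_im

theorem isOpen_lower : IsOpen lower := isOpen_lt Complex.continuous_im continuous_const

section Sqrt

theorem cpow_half_sq (w : ℂ) : (w ^ (1 / 2 : ℂ)) ^ 2 = w := by
  rw [← Complex.cpow_nat_mul]; norm_num

theorem cpow_half_re_im {w : ℂ} (hw : 0 ≤ w.im) :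
    0 ≤ (w ^ (1 / 2 : ℂ)).re ∧ 0 ≤ (w ^ (1 / 2 : ℂ)).im := by
  rcases eq_or_ne w 0 with rfl | h
  · simp
  have ha := Complex.arg_nonneg_iff.2 hw
  have hb := Complex.arg_le_pi w
  rw [Complex.cpow_def_of_ne_zero h, Complex.exp_re, Complex.exp_im]
  have h2 : (Complex.log w * (1 / 2)).im = w.arg / 2 := by
    rw [show Complex.log w * (1 / 2) = ((1 / 2 : ℝ) : ℂ) * Complex.log w by push_cast; ring,
      Complex.im_ofReal_mul, Complex.log_im]
    ring
  rw [h2]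
  exact ⟨mul_nonneg (Real.exp_pos _).le (Real.cos_nonneg_of_mem_Icc ⟨by linarith, by linarith⟩),
    mul_nonneg (Real.exp_pos _).le (Real.sin_nonneg_of_mem_Icc ⟨by linarith, by linarith⟩)⟩

theorem cpow_half_re_im_pos {w : ℂ} (hw : 0 < w.im) :
    0 < (w ^ (1 / 2 : ℂ)).re ∧ 0 < (w ^ (1 / 2 : ℂ)).im := by
  obtain ⟨h1, h2⟩ := cpow_half_re_im hw.le
  have h3 : w.im = 2 * ((w ^ (1 / 2 : ℂ)).re * (w ^ (1 / 2 : ℂ)).im) := by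
    conv_lhs => rw [← cpow_half_sq w]
    rw [pow_two, Complex.mul_im]; ring
  have h4 : (w ^ (1 / 2 : ℂ)).re ≠ 0 := fun h => by rw [h] at h3; simp at h3; linarith
  have h5 : (w ^ (1 / 2 : ℂ)).im ≠ 0 := fun h => by rw [h] at h3; simp at h3; linarith
  exact ⟨lt_of_le_of_ne h1 h4.symm, lt_of_le_of_ne h2 h5.symm⟩

/-- On the negative axis the principal branch is continuous only from above. This one-sided
continuity is why values at real points are boundary values from the upper half-plane. -/
theorem continuousOn_cpow_half : ContinuousOn (fun w : ℂ => w ^ (1 / 2 : ℂ)) closedUpper := by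
  intro w hw
  by_cases h : 0 ≤ w.re ∨ w.im ≠ 0
  · exact (Complex.continuousAt_cpow_const_of_re_pos h (by norm_num)).continuousWithinAt
  · push Not at h
    have hne : w ≠ 0 := fun h0 => by simp [h0] at h
    refine ContinuousWithinAt.congr_of_eventuallyEq
      (f := fun w => Complex.exp (Complex.log w * (1 / 2))) ?_ ?_
      (Complex.cpow_def_of_ne_zero hne _)
    · exact Complex.continuous_exp.continuousAt.comp_continuousWithinAt
        ((Complex.continuousWithinAt_log_of_re_neg_of_im_zero h.1 h.2).mul_const _)
    · filter_upwards [nhdsWithin_le_nhds (isOpen_ne.mem_nhds hne)] with x hx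
      exact Complex.cpow_def_of_ne_zero hx _

theorem cpow_half_ofReal_of_nonneg {x : ℝ} (hx : 0 ≤ x) :
    ((x : ℂ) ^ (1 / 2 : ℂ)) = (Real.sqrt x : ℂ) := by
  rw [Real.sqrt_eq_rpow, Complex.ofReal_cpow hx]; norm_num

end Sqrt

/-- The wave number `k = A l / 2` of the background `A`. -/
def wave (A : ℝ) (z : ℂ) : ℂ := A * lRoot A z / 2

/-- The component `β` of the eigenvector `(1, β)` of the Lax matrix of the background `A`. -/
def beta (A : ℝ) (z : ℂ) : ℂ := z * A / (1 - Complex.I * A * lRoot A z)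

/-- The scalar factor of `Hinv`. -/
def alpha (A : ℝ) (z : ℂ) : ℂ :=
  (Real.sqrt (1 / 2) : ℂ) * cutSqrt (1 / (Complex.I * A * lRoot A z) - 1)

theorem Hinv_eq (A : ℝ) (z : ℂ) : Hinv A z = alpha A z • !![beta A z, 1; 1, beta A z] := rfl

section Root

variable {A : ℝ} {z : ℂ}

theorem two_I_wave : 2 * Complex.I * wave A z = Complex.I * A * lRoot A z := by
  rw [wave]; ring

theorem lRoot_sq (A : ℝ) (z : ℂ) : lRoot A z ^ 2 = z ^ 2 - 1 / (A : ℂ) ^ 2 := by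
  rw [lRoot, mul_pow, cpow_half_sq, cpow_half_sq]; ring

/-- The dispersion relation: ±ik are the eigenvalues of the Lax matrix with m replaced by A. -/
theorem wave_sq (hA : 0 < A) (z : ℂ) : 4 * wave A z ^ 2 + 1 = A ^ 2 * z ^ 2 := by
  have : (A : ℂ) ≠ 0 := Complex.ofReal_ne_zero.2 hA.ne'
  rw [wave, div_pow, mul_pow, lRoot_sq]; field_simp; ring

theorem im_sub_inv : (z - 1 / (A : ℂ)).im = z.im := by
  rw [show (1 / (A : ℂ)) = ((1 / A : ℝ) : ℂ) by push_cast; rfl]; simp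

theorem im_add_inv : (z + 1 / (A : ℂ)).im = z.im := by
  rw [show (1 / (A : ℂ)) = ((1 / A : ℝ) : ℂ) by push_cast; rfl]; simp

theorem lRoot_im_nonneg (hz : 0 ≤ z.im) : 0 ≤ (lRoot A z).im := by
  obtain ⟨a, b⟩ := cpow_half_re_im (w := z - 1 / (A : ℂ)) (by rwa [im_sub_inv])
  obtain ⟨c, d⟩ := cpow_half_re_im (w := z + 1 / (A : ℂ)) (by rwa [im_add_inv])
  rw [lRoot, Complex.mul_im]
  exact add_nonneg (mul_nonneg a d) (mul_nonneg b c)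

theorem lRoot_im_pos (hz : 0 < z.im) : 0 < (lRoot A z).im := by
  obtain ⟨a, b⟩ := cpow_half_re_im_pos (w := z - 1 / (A : ℂ)) (by rwa [im_sub_inv])
  obtain ⟨c, d⟩ := cpow_half_re_im_pos (w := z + 1 / (A : ℂ)) (by rwa [im_add_inv])
  rw [lRoot, Complex.mul_im]
  exact add_pos (mul_pos a d) (mul_pos b c)

theorem wave_im : (wave A z).im = A / 2 * (lRoot A z).im := by
  rw [wave, show (A : ℂ) * lRoot A z / 2 = ((A / 2 : ℝ) : ℂ) * lRoot A z by push_cast; ring,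
    Complex.im_ofReal_mul]

theorem wave_im_nonneg (hA : 0 < A) (hz : z ∈ closedUpper) : 0 ≤ (wave A z).im := by
  rw [wave_im]; exact mul_nonneg (by positivity) (lRoot_im_nonneg hz)

theorem wave_im_pos (hA : 0 < A) (hz : z ∈ upper) : 0 < (wave A z).im := by
  rw [wave_im]; exact mul_pos (by positivity) (lRoot_im_pos hz)

theorem continuousOn_lRoot (A : ℝ) : ContinuousOn (lRoot A) closedUpper := by
  refine ContinuousOn.mul ?_ ?_
  · exact continuousOn_cpow_half.comp (f := fun z => z - 1 / (A : ℂ)) (by fun_prop)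
      fun z hz => by simpa only [closedUpper, mem_ofPred_eq, im_sub_inv] using hz
  · exact continuousOn_cpow_half.comp (f := fun z => z + 1 / (A : ℂ)) (by fun_prop)
      fun z hz => by simpa only [closedUpper, mem_ofPred_eq, im_add_inv] using hz

theorem continuousOn_wave (A : ℝ) : ContinuousOn (wave A) closedUpper :=
  ((continuousOn_lRoot A).const_smul (A : ℂ)).div_const 2

theorem differentiableOn_lRoot (A : ℝ) : DifferentiableOn ℂ (lRoot A) upper := by
  intro z hz
  have h1 : z - 1 / (A : ℂ) ∈ Complex.slitPlane :=
    Or.inr (by rw [im_sub_inv]; exact (ne_of_gt hz))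
  have h2 : z + 1 / (A : ℂ) ∈ Complex.slitPlane :=
    Or.inr (by rw [im_add_inv]; exact (ne_of_gt hz))
  have h3 : DifferentiableAt ℂ (fun z : ℂ => (z - 1 / (A : ℂ)) ^ (1 / 2 : ℂ)) z :=
    DifferentiableAt.cpow_const (by fun_prop) h1
  have h4 : DifferentiableAt ℂ (fun z : ℂ => (z + 1 / (A : ℂ)) ^ (1 / 2 : ℂ)) z :=
    DifferentiableAt.cpow_const (by fun_prop) h2
  exact (h3.mul h4).differentiableWithinAt

theorem differentiableOn_wave (A : ℝ) : DifferentiableOn ℂ (wave A) upper :=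
  ((differentiableOn_lRoot A).const_mul (A : ℂ)).div_const 2

theorem wave_eq_zero_iff (hA : 0 < A) : wave A z = 0 ↔ z = 1 / (A : ℂ) ∨ z = -(1 / (A : ℂ)) := by
  have h := lRoot_sq A z
  have hA' : (A : ℂ) ≠ 0 := Complex.ofReal_ne_zero.2 hA.ne'
  have h1 : wave A z = 0 ↔ lRoot A z ^ 2 = 0 := by
    rw [wave, pow_eq_zero_iff two_ne_zero]; simp [hA']
  rw [h1, h, show z ^ 2 - 1 / (A : ℂ) ^ 2 = (z - 1 / A) * (z + 1 / A) by ring, mul_eq_zero,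
    sub_eq_zero, add_eq_zero_iff_eq_neg]

theorem wave_ne_zero_of_upper (hA : 0 < A) (hz : z ∈ upper) : wave A z ≠ 0 := fun h => by
  have := wave_im_pos hA hz
  rw [h] at this; simp at this

theorem wave_ne_zero_ofReal (hA : 0 < A) {x : ℝ} (hx : |x| ≠ 1 / A) : wave A x ≠ 0 := by
  rw [Ne, wave_eq_zero_iff hA]
  rintro (h | h)
  · have h2 : x = 1 / A := by exact_mod_cast h
    exact hx (by rw [h2, abs_of_pos (by positivity)])
  · have h2 : x = -(1 / A) := by exact_mod_cast h
    exact hx (by rw [h2, abs_neg, abs_of_pos (by positivity)])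

/-- Since (l - z)(l + z) = -1/A², it is enough that |l + z| ≥ |z|, which follows from Re(l z̄) ≥ 0.
With p and r the two square roots, l = pr and 2z = p² + r²; both lie in the first quadrant, which
makes the real part visibly nonnegative. -/
theorem norm_lRoot_sub_le (hA : 0 < A) (hz : z ∈ upper) :
    ‖lRoot A z - z‖ ≤ 1 / (A ^ 2 * ‖z‖) := by
  set p := (z - 1 / (A : ℂ)) ^ (1 / 2 : ℂ) with hp
  set r := (z + 1 / (A : ℂ)) ^ (1 / 2 : ℂ) with hr
  obtain ⟨a, b⟩ := cpow_half_re_im_pos (w := z - 1 / (A : ℂ)) (by rwa [im_sub_inv])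
  obtain ⟨c, d⟩ := cpow_half_re_im_pos (w := z + 1 / (A : ℂ)) (by rwa [im_add_inv])
  rw [← hp] at a b
  rw [← hr] at c d
  have hl : lRoot A z = p * r := rfl
  have hzz : 2 * z = p ^ 2 + r ^ 2 := by rw [hp, hr, cpow_half_sq, cpow_half_sq]; ring
  have hz0 : 0 < ‖z‖ := norm_pos_iff.2 fun h => by rw [h] at hz; simp [upper] at hz
  have hre : 0 ≤ (lRoot A z * (starRingEnd ℂ) z).re := by
    have h2 : 2 * (lRoot A z * (starRingEnd ℂ) z).re =
        (p * r * (starRingEnd ℂ) (p ^ 2 + r ^ 2)).re := by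
      rw [← hzz, hl, map_mul, Complex.conj_ofNat, mul_left_comm, ← Complex.re_ofReal_mul]
      norm_num
    have h3 : (p * r * (starRingEnd ℂ) (p ^ 2 + r ^ 2)).re =
        (p.re * r.re + p.im * r.im) * (p.re ^ 2 + p.im ^ 2 + (r.re ^ 2 + r.im ^ 2)) := by
      simp [pow_two]; ring
    have : 0 ≤ 2 * (lRoot A z * (starRingEnd ℂ) z).re := by rw [h2, h3]; positivity
    linarith
  have hge : ‖z‖ ≤ ‖lRoot A z + z‖ := by
    refine le_of_sq_le_sq ?_ (norm_nonneg _)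
    rw [← Complex.normSq_eq_norm_sq, ← Complex.normSq_eq_norm_sq, Complex.normSq_add]
    have := Complex.normSq_nonneg (lRoot A z)
    linarith
  have hprod : (lRoot A z - z) * (lRoot A z + z) = -(1 / (A : ℂ) ^ 2) := by
    have := lRoot_sq A z
    linear_combination this
  have hn : ‖lRoot A z - z‖ * ‖lRoot A z + z‖ = 1 / A ^ 2 := by
    rw [← norm_mul, hprod, norm_neg, norm_div, norm_one, norm_pow, Complex.norm_real,
      Real.norm_of_nonneg hA.le]
  rw [div_mul_eq_div_div, le_div_iff₀ hz0, ← hn]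
  exact mul_le_mul_of_nonneg_left hge (norm_nonneg _)

theorem one_sub_wave_re (hk : 0 ≤ (wave A z).im) : 1 ≤ (1 - 2 * Complex.I * wave A z).re := by
  have : (2 * Complex.I * wave A z).re = -(2 * (wave A z).im) := by simp
  rw [Complex.sub_re, this, Complex.one_re]; linarith

theorem one_sub_wave_ne_zero (hA : 0 < A) (hz : z ∈ closedUpper) :
    1 - 2 * Complex.I * wave A z ≠ 0 := fun h => by
  have := one_sub_wave_re (wave_im_nonneg hA hz)
  rw [h] at this; norm_num at this

theorem one_le_norm_one_sub_wave (hA : 0 < A) (hz : z ∈ closedUpper) :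
    1 ≤ ‖1 - 2 * Complex.I * wave A z‖ :=
  (one_sub_wave_re (wave_im_nonneg hA hz)).trans (Complex.re_le_norm _)

theorem beta_eq (A : ℝ) (z : ℂ) : beta A z = z * A / (1 - 2 * Complex.I * wave A z) := by
  rw [beta, two_I_wave]

/-- With `mul_beta` this is the eigenvector equation for (1, β) and the eigenvalue ik, one row each;
all later algebra with β goes through these two relations. -/
theorem beta_mul (hA : 0 < A) (hz : z ∈ closedUpper) :
    beta A z * (1 - 2 * Complex.I * wave A z) = z * A := by
  rw [beta_eq, div_mul_cancel₀ _ (one_sub_wave_ne_zero hA hz)]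

theorem mul_beta (hA : 0 < A) (hz : z ∈ closedUpper) :
    z * A * beta A z = 1 + 2 * Complex.I * wave A z := by
  have h := one_sub_wave_ne_zero hA hz
  rw [beta_eq]
  field_simp
  linear_combination (-1 : ℂ) * wave_sq hA z + 4 * wave A z ^ 2 * Complex.I_sq

theorem continuousOn_beta (hA : 0 < A) : ContinuousOn (beta A) closedUpper := by
  have : beta A = fun z => z * A / (1 - 2 * Complex.I * wave A z) := funext (beta_eq A)
  rw [this]
  exact (continuousOn_id.mul_const _).div
    (continuousOn_const.sub ((continuousOn_wave A).const_smul (2 * Complex.I)))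
    fun z hz => one_sub_wave_ne_zero hA hz

theorem differentiableOn_beta (hA : 0 < A) : DifferentiableOn ℂ (beta A) upper := by
  have : beta A = fun z => z * A / (1 - 2 * Complex.I * wave A z) := funext (beta_eq A)
  rw [this]
  exact (differentiableOn_id.mul_const _).div
    ((differentiableOn_const _).sub ((differentiableOn_wave A).const_mul (2 * Complex.I)))
    fun z hz => one_sub_wave_ne_zero hA (upper_subset_closedUpper hz)

/-- The square root in `alpha`. -/
def alphaRoot (A : ℝ) (z : ℂ) : ℂ := (1 + Complex.I / (2 * wave A z)) ^ (1 / 2 : ℂ)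

theorem alpha_eq (A : ℝ) (z : ℂ) :
    alpha A z = (Real.sqrt (1 / 2) : ℂ) * (Complex.I * alphaRoot A z) := by
  rw [alpha, cutSqrt, alphaRoot]
  congr 3
  rw [← two_I_wave]
  rcases eq_or_ne (wave A z) 0 with h | h
  · simp [h]
  · field_simp
    linear_combination (-1 : ℂ) * Complex.I_sq

theorem sqrt_half_sq : (Real.sqrt (1 / 2) : ℂ) ^ 2 = 1 / 2 := by
  rw [← Complex.ofReal_pow, Real.sq_sqrt (by norm_num)]; push_cast; rfl

theorem alphaRoot_sq (A : ℝ) (z : ℂ) : alphaRoot A z ^ 2 = 1 + Complex.I / (2 * wave A z) :=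
  cpow_half_sq _

/-- For Im k ≥ 0 the number i/(2k) has nonnegative real part, so the argument of the square root
never meets the cut of the principal branch. -/
theorem alphaRoot_base_re (hk : 0 ≤ (wave A z).im) :
    1 ≤ (1 + Complex.I / (2 * wave A z)).re := by
  have : (Complex.I / (2 * wave A z)).re = (wave A z).im * 2 / Complex.normSq (2 * wave A z) := by
    rw [Complex.div_re]; simp; ring
  rw [Complex.add_re, this, Complex.one_re]
  have := Complex.normSq_nonneg (2 * wave A z)
  have : 0 ≤ (wave A z).im * 2 / Complex.normSq (2 * wave A z) := by positivity
  linarith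

theorem alphaRoot_base_mem (hk : 0 ≤ (wave A z).im) :
    1 + Complex.I / (2 * wave A z) ∈ Complex.slitPlane :=
  Or.inl (by linarith [alphaRoot_base_re hk])

theorem alphaRoot_ne_zero (hk : 0 ≤ (wave A z).im) : alphaRoot A z ≠ 0 := fun h => by
  have h1 := alphaRoot_sq A z
  have h2 := alphaRoot_base_re hk
  rw [← h1, h] at h2; norm_num at h2

theorem alpha_ne_zero (hk : 0 ≤ (wave A z).im) : alpha A z ≠ 0 := by
  rw [alpha_eq]
  have : (Real.sqrt (1 / 2) : ℂ) ≠ 0 := fun h => by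
    have := sqrt_half_sq; rw [h] at this; norm_num at this
  exact mul_ne_zero this (mul_ne_zero Complex.I_ne_zero (alphaRoot_ne_zero hk))

theorem alpha_sq (hk0 : wave A z ≠ 0) :
    4 * Complex.I * wave A z * alpha A z ^ 2 = 1 - 2 * Complex.I * wave A z := by
  rw [alpha_eq, mul_pow, mul_pow, sqrt_half_sq, alphaRoot_sq, Complex.I_sq]
  field_simp
  linear_combination (-4 : ℂ) * Complex.I_sq

/-- The normalization det H⁻¹ = 1. -/
theorem alpha_sq_mul (hA : 0 < A) (hz : z ∈ closedUpper) (hk0 : wave A z ≠ 0) :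
    alpha A z ^ 2 * (beta A z ^ 2 - 1) = 1 := by
  have h1 := alpha_sq hk0
  have h2 := one_sub_wave_ne_zero hA hz
  have h3 : 4 * Complex.I * wave A z ≠ 0 := by simp [hk0]
  have h4 : alpha A z ^ 2 = (1 - 2 * Complex.I * wave A z) / (4 * Complex.I * wave A z) := by
    rw [eq_div_iff h3, ← h1]; ring
  rw [h4, beta_eq]
  field_simp
  linear_combination (-1 : ℂ) * wave_sq hA z + 4 * wave A z ^ 2 * Complex.I_sq

theorem continuousOn_alpha (hA : 0 < A) :
    ContinuousOn (alpha A) (closedUpper ∩ {z | wave A z ≠ 0}) := by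
  have : alpha A = fun z => (Real.sqrt (1 / 2) : ℂ) * (Complex.I * alphaRoot A z) :=
    funext (alpha_eq A)
  rw [this]
  refine continuousOn_const.mul (continuousOn_const.mul ?_)
  have h1 : ContinuousOn (fun z => 1 + Complex.I / (2 * wave A z))
      (closedUpper ∩ {z | wave A z ≠ 0}) :=
    continuousOn_const.add (continuousOn_const.div
      (continuousOn_const.mul ((continuousOn_wave A).mono inter_subset_left))
      fun z hz => mul_ne_zero two_ne_zero hz.2)
  exact h1.cpow_const fun z hz => alphaRoot_base_mem (wave_im_nonneg hA hz.1)

theorem differentiableOn_alpha (hA : 0 < A) : DifferentiableOn ℂ (alpha A) upper := by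
  have : alpha A = fun z => (Real.sqrt (1 / 2) : ℂ) * (Complex.I * alphaRoot A z) :=
    funext (alpha_eq A)
  rw [this]
  intro z hz
  have h1 : DifferentiableAt ℂ (fun z => 1 + Complex.I / (2 * wave A z)) z := by
    have := (differentiableOn_wave A).differentiableAt (isOpen_upper.mem_nhds hz)
    have h0 : 2 * wave A z ≠ 0 := mul_ne_zero two_ne_zero (wave_ne_zero_of_upper hA hz)
    exact ((this.const_mul 2).inv h0 |>.const_mul Complex.I).const_add 1
  have h2 : DifferentiableAt ℂ (alphaRoot A) z :=
    h1.cpow_const (alphaRoot_base_mem (wave_im_nonneg hA (upper_subset_closedUpper hz)))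
  exact ((h2.const_mul _).const_mul _).differentiableWithinAt

end Root

section RealAxis

variable {A : ℝ} {x : ℝ}

theorem ofReal_mem_closedUpper (x : ℝ) : (x : ℂ) ∈ closedUpper := by simp [closedUpper]

/-- On the continuous spectrum the wave number is real and has the sign of the parameter. -/
theorem wave_ofReal_of_lt (hA : 0 < A) (hx : 1 / A < |x|) :
    ∃ κ : ℝ, wave A x = κ ∧ 0 < κ * x := by
  have hA1 : 0 < 1 / A := by positivity
  rcases lt_abs.1 hx with h | h
  · refine ⟨A * (Real.sqrt (x - 1 / A) * Real.sqrt (x + 1 / A)) / 2, ?_, ?_⟩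
    · rw [wave, lRoot]
      push_cast
      rw [← cpow_half_ofReal_of_nonneg (by linarith), ← cpow_half_ofReal_of_nonneg (by linarith)]
      push_cast; rfl
    · have h1 : 0 < Real.sqrt (x - 1 / A) := Real.sqrt_pos.2 (by linarith)
      have h2 : 0 < Real.sqrt (x + 1 / A) := Real.sqrt_pos.2 (by linarith)
      have h3 : 0 < x := by linarith
      positivity
  · have key : ∀ y : ℝ, y < 0 → ((y : ℂ) ^ (1 / 2 : ℂ)) = Complex.I * (Real.sqrt (-y) : ℂ) := by
      intro y hy
      rw [Complex.ofReal_cpow_of_nonpos hy.le, ← Complex.ofReal_neg,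
        cpow_half_ofReal_of_nonneg (by linarith), mul_comm]
      congr 1
      rw [show (Real.pi : ℂ) * Complex.I * (1 / 2) = Real.pi / 2 * Complex.I by ring,
        Complex.exp_pi_div_two_mul_I]
    refine ⟨-(A * (Real.sqrt (-(x - 1 / A)) * Real.sqrt (-(x + 1 / A))) / 2), ?_, ?_⟩
    · have h1 := key (x - 1 / A) (by linarith)
      have h2 := key (x + 1 / A) (by linarith)
      push_cast at h1 h2
      rw [wave, lRoot, h1, h2]
      push_cast
      linear_combination (A * Real.sqrt (-(x - 1 / A)) * Real.sqrt (-(x + 1 / A)) / 2 : ℂ) *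
        Complex.I_sq
    · have h1 : 0 < Real.sqrt (-(x - 1 / A)) := Real.sqrt_pos.2 (by linarith)
      have h2 : 0 < Real.sqrt (-(x + 1 / A)) := Real.sqrt_pos.2 (by linarith)
      have h3 : 0 < -x := by linarith
      have : 0 < A * (Real.sqrt (-(x - 1 / A)) * Real.sqrt (-(x + 1 / A))) / 2 * (-x) := by
        positivity
      linarith

/-- In the gap the wave number is a positive multiple of `i`. -/
theorem wave_ofReal_of_gt (hA : 0 < A) (hx : |x| < 1 / A) :
    wave A x = Complex.I * (Real.sqrt (1 - A ^ 2 * x ^ 2) / 2 : ℝ) := by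
  obtain ⟨h1, h2⟩ := abs_lt.1 hx
  have e1 : ((x : ℂ) - 1 / A) ^ (1 / 2 : ℂ) = Complex.I * (Real.sqrt (1 / A - x) : ℂ) := by
    have h : x - 1 / A ≤ 0 := by linarith
    have := Complex.ofReal_cpow_of_nonpos h (1 / 2 : ℂ)
    rw [← Complex.ofReal_neg, cpow_half_ofReal_of_nonneg (x := -(x - 1 / A)) (by linarith),
      mul_comm, show (Real.pi : ℂ) * Complex.I * (1 / 2) = Real.pi / 2 * Complex.I by ring,
      Complex.exp_pi_div_two_mul_I, neg_sub] at this
    rw [← this]; push_cast; rfl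
  have e2 : ((x : ℂ) + 1 / A) ^ (1 / 2 : ℂ) = (Real.sqrt (x + 1 / A) : ℂ) := by
    rw [← cpow_half_ofReal_of_nonneg (by linarith)]; push_cast; rfl
  have e3 : Real.sqrt (1 - A ^ 2 * x ^ 2) =
      A * (Real.sqrt (1 / A - x) * Real.sqrt (x + 1 / A)) := by
    rw [← Real.sqrt_mul (by linarith), show 1 - A ^ 2 * x ^ 2 =
      A ^ 2 * ((1 / A - x) * (x + 1 / A)) by field_simp; ring, Real.sqrt_mul (by positivity),
      Real.sqrt_sq hA.le]
  rw [wave, lRoot, e1, e2, e3]; push_cast; ring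

theorem gap_pos (hA : 0 < A) (hx : |x| < 1 / A) : 0 < 1 - A ^ 2 * x ^ 2 := by
  have h1 : |x| * A < 1 := (lt_div_iff₀ hA).1 hx
  have h2 : (|x| * A) ^ 2 < 1 := by
    have : 0 ≤ |x| * A := by positivity
    nlinarith
  rw [mul_pow, sq_abs] at h2; linarith

theorem wave_im_pos_of_gt (hA : 0 < A) (hx : |x| < 1 / A) : 0 < (wave A x).im := by
  rw [wave_ofReal_of_gt hA hx, Complex.I_mul_im, Complex.ofReal_re]
  exact half_pos (Real.sqrt_pos.2 (gap_pos hA hx))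

/-- In the gap k is purely imaginary, hence β is real and α purely imaginary. This reality is the
source of the constant jump -iσ₁. -/
theorem conj_wave_of_gt (hA : 0 < A) (hx : |x| < 1 / A) :
    (starRingEnd ℂ) (wave A x) = -wave A x := by
  rw [wave_ofReal_of_gt hA hx, map_mul, Complex.conj_I, Complex.conj_ofReal]; ring

theorem conj_beta_of_gt (hA : 0 < A) (hx : |x| < 1 / A) :
    (starRingEnd ℂ) (beta A x) = beta A x := by
  rw [beta_eq, map_div₀, map_mul, map_sub, map_mul, map_mul, conj_wave_of_gt hA hx,
    Complex.conj_ofNat]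
  simp

theorem conj_alpha_of_gt (hA : 0 < A) (hx : |x| < 1 / A) :
    (starRingEnd ℂ) (alpha A x) = -alpha A x := by
  rw [alpha_eq, map_mul, map_mul, Complex.conj_I, Complex.conj_ofReal]
  have hk := (wave_im_pos_of_gt hA hx).le
  have : (starRingEnd ℂ) (alphaRoot A x) = alphaRoot A x := by
    have h := Complex.conj_cpow (1 + Complex.I / (2 * wave A x)) (1 / 2)
      (Complex.slitPlane_arg_ne_pi (alphaRoot_base_mem hk))
    have h2 : (starRingEnd ℂ) (1 + Complex.I / (2 * wave A x)) =
        1 + Complex.I / (2 * wave A x) := by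
      rw [map_add, map_div₀, map_mul, conj_wave_of_gt hA hx, Complex.conj_ofNat]
      simp
    have h3 : (starRingEnd ℂ) (1 / 2 : ℂ) = 1 / 2 := by
      rw [map_div₀, map_one, Complex.conj_ofNat]
    rw [h2, h3] at h
    rw [alphaRoot]
    conv_rhs => rw [h]
  rw [this]; ring

theorem beta_im_of_lt (hA : 0 < A) {κ : ℝ} (hκ : wave A x = κ) (hx : x ≠ 0) :
    (beta A x).im = 2 * κ / (x * A) := by
  have h := mul_beta hA (ofReal_mem_closedUpper x)
  rw [hκ] at h
  have h2 := congrArg Complex.im h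
  have h3 : ((x : ℂ) * A * beta A x).im = x * A * (beta A x).im := by
    rw [← Complex.ofReal_mul, Complex.im_ofReal_mul]
  rw [h3] at h2
  rw [eq_div_iff (mul_ne_zero hx hA.ne'), mul_comm, h2]; simp

theorem alphaRoot_normSq (hA : 0 < A) {κ : ℝ} (hκ : wave A x = κ) (hκx : 0 < κ * x) :
    ‖alphaRoot A x‖ ^ 2 = x * A / (2 * κ) := by
  have hκ0 : κ ≠ 0 := fun h => by simp [h] at hκx
  have h2 := wave_sq hA (x : ℂ)
  rw [hκ] at h2
  have h2r : 4 * κ ^ 2 + 1 = A ^ 2 * x ^ 2 := by exact_mod_cast h2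
  have hpos : 0 ≤ x * A / (2 * κ) := by
    rw [show x * A / (2 * κ) = (κ * x) * A / (2 * κ ^ 2) by field_simp]
    positivity
  rw [← norm_pow, alphaRoot_sq, hκ]
  refine (pow_left_inj₀ (norm_nonneg _) hpos two_ne_zero).1 ?_
  rw [← Complex.normSq_eq_norm_sq, show (1 : ℂ) + Complex.I / (2 * κ) =
    ((1 : ℝ) : ℂ) + ((1 / (2 * κ) : ℝ) : ℂ) * Complex.I by push_cast; ring,
    Complex.normSq_add_mul_I]
  field_simp
  linarith

/-- On the continuous spectrum v ↦ -i v̄ exchanges the two columns of H⁻¹; this relates the two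
columns of Ψ₂ in `jost_right_zero`. -/
theorem alpha_mul_beta_of_lt (hA : 0 < A) (hx : 1 / A < |x|) :
    alpha A x * beta A x = -Complex.I * (starRingEnd ℂ) (alpha A x) := by
  obtain ⟨κ, hκ, hκx⟩ := wave_ofReal_of_lt hA hx
  have hκ0 : (κ : ℂ) ≠ 0 := Complex.ofReal_ne_zero.2 fun h => by simp [h] at hκx
  have hs := alphaRoot_ne_zero (wave_im_nonneg hA (ofReal_mem_closedUpper x))
  have h1 : alphaRoot A x * (starRingEnd ℂ) (alphaRoot A x) = x * A / (2 * κ) := by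
    rw [Complex.mul_conj, Complex.normSq_eq_norm_sq, alphaRoot_normSq hA hκ hκx]; push_cast; rfl
  have h2 : alphaRoot A x ^ 2 * beta A x = Complex.I * (x * A / (2 * κ)) := by
    have h3 := one_sub_wave_ne_zero hA (ofReal_mem_closedUpper x)
    rw [alphaRoot_sq, beta_eq]
    rw [hκ] at h3 ⊢
    have h5 : 1 + Complex.I / (2 * (κ : ℂ)) = Complex.I * (1 - 2 * Complex.I * κ) / (2 * κ) := by
      field_simp
      linear_combination (2 * (κ : ℂ)) * Complex.I_sq
    rw [h5]
    linear_combination (Complex.I / (2 * κ)) * div_mul_cancel₀ ((x : ℂ) * A) h3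
  have h4 : alphaRoot A x * beta A x = Complex.I * (starRingEnd ℂ) (alphaRoot A x) := by
    refine mul_left_cancel₀ hs ?_
    linear_combination h2 - Complex.I * h1
  rw [alpha_eq, map_mul, map_mul, Complex.conj_I, Complex.conj_ofReal]
  linear_combination ((Real.sqrt (1 / 2) : ℂ) * Complex.I) * h4

theorem two_mul_alpha_beta_im (hA : 0 < A) (hx : 1 / A < |x|) :
    2 * ‖alpha A x‖ ^ 2 * (beta A x).im = 1 := by
  obtain ⟨κ, hκ, hκx⟩ := wave_ofReal_of_lt hA hx
  have hκ0 : κ ≠ 0 := fun h => by simp [h] at hκx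
  have hx0 : x ≠ 0 := fun h => by simp [h] at hκx
  rw [beta_im_of_lt hA hκ hx0, alpha_eq, norm_mul, norm_mul, Complex.norm_I, one_mul, mul_pow,
    alphaRoot_normSq hA hκ hκx, Complex.norm_real, Real.norm_of_nonneg (Real.sqrt_nonneg _),
    Real.sq_sqrt (by norm_num)]
  field_simp

theorem beta_im_pos_of_lt (hA : 0 < A) (hx : 1 / A < |x|) : 0 < (beta A x).im := by
  have h := two_mul_alpha_beta_im hA hx
  by_contra hc
  have : 2 * ‖alpha A x‖ ^ 2 * (beta A x).im ≤ 0 :=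
    mul_nonpos_of_nonneg_of_nonpos (by positivity) (not_lt.1 hc)
  linarith

end RealAxis

end MCH

end

/-! ### The right Jost solution, constructed uniformly down to the branch points. -/

noncomputable section

namespace MCH

section Osc

/-- `∫_0^t e^{2ikτ} dτ`. -/
def osc (k : ℂ) (t : ℝ) : ℂ := ∫ τ in (0 : ℝ)..t, Complex.exp (2 * Complex.I * k * τ)

theorem osc_eq {k : ℂ} (hk : k ≠ 0) (t : ℝ) :
    osc k t = (Complex.exp (2 * Complex.I * k * t) - 1) / (2 * Complex.I * k) := by
  rw [osc, integral_exp_mul_complex (by simp [hk])]; simp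

theorem two_I_mul_osc (k : ℂ) (t : ℝ) :
    2 * Complex.I * k * osc k t = Complex.exp (2 * Complex.I * k * t) - 1 := by
  rcases eq_or_ne k 0 with rfl | hk
  · simp
  · rw [osc_eq hk, mul_div_cancel₀]; simp [hk]

theorem osc_zero_left (t : ℝ) : osc 0 t = t := by simp [osc]

theorem osc_zero_right (k : ℂ) : osc k 0 = 0 := by simp [osc]

theorem hasDerivAt_osc (k : ℂ) (t : ℝ) :
    HasDerivAt (osc k) (Complex.exp (2 * Complex.I * k * t)) t := by
  have hc : Continuous fun τ : ℝ => Complex.exp (2 * Complex.I * k * τ) := by fun_prop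
  exact intervalIntegral.integral_hasDerivAt_right (hc.intervalIntegrable _ _)
    (hc.stronglyMeasurableAtFilter _ _) hc.continuousAt

/-- Separating x from ξ lets the Volterra integral be differentiated in x as a combination of plain
tail integrals. The identity survives at k = 0. -/
theorem osc_sub (k : ℂ) (x ξ : ℝ) :
    osc k (ξ - x) = osc k (-x) + Complex.exp (-(2 * Complex.I * k * x)) * osc k ξ := by
  rcases eq_or_ne k 0 with rfl | hk
  · simp only [osc_zero_left]; push_cast; simp; ring
  · have h2 : 2 * Complex.I * k ≠ 0 := by simp [hk]
    have e : Complex.exp (2 * Complex.I * k * ((ξ - x : ℝ) : ℂ)) =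
        Complex.exp (-(2 * Complex.I * k * x)) * Complex.exp (2 * Complex.I * k * ξ) := by
      rw [← Complex.exp_add]; congr 1; push_cast; ring
    have e2 : Complex.exp (2 * Complex.I * k * ((-x : ℝ) : ℂ)) =
        Complex.exp (-(2 * Complex.I * k * x)) := by congr 1; push_cast; ring
    rw [osc_eq hk, osc_eq hk, osc_eq hk, e, e2]
    field_simp
    ring

theorem continuous_osc : Continuous fun p : ℂ × ℝ => osc p.1 p.2 := by
  unfold osc
  exact intervalIntegral.continuous_parametric_intervalIntegral_of_continuous
    (f := fun (p : ℂ × ℝ) (τ : ℝ) => Complex.exp (2 * Complex.I * p.1 * τ))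
    (s := fun p : ℂ × ℝ => p.2) (by fun_prop) continuous_snd

theorem norm_exp_two_I_le {k : ℂ} (hk : 0 ≤ k.im) {t : ℝ} (ht : 0 ≤ t) :
    ‖Complex.exp (2 * Complex.I * k * t)‖ ≤ 1 := by
  rw [Complex.norm_exp, Real.exp_le_one_iff]
  simp
  positivity

theorem norm_osc_le {k : ℂ} (hk : 0 ≤ k.im) {t : ℝ} (ht : 0 ≤ t) : ‖osc k t‖ ≤ t := by
  have := intervalIntegral.norm_integral_le_of_norm_le_const (a := 0) (b := t) (C := 1)
    (f := fun τ : ℝ => Complex.exp (2 * Complex.I * k * τ)) fun τ hτ => by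
      rw [uIoc_of_le ht] at hτ
      exact norm_exp_two_I_le hk hτ.1.le
  rw [osc]
  simpa [abs_of_nonneg ht] using this

theorem norm_exp_sub_exp_le {a b : ℂ} (ha : a.re ≤ 0) (hb : b.re ≤ 0) :
    ‖Complex.exp a - Complex.exp b‖ ≤ ‖a - b‖ := by
  have h := Convex.norm_image_sub_le_of_norm_hasDerivWithin_le (𝕜 := ℂ) (f := Complex.exp)
    (f' := Complex.exp) (s := {w : ℂ | w.re ≤ 0}) (C := 1)
    (fun w _ => (Complex.hasDerivAt_exp w).hasDerivWithinAt)
    (fun w hw => by rw [Complex.norm_exp]; exact Real.exp_le_one_iff.2 hw)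
    (convex_halfSpace_re_le 0) hb ha
  simpa using h

/-- The factor t² is where the second moment of m - A is consumed: in the expansion at z = 0 and in
the estimates at the branch points. -/
theorem norm_osc_sub_le {k k' : ℂ} (hk : 0 ≤ k.im) (hk' : 0 ≤ k'.im) {t : ℝ} (ht : 0 ≤ t) :
    ‖osc k t - osc k' t‖ ≤ 2 * ‖k - k'‖ * t ^ 2 := by
  have hc : ∀ k : ℂ, IntervalIntegrable (fun τ : ℝ => Complex.exp (2 * Complex.I * k * τ))
      volume 0 t := fun k => Continuous.intervalIntegrable (by fun_prop) _ _
  rw [osc, osc, ← intervalIntegral.integral_sub (hc k) (hc k')]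
  refine (intervalIntegral.norm_integral_le_of_norm_le_const (C := 2 * ‖k - k'‖ * t)
    fun τ hτ => ?_).trans (le_of_eq ?_)
  · rw [uIoc_of_le ht] at hτ
    have h0 : 0 ≤ τ := hτ.1.le
    refine (norm_exp_sub_exp_le ?_ ?_).trans ?_
    · simp; positivity
    · simp; positivity
    · rw [show 2 * Complex.I * k * (τ : ℂ) - 2 * Complex.I * k' * τ =
        2 * Complex.I * (k - k') * τ by ring, norm_mul, norm_mul, norm_mul, Complex.norm_real,
        Real.norm_of_nonneg h0, Complex.norm_I, Complex.norm_ofNat, mul_one]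
      exact mul_le_mul_of_nonneg_left hτ.2 (by positivity)
  · rw [sub_zero, abs_of_nonneg ht]; ring

end Osc

/-- A momentum `m` bounded between positive constants that tends to `A` at `+∞` with two
moments. -/
structure RightProfile (A : ℝ) (m : ℝ → ℝ) : Prop where
  pos : 0 < A
  differentiable : Differentiable ℝ m
  continuous_deriv : Continuous (deriv m)
  integrable_deriv : Integrable (deriv m)
  moment : ∀ n ≤ 2, IntegrableOn (fun x => x ^ n * (m x - A)) (Ioi 0)
  lower : ∃ c, 0 < c ∧ ∀ x, c ≤ m x
  upper : ∃ C, ∀ x, m x ≤ C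

theorem integrableOn_Ioi_of_continuous {F : Type*} [NormedAddCommGroup F] {f : ℝ → F}
    (hf : Continuous f) (h : IntegrableOn f (Ioi 0)) (x : ℝ) : IntegrableOn f (Ioi x) := by
  have h1 : IntegrableOn f (Icc x 0) := hf.integrableOn_Icc
  refine (h1.union h).mono_set fun y hy => ?_
  rcases le_or_gt y 0 with h | h
  · exact Or.inl ⟨le_of_lt hy, h⟩
  · exact Or.inr h

namespace RightProfile

variable {A : ℝ} {m : ℝ → ℝ}

theorem continuous (hm : RightProfile A m) : Continuous m := hm.differentiable.continuous

theorem integrableOn_sq (hm : RightProfile A m) (x : ℝ) :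
    IntegrableOn (fun ξ => (1 + |ξ|) ^ 2 * |m ξ - A|) (Ioi x) := by
  have hc := hm.continuous
  refine integrableOn_Ioi_of_continuous (by fun_prop) ?_ x
  have h := ((hm.moment 0 (by norm_num)).norm.add ((hm.moment 1 (by norm_num)).norm.const_mul 2)).add
    (hm.moment 2 le_rfl).norm
  refine (integrableOn_congr_fun (fun ξ hξ => ?_) measurableSet_Ioi).1 h
  have h0 : 0 < ξ := hξ
  simp only [Pi.add_apply, norm_mul, norm_pow, Real.norm_eq_abs]
  ring

theorem integrableOn_weighted (hm : RightProfile A m) {f : ℝ → ℝ} (hf : Continuous f) {C : ℝ}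
    (hb : ∀ ξ, |f ξ| ≤ C * (1 + |ξ|) ^ 2) (x : ℝ) :
    IntegrableOn (fun ξ => f ξ * |m ξ - A|) (Ioi x) := by
  have hc := hm.continuous
  refine Integrable.mono' ((hm.integrableOn_sq x).const_mul C)
    (Continuous.aestronglyMeasurable (by fun_prop)) (ae_of_all _ fun ξ => ?_)
  rw [norm_mul, Real.norm_eq_abs, Real.norm_eq_abs, abs_abs, ← mul_assoc]
  exact mul_le_mul_of_nonneg_right (hb ξ) (abs_nonneg _)

theorem integrableOn_sub (hm : RightProfile A m) (x : ℝ) :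
    IntegrableOn (fun ξ => m ξ - A) (Ioi x) := by
  have hc := hm.continuous
  refine integrableOn_Ioi_of_continuous (by fun_prop) ?_ x
  simpa using hm.moment 0 (by norm_num)

end RightProfile

/-- A `2 × 2` matrix as a continuous linear map. -/
def matCLM (M : Matrix (Fin 2) (Fin 2) ℂ) : (Fin 2 → ℂ) →L[ℂ] (Fin 2 → ℂ) :=
  LinearMap.toContinuousLinearMap (Matrix.toLin' M)

theorem matCLM_apply (M : Matrix (Fin 2) (Fin 2) ℂ) (v : Fin 2 → ℂ) : matCLM M v = M *ᵥ v := by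
  simp [matCLM]

/-- The vector field of the Lax equation `Ψ_x = U Ψ`. -/
def laxField (m : ℝ → ℝ) (z : ℂ) (x : ℝ) (w : Fin 2 → ℂ) : Fin 2 → ℂ :=
  ![(-(w 0) + z * m x * w 1) / 2, (-(z * m x * w 0) + w 1) / 2]

/-- `φ` solves the Lax equation `Ψ_x = U Ψ`. -/
def IsLaxSol (m : ℝ → ℝ) (z : ℂ) (φ : ℝ → Fin 2 → ℂ) : Prop :=
  ∀ x, HasDerivAt φ (laxField m z x (φ x)) x

/-- The matrix `J = i σ₂`. -/
def rotJ : Matrix (Fin 2) (Fin 2) ℂ := !![0, 1; -1, 0]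

/-- The matrix `(ik - U_A) J` for the constant background `A`. -/
def projCLM (A : ℝ) (z : ℂ) : (Fin 2 → ℂ) →L[ℂ] (Fin 2 → ℂ) :=
  (Complex.I * wave A z) • matCLM rotJ + (1 / 2 : ℂ) • matCLM sigma1 +
    (z * A / 2) • ContinuousLinearMap.id ℂ (Fin 2 → ℂ)

/-- The Volterra kernel of the right Jost solution, regular at the branch points. -/
def jostKernel (A : ℝ) (m : ℝ → ℝ) (x ξ : ℝ) (z : ℂ) : (Fin 2 → ℂ) →L[ℂ] (Fin 2 → ℂ) :=
  (-(z * ((m ξ - A : ℝ) : ℂ) / 2)) • (matCLM rotJ + osc (wave A z) (ξ - x) • projCLM A z)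

/-- The eigenvector `(1, β)`. -/
def eigvec (A : ℝ) (z : ℂ) : Fin 2 → ℂ := ![1, beta A z]

/-- The right Jost solution without its exponential factor. -/
def jostAmp (A : ℝ) (m : ℝ → ℝ) (x : ℝ) (z : ℂ) : Fin 2 → ℂ :=
  volterraSol (jostKernel A m) (eigvec A) x z

/-- The right Jost solution `e^{ikx} (1, β)ᵀ (1 + o(1))`. -/
def jostR (A : ℝ) (m : ℝ → ℝ) (x : ℝ) (z : ℂ) : Fin 2 → ℂ :=
  Complex.exp (Complex.I * wave A z * x) • jostAmp A m x z

/-- The part of the closed upper half-plane in the disk of radius `R`. -/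
def halfDisk (R : ℝ) : Set ℂ := closedUpper ∩ Metric.ball 0 R

theorem mem_halfDisk {z : ℂ} (hz : z ∈ closedUpper) : z ∈ halfDisk (‖z‖ + 1) :=
  ⟨hz, by simp⟩

theorem norm_wave_le {A : ℝ} (hA : 0 < A) {R : ℝ} {z : ℂ} (hz : ‖z‖ ≤ R) :
    ‖wave A z‖ ≤ A * R + 1 := by
  have h := wave_sq hA z
  have h1 : 4 * ‖wave A z‖ ^ 2 ≤ A ^ 2 * R ^ 2 + 1 := by
    have h2 : 4 * wave A z ^ 2 = A ^ 2 * z ^ 2 - 1 := by linear_combination h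
    have h3 : ‖4 * wave A z ^ 2‖ ≤ ‖(A : ℂ) ^ 2 * z ^ 2‖ + ‖(1 : ℂ)‖ := by
      rw [h2]; exact norm_sub_le _ _
    rw [norm_mul, norm_pow, norm_mul, norm_pow, norm_pow, Complex.norm_real,
      Real.norm_of_nonneg hA.le, norm_one, Complex.norm_ofNat] at h3
    have : ‖z‖ ^ 2 ≤ R ^ 2 := pow_le_pow_left₀ (norm_nonneg _) hz 2
    nlinarith [mul_le_mul_of_nonneg_left this (sq_nonneg A)]
  have hR : 0 ≤ R := (norm_nonneg z).trans hz
  have : 0 ≤ A * R := by positivity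
  nlinarith [norm_nonneg (wave A z)]

/-- A bound for the kernel constants on `halfDisk R`. -/
def kernelConst (A R : ℝ) : ℝ :=
  R / 2 * (‖matCLM rotJ‖ + ((A * R + 1) * ‖matCLM rotJ‖ + 1 / 2 * ‖matCLM sigma1‖ +
    R * A / 2 * ‖ContinuousLinearMap.id ℂ (Fin 2 → ℂ)‖))

theorem norm_projCLM_le {A : ℝ} (hA : 0 < A) {R : ℝ} {z : ℂ} (hz : ‖z‖ ≤ R) :
    ‖projCLM A z‖ ≤ (A * R + 1) * ‖matCLM rotJ‖ + 1 / 2 * ‖matCLM sigma1‖ +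
      R * A / 2 * ‖ContinuousLinearMap.id ℂ (Fin 2 → ℂ)‖ := by
  rw [projCLM]
  refine (norm_add₃_le).trans ?_
  rw [norm_smul, norm_smul, norm_smul]
  have h1 : ‖Complex.I * wave A z‖ ≤ A * R + 1 := by
    rw [norm_mul, Complex.norm_I, one_mul]; exact norm_wave_le hA hz
  have h2 : ‖(1 / 2 : ℂ)‖ = 1 / 2 := by norm_num
  have h3 : ‖z * A / 2‖ ≤ R * A / 2 := by
    rw [norm_div, norm_mul, Complex.norm_real, Real.norm_of_nonneg hA.le, Complex.norm_ofNat]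
    gcongr
  rw [h2]
  gcongr

/-- The kernel is -(z(m - A)/2) e^{t(ik - U_A)}J with t = ξ - x and U_A the Lax matrix of the
background. As ik - U_A has eigenvalues 0 and 2ik, the exponential is 1 + osc(k, t)(ik - U_A),
without division by k. It grows at most linearly in t, uniformly up to k = 0, at the price of one
moment of m - A. -/
theorem norm_jostKernel_le {A : ℝ} (hA : 0 < A) (m : ℝ → ℝ) {R : ℝ} {z : ℂ} (hz : z ∈ halfDisk R)
    {x ξ : ℝ} (hx : x ≤ ξ) :
    ‖jostKernel A m x ξ z‖ ≤ kernelConst A R * (1 + (ξ - x)) * |m ξ - A| := by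
  have hzR : ‖z‖ ≤ R := by
    have := hz.2; rw [Metric.mem_ball, dist_zero_right] at this; exact this.le
  have hR : 0 ≤ R := (norm_nonneg z).trans hzR
  have hP := norm_projCLM_le hA hzR
  set P := (A * R + 1) * ‖matCLM rotJ‖ + 1 / 2 * ‖matCLM sigma1‖ +
      R * A / 2 * ‖ContinuousLinearMap.id ℂ (Fin 2 → ℂ)‖ with hPdef
  have hP0 : 0 ≤ P := (norm_nonneg _).trans hP
  have ht : 0 ≤ ξ - x := by linarith
  have ho := norm_osc_le (wave_im_nonneg hA hz.1) ht
  rw [jostKernel, norm_smul, norm_neg, norm_div, norm_mul, Complex.norm_real, Complex.norm_ofNat,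
    Real.norm_eq_abs, kernelConst, ← hPdef]
  have h1 : ‖matCLM rotJ + osc (wave A z) (ξ - x) • projCLM A z‖ ≤
      (‖matCLM rotJ‖ + P) * (1 + (ξ - x)) := by
    refine (norm_add_le _ _).trans ?_
    rw [norm_smul]
    have h2 : ‖osc (wave A z) (ξ - x)‖ * ‖projCLM A z‖ ≤ (ξ - x) * P := by gcongr
    nlinarith [norm_nonneg (matCLM rotJ)]
  calc ‖z‖ * |m ξ - A| / 2 * ‖matCLM rotJ + osc (wave A z) (ξ - x) • projCLM A z‖
      ≤ R * |m ξ - A| / 2 * ((‖matCLM rotJ‖ + P) * (1 + (ξ - x))) := by gcongr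
    _ = _ := by ring

theorem kernelConst_nonneg {A R : ℝ} (hA : 0 < A) (hR : 0 ≤ R) : 0 ≤ kernelConst A R := by
  rw [kernelConst]; positivity

theorem isVolterraKernel_jostKernel {A : ℝ} {m : ℝ → ℝ} (hm : RightProfile A m) {R : ℝ}
    (hR : 0 ≤ R) :
    IsVolterraKernel (jostKernel A m) (halfDisk R) (fun x => 1 + max 0 (-x))
      (fun ξ => kernelConst A R * (1 + |ξ|) * |m ξ - A|) where
  weight_continuous := by fun_prop
  one_le_weight x := by simp
  majorant_continuous := by have := hm.continuous; fun_prop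
  majorant_nonneg x := by have := kernelConst_nonneg hm.pos hR; positivity
  majorant_integrable x := by
    have hk := kernelConst_nonneg hm.pos hR
    refine hm.integrableOn_weighted (C := kernelConst A R) (by fun_prop) (fun ξ => ?_) x
    rw [abs_of_nonneg (by positivity)]
    have := abs_nonneg ξ
    exact mul_le_mul_of_nonneg_left (by nlinarith) hk
  bound z hz x ξ hx := by
    have h := norm_jostKernel_le hm.pos m hz hx
    have hk := kernelConst_nonneg hm.pos hR
    have hw : 0 ≤ 1 + max 0 (-ξ) := by positivity
    refine (mul_le_mul_of_nonneg_right h hw).trans ?_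
    -- The linear growth in ξ - x is shared out: |ξ| goes into the majorant, the contribution of
    -- negative x into the weight.
    have key : (1 + (ξ - x)) * (1 + max 0 (-ξ)) ≤ (1 + max 0 (-x)) * (1 + |ξ|) := by
      rcases le_total 0 ξ with h1 | h1 <;> rcases le_total 0 x with h2 | h2
      · rw [max_eq_left (by linarith), max_eq_left (by linarith), abs_of_nonneg h1]; nlinarith
      · rw [max_eq_left (by linarith), max_eq_right (by linarith), abs_of_nonneg h1]; nlinarith
      · have e1 : ξ = 0 := by linarith
        have e2 : x = 0 := by linarith
        simp [e1, e2]
      · rw [max_eq_right (by linarith), max_eq_right (by linarith), abs_of_nonpos h1]; nlinarith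
    calc kernelConst A R * (1 + (ξ - x)) * |m ξ - A| * (1 + max 0 (-ξ))
        = kernelConst A R * |m ξ - A| * ((1 + (ξ - x)) * (1 + max 0 (-ξ))) := by ring
      _ ≤ kernelConst A R * |m ξ - A| * ((1 + max 0 (-x)) * (1 + |ξ|)) := by gcongr
      _ = _ := by ring
  continuousOn := by
    have hmc := hm.continuous
    have hw : ContinuousOn (fun p : ℝ × ℝ × ℂ => wave A p.2.2) (univ ×ˢ univ ×ˢ halfDisk R) :=
      (continuousOn_wave A).comp (f := fun p : ℝ × ℝ × ℂ => p.2.2) (by fun_prop)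
        fun p hp => hp.2.2.1
    have ho : ContinuousOn (fun p : ℝ × ℝ × ℂ => osc (wave A p.2.2) (p.2.1 - p.1))
        (univ ×ˢ univ ×ˢ halfDisk R) := by
      refine continuous_osc.comp_continuousOn (f := fun p : ℝ × ℝ × ℂ =>
        (wave A p.2.2, p.2.1 - p.1)) (hw.prodMk (by fun_prop))
    unfold jostKernel projCLM
    fun_prop

theorem continuousOn_eigvec {A : ℝ} (hA : 0 < A) : ContinuousOn (eigvec A) closedUpper := by
  refine continuousOn_pi.2 fun i => ?_
  fin_cases i
  · exact continuousOn_const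
  · exact continuousOn_beta hA

theorem norm_eigvec_le {A : ℝ} (hA : 0 < A) {R : ℝ} {z : ℂ} (hz : z ∈ halfDisk R) :
    ‖eigvec A z‖ ≤ 1 + A * R := by
  have hzR : ‖z‖ ≤ R := by
    have := hz.2; rw [Metric.mem_ball, dist_zero_right] at this; exact this.le
  have hR : 0 ≤ R := (norm_nonneg z).trans hzR
  have hAR : 0 ≤ A * R := by positivity
  refine (pi_norm_le_iff_of_nonneg (by linarith)).2 fun i => ?_
  fin_cases i
  · simpa [eigvec] using hAR
  · have h1 := one_le_norm_one_sub_wave hA hz.1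
    have : ‖beta A z‖ ≤ A * R := by
      rw [beta_eq, norm_div, norm_mul, Complex.norm_real, Real.norm_of_nonneg hA.le]
      refine (div_le_self (by positivity) h1).trans ?_
      nlinarith
    simp only [eigvec]
    change ‖beta A z‖ ≤ _
    linarith

section Amp

variable {A : ℝ} {m : ℝ → ℝ}

/-- The majorant of the Jost kernel on `halfDisk R`. -/
def jostMajorant (A : ℝ) (m : ℝ → ℝ) (R ξ : ℝ) : ℝ := kernelConst A R * (1 + |ξ|) * |m ξ - A|

theorem continuousOn_jostAmp (hm : RightProfile A m) (x : ℝ) :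
    ContinuousOn (jostAmp A m x) closedUpper := by
  intro z hz
  have hR : 0 ≤ ‖z‖ + 1 := by positivity
  have hK := isVolterraKernel_jostKernel hm hR
  have h := hK.continuousOn_sol (g := eigvec A) (fun z hz => norm_eigvec_le hm.pos hz)
    ((continuousOn_eigvec hm.pos).mono inter_subset_left)
  have h2 : ContinuousOn (jostAmp A m x) (halfDisk (‖z‖ + 1)) :=
    h.comp (f := fun z : ℂ => (x, z)) (by fun_prop) fun z hz => ⟨trivial, hz⟩
  exact (h2 z (mem_halfDisk hz)).mono_of_mem_nhdsWithin (inter_mem self_mem_nhdsWithin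
    (mem_nhdsWithin_of_mem_nhds (Metric.isOpen_ball.mem_nhds (by simp))))

theorem continuous_jostAmp (hm : RightProfile A m) {z : ℂ} (hz : z ∈ closedUpper) :
    Continuous fun x => jostAmp A m x z :=
  (isVolterraKernel_jostKernel hm (by positivity : 0 ≤ ‖z‖ + 1)).continuous_sol
    (fun z hz => norm_eigvec_le hm.pos hz) ((continuousOn_eigvec hm.pos).mono inter_subset_left)
    (mem_halfDisk hz)

theorem differentiableOn_jostAmp (hm : RightProfile A m) (x : ℝ) :
    DifferentiableOn ℂ (jostAmp A m x) upper := by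
  intro z hz
  have hR : 0 ≤ ‖z‖ + 1 := by positivity
  have hK := isVolterraKernel_jostKernel hm hR
  have hUo : IsOpen (upper ∩ Metric.ball (0 : ℂ) (‖z‖ + 1)) :=
    isOpen_upper.inter Metric.isOpen_ball
  have hw : DifferentiableOn ℂ (wave A) (upper ∩ Metric.ball (0 : ℂ) (‖z‖ + 1)) :=
    (differentiableOn_wave A).mono inter_subset_left
  have h := hK.differentiableOn_sol (g := eigvec A) (fun z hz => norm_eigvec_le hm.pos hz)
    ((continuousOn_eigvec hm.pos).mono inter_subset_left) hUo
    (inter_subset_inter_left _ upper_subset_closedUpper) ?_ ?_ x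
  · exact ((h z ⟨hz, by simp⟩).differentiableAt (hUo.mem_nhds ⟨hz, by simp⟩)).differentiableWithinAt
  · refine differentiableOn_pi.2 fun i => ?_
    fin_cases i
    · exact differentiableOn_const _
    · exact (differentiableOn_beta hm.pos).mono inter_subset_left
  · intro x ξ
    have ho : DifferentiableOn ℂ (fun z => osc (wave A z) (ξ - x))
        (upper ∩ Metric.ball (0 : ℂ) (‖z‖ + 1)) := by
      refine DifferentiableOn.congr (f := fun z =>
        (Complex.exp (2 * Complex.I * wave A z * ((ξ - x : ℝ) : ℂ)) - 1) /
          (2 * Complex.I * wave A z)) ?_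
        fun z hz => osc_eq (wave_ne_zero_of_upper hm.pos hz.1) _
      refine DifferentiableOn.div (by fun_prop) (by fun_prop) fun z hz => ?_
      simp [wave_ne_zero_of_upper hm.pos hz.1]
    unfold jostKernel projCLM
    fun_prop

theorem jostAmp_eq (hm : RightProfile A m) {z : ℂ} (hz : z ∈ closedUpper) (x : ℝ) :
    jostAmp A m x z = eigvec A z + ∫ ξ in Ioi x, jostKernel A m x ξ z (jostAmp A m ξ z) :=
  (isVolterraKernel_jostKernel hm (by positivity : 0 ≤ ‖z‖ + 1)).sol_eq
    (fun z hz => norm_eigvec_le hm.pos hz) ((continuousOn_eigvec hm.pos).mono inter_subset_left)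
    (mem_halfDisk hz) x

theorem jostMajorant_nonneg (hm : RightProfile A m) {R : ℝ} (hR : 0 ≤ R) (x : ℝ) :
    0 ≤ jostMajorant A m R x := (isVolterraKernel_jostKernel hm hR).majorant_nonneg x

theorem integrableOn_jostMajorant (hm : RightProfile A m) {R : ℝ} (hR : 0 ≤ R) (x : ℝ) :
    IntegrableOn (jostMajorant A m R) (Ioi x) :=
  (isVolterraKernel_jostKernel hm hR).majorant_integrable x

/-- The Jost amplitude is bounded on right half-lines, uniformly on half-disks. -/
theorem norm_jostAmp_le (hm : RightProfile A m) {R : ℝ} (hR : 0 ≤ R) (x₀ : ℝ) :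
    ∃ C, 0 ≤ C ∧ ∀ z ∈ halfDisk R, ∀ x, x₀ ≤ x → ‖jostAmp A m x z‖ ≤ C := by
  have hK := isVolterraKernel_jostKernel hm hR
  have hA := hm.pos
  refine ⟨2 * (1 + A * R) * ((1 + max 0 (-x₀)) * tailWeight (jostMajorant A m R) x₀), ?_,
    fun z hz x hx => ?_⟩
  · have := one_le_tailWeight (jostMajorant_nonneg hm hR) x₀
    positivity
  · refine (hK.norm_sol_le (g := eigvec A) (fun z hz => norm_eigvec_le hm.pos hz) hz x).trans ?_
    have h1 := tailWeight_anti (jostMajorant_nonneg hm hR) (integrableOn_jostMajorant hm hR) hx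
    have h2 := one_le_tailWeight (jostMajorant_nonneg hm hR) x
    have h3 : max 0 (-x) ≤ max 0 (-x₀) := max_le_max_left _ (by linarith)
    have h4 : (0 : ℝ) ≤ 1 + A * R := by positivity
    change _ * ((1 + max 0 (-x)) * tailWeight (jostMajorant A m R) x) ≤ _
    gcongr

theorem tendsto_jostAmp (hm : RightProfile A m) {z : ℂ} (hz : z ∈ closedUpper) :
    Tendsto (fun x => jostAmp A m x z) atTop (𝓝 (eigvec A z)) := by
  have hR : 0 ≤ ‖z‖ + 1 := by positivity
  have hK := isVolterraKernel_jostKernel hm hR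
  rw [tendsto_iff_norm_sub_tendsto_zero]
  have hlim := ((tendsto_tailWeight (integrableOn_jostMajorant hm hR)).sub_const 1).const_mul
    (1 + A * (‖z‖ + 1))
  rw [sub_self, mul_zero] at hlim
  refine tendsto_of_tendsto_of_tendsto_of_le_of_le' tendsto_const_nhds hlim
    (Eventually.of_forall fun x => norm_nonneg _) ?_
  filter_upwards [eventually_ge_atTop 0] with x hx
  have := hK.norm_sol_sub_le (g := eigvec A) (fun z hz => norm_eigvec_le hm.pos hz)
    ((continuousOn_eigvec hm.pos).mono inter_subset_left) (mem_halfDisk hz) x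
  rw [max_eq_left (by linarith), add_zero, mul_one] at this
  exact this

theorem integrableOn_mul_jostAmp (hm : RightProfile A m) {z : ℂ} (hz : z ∈ closedUpper)
    {f : ℝ → ℂ} (hf : Continuous f) {C : ℝ} (hb : ∀ ξ, 0 ≤ ξ → ‖f ξ‖ ≤ C * (1 + |ξ|) ^ 2) (x : ℝ) :
    IntegrableOn (fun ξ => (f ξ * ((m ξ - A : ℝ) : ℂ)) • jostAmp A m ξ z) (Ioi x) := by
  have hc := hm.continuous
  have hh := continuous_jostAmp hm hz
  obtain ⟨D, hD, hbd⟩ := norm_jostAmp_le hm (by positivity : 0 ≤ ‖z‖ + 1) 0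
  refine integrableOn_Ioi_of_continuous (by fun_prop) ?_ x
  refine Integrable.mono' ((hm.integrableOn_sq 0).const_mul (C * D))
    (Continuous.aestronglyMeasurable (by fun_prop))
    ((ae_restrict_iff' measurableSet_Ioi).2 (ae_of_all _ fun ξ hξ => ?_))
  have h0 : 0 ≤ ξ := le_of_lt hξ
  rw [norm_smul, norm_mul, Complex.norm_real, Real.norm_eq_abs]
  calc ‖f ξ‖ * |m ξ - A| * ‖jostAmp A m ξ z‖ ≤ (C * (1 + |ξ|) ^ 2) * |m ξ - A| * D := by
        have := hb ξ h0
        have := hbd z (mem_halfDisk hz) ξ h0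
        have : 0 ≤ C * (1 + |ξ|) ^ 2 := (norm_nonneg _).trans (hb ξ h0)
        gcongr
    _ = _ := by ring

/-- Differentiation of the integral equation. By `osc_sub` the dependence on x sits in explicit
factors in front of two tail integrals `I1` and `I2`; what remains is algebra with the dispersion
relation and the eigenvector equations. -/
theorem hasDerivAt_jostAmp (hm : RightProfile A m) {z : ℂ} (hz : z ∈ closedUpper) (x : ℝ) :
    HasDerivAt (fun x => jostAmp A m x z)
      (laxField m z x (jostAmp A m x z) - (Complex.I * wave A z) • jostAmp A m x z) x := by
  have hc := hm.continuous
  have hh := continuous_jostAmp hm hz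
  have hoc : Continuous fun ξ : ℝ => osc (wave A z) ξ :=
    continuous_osc.comp (f := fun ξ : ℝ => (wave A z, ξ)) (by fun_prop)
  have hi1 := integrableOn_mul_jostAmp hm hz (f := fun _ => 1) (C := 1) continuous_const
    (fun ξ h => by simp only [norm_one]; nlinarith [abs_nonneg ξ])
  have hi2 := integrableOn_mul_jostAmp hm hz (f := fun ξ => osc (wave A z) ξ) (C := 1) hoc
    (fun ξ h => (norm_osc_le (wave_im_nonneg hm.pos hz) h).trans
      (by nlinarith [abs_nonneg ξ, le_abs_self ξ]))
  set I1 : ℝ → Fin 2 → ℂ := fun x =>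
    ∫ ξ in Ioi x, ((1 : ℂ) * ((m ξ - A : ℝ) : ℂ)) • jostAmp A m ξ z with hI1
  set I2 : ℝ → Fin 2 → ℂ := fun x =>
    ∫ ξ in Ioi x, (osc (wave A z) ξ * ((m ξ - A : ℝ) : ℂ)) • jostAmp A m ξ z with hI2
  have hform : ∀ x, jostAmp A m x z = eigvec A z - (z / 2) • (matCLM rotJ (I1 x) +
      osc (wave A z) (-x) • projCLM A z (I1 x) +
      Complex.exp (-(2 * Complex.I * wave A z * x)) • projCLM A z (I2 x)) := by
    intro x
    rw [jostAmp_eq hm hz x, sub_eq_add_neg]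
    congr 1
    have e1 : ∀ L : (Fin 2 → ℂ) →L[ℂ] (Fin 2 → ℂ), L (I1 x) = ∫ ξ in Ioi x,
        L (((1 : ℂ) * ((m ξ - A : ℝ) : ℂ)) • jostAmp A m ξ z) := fun L =>
      (L.integral_comp_comm (hi1 x)).symm
    have e2 : ∀ L : (Fin 2 → ℂ) →L[ℂ] (Fin 2 → ℂ), L (I2 x) = ∫ ξ in Ioi x,
        L ((osc (wave A z) ξ * ((m ξ - A : ℝ) : ℂ)) • jostAmp A m ξ z) := fun L =>
      (L.integral_comp_comm (hi2 x)).symm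
    have j1 : ∀ L : (Fin 2 → ℂ) →L[ℂ] (Fin 2 → ℂ), IntegrableOn (fun ξ =>
        L (((1 : ℂ) * ((m ξ - A : ℝ) : ℂ)) • jostAmp A m ξ z)) (Ioi x) := fun L =>
      L.integrable_comp (hi1 x)
    have j2 : ∀ L : (Fin 2 → ℂ) →L[ℂ] (Fin 2 → ℂ), IntegrableOn (fun ξ =>
        L ((osc (wave A z) ξ * ((m ξ - A : ℝ) : ℂ)) • jostAmp A m ξ z)) (Ioi x) := fun L =>
      L.integrable_comp (hi2 x)
    have hsum := integral_add ((j1 (matCLM rotJ)).add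
      ((j1 (projCLM A z)).smul (osc (wave A z) (-x))))
      ((j2 (projCLM A z)).smul (Complex.exp (-(2 * Complex.I * wave A z * x))))
    have hsum2 := integral_add (j1 (matCLM rotJ))
      ((j1 (projCLM A z)).smul (osc (wave A z) (-x)))
    simp only [Pi.add_apply, Pi.smul_apply] at hsum hsum2
    rw [e1, e1, e2, ← integral_smul, ← integral_smul, ← hsum2, ← hsum, ← integral_smul,
      ← integral_neg]
    refine integral_congr_ae (ae_of_all _ fun ξ => ?_)
    simp only [jostKernel, osc_sub, _root_.smul_apply,
      _root_.add_apply, map_smul]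
    module
  have d1 : HasDerivAt I1 (-(((1 : ℂ) * ((m x - A : ℝ) : ℂ)) • jostAmp A m x z)) x :=
    hasDerivAt_integral_Ioi (by fun_prop) hi1 x
  have d2 : HasDerivAt I2 (-((osc (wave A z) x * ((m x - A : ℝ) : ℂ)) • jostAmp A m x z)) x :=
    hasDerivAt_integral_Ioi (by fun_prop) hi2 x
  have d3 : HasDerivAt (fun x : ℝ => osc (wave A z) (-x))
      (-Complex.exp (-(2 * Complex.I * wave A z * x))) x := by
    have := (hasDerivAt_osc (wave A z) (-x)).scomp x (hasDerivAt_neg x)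
    simpa [Function.comp_def] using this
  have d4 : HasDerivAt (fun x : ℝ => Complex.exp (-(2 * Complex.I * wave A z * x)))
      (Complex.exp (-(2 * Complex.I * wave A z * x)) * -(2 * Complex.I * wave A z)) x := by
    have : HasDerivAt (fun x : ℝ => -(2 * Complex.I * wave A z * (x : ℂ)))
        (-(2 * Complex.I * wave A z)) x := by
      have := ((hasDerivAt_id x).ofReal_comp.const_mul (2 * Complex.I * wave A z)).neg
      simp only [id, Complex.ofReal_one, mul_one] at this
      exact this
    exact this.cexp
  have D := ((((matCLM rotJ).hasFDerivAt.restrictScalars ℝ).comp_hasDerivAt x d1).add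
    (d3.smul (((projCLM A z).hasFDerivAt.restrictScalars ℝ).comp_hasDerivAt x d1))).add
    (d4.smul (((projCLM A z).hasFDerivAt.restrictScalars ℝ).comp_hasDerivAt x d2))
  have D2 := (D.const_smul (z / 2)).const_sub (eigvec A z)
  have hfun : (fun x => jostAmp A m x z) = fun x => eigvec A z - (z / 2) • (matCLM rotJ (I1 x) +
      osc (wave A z) (-x) • projCLM A z (I1 x) +
      Complex.exp (-(2 * Complex.I * wave A z * x)) • projCLM A z (I2 x)) := funext hform
  rw [hfun]
  refine D2.congr_deriv ?_
  have hx := hform x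
  have hosc := osc_sub (wave A z) x x
  rw [sub_self, osc_zero_right] at hosc
  have hexp := two_I_mul_osc (wave A z) (-x)
  rw [show 2 * Complex.I * wave A z * ((-x : ℝ) : ℂ) = -(2 * Complex.I * wave A z * x) by
    push_cast; ring] at hexp
  have hb := mul_beta hm.pos hz
  have hb2 := beta_mul hm.pos hz
  have hw := wave_sq hm.pos z
  change -((z / 2) • ((matCLM rotJ) (-(((1 : ℂ) * ((m x - A : ℝ) : ℂ)) • jostAmp A m x z)) +
    (osc (wave A z) (-x) • projCLM A z (-(((1 : ℂ) * ((m x - A : ℝ) : ℂ)) • jostAmp A m x z)) +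
      -Complex.exp (-(2 * Complex.I * wave A z * x)) • projCLM A z (I1 x)) +
    (Complex.exp (-(2 * Complex.I * wave A z * x)) • projCLM A z
      (-((osc (wave A z) x * ((m x - A : ℝ) : ℂ)) • jostAmp A m x z)) +
      (Complex.exp (-(2 * Complex.I * wave A z * x)) * -(2 * Complex.I * wave A z)) •
        projCLM A z (I2 x)))) =
    laxField m z x (jostAmp A m x z) - (Complex.I * wave A z) • jostAmp A m x z
  have hx0 := congrFun hx 0
  have hx1 := congrFun hx 1
  generalize jostAmp A m x z = h at *
  generalize I1 x = a at *
  generalize I2 x = b at *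
  generalize osc (wave A z) (-x) = s at *
  generalize osc (wave A z) x = s' at *
  generalize Complex.exp (-(2 * Complex.I * wave A z * x)) = e at *
  have hκ : 4 * (Complex.I * wave A z) ^ 2 = 1 - A ^ 2 * z ^ 2 := by
    linear_combination (4 * wave A z ^ 2) * Complex.I_sq - hw
  have hG0 : ∀ w : Fin 2 → ℂ, projCLM A z w 0 =
      (Complex.I * wave A z + 1 / 2) * w 1 + z * A / 2 * w 0 := fun w => by
    simp [projCLM, matCLM_apply, rotJ, sigma1, dotProduct, Fin.sum_univ_two]; ring
  have hG1 : ∀ w : Fin 2 → ℂ, projCLM A z w 1 =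
      (-(Complex.I * wave A z) + 1 / 2) * w 0 + z * A / 2 * w 1 := fun w => by
    simp [projCLM, matCLM_apply, rotJ, sigma1, dotProduct, Fin.sum_univ_two]; ring
  have hJ0 : ∀ w : Fin 2 → ℂ, matCLM rotJ w 0 = w 1 := fun w => by
    simp [matCLM_apply, rotJ, Matrix.mulVec, dotProduct, Fin.sum_univ_two]
  have hJ1 : ∀ w : Fin 2 → ℂ, matCLM rotJ w 1 = -w 0 := fun w => by
    simp [matCLM_apply, rotJ, Matrix.mulVec, dotProduct, Fin.sum_univ_two]
  have hv0 : eigvec A z 0 = 1 := rfl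
  have hv1 : eigvec A z 1 = beta A z := rfl
  have hL0 : laxField m z x h 0 = (-(h 0) + z * m x * h 1) / 2 := rfl
  have hL1 : laxField m z x h 1 = (-(z * m x * h 0) + h 1) / 2 := rfl
  rw [mul_assoc 2 Complex.I] at hexp hb hb2 ⊢
  simp only [Pi.sub_apply, Pi.add_apply, Pi.smul_apply, smul_eq_mul, hG0, hG1, hJ0, hJ1, hv0,
    hv1] at hx0 hx1
  generalize Complex.I * wave A z = κ at *
  ext i
  fin_cases i
  · simp only [Fin.zero_eta, Pi.sub_apply, Pi.add_apply, Pi.neg_apply, Pi.smul_apply, smul_eq_mul,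
      hG0, hJ0, hL0]
    push_cast
    linear_combination (κ + 1 / 2) * hx0 - z * A / 2 * hx1 -
      z / 2 * (m x - A) * ((κ + 1 / 2) * h 1 + z * A / 2 * h 0) * hosc - 1 / 2 * hb -
      z / 2 * ((κ + 1 / 2) * a 1 + z * A / 2 * a 0) * hexp + z / 8 * (e * b 1 + s * a 1) * hκ
  · simp only [Fin.mk_one, Pi.sub_apply, Pi.add_apply, Pi.neg_apply, Pi.smul_apply, smul_eq_mul,
      hG1, hJ1, hL1]
    push_cast
    linear_combination z * A / 2 * hx0 + (κ - 1 / 2) * hx1 -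
      z / 2 * (m x - A) * ((-κ + 1 / 2) * h 0 + z * A / 2 * h 1) * hosc - 1 / 2 * hb2 -
      z / 2 * ((-κ + 1 / 2) * a 0 + z * A / 2 * a 1) * hexp - z / 8 * (e * b 0 + s * a 0) * hκ

theorem isLaxSol_jostR (hm : RightProfile A m) {z : ℂ} (hz : z ∈ closedUpper) :
    IsLaxSol m z fun x => jostR A m x z := by
  intro x
  have h1 : HasDerivAt (fun x : ℝ => Complex.exp (Complex.I * wave A z * x))
      (Complex.exp (Complex.I * wave A z * x) * (Complex.I * wave A z)) x := by
    have := (hasDerivAt_id x).ofReal_comp.const_mul (Complex.I * wave A z)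
    simp only [id, Complex.ofReal_one, mul_one] at this
    exact this.cexp
  refine (h1.smul (hasDerivAt_jostAmp hm hz x)).congr_deriv ?_
  ext i
  fin_cases i <;> simp [laxField, jostR, Matrix.vecHead, Matrix.vecTail] <;> ring

end Amp

section Lax

variable {m : ℝ → ℝ} {z : ℂ} {φ χ : ℝ → Fin 2 → ℂ}

theorem IsLaxSol.hasDerivAt_zero (h : IsLaxSol m z φ) (x : ℝ) :
    HasDerivAt (fun x => φ x 0) ((-(φ x 0) + z * m x * φ x 1) / 2) x :=
  (hasDerivAt_pi.1 (h x)) 0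

theorem IsLaxSol.hasDerivAt_one (h : IsLaxSol m z φ) (x : ℝ) :
    HasDerivAt (fun x => φ x 1) ((-(z * m x * φ x 0) + φ x 1) / 2) x :=
  (hasDerivAt_pi.1 (h x)) 1

/-- The Wronskian of two solutions of the Lax equation does not depend on `x`. -/
theorem IsLaxSol.colDet_eq (h : IsLaxSol m z φ) (h' : IsLaxSol m z χ) (x y : ℝ) :
    colDet (φ x) (χ x) = colDet (φ y) (χ y) := by
  have hd : ∀ x, HasDerivAt (fun x => colDet (φ x) (χ x)) 0 x := fun x => by
    have := ((h.hasDerivAt_zero x).mul (h'.hasDerivAt_one x)).sub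
      ((h'.hasDerivAt_zero x).mul (h.hasDerivAt_one x))
    refine this.congr_deriv ?_
    ring
  exact is_const_of_deriv_eq_zero (fun x => (hd x).differentiableAt) (fun x => (hd x).deriv) x y

theorem IsLaxSol.unique {C : ℝ} (hC : ∀ x, |m x| ≤ C) (h : IsLaxSol m z φ) (h' : IsLaxSol m z χ)
    {x : ℝ} (hx : φ x = χ x) : φ = χ := by
  have hC0 : 0 ≤ C := (abs_nonneg _).trans (hC 0)
  refine ODE_solution_unique_univ (v := laxField m z) (s := fun _ => univ)
    (K := Real.toNNReal (1 + ‖z‖ * C)) (fun t => ?_) (fun t => ⟨h t, trivial⟩)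
    (fun t => ⟨h' t, trivial⟩) hx
  refine LipschitzOnWith.of_dist_le_mul fun u _ w _ => ?_
  have hzC : 0 ≤ ‖z‖ * C := by positivity
  rw [Real.coe_toNNReal _ (by linarith), dist_eq_norm, dist_eq_norm]
  have h0 := norm_le_pi_norm (u - w) 0
  have h1 := norm_le_pi_norm (u - w) 1
  simp only [Pi.sub_apply] at h0 h1
  have hzm : ‖z * m t‖ ≤ ‖z‖ * C := by
    rw [norm_mul, Complex.norm_real, Real.norm_eq_abs]
    exact mul_le_mul_of_nonneg_left (hC t) (norm_nonneg _)
  have hn := norm_nonneg (u - w)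
  refine (pi_norm_le_iff_of_nonneg (by positivity)).2 fun i => ?_
  have key : ∀ a b c : ℂ, ‖a‖ ≤ ‖u - w‖ → ‖b‖ ≤ ‖u - w‖ → ‖c‖ = 1 →
      ‖(c * a + -c * (z * m t) * b) / 2‖ ≤ (1 + ‖z‖ * C) * ‖u - w‖ := by
    intro a b c ha hb hc
    rw [norm_div, Complex.norm_ofNat]
    have e1 : ‖c * a‖ ≤ ‖u - w‖ := by rw [norm_mul, hc, one_mul]; exact ha
    have e2 : ‖-c * (z * m t) * b‖ ≤ ‖z‖ * C * ‖u - w‖ := by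
      rw [norm_mul, norm_mul, norm_neg, hc, one_mul]; gcongr
    have := norm_add_le (c * a) (-c * (z * m t) * b)
    nlinarith [mul_nonneg hzC hn]
  fin_cases i
  · have := key (u 0 - w 0) (u 1 - w 1) (-1) h0 h1 (by simp)
    have e : (-1 * (u 0 - w 0) + - -1 * (z * m t) * (u 1 - w 1)) / 2 =
        (-(u 0) + z * m t * u 1) / 2 - (-(w 0) + z * m t * w 1) / 2 := by ring
    rwa [e] at this
  · have := key (u 1 - w 1) (u 0 - w 0) 1 h1 h0 (by simp)
    have e : (1 * (u 1 - w 1) + -1 * (z * m t) * (u 0 - w 0)) / 2 =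
        (-(z * m t * u 0) + u 1) / 2 - (-(z * m t * w 0) + w 1) / 2 := by ring
    rwa [e] at this

theorem IsLaxSol.const_smul (h : IsLaxSol m z φ) (c : ℂ) : IsLaxSol m z fun x => c • φ x := by
  intro x
  refine ((h x).const_smul c).congr_deriv ?_
  ext i
  fin_cases i <;> simp [laxField] <;> ring

theorem IsLaxSol.conj {s : ℝ} (h : IsLaxSol m s φ) :
    IsLaxSol m s fun x => star (φ x) := by
  intro x
  refine hasDerivAt_pi.2 fun i => ?_
  fin_cases i
  · refine ((h.hasDerivAt_zero x).star).congr_deriv ?_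
    simp [laxField]
  · refine ((h.hasDerivAt_one x).star).congr_deriv ?_
    simp [laxField]

end Lax

end MCH

end

/-! ### The height form, and uniqueness of the Jost solutions. -/

noncomputable section

namespace MCH

section HeightForm

/-- The Hermitian form `Im (w₀ w̄₁)`. -/
def heightForm (w : Fin 2 → ℂ) : ℝ := (w 0 * (starRingEnd ℂ) (w 1)).im

theorem heightForm_smul (c : ℂ) (w : Fin 2 → ℂ) :
    heightForm (c • w) = ‖c‖ ^ 2 * heightForm w := by
  rw [heightForm, heightForm, ← Complex.normSq_eq_norm_sq, Complex.normSq_apply]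
  simp; ring

theorem continuous_heightForm : Continuous heightForm := by unfold heightForm; fun_prop

variable {m : ℝ → ℝ} {z : ℂ} {φ : ℝ → Fin 2 → ℂ}

/-- Here positivity of m enters: the form is nondecreasing along solutions for Im z ≥ 0, and
conserved for real z. -/
theorem IsLaxSol.hasDerivAt_heightForm (h : IsLaxSol m z φ) (x : ℝ) :
    HasDerivAt (fun x => heightForm (φ x))
      (m x * z.im * (‖φ x 0‖ ^ 2 + ‖φ x 1‖ ^ 2) / 2) x := by
  have h1 : HasDerivAt (fun x => φ x 0 * (starRingEnd ℂ) (φ x 1))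
      ((-(φ x 0) + z * m x * φ x 1) / 2 * (starRingEnd ℂ) (φ x 1) +
        φ x 0 * (starRingEnd ℂ) ((-(z * m x * φ x 0) + φ x 1) / 2)) x :=
    (h.hasDerivAt_zero x).mul (h.hasDerivAt_one x).star
  have h2 := Complex.imCLM.hasFDerivAt.comp_hasDerivAt x h1
  refine h2.congr_deriv ?_
  rw [← Complex.normSq_eq_norm_sq, ← Complex.normSq_eq_norm_sq, Complex.normSq_apply,
    Complex.normSq_apply]
  simp [Complex.conj_ofNat]
  ring

end HeightForm

section RightJost

variable {A : ℝ} {m : ℝ → ℝ} {z : ℂ}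

theorem RightProfile.abs_le (hm : RightProfile A m) : ∃ C, ∀ x, |m x| ≤ C := by
  obtain ⟨c, hc, hl⟩ := hm.lower
  obtain ⟨C, hC⟩ := hm.upper
  exact ⟨C, fun x => by rw [abs_of_pos (hc.trans_le (hl x))]; exact hC x⟩

theorem RightProfile.pos_apply (hm : RightProfile A m) (x : ℝ) : 0 < m x := by
  obtain ⟨c, hc, hl⟩ := hm.lower
  exact hc.trans_le (hl x)

theorem continuousOn_jostR (hm : RightProfile A m) (x : ℝ) :
    ContinuousOn (jostR A m x) closedUpper := by
  have h := continuousOn_jostAmp hm x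
  have hw := continuousOn_wave A
  refine ContinuousOn.smul (f := fun z => Complex.exp (Complex.I * wave A z * x)) ?_ h
  fun_prop

theorem differentiableOn_jostR (hm : RightProfile A m) (x : ℝ) :
    DifferentiableOn ℂ (jostR A m x) upper := by
  have h := differentiableOn_jostAmp hm x
  have hw := differentiableOn_wave A
  refine DifferentiableOn.smul (c := fun z => Complex.exp (Complex.I * wave A z * x)) ?_ h
  fun_prop

theorem exp_neg_smul_jostR (x : ℝ) :
    Complex.exp (-(Complex.I * wave A z * x)) • jostR A m x z = jostAmp A m x z := by
  rw [jostR, smul_smul, ← Complex.exp_add, neg_add_cancel, Complex.exp_zero, one_smul]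

theorem norm_exp_I_wave (x : ℝ) :
    ‖Complex.exp (Complex.I * wave A z * x)‖ = Real.exp (-((wave A z).im * x)) := by
  rw [Complex.norm_exp]; simp

theorem tendsto_norm_exp_I_wave (hz : 0 < (wave A z).im) :
    Tendsto (fun x : ℝ => Complex.exp (Complex.I * wave A z * x)) atTop (𝓝 0) := by
  rw [tendsto_zero_iff_norm_tendsto_zero]
  simp_rw [norm_exp_I_wave]
  exact Real.tendsto_exp_neg_atTop_nhds_zero.comp (tendsto_id.const_mul_atTop hz)

theorem tendsto_jostR_zero (hm : RightProfile A m) (hz : z ∈ closedUpper)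
    (hk : 0 < (wave A z).im) : Tendsto (fun x => jostR A m x z) atTop (𝓝 0) := by
  have := (tendsto_norm_exp_I_wave hk).smul (tendsto_jostAmp hm hz)
  rwa [zero_smul] at this

/-- The form is monotone and tends to 0 at +∞, where the solution decays, so it is nonpositive. A
zero at one point would make it vanish from there on; its derivative, and with it the solution,
would vanish too, against the limit 1 of the first component of the amplitude. -/
theorem heightForm_jostR_neg_of_upper (hm : RightProfile A m) (hz : z ∈ upper) (x : ℝ) :
    heightForm (jostR A m x z) < 0 := by
  have hz' := upper_subset_closedUpper hz
  have hsol := isLaxSol_jostR hm hz'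
  have hmono : Monotone fun x => heightForm (jostR A m x z) :=
    monotone_of_hasDerivAt_nonneg (fun x => hsol.hasDerivAt_heightForm x) fun x => by
      have h1 := (hm.pos_apply x).le
      have h2 : 0 ≤ z.im := hz'
      positivity
  have hlim : Tendsto (fun x => heightForm (jostR A m x z)) atTop (𝓝 0) := by
    have := (continuous_heightForm.tendsto 0).comp
      (tendsto_jostR_zero hm hz' (wave_im_pos hm.pos hz))
    simpa [heightForm, Function.comp_def] using this
  have hle : ∀ y, heightForm (jostR A m y z) ≤ 0 := fun y => hmono.ge_of_tendsto hlim y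
  refine lt_of_le_of_ne (hle x) fun h0 => ?_
  have hzero : ∀ y, x ≤ y → heightForm (jostR A m y z) = 0 := fun y hy =>
    le_antisymm (hle y) (h0 ▸ hmono hy)
  have hvan : ∀ y, x < y → jostR A m y z 0 = 0 := by
    intro y hy
    have h1 := hsol.hasDerivAt_heightForm y
    have h2 : HasDerivAt (fun x => heightForm (jostR A m x z)) 0 y := by
      refine (hasDerivAt_const y (0 : ℝ)).congr_of_eventuallyEq ?_
      filter_upwards [lt_mem_nhds hy] with w hw using hzero w hw.le
    have h3 := h1.unique h2
    have h4 : (0 : ℝ) < m y * z.im := mul_pos (hm.pos_apply y) hz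
    have h5 : ‖jostR A m y z 0‖ ^ 2 = 0 := by
      nlinarith [sq_nonneg ‖jostR A m y z 0‖, sq_nonneg ‖jostR A m y z 1‖]
    simpa using h5
  have hamp : Tendsto (fun y => jostAmp A m y z 0) atTop (𝓝 1) :=
    (tendsto_pi_nhds.1 (tendsto_jostAmp hm hz')) 0
  have hamp0 : Tendsto (fun y => jostAmp A m y z 0) atTop (𝓝 0) := by
    refine tendsto_const_nhds.congr' ?_
    filter_upwards [eventually_gt_atTop x] with y hy
    have := hvan y hy
    simp only [jostR, Pi.smul_apply, smul_eq_mul, mul_eq_zero, Complex.exp_ne_zero, false_or] at this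
    exact this.symm
  exact one_ne_zero (tendsto_nhds_unique hamp hamp0)

theorem heightForm_jostR_nonpos (hm : RightProfile A m) (hz : z ∈ closedUpper) (x : ℝ) :
    heightForm (jostR A m x z) ≤ 0 := by
  have hcl : z ∈ closure upper := by
    have : closure upper = closedUpper := Complex.closure_setOfPred_lt_im 0
    rwa [this]
  have := mem_closure_iff_nhdsWithin_neBot.1 hcl
  have hc := ((continuous_heightForm.comp_continuousOn (continuousOn_jostR hm x)) z hz).mono
    upper_subset_closedUpper
  refine le_of_tendsto hc ?_
  filter_upwards [self_mem_nhdsWithin] with w hw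
  exact (heightForm_jostR_neg_of_upper hm hw x).le

/-- For real z the form is conserved, and |e^{ikx}| = 1, so its value is that of the eigenvector at
+∞. -/
theorem heightForm_jostR_neg_of_lt (hm : RightProfile A m) {s : ℝ} (hs : 1 / A < |s|) (x : ℝ) :
    heightForm (jostR A m x s) = -(beta A s).im := by
  have hsol := isLaxSol_jostR hm (ofReal_mem_closedUpper s)
  have hconst : ∀ y, heightForm (jostR A m x s) = heightForm (jostR A m y s) := by
    intro y
    refine is_const_of_deriv_eq_zero
      (fun x => (hsol.hasDerivAt_heightForm x).differentiableAt) (fun x => ?_) x y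
    rw [(hsol.hasDerivAt_heightForm x).deriv]; simp
  obtain ⟨κ, hκ, -⟩ := wave_ofReal_of_lt hm.pos hs
  have hamp : ∀ y, heightForm (jostR A m y s) = heightForm (jostAmp A m y s) := by
    intro y
    rw [jostR, heightForm_smul, norm_exp_I_wave, hκ]; simp
  have hlim := (continuous_heightForm.tendsto _).comp
    (tendsto_jostAmp hm (ofReal_mem_closedUpper s))
  have h2 : Tendsto (fun _ : ℝ => heightForm (jostR A m x s)) atTop
      (𝓝 (heightForm (eigvec A s))) := by
    refine hlim.congr fun y => ?_
    rw [Function.comp_apply, ← hamp y, hconst y]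
  rw [tendsto_nhds_unique tendsto_const_nhds h2]
  simp [heightForm, eigvec]

/-- The right Jost solution is determined by its behaviour at `+∞`. -/
theorem eq_jostR_of_tendsto (hm : RightProfile A m) (hz : z ∈ closedUpper) {φ : ℝ → Fin 2 → ℂ}
    (hφ : IsLaxSol m z φ)
    (hlim : Tendsto (fun x : ℝ => Complex.exp (-(Complex.I * wave A z * x)) • φ x) atTop
      (𝓝 (eigvec A z))) (x : ℝ) : φ x = jostR A m x z := by
  obtain ⟨C, hC⟩ := hm.abs_le
  have hsol := isLaxSol_jostR hm hz
  set a : ℝ → Fin 2 → ℂ := fun x => Complex.exp (-(Complex.I * wave A z * x)) • φ x with ha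
  have hφa : ∀ x, φ x = Complex.exp (Complex.I * wave A z * x) • a x := fun x => by
    rw [ha, smul_smul, ← Complex.exp_add, add_neg_cancel, Complex.exp_zero, one_smul]
  have hamp := tendsto_jostAmp hm hz
  have hdet : ∀ x, colDet (φ x) (jostR A m x z) =
      Complex.exp (Complex.I * wave A z * x) ^ 2 * colDet (a x) (jostAmp A m x z) := fun x => by
    rw [hφa x, jostR]; simp [colDet]; ring
  have hlim0 : Tendsto (fun x => colDet (a x) (jostAmp A m x z)) atTop (𝓝 0) := by
    have hc : Continuous fun p : (Fin 2 → ℂ) × (Fin 2 → ℂ) => colDet p.1 p.2 := by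
      unfold colDet; fun_prop
    have := (hc.tendsto (eigvec A z, eigvec A z)).comp (hlim.prodMk_nhds hamp)
    have h0 : colDet (eigvec A z) (eigvec A z) = 0 := by rw [colDet]; ring
    rw [h0] at this
    exact this
  -- Both amplitudes tend to the same vector and the exponential stays bounded for x ≥ 0, so the
  -- constant Wronskian has limit 0. The two solutions are therefore proportional, with constant 1
  -- by the normalization.
  have hW : ∀ x, colDet (φ x) (jostR A m x z) = 0 := by
    intro x
    have h1 : Tendsto (fun y => colDet (φ y) (jostR A m y z)) atTop (𝓝 0) := by
      rw [tendsto_zero_iff_norm_tendsto_zero] at hlim0 ⊢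
      refine squeeze_zero' (Eventually.of_forall fun y => norm_nonneg _) ?_ hlim0
      filter_upwards [eventually_ge_atTop 0] with y hy
      rw [hdet, norm_mul, norm_pow, norm_exp_I_wave]
      refine mul_le_of_le_one_left (norm_nonneg _) (pow_le_one₀ (Real.exp_pos _).le ?_)
      rw [Real.exp_le_one_iff]
      have := mul_nonneg (wave_im_nonneg hm.pos hz) hy
      linarith
    refine tendsto_nhds_unique (tendsto_const_nhds.congr fun y => ?_) h1
    exact hφ.colDet_eq hsol x y
  have hne : ∀ᶠ y in atTop, jostAmp A m y z 0 ≠ 0 := by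
    have h1 : Tendsto (fun y => jostAmp A m y z 0) atTop (𝓝 1) := (tendsto_pi_nhds.1 hamp) 0
    exact h1.eventually_ne one_ne_zero
  obtain ⟨X, hX⟩ := hne.exists
  have hX0 : jostR A m X z 0 ≠ 0 := by
    simp only [jostR, Pi.smul_apply, smul_eq_mul]
    exact mul_ne_zero (Complex.exp_ne_zero _) hX
  set c := φ X 0 / jostR A m X z 0 with hc
  have hcX : φ X = c • jostR A m X z := by
    have hw := hW X
    rw [colDet] at hw
    ext i
    fin_cases i
    · simp [hc, hX0]
    · simp [hc]
      field_simp
      linear_combination -hw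
  have hall : φ = fun x => c • jostR A m x z := hφ.unique hC (hsol.const_smul c) hcX
  have hc1 : c = 1 := by
    have h1 : Tendsto (fun y => a y 0) atTop (𝓝 1) := (tendsto_pi_nhds.1 hlim) 0
    have h2 : Tendsto (fun y => jostAmp A m y z 0) atTop (𝓝 1) := (tendsto_pi_nhds.1 hamp) 0
    have h3 : Tendsto (fun y => a y 0) atTop (𝓝 (c * 1)) := by
      refine (h2.const_mul c).congr fun y => ?_
      have e : a y = c • jostAmp A m y z := by
        simp only [ha, congrFun hall y]
        rw [smul_comm, exp_neg_smul_jostR]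
      rw [e]; rfl
    have := tendsto_nhds_unique h3 h1
    simpa using this
  rw [congrFun hall x, hc1, one_smul]

/-- Conjugation preserves the Lax equation at real z and, in the gap, also the normalization at +∞;
uniqueness makes the solution real. -/
theorem star_jostR_of_gt (hm : RightProfile A m) {s : ℝ} (hs : |s| < 1 / A) (x : ℝ) :
    star (jostR A m x s) = jostR A m x s := by
  have hz := ofReal_mem_closedUpper s
  refine eq_jostR_of_tendsto hm hz (isLaxSol_jostR hm hz).conj ?_ x
  have h1 := (continuous_star.tendsto _).comp (tendsto_jostAmp hm hz)
  have h2 : star (eigvec A s) = eigvec A s := by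
    ext i
    fin_cases i
    · simp [eigvec]
    · exact conj_beta_of_gt hm.pos hs
  rw [h2] at h1
  refine h1.congr fun y => ?_
  rw [Function.comp_apply, ← exp_neg_smul_jostR, star_smul]
  congr 1
  change (starRingEnd ℂ) _ = _
  rw [← Complex.exp_conj, map_neg, map_mul, map_mul, conj_wave_of_gt hm.pos hs, Complex.conj_I,
    Complex.conj_ofReal]
  congr 1; ring

end RightJost

section JostColumn

/-- The exchange of the two components. -/
def swapVec (v : Fin 2 → ℂ) : Fin 2 → ℂ := ![v 1, v 0]

@[simp] theorem swapVec_zero (v : Fin 2 → ℂ) : swapVec v 0 = v 1 := rfl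

@[simp] theorem swapVec_one (v : Fin 2 → ℂ) : swapVec v 1 = v 0 := rfl

theorem swapVec_swapVec (v : Fin 2 → ℂ) : swapVec (swapVec v) = v := by
  ext i; fin_cases i <;> rfl

theorem norm_swapVec (v : Fin 2 → ℂ) : ‖swapVec v‖ = ‖v‖ := by
  have h : ∀ v, ‖swapVec v‖ ≤ ‖v‖ := fun v =>
    (pi_norm_le_iff_of_nonneg (norm_nonneg _)).2 fun i => by
      fin_cases i
      · exact norm_le_pi_norm v 1
      · exact norm_le_pi_norm v 0
  exact le_antisymm (h v) (by simpa [swapVec_swapVec] using h (swapVec v))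

/-- `swapVec` as a continuous linear map. -/
def swapCLM : (Fin 2 → ℂ) →L[ℂ] (Fin 2 → ℂ) := matCLM sigma1

theorem swapCLM_apply (v : Fin 2 → ℂ) : swapCLM v = swapVec v := by
  ext i
  fin_cases i <;> simp [swapCLM, matCLM_apply, sigma1, swapVec, Matrix.vecHead, Matrix.vecTail]

theorem continuous_swapVec : Continuous swapVec := by
  have : swapVec = swapCLM := funext fun v => (swapCLM_apply v).symm
  rw [this]; exact swapCLM.continuous

variable {A : ℝ} {m : ℝ → ℝ} {z : ℂ}

/-- Within a single column the conjugation by e^{θσ₃} leaves just one exponential, e^{2θ}, which is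
bounded for ξ ≥ x in the closed upper half-plane. That is why this column exists there. -/
theorem col_one_integrand (θ : ℂ) (W : Matrix (Fin 2) (Fin 2) ℂ) (v : Fin 2 → ℂ) :
    Complex.exp (-(θ * sigma3 1 1)) • ((expSigma3 θ * W) *ᵥ v) =
      ![Complex.exp (2 * θ) * (W *ᵥ v) 0, (W *ᵥ v) 1] := by
  rw [← Matrix.mulVec_mulVec]
  have h2 : Complex.exp (2 * θ) = Complex.exp θ * Complex.exp θ := by
    rw [← Complex.exp_add]; congr 1; ring
  have h3 : Complex.exp θ * Complex.exp (-θ) = 1 := by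
    rw [← Complex.exp_add, add_neg_cancel, Complex.exp_zero]
  generalize W *ᵥ v = w
  ext i
  fin_cases i
  · simp [sigma3, expSigma3, h2, Matrix.vecHead]; ring
  · simp [sigma3, expSigma3, Matrix.vecHead, Matrix.vecTail]
    rw [← mul_assoc, h3, one_mul]

theorem col_zero_integrand (θ : ℂ) (W : Matrix (Fin 2) (Fin 2) ℂ) (v : Fin 2 → ℂ) :
    Complex.exp (-(θ * sigma3 0 0)) • ((expSigma3 θ * W) *ᵥ v) =
      ![(W *ᵥ v) 0, Complex.exp (-(2 * θ)) * (W *ᵥ v) 1] := by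
  rw [← Matrix.mulVec_mulVec]
  have h2 : Complex.exp (-(2 * θ)) = Complex.exp (-θ) * Complex.exp (-θ) := by
    rw [← Complex.exp_add]; congr 1; ring
  have h3 : Complex.exp (-θ) * Complex.exp θ = 1 := by
    rw [← Complex.exp_add, neg_add_cancel, Complex.exp_zero]
  generalize W *ᵥ v = w
  ext i
  fin_cases i
  · simp [sigma3, expSigma3, Matrix.vecHead]
    rw [← mul_assoc, h3, one_mul]
  · simp [sigma3, expSigma3, h2, Matrix.vecHead, Matrix.vecTail]; ring

/-- The matrix `Ŵ` without the factor `m - A`. -/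
def whatCoeff (A : ℝ) (z : ℂ) : Matrix (Fin 2) (Fin 2) ℂ :=
  (z / (2 * A * lRoot A z)) • sigma2 + (1 / (2 * Complex.I * A ^ 2 * lRoot A z)) • sigma3

theorem What_mulVec (ξ : ℝ) (v : Fin 2 → ℂ) :
    What A m z ξ *ᵥ v = ((m ξ - A : ℝ) : ℂ) • matCLM (whatCoeff A z) v := by
  rw [matCLM_apply, ← Matrix.smul_mulVec]
  congr 1
  rw [What, whatCoeff, smul_add, smul_smul, smul_smul]
  congr 2 <;> ring

theorem whatCoeff_zero (v : Fin 2 → ℂ) : matCLM (whatCoeff A z) v 0 =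
    1 / (2 * Complex.I * A ^ 2 * lRoot A z) * v 0 -
      Complex.I * (z / (2 * A * lRoot A z)) * v 1 := by
  simp [matCLM_apply, whatCoeff, sigma2, sigma3, dotProduct, Fin.sum_univ_two, Matrix.mulVec]
  ring

theorem whatCoeff_one (v : Fin 2 → ℂ) : matCLM (whatCoeff A z) v 1 =
    Complex.I * (z / (2 * A * lRoot A z)) * v 0 -
      1 / (2 * Complex.I * A ^ 2 * lRoot A z) * v 1 := by
  simp [-mul_eq_mul_right_iff, matCLM_apply, whatCoeff, sigma2, sigma3, dotProduct, Fin.sum_univ_two, Matrix.mulVec]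
  ring

/-- The integrand of the Volterra equation for the second column. -/
def colIntegrand (A : ℝ) (m : ℝ → ℝ) (z : ℂ) (x ξ : ℝ) (v : Fin 2 → ℂ) : Fin 2 → ℂ :=
  ((m ξ - A : ℝ) : ℂ) • ![Complex.exp (2 * theta A m z x ξ) * matCLM (whatCoeff A z) v 0,
    matCLM (whatCoeff A z) v 1]

theorem colIntegrand_eq (x ξ : ℝ) (v : Fin 2 → ℂ) :
    Complex.exp (-(theta A m z x ξ * sigma3 1 1)) •
      ((expSigma3 (theta A m z x ξ) * What A m z ξ) *ᵥ v) = colIntegrand A m z x ξ v := by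
  rw [col_one_integrand, What_mulVec, colIntegrand]
  ext i
  fin_cases i
  · simp; ring
  · simp

theorem two_theta_re_nonpos (hm : RightProfile A m) (hz : z ∈ closedUpper) {x ξ : ℝ} (hx : x ≤ ξ) :
    (2 * theta A m z x ξ).re ≤ 0 := by
  have h1 : 0 ≤ ∫ τ in x..ξ, m τ :=
    intervalIntegral.integral_nonneg hx fun τ _ => (hm.pos_apply τ).le
  have h2 := lRoot_im_nonneg (A := A) hz
  rw [theta, show 2 * (Complex.I * lRoot A z / 2 * ((∫ τ in x..ξ, m τ : ℝ) : ℂ)) =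
    ((∫ τ in x..ξ, m τ : ℝ) : ℂ) * (Complex.I * lRoot A z) by ring, Complex.re_ofReal_mul,
    Complex.I_mul_re]
  nlinarith

theorem norm_colIntegrand_le (hm : RightProfile A m) (hz : z ∈ closedUpper) {x ξ : ℝ} (hx : x ≤ ξ)
    (v : Fin 2 → ℂ) :
    ‖colIntegrand A m z x ξ v‖ ≤ ‖matCLM (whatCoeff A z)‖ * |m ξ - A| * ‖v‖ := by
  have h0 := (matCLM (whatCoeff A z)).le_opNorm v
  have hc := norm_le_pi_norm (matCLM (whatCoeff A z) v)
  rw [colIntegrand, norm_smul, Complex.norm_real, Real.norm_eq_abs]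
  have h1 : ‖(![Complex.exp (2 * theta A m z x ξ) * matCLM (whatCoeff A z) v 0,
      matCLM (whatCoeff A z) v 1] : Fin 2 → ℂ)‖ ≤ ‖matCLM (whatCoeff A z)‖ * ‖v‖ := by
    refine (pi_norm_le_iff_of_nonneg (by positivity)).2 fun i => ?_
    fin_cases i
    · change ‖Complex.exp (2 * theta A m z x ξ) * matCLM (whatCoeff A z) v 0‖ ≤ _
      rw [norm_mul, Complex.norm_exp]
      refine (mul_le_of_le_one_left (norm_nonneg _) ?_).trans ((hc 0).trans h0)
      exact Real.exp_le_one_iff.2 (two_theta_re_nonpos hm hz hx)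
    · exact (hc 1).trans h0
  calc |m ξ - A| * _ ≤ |m ξ - A| * (‖matCLM (whatCoeff A z)‖ * ‖v‖) := by gcongr
    _ = _ := by ring

theorem hasDerivAt_theta (hm : RightProfile A m) (x ξ : ℝ) :
    HasDerivAt (fun ξ => theta A m z x ξ) (Complex.I * lRoot A z / 2 * m ξ) ξ := by
  have h1 := intervalIntegral.integral_hasDerivAt_right (hm.continuous.intervalIntegrable x ξ)
    (hm.continuous.stronglyMeasurableAtFilter _ _) hm.continuous.continuousAt
  exact h1.ofReal_comp.const_mul _

theorem continuous_theta (hm : RightProfile A m) (x : ℝ) : Continuous fun ξ => theta A m z x ξ :=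
  continuous_iff_continuousAt.2 fun ξ => (hasDerivAt_theta hm x ξ).continuousAt

theorem continuous_colIntegrand (hm : RightProfile A m) (x : ℝ) {φ : ℝ → Fin 2 → ℂ}
    (hφ : Continuous φ) : Continuous fun ξ => colIntegrand A m z x ξ (φ ξ) := by
  have h1 := continuous_theta (z := z) hm x
  have h2 := hm.continuous
  unfold colIntegrand
  refine Continuous.smul (f := fun ξ => ((m ξ - A : ℝ) : ℂ)) (by fun_prop)
    (continuous_pi fun i => ?_)
  fin_cases i
  · change Continuous fun ξ => Complex.exp (2 * theta A m z x ξ) *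
      matCLM (whatCoeff A z) (φ ξ) 0
    fun_prop
  · change Continuous fun ξ => matCLM (whatCoeff A z) (φ ξ) 1
    fun_prop

theorem bounded_Ici_of_bounded {φ : ℝ → Fin 2 → ℂ} (hφ : Continuous φ) {C : ℝ}
    (hC : ∀ x, 0 ≤ x → ‖φ x‖ ≤ C) (x₀ : ℝ) : ∃ D, ∀ x, x₀ ≤ x → ‖φ x‖ ≤ D := by
  obtain ⟨D, hD⟩ := isCompact_Icc.exists_bound_of_continuousOn (hφ.continuousOn (s := Icc x₀ 0))
  refine ⟨max C D, fun x hx => ?_⟩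
  rcases le_total 0 x with h | h
  · exact (hC x h).trans (le_max_left _ _)
  · exact (hD x ⟨hx, h⟩).trans (le_max_right _ _)

theorem integrableOn_colIntegrand (hm : RightProfile A m) (hz : z ∈ closedUpper)
    {φ : ℝ → Fin 2 → ℂ} (hφ : Continuous φ) {C : ℝ} (hC : ∀ x, 0 ≤ x → ‖φ x‖ ≤ C) (x : ℝ) :
    IntegrableOn (fun ξ => colIntegrand A m z x ξ (φ ξ)) (Ioi x) := by
  obtain ⟨D, hD⟩ := bounded_Ici_of_bounded hφ hC x
  refine Integrable.mono' (((hm.integrableOn_sub x).norm.const_mul ‖matCLM (whatCoeff A z)‖).mul_const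
    D) (continuous_colIntegrand hm x hφ).aestronglyMeasurable
    ((ae_restrict_iff' measurableSet_Ioi).2 (ae_of_all _ fun ξ hξ => ?_))
  refine (norm_colIntegrand_le hm hz (le_of_lt hξ) _).trans ?_
  rw [Real.norm_eq_abs]
  exact mul_le_mul_of_nonneg_left (hD ξ (le_of_lt hξ)) (by positivity)

theorem isJostColumn_right_one_iff {φ : ℝ → Fin 2 → ℂ} :
    IsJostColumn .right A m z 1 φ ↔ Continuous φ ∧ (∃ C : ℝ, ∀ x, 0 ≤ x → ‖φ x‖ ≤ C) ∧
      ∀ x : ℝ, φ x = Pi.single 1 1 - ∫ ξ in Ioi x, colIntegrand A m z x ξ (φ ξ) := by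
  simp only [IsJostColumn, intFrom, colIntegrand_eq, ← sub_eq_add_neg]
  rfl

/-- The difference of two solutions satisfies a homogeneous Volterra inequality with integrable
kernel and vanishes by Gronwall. Hence the choice made by `Classical.epsilon` in `jostTilde` is
determined once existence is known. -/
theorem isJostColumn_right_one_unique (hm : RightProfile A m) (hz : z ∈ closedUpper)
    {φ χ : ℝ → Fin 2 → ℂ} (hφ : IsJostColumn .right A m z 1 φ)
    (hχ : IsJostColumn .right A m z 1 χ) : φ = χ := by
  obtain ⟨c1, ⟨C1, b1⟩, e1⟩ := isJostColumn_right_one_iff.1 hφ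
  obtain ⟨c2, ⟨C2, b2⟩, e2⟩ := isJostColumn_right_one_iff.1 hχ
  have hlin : ∀ x ξ, colIntegrand A m z x ξ (φ ξ - χ ξ) =
      colIntegrand A m z x ξ (φ ξ) - colIntegrand A m z x ξ (χ ξ) := by
    intro x ξ
    simp only [colIntegrand, map_sub]
    ext i
    fin_cases i
    · simp; ring
    · simp; ring
  have hcm := hm.continuous
  have hρi : ∀ x, IntegrableOn (fun ξ => ‖matCLM (whatCoeff A z)‖ * |m ξ - A|) (Ioi x) :=
    fun x => (hm.integrableOn_sub x).norm.const_mul _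
  ext1 x
  have hbd : ∀ y, 0 ≤ y → ‖φ y - χ y‖ ≤ C1 + C2 := fun y hy =>
    (norm_sub_le _ _).trans (add_le_add (b1 y hy) (b2 y hy))
  obtain ⟨D, hD⟩ := bounded_Ici_of_bounded (c1.sub c2) hbd x
  have := gronwall_Ioi (ρ := fun ξ => ‖matCLM (whatCoeff A z)‖ * |m ξ - A|) (fun ξ => by positivity)
    (by fun_prop) hρi (f := fun x => ‖φ x - χ x‖) (by fun_prop) (fun x => norm_nonneg _) (a := 0)
    (x₀ := x) (C := D) le_rfl hD (fun y hy => ?_) x le_rfl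
  · simp only [mul_zero, zero_mul] at this
    exact sub_eq_zero.1 (norm_le_zero_iff.1 this)
  · rw [e1 y, e2 y, zero_add]
    have hI := integral_sub (integrableOn_colIntegrand hm hz c1 b1 y)
      (integrableOn_colIntegrand hm hz c2 b2 y)
    rw [sub_sub_sub_cancel_left, ← neg_sub, norm_neg, ← hI]
    refine norm_integral_le_of_norm_le ?_ ((ae_restrict_iff' measurableSet_Ioi).2
      (ae_of_all _ fun ξ hξ => ?_))
    · refine Integrable.mono' ((hρi y).mul_const D) (Continuous.aestronglyMeasurable (by fun_prop))
        ((ae_restrict_iff' measurableSet_Ioi).2 (ae_of_all _ fun ξ hξ => ?_))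
      rw [Real.norm_of_nonneg (by positivity)]
      exact mul_le_mul_of_nonneg_left (hD ξ (hy.trans (le_of_lt hξ))) (by positivity)
    · rw [← hlin]
      exact norm_colIntegrand_le hm hz (le_of_lt hξ) _

end JostColumn

end MCH

end

/-! ### Identification with the Jost columns of the statement. -/

noncomputable section

namespace MCH

section JostIdentification

variable {A : ℝ} {m : ℝ → ℝ} {z : ℂ}

theorem lRoot_eq (hA : 0 < A) : lRoot A z = 2 * wave A z / A := by
  have : (A : ℂ) ≠ 0 := Complex.ofReal_ne_zero.2 hA.ne'
  rw [wave]; field_simp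

/-- With `whatCoeff_beta'` this says how the entries of Ŵ combine with β; the two identities are the
algebra by which H turns the Lax equation into the equation for Ψ̃. -/
theorem whatCoeff_beta (hA : 0 < A) (hz : z ∈ closedUpper) (hk : wave A z ≠ 0) :
    1 / (2 * Complex.I * A ^ 2 * lRoot A z) * beta A z +
      Complex.I * (z / (2 * A * lRoot A z)) = beta A z / (2 * A) := by
  have hA' : (A : ℂ) ≠ 0 := Complex.ofReal_ne_zero.2 hA.ne'
  have h := beta_mul hA hz
  rw [lRoot_eq hA]
  field_simp
  linear_combination h + z * A * Complex.I_sq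

theorem whatCoeff_beta' (hA : 0 < A) (hz : z ∈ closedUpper) (hk : wave A z ≠ 0) :
    1 / (2 * Complex.I * A ^ 2 * lRoot A z) +
      Complex.I * (z / (2 * A * lRoot A z)) * beta A z = -(1 / (2 * A)) := by
  have hA' : (A : ℂ) ≠ 0 := Complex.ofReal_ne_zero.2 hA.ne'
  have h := mul_beta hA hz
  rw [lRoot_eq hA]
  field_simp
  linear_combination (-1 : ℂ) * h + z * A * beta A z * Complex.I_sq

theorem hasDerivAt_phase_right (hm : RightProfile A m) (x : ℝ) :
    HasDerivAt (fun x => phase .right A m x z) (Complex.I * wave A z / A * m x) x := by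
  have h1 : HasDerivAt (fun x => ∫ ξ in Ioi x, (m ξ - A)) (-(m x - A)) x :=
    hasDerivAt_integral_Ioi (by have := hm.continuous; fun_prop) hm.integrableOn_sub x
  have h2 : HasDerivAt (fun x : ℝ => 1 / (2 * A) * (-∫ ξ in Ioi x, (m ξ - A)) + x / 2)
      (1 / (2 * A) * (-(-(m x - A))) + 1 / 2) x :=
    (h1.neg.const_mul _).add ((hasDerivAt_id x).div_const 2)
  have hA' : (A : ℂ) ≠ 0 := Complex.ofReal_ne_zero.2 hm.pos.ne'
  refine (h2.ofReal_comp.const_mul (Complex.I * A * lRoot A z)).congr_deriv ?_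
  rw [lRoot_eq hm.pos]
  push_cast
  field_simp
  ring

theorem phase_right_eq (hA : 0 < A) (x : ℝ) : phase .right A m x z =
    Complex.I * wave A z * x - Complex.I * wave A z / A * ((∫ ξ in Ioi x, (m ξ - A) : ℝ) : ℂ) := by
  have hA' : (A : ℂ) ≠ 0 := Complex.ofReal_ne_zero.2 hA.ne'
  rw [phase, lRoot_eq hA, intFrom]
  push_cast
  field_simp
  ring

/-- The phase f and ikx differ by a multiple of the tail integral of m - A, which tends to 0, so
either one may be used for the normalization. -/
theorem tendsto_jostR_phase (hm : RightProfile A m) (hz : z ∈ closedUpper) :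
    Tendsto (fun x => Complex.exp (-phase .right A m x z) • jostR A m x z) atTop
      (𝓝 (eigvec A z)) := by
  have h1 : Tendsto (fun x => Complex.exp (Complex.I * wave A z / A *
      ((∫ ξ in Ioi x, (m ξ - A) : ℝ) : ℂ))) atTop (𝓝 1) := by
    have h2 := (Complex.continuous_ofReal.tendsto 0).comp
      (tendsto_integral_Ioi_atTop hm.integrableOn_sub)
    have h3 := (Complex.continuous_exp.tendsto _).comp
      (h2.const_mul (Complex.I * wave A z / A))
    simpa [Function.comp_def] using h3
  have h4 := h1.smul (tendsto_jostAmp hm hz)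
  rw [one_smul] at h4
  refine h4.congr fun x => ?_
  rw [phase_right_eq hm.pos, jostR, smul_smul, ← Complex.exp_add]
  congr 2
  ring

theorem bounded_of_tendsto {φ : ℝ → Fin 2 → ℂ} (hφ : Continuous φ) {v : Fin 2 → ℂ}
    (hv : Tendsto φ atTop (𝓝 v)) (x₀ : ℝ) : ∃ C, ∀ x, x₀ ≤ x → ‖φ x‖ ≤ C := by
  obtain ⟨X, hX⟩ := eventually_atTop.1 (hv.norm.eventually (gt_mem_nhds (lt_add_one ‖v‖)))
  obtain ⟨D, hD⟩ := isCompact_Icc.exists_bound_of_continuousOn (hφ.continuousOn (s := Icc x₀ X))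
  refine ⟨max (‖v‖ + 1) D, fun x hx => ?_⟩
  rcases le_total X x with h | h
  · exact (hX x h).le.trans (le_max_left _ _)
  · exact (hD x ⟨hx, h⟩).trans (le_max_right _ _)

/-- The matrix `α² (β - σ₁)`, which is `α H`. -/
def invCLM (A : ℝ) (z : ℂ) : (Fin 2 → ℂ) →L[ℂ] (Fin 2 → ℂ) :=
  matCLM (alpha A z ^ 2 • !![beta A z, -1; -1, beta A z])

theorem invCLM_zero (v : Fin 2 → ℂ) :
    invCLM A z v 0 = alpha A z ^ 2 * (beta A z * v 0 - v 1) := by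
  simp [invCLM, matCLM_apply, Matrix.vecHead, Matrix.vecTail]; ring

theorem invCLM_one (v : Fin 2 → ℂ) :
    invCLM A z v 1 = alpha A z ^ 2 * (-v 0 + beta A z * v 1) := by
  simp [invCLM, matCLM_apply, Matrix.vecHead, Matrix.vecTail]; ring

theorem Hinv_invCLM (hA : 0 < A) (hz : z ∈ closedUpper) (hk : wave A z ≠ 0) (v : Fin 2 → ℂ) :
    Hinv A z *ᵥ invCLM A z v = alpha A z • v := by
  have h := alpha_sq_mul hA hz hk
  have h0 := invCLM_zero (A := A) (z := z) v
  have h1 := invCLM_one (A := A) (z := z) v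
  rw [Hinv_eq]
  ext i
  fin_cases i
  -- Both components come down to det H⁻¹ = 1.
  · simp [Matrix.vecHead, Matrix.vecTail] at h0 h1 ⊢
    rw [h0, h1]
    linear_combination alpha A z * v 0 * h
  · simp [Matrix.vecHead, Matrix.vecTail] at h0 h1 ⊢
    rw [h0, h1]
    linear_combination alpha A z * v 1 * h

/-- The second column of `Ψ̃` at the right end, in terms of `jostR`. -/
def jostCol (A : ℝ) (m : ℝ → ℝ) (z : ℂ) (x : ℝ) : Fin 2 → ℂ :=
  invCLM A z (Complex.exp (-phase .right A m x z) • jostR A m x z)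

theorem hasDerivAt_jostCol (hm : RightProfile A m) (hz : z ∈ closedUpper) (x : ℝ) :
    HasDerivAt (jostCol A m z) (invCLM A z (laxField m z x
      (Complex.exp (-phase .right A m x z) • jostR A m x z)) -
        (Complex.I * wave A z / A * m x) • jostCol A m z x) x := by
  have h1 : HasDerivAt (fun x => Complex.exp (-phase .right A m x z) • jostR A m x z)
      (Complex.exp (-phase .right A m x z) • laxField m z x (jostR A m x z) +
        (Complex.exp (-phase .right A m x z) * -(Complex.I * wave A z / A * m x)) •
          jostR A m x z) x :=
    ((hasDerivAt_phase_right hm x).neg.cexp).smul (isLaxSol_jostR hm hz x)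
  have h2 := ((invCLM A z).hasFDerivAt.restrictScalars ℝ).comp_hasDerivAt x h1
  refine h2.congr_deriv ?_
  change invCLM A z _ = _
  rw [jostCol, ← map_smul, ← map_sub]
  congr 1
  ext i
  fin_cases i <;> simp [laxField, Matrix.vecHead, Matrix.vecTail] <;> ring

theorem theta_self (x : ℝ) : theta A m z x x = 0 := by simp [theta]

/-- Once the first component is multiplied by e^{2θ(x,ξ)}, its ξ-derivative, and that of the second
component, are exactly the Volterra integrand. Integration from x to +∞ then gives the equation,
because θ vanishes at ξ = x. -/
theorem isJostColumn_jostCol (hm : RightProfile A m) (hz : z ∈ closedUpper)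
    (hk : wave A z ≠ 0) : IsJostColumn .right A m z 1 (jostCol A m z) := by
  have hcont : Continuous (jostCol A m z) :=
    continuous_iff_continuousAt.2 fun x => (hasDerivAt_jostCol hm hz x).continuousAt
  have hlim : Tendsto (jostCol A m z) atTop (𝓝 (Pi.single 1 1)) := by
    have h1 := ((invCLM A z).continuous.tendsto _).comp (tendsto_jostR_phase hm hz)
    have h2 : invCLM A z (eigvec A z) = Pi.single 1 1 := by
      have h := alpha_sq_mul hm.pos hz hk
      have e0 : eigvec A z 0 = 1 := rfl
      have e1 : eigvec A z 1 = beta A z := rfl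
      ext i
      fin_cases i
      · change invCLM A z (eigvec A z) 0 = _
        rw [invCLM_zero, e0, e1]; simp
      · change invCLM A z (eigvec A z) 1 = _
        rw [invCLM_one, e0, e1]; simp; linear_combination h
    rwa [h2] at h1
  obtain ⟨C, hC⟩ := bounded_of_tendsto hcont hlim 0
  refine isJostColumn_right_one_iff.2 ⟨hcont, ⟨C, hC⟩, fun x => ?_⟩
  have hA' : (A : ℂ) ≠ 0 := Complex.ofReal_ne_zero.2 hm.pos.ne'
  have hd : ∀ ξ ∈ Ici x, HasDerivAt (fun ξ => (![Complex.exp (2 * theta A m z x ξ) *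
      jostCol A m z ξ 0, jostCol A m z ξ 1] : Fin 2 → ℂ))
      (colIntegrand A m z x ξ (jostCol A m z ξ)) ξ := by
    intro ξ _
    have h1 := hasDerivAt_pi.1 (hasDerivAt_jostCol hm hz ξ)
    have h2 := ((hasDerivAt_theta (z := z) hm x ξ).const_mul 2).cexp
    have hP := whatCoeff_beta hm.pos hz hk
    have hQ := whatCoeff_beta' hm.pos hz hk
    have hb := mul_beta hm.pos hz
    have hb2 := beta_mul hm.pos hz
    have hl := lRoot_eq (z := z) hm.pos
    have eL0 : ∀ w, laxField m z ξ w 0 = (-(w 0) + z * m ξ * w 1) / 2 := fun w => rfl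
    have eL1 : ∀ w, laxField m z ξ w 1 = (-(z * m ξ * w 0) + w 1) / 2 := fun w => rfl
    have eJ : jostCol A m z ξ = invCLM A z (Complex.exp (-phase .right A m ξ z) •
      jostR A m ξ z) := rfl
    refine hasDerivAt_pi.2 fun i => ?_
    fin_cases i
    · refine (h2.mul (h1 0)).congr_deriv ?_
      simp only [colIntegrand, Pi.sub_apply, Pi.smul_apply, smul_eq_mul, eJ]
      change _ = _ * (_ * matCLM (whatCoeff A z) _ 0)
      rw [whatCoeff_zero]
      generalize Complex.exp (-phase .right A m ξ z) • jostR A m ξ z = a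
      simp only [invCLM_zero, invCLM_one, eL0, eL1]
      generalize 1 / (2 * Complex.I * A ^ 2 * lRoot A z) = p at *
      generalize z / (2 * A * lRoot A z) = q at *
      rw [hl]
      have hP' : (p * beta A z + Complex.I * q) * (2 * A) = beta A z := by
        rw [hP]; field_simp
      have hQ' : (p + Complex.I * q * beta A z) * (2 * A) = -1 := by
        rw [hQ]; field_simp
      push_cast
      field_simp
      linear_combination (-(alpha A z ^ 2 * a 0 * (m ξ - A))) * hP' +
        (alpha A z ^ 2 * a 1 * (m ξ - A)) * hQ' -
        (alpha A z ^ 2 * a 0 * m ξ) * hb2 + (alpha A z ^ 2 * a 1 * m ξ) * hb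
    · refine (h1 1).congr_deriv ?_
      simp only [colIntegrand, Pi.sub_apply, Pi.smul_apply, smul_eq_mul, eJ]
      change _ = _ * matCLM (whatCoeff A z) _ 1
      rw [whatCoeff_one]
      generalize Complex.exp (-phase .right A m ξ z) • jostR A m ξ z = a
      simp only [invCLM_zero, invCLM_one, eL0, eL1]
      generalize 1 / (2 * Complex.I * A ^ 2 * lRoot A z) = p at *
      generalize z / (2 * A * lRoot A z) = q at *
      have hP' : (p * beta A z + Complex.I * q) * (2 * A) = beta A z := by
        rw [hP]; field_simp
      have hQ' : (p + Complex.I * q * beta A z) * (2 * A) = -1 := by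
        rw [hQ]; field_simp
      push_cast
      field_simp
      linear_combination (alpha A z ^ 2 * a 1 * (m ξ - A)) * hP' -
        (alpha A z ^ 2 * a 0 * (m ξ - A)) * hQ' +
        (alpha A z ^ 2 * a 1 * m ξ) * hb2 - (alpha A z ^ 2 * a 0 * m ξ) * hb
  have hlim2 : Tendsto (fun ξ => (![Complex.exp (2 * theta A m z x ξ) *
      jostCol A m z ξ 0, jostCol A m z ξ 1] : Fin 2 → ℂ)) atTop (𝓝 (Pi.single 1 1)) := by
    refine tendsto_pi_nhds.2 fun i => ?_
    have h1 := tendsto_pi_nhds.1 hlim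
    fin_cases i
    · have h0 : Tendsto (fun ξ => jostCol A m z ξ 0) atTop (𝓝 0) := by simpa using h1 0
      change Tendsto (fun ξ => Complex.exp (2 * theta A m z x ξ) * jostCol A m z ξ 0) atTop _
      have e : (Pi.single 1 1 : Fin 2 → ℂ) ((fun i => i) ⟨0, by norm_num⟩) = 0 := by simp
      rw [e]
      rw [tendsto_zero_iff_norm_tendsto_zero] at h0 ⊢
      refine squeeze_zero' (Eventually.of_forall fun y => norm_nonneg _) ?_ h0
      filter_upwards [eventually_ge_atTop x] with y hy
      rw [norm_mul, Complex.norm_exp]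
      exact mul_le_of_le_one_left (norm_nonneg _)
        (Real.exp_le_one_iff.2 (two_theta_re_nonpos hm hz hy))
    · exact h1 1
  have := integral_Ioi_of_hasDerivAt_of_tendsto' hd
    (integrableOn_colIntegrand hm hz hcont hC x) hlim2
  rw [this, sub_sub_cancel, theta_self, mul_zero, Complex.exp_zero, one_mul]
  ext i
  fin_cases i <;> rfl

theorem jostTilde_right_one (hm : RightProfile A m) (hz : z ∈ closedUpper)
    (hk : wave A z ≠ 0) : jostTilde .right A m z 1 = jostCol A m z :=
  isJostColumn_right_one_unique hm hz
    (Classical.epsilon_spec (p := IsJostColumn .right A m z 1)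
      ⟨_, isJostColumn_jostCol hm hz hk⟩) (isJostColumn_jostCol hm hz hk)

theorem jost_right_one (hm : RightProfile A m) (hz : z ∈ closedUpper) (hk : wave A z ≠ 0)
    (x : ℝ) : jost .right A m z 1 x = alpha A z • jostR A m x z := by
  have hs : sigma3 1 1 = -1 := rfl
  rw [jost, jostTilde_right_one hm hz hk, jostCol, Hinv_invCLM hm.pos hz hk, hs, mul_neg_one,
    neg_neg, smul_smul, smul_smul, mul_comm, ← mul_assoc, ← Complex.exp_add]
  simp

theorem whatCoeff_swap (v : Fin 2 → ℂ) :
    matCLM (whatCoeff A z) (swapVec v) = -swapVec (matCLM (whatCoeff A z) v) := by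
  ext i
  fin_cases i
  · change matCLM (whatCoeff A z) (swapVec v) 0 = -(matCLM (whatCoeff A z) v 1)
    rw [whatCoeff_zero, whatCoeff_one, swapVec_zero, swapVec_one]; ring
  · change matCLM (whatCoeff A z) (swapVec v) 1 = -(matCLM (whatCoeff A z) v 0)
    rw [whatCoeff_zero, whatCoeff_one, swapVec_zero, swapVec_one]; ring

theorem theta_reflect (x ξ : ℝ) :
    theta A (fun y => m (-y)) z (-x) (-ξ) = -theta A m z x ξ := by
  rw [theta, theta, intervalIntegral.integral_comp_neg (fun y => m y), neg_neg, neg_neg,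
    intervalIntegral.integral_symm]
  push_cast; ring

/-- Reflection changes the sign of θ and exchange of components changes the sign of Ŵ, which matches
the reversed direction of integration. The left end therefore needs no theory of its own. -/
theorem isJostColumn_reflect {φ : ℝ → Fin 2 → ℂ} :
    IsJostColumn .left A m z 0 φ ↔
      IsJostColumn .right A (fun y => m (-y)) z 1 fun x => swapVec (φ (-x)) := by
  have hint : ∀ x ξ, colIntegrand A (fun y => m (-y)) z (-x) (-ξ) (swapVec (φ ξ)) =
      -swapVec (Complex.exp (-(theta A m z x ξ * sigma3 0 0)) •
        ((expSigma3 (theta A m z x ξ) * What A m z ξ) *ᵥ φ ξ)) := by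
    intro x ξ
    rw [col_zero_integrand, What_mulVec, colIntegrand, theta_reflect, neg_neg, whatCoeff_swap]
    ext i
    fin_cases i
    · simp [swapVec, Matrix.vecHead, Matrix.vecTail]; ring
    · simp [swapVec, Matrix.vecHead, Matrix.vecTail]
  have heq : ∀ x, (φ x = Pi.single 0 1 + intFrom .left (fun ξ =>
        Complex.exp (-(theta A m z x ξ * sigma3 0 0)) •
        ((expSigma3 (theta A m z x ξ) * What A m z ξ) *ᵥ φ ξ)) x) ↔
      swapVec (φ x) = Pi.single 1 1 - ∫ ξ in Ioi (-x),
        colIntegrand A (fun y => m (-y)) z (-x) ξ (swapVec (φ (-ξ))) := by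
    intro x
    have h1 : ∫ ξ in Ioi (-x), colIntegrand A (fun y => m (-y)) z (-x) ξ (swapVec (φ (-ξ))) =
        -swapVec (intFrom .left (fun ξ => Complex.exp (-(theta A m z x ξ * sigma3 0 0)) •
        ((expSigma3 (theta A m z x ξ) * What A m z ξ) *ᵥ φ ξ)) x) := by
      rw [← integral_comp_neg_Iic]
      simp only [neg_neg, hint]
      rw [integral_neg, intFrom]
      congr 1
      simp_rw [← swapCLM_apply]
      -- The exchange is invertible, so it commutes with the integral even without integrability: in
      -- that case both sides are the default value 0.
      have hl : ∀ f : ℝ → Fin 2 → ℂ, ∫ ξ in Iic x, swapCLM (f ξ) = swapCLM (∫ ξ in Iic x, f ξ) := by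
        intro f
        by_cases hf : IntegrableOn f (Iic x)
        · exact swapCLM.integral_comp_comm hf
        · rw [integral_undef hf, integral_undef, map_zero]
          intro hf2
          apply hf
          have := swapCLM.integrable_comp hf2
          simp only [swapCLM_apply, swapVec_swapVec] at this
          exact this
      exact hl _
    rw [h1, sub_neg_eq_add]
    have h2 : ∀ a b : Fin 2 → ℂ, swapVec (a + b) = swapVec a + swapVec b := fun a b => by
      ext i; fin_cases i <;> rfl
    have h3 : swapVec (Pi.single 0 1) = Pi.single 1 1 := by
      ext i; fin_cases i <;> simp [swapVec]
    rw [← h3, ← h2]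
    exact ⟨fun h => congrArg swapVec h, fun h => by
      have := congrArg swapVec h
      rwa [swapVec_swapVec, swapVec_swapVec] at this⟩
  rw [isJostColumn_right_one_iff, IsJostColumn]
  refine and_congr ?_ (and_congr ?_ ?_)
  · constructor
    · intro h; exact continuous_swapVec.comp (h.comp continuous_neg)
    · intro h
      have := continuous_swapVec.comp (h.comp continuous_neg)
      simpa [Function.comp_def, swapVec_swapVec] using this
  · refine exists_congr fun C => ?_
    constructor
    · intro h x hx
      rw [norm_swapVec]
      exact h (-x) (show -x ≤ 0 by linarith)
    · intro h x hx
      have hx' : x ≤ 0 := hx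
      have := h (-x) (by linarith)
      rwa [norm_swapVec, neg_neg] at this
  · constructor
    · intro h x
      have := (heq (-x)).1 (h (-x))
      rwa [neg_neg] at this
    · intro h x
      refine (heq x).2 ?_
      have := h (-x)
      rwa [neg_neg] at this

/-- When l is real, θ is purely imaginary, and conjugation followed by exchange of components maps
the equation of the first column to that of the second at the same end. Only c₂₁ needs this first
right column. -/
theorem isJostColumn_conj {s κ : ℝ} (hκ : lRoot A s = κ) {φ : ℝ → Fin 2 → ℂ} :
    IsJostColumn .right A m s 0 φ ↔
      IsJostColumn .right A m s 1 fun x => swapVec (star (φ x)) := by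
  have hθ : ∀ x ξ, (starRingEnd ℂ) (theta A m s x ξ) = -theta A m s x ξ := by
    intro x ξ
    rw [theta, hκ]
    simp [Complex.conj_ofNat]; ring
  have hint : ∀ x ξ, colIntegrand A m s x ξ (swapVec (star (φ ξ))) =
      swapVec (star (Complex.exp (-(theta A m s x ξ * sigma3 0 0)) •
        ((expSigma3 (theta A m s x ξ) * What A m s ξ) *ᵥ φ ξ))) := by
    intro x ξ
    have he : (starRingEnd ℂ) (Complex.exp (-(2 * theta A m s x ξ))) =
        Complex.exp (2 * theta A m s x ξ) := by
      rw [← Complex.exp_conj, map_neg, map_mul, hθ, Complex.conj_ofNat]; congr 1; ring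
    rw [col_zero_integrand, What_mulVec, colIntegrand]
    have w0 : matCLM (whatCoeff A s) (swapVec (star (φ ξ))) 0 =
        (starRingEnd ℂ) (matCLM (whatCoeff A s) (φ ξ) 1) := by
      rw [whatCoeff_zero, whatCoeff_one, hκ]
      simp [Complex.conj_ofNat]; ring
    have w1 : matCLM (whatCoeff A s) (swapVec (star (φ ξ))) 1 =
        (starRingEnd ℂ) (matCLM (whatCoeff A s) (φ ξ) 0) := by
      rw [whatCoeff_zero, whatCoeff_one, hκ]
      simp [Complex.conj_ofNat]; ring
    rw [w0, w1]
    ext i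
    fin_cases i
    · simp [swapVec, Matrix.vecHead, Matrix.vecTail, he]; ring
    · simp [swapVec, Matrix.vecHead, Matrix.vecTail]
  have hst : ∀ v : Fin 2 → ℂ, star (swapVec v) = swapVec (star v) := fun v => by
    ext i; fin_cases i <;> rfl
  have hinv : ∀ v : Fin 2 → ℂ, swapVec (star (swapVec (star v))) = v := fun v => by
    rw [hst, star_star, swapVec_swapVec]
  have heq : ∀ x, (φ x = Pi.single 0 1 + intFrom .right (fun ξ =>
        Complex.exp (-(theta A m s x ξ * sigma3 0 0)) •
        ((expSigma3 (theta A m s x ξ) * What A m s ξ) *ᵥ φ ξ)) x) ↔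
      swapVec (star (φ x)) = Pi.single 1 1 - ∫ ξ in Ioi x,
        colIntegrand A m s x ξ (swapVec (star (φ ξ))) := by
    intro x
    set L : (Fin 2 → ℂ) →L[ℝ] (Fin 2 → ℂ) :=
      (swapCLM.restrictScalars ℝ).comp
        ((starL' ℝ : (Fin 2 → ℂ) ≃L[ℝ] (Fin 2 → ℂ)) : (Fin 2 → ℂ) →L[ℝ] (Fin 2 → ℂ)) with hL
    have hLa : ∀ v, L v = swapVec (star v) := fun v => by
      rw [hL]; exact swapCLM_apply _
    have hl : ∀ f : ℝ → Fin 2 → ℂ, ∫ ξ in Ioi x, L (f ξ) = L (∫ ξ in Ioi x, f ξ) := by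
      intro f
      by_cases hf : IntegrableOn f (Ioi x)
      · exact L.integral_comp_comm hf
      · rw [integral_undef hf, integral_undef, map_zero]
        intro hf2
        apply hf
        have := L.integrable_comp hf2
        simp only [hLa, hinv] at this
        exact this
    simp_rw [hint, ← hLa]
    rw [hl, intFrom]
    have h3 : L (Pi.single 0 1) = Pi.single 1 1 := by
      rw [hLa]; ext i; fin_cases i <;> simp [swapVec]
    rw [← h3, ← map_sub, ← sub_eq_add_neg]
    exact ⟨fun h => congrArg L h, fun h => by
      have := congrArg L h
      rwa [hLa, hLa, hLa, hLa, hinv, hinv] at this⟩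
  have hcs : Continuous fun v : Fin 2 → ℂ => swapVec (star v) :=
    continuous_swapVec.comp continuous_star
  rw [isJostColumn_right_one_iff, IsJostColumn]
  refine and_congr ?_ (and_congr ?_ ?_)
  · constructor
    · intro h; exact hcs.comp h
    · intro h
      have := hcs.comp h
      simpa only [Function.comp_def, hinv] using this
  · simp only [norm_swapVec, norm_star]; rfl
  · exact forall_congr' heq

theorem jostTilde_left_zero (hm : RightProfile A fun y => m (-y)) (hz : z ∈ closedUpper)
    (hk : wave A z ≠ 0) (x : ℝ) :
    jostTilde .left A m z 0 x = swapVec (jostCol A (fun y => m (-y)) z (-x)) := by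
  have hex : IsJostColumn .left A m z 0
      fun x => swapVec (jostCol A (fun y => m (-y)) z (-x)) := by
    rw [isJostColumn_reflect]
    simp only [swapVec_swapVec, neg_neg]
    exact isJostColumn_jostCol hm hz hk
  have hsp : IsJostColumn .left A m z 0 (jostTilde .left A m z 0) :=
    Classical.epsilon_spec (p := IsJostColumn .left A m z 0) ⟨_, hex⟩
  have := isJostColumn_right_one_unique hm hz (isJostColumn_reflect.1 hsp)
    (isJostColumn_jostCol hm hz hk)
  have h2 := congrArg swapVec (congrFun this (-x))
  simpa only [swapVec_swapVec, neg_neg] using h2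

theorem Hinv_swap (v : Fin 2 → ℂ) : Hinv A z *ᵥ swapVec v = swapVec (Hinv A z *ᵥ v) := by
  rw [Hinv_eq]
  ext i
  fin_cases i <;> simp [swapVec, Matrix.vecHead, Matrix.vecTail] <;> ring

theorem phase_left_eq (x : ℝ) :
    phase .left A m x z = -phase .right A (fun y => m (-y)) (-x) z := by
  rw [phase, phase, intFrom, intFrom, ← integral_comp_neg_Iic]
  simp only [neg_neg]
  push_cast; ring

theorem jost_left_zero (hm : RightProfile A fun y => m (-y)) (hz : z ∈ closedUpper)
    (hk : wave A z ≠ 0) (x : ℝ) :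
    jost .left A m z 0 x = alpha A z • swapVec (jostR A (fun y => m (-y)) (-x) z) := by
  have hs : sigma3 0 0 = 1 := rfl
  have h := jost_right_one hm hz hk (-x)
  have hs1 : sigma3 1 1 = -1 := rfl
  have hsm : ∀ (c : ℂ) (v : Fin 2 → ℂ), swapVec (c • v) = c • swapVec v := fun c v => by
    ext i; fin_cases i <;> rfl
  rw [jost, jostTilde_right_one hm hz hk, hs1, mul_neg_one, neg_neg] at h
  rw [jost, jostTilde_left_zero hm hz hk, Hinv_swap, hs, mul_one, phase_left_eq, neg_neg, ← hsm, h,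
    hsm]

/-- The symmetry of Ψ̃ from `isJostColumn_conj`, combined with the exchange of the columns of H⁻¹ in
`alpha_mul_beta_of_lt`, which supplies the factor -i. -/
theorem jost_right_zero (hm : RightProfile A m) {s : ℝ} (hs : 1 / A < |s|) (x : ℝ) :
    jost .right A m s 0 x = -Complex.I • star (jost .right A m s 1 x) := by
  have hz := ofReal_mem_closedUpper s
  obtain ⟨κ, hκ, hκs⟩ := wave_ofReal_of_lt hm.pos hs
  have hk : wave A s ≠ 0 := by
    rw [hκ]; exact Complex.ofReal_ne_zero.2 fun h => by simp [h] at hκs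
  have hl : lRoot A s = ((2 * κ / A : ℝ) : ℂ) := by
    rw [lRoot_eq hm.pos, hκ]; push_cast; rfl
  have hst : ∀ v : Fin 2 → ℂ, star (swapVec v) = swapVec (star v) := fun v => by
    ext i; fin_cases i <;> rfl
  have hex : IsJostColumn .right A m s 0 fun x => swapVec (star (jostCol A m s x)) := by
    rw [isJostColumn_conj hl]
    simp only [hst, star_star, swapVec_swapVec]
    exact isJostColumn_jostCol hm hz hk
  have hsp : IsJostColumn .right A m s 0 (jostTilde .right A m s 0) :=
    Classical.epsilon_spec (p := IsJostColumn .right A m s 0) ⟨_, hex⟩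
  have h1 := isJostColumn_right_one_unique hm hz ((isJostColumn_conj hl).1 hsp)
    (isJostColumn_jostCol hm hz hk)
  have h2 := congrArg (fun v => swapVec (star v)) (congrFun h1 x)
  simp only [hst, star_star, swapVec_swapVec] at h2
  rw [jost, jost, jostTilde_right_one hm hz hk, h2]
  have hab := alpha_mul_beta_of_lt hm.pos hs
  have hab2 : alpha A s = -Complex.I * ((starRingEnd ℂ) (alpha A s) *
      (starRingEnd ℂ) (beta A s)) := by
    have := congrArg (starRingEnd ℂ) hab
    simp only [map_mul, map_neg, Complex.conj_I, Complex.conj_conj, neg_neg] at this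
    rw [this]
    linear_combination (alpha A s) * Complex.I_sq
  have hs0 : sigma3 0 0 = 1 := rfl
  have hs1 : sigma3 1 1 = -1 := rfl
  have hph : (starRingEnd ℂ) (Complex.exp (phase .right A m x s)) =
      Complex.exp (-phase .right A m x s) := by
    rw [← Complex.exp_conj, phase, hl]
    congr 1
    simp [Complex.conj_ofNat]
  rw [hs0, hs1, mul_one, mul_neg_one, neg_neg, Hinv_eq, star_smul]
  change _ = -Complex.I • ((starRingEnd ℂ) (Complex.exp (phase .right A m x s)) • _)
  rw [hph, smul_comm]
  congr 1
  ext i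
  fin_cases i
  · simp [swapVec, Matrix.vecHead, Matrix.vecTail]
    linear_combination (starRingEnd ℂ) (jostCol A m s x 1) * hab +
      (starRingEnd ℂ) (jostCol A m s x 0) * hab2
  · simp [swapVec, Matrix.vecHead, Matrix.vecTail]
    linear_combination (starRingEnd ℂ) (jostCol A m s x 0) * hab +
      (starRingEnd ℂ) (jostCol A m s x 1) * hab2

end JostIdentification

end MCH

end

/-! ### The left Jost solution, the Wronskian and the jump relation. -/

noncomputable section

namespace MCH

section LeftJost

/-- The left Jost solution, normalized to a multiple of `(β, 1)` at `-∞`. -/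
def jostL (A : ℝ) (m : ℝ → ℝ) (x : ℝ) (z : ℂ) : Fin 2 → ℂ :=
  swapVec (jostR A (fun y => m (-y)) (-x) z)

variable {A : ℝ} {m : ℝ → ℝ} {z : ℂ}

theorem IsLaxSol.reflect {φ : ℝ → Fin 2 → ℂ} (h : IsLaxSol (fun y => m (-y)) z φ) :
    IsLaxSol m z fun x => swapVec (φ (-x)) := by
  intro x
  refine hasDerivAt_pi.2 fun i => ?_
  have h0 := (h.hasDerivAt_zero (-x)).scomp x (hasDerivAt_neg x)
  have h1 := (h.hasDerivAt_one (-x)).scomp x (hasDerivAt_neg x)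
  fin_cases i
  · refine h1.congr_deriv ?_
    simp [laxField]; ring
  · refine h0.congr_deriv ?_
    simp [laxField]; ring

theorem isLaxSol_jostL (hm : RightProfile A fun y => m (-y)) (hz : z ∈ closedUpper) :
    IsLaxSol m z fun x => jostL A m x z :=
  (isLaxSol_jostR hm hz).reflect

theorem continuousOn_jostL (hm : RightProfile A fun y => m (-y)) (x : ℝ) :
    ContinuousOn (jostL A m x) closedUpper :=
  continuous_swapVec.comp_continuousOn (continuousOn_jostR hm (-x))

theorem differentiableOn_jostL (hm : RightProfile A fun y => m (-y)) (x : ℝ) :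
    DifferentiableOn ℂ (jostL A m x) upper := by
  have := swapCLM.differentiable.comp_differentiableOn (differentiableOn_jostR hm (-x))
  exact this.congr fun z _ => (swapCLM_apply _).symm

theorem heightForm_swapVec (v : Fin 2 → ℂ) : heightForm (swapVec v) = -heightForm v := by
  simp [heightForm]; ring

theorem heightForm_jostL_nonneg (hm : RightProfile A fun y => m (-y)) (hz : z ∈ closedUpper)
    (x : ℝ) : 0 ≤ heightForm (jostL A m x z) := by
  rw [jostL, heightForm_swapVec]
  linarith [heightForm_jostR_nonpos hm hz (-x)]

theorem star_jostL_of_gt (hm : RightProfile A fun y => m (-y)) {s : ℝ} (hs : |s| < 1 / A) (x : ℝ) :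
    star (jostL A m x s) = jostL A m x s := by
  have h := star_jostR_of_gt hm hs (-x)
  have hst : ∀ v : Fin 2 → ℂ, star (swapVec v) = swapVec (star v) := fun v => by
    ext i; fin_cases i <;> rfl
  rw [jostL, hst, h]

theorem isLaxSol_zero : IsLaxSol m z fun _ => 0 := fun x => by
  refine (hasDerivAt_const x (0 : Fin 2 → ℂ)).congr_deriv ?_
  ext i; fin_cases i <;> simp [laxField]

theorem jostR_ne_zero (hm : RightProfile A m) (hz : z ∈ closedUpper) (x : ℝ) :
    jostR A m x z ≠ 0 := by
  intro h
  obtain ⟨C, hC⟩ := hm.abs_le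
  have h0 := (isLaxSol_jostR hm hz).unique hC isLaxSol_zero h
  have h1 : ∀ y, jostAmp A m y z = 0 := fun y => by
    rw [← exp_neg_smul_jostR, show jostR A m y z = 0 from congrFun h0 y, smul_zero]
  have h2 := tendsto_jostAmp hm hz
  simp only [h1] at h2
  have h3 := congrFun (tendsto_nhds_unique h2 tendsto_const_nhds) 0
  simp [eigvec] at h3

theorem jostL_ne_zero (hm : RightProfile A fun y => m (-y)) (hz : z ∈ closedUpper) (x : ℝ) :
    jostL A m x z ≠ 0 := by
  intro h
  apply jostR_ne_zero hm hz (-x)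
  rw [← swapVec_swapVec (jostR _ _ _ _)]
  rw [jostL] at h
  rw [h]
  ext i; fin_cases i <;> rfl

/-- Two columns with vanishing determinant are proportional. -/
theorem exists_smul_of_colDet_eq_zero {v w : Fin 2 → ℂ} (hw : w ≠ 0) (h : colDet v w = 0) :
    ∃ c : ℂ, v = c • w := by
  rw [colDet] at h
  by_cases h0 : w 0 = 0
  · have h1 : w 1 ≠ 0 := fun h1 => hw (by ext i; fin_cases i <;> simp [h0, h1])
    refine ⟨v 1 / w 1, ?_⟩
    ext i
    fin_cases i
    · simp only [h0, zero_mul, sub_zero, mul_eq_zero] at h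
      simp [h0, h.resolve_right h1]
    · simp; field_simp
  · refine ⟨v 0 / w 0, ?_⟩
    ext i
    fin_cases i
    · simp; field_simp
    · simp; field_simp; linear_combination -h

end LeftJost

/-- A positive momentum with backgrounds `A₁` at `-∞` and `A₂` at `+∞`. -/
structure StepProfile (A₁ A₂ : ℝ) (m : ℝ → ℝ) : Prop where
  lt : A₁ < A₂
  left : RightProfile A₁ fun y => m (-y)
  right : RightProfile A₂ m

/-- The determinant of the left and right Jost solutions. -/
def wronskian (A₁ A₂ : ℝ) (m : ℝ → ℝ) (z : ℂ) : ℂ :=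
  colDet (jostL A₁ m 0 z) (jostR A₂ m 0 z)

section Wronskian

variable {A₁ A₂ : ℝ} {m : ℝ → ℝ} {z : ℂ}

theorem StepProfile.inv_lt (hm : StepProfile A₁ A₂ m) : 1 / A₂ < 1 / A₁ :=
  one_div_lt_one_div_of_lt hm.left.pos hm.lt

theorem wronskian_eq (hm : StepProfile A₁ A₂ m) (hz : z ∈ closedUpper) (x : ℝ) :
    colDet (jostL A₁ m x z) (jostR A₂ m x z) = wronskian A₁ A₂ m z :=
  (isLaxSol_jostL hm.left hz).colDet_eq (isLaxSol_jostR hm.right hz) x 0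

theorem continuousOn_wronskian (hm : StepProfile A₁ A₂ m) :
    ContinuousOn (wronskian A₁ A₂ m) closedUpper := by
  have h1 := continuousOn_pi.1 (continuousOn_jostL hm.left 0)
  have h2 := continuousOn_pi.1 (continuousOn_jostR hm.right 0)
  exact ((h1 0).mul (h2 1)).sub ((h2 0).mul (h1 1))

theorem differentiableOn_wronskian (hm : StepProfile A₁ A₂ m) :
    DifferentiableOn ℂ (wronskian A₁ A₂ m) upper := by
  have h1 := differentiableOn_pi.1 (differentiableOn_jostL hm.left 0)
  have h2 := differentiableOn_pi.1 (differentiableOn_jostR hm.right 0)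
  exact ((h1 0).mul (h2 1)).sub ((h2 0).mul (h1 1))

/-- If the Wronskian vanished, the left solution would be a nonzero multiple of the right one and
its height form would be negative, whereas it is nonnegative. -/
theorem wronskian_ne_zero_of_heightForm_neg (hm : StepProfile A₁ A₂ m) (hz : z ∈ closedUpper)
    (h : heightForm (jostR A₂ m 0 z) < 0) : wronskian A₁ A₂ m z ≠ 0 := by
  intro hW
  obtain ⟨c, hc⟩ := exists_smul_of_colDet_eq_zero (jostR_ne_zero hm.right hz 0) hW
  have h1 := heightForm_jostL_nonneg hm.left hz 0
  rw [hc, heightForm_smul] at h1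
  have h2 : c ≠ 0 := fun h0 => jostL_ne_zero hm.left hz 0 (by rw [hc, h0, zero_smul])
  have h3 : 0 < ‖c‖ ^ 2 := by positivity
  nlinarith

theorem wronskian_ne_zero_of_upper (hm : StepProfile A₁ A₂ m) (hz : z ∈ upper) :
    wronskian A₁ A₂ m z ≠ 0 :=
  wronskian_ne_zero_of_heightForm_neg hm (upper_subset_closedUpper hz)
    (heightForm_jostR_neg_of_upper hm.right hz 0)

theorem wronskian_ne_zero_of_lt (hm : StepProfile A₁ A₂ m) {s : ℝ} (hs : 1 / A₂ < |s|) :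
    wronskian A₁ A₂ m s ≠ 0 := by
  refine wronskian_ne_zero_of_heightForm_neg hm (ofReal_mem_closedUpper s) ?_
  rw [heightForm_jostR_neg_of_lt hm.right hs]
  linarith [beta_im_pos_of_lt hm.right.pos hs]

theorem colDet_smul_smul (a b : ℂ) (v w : Fin 2 → ℂ) :
    colDet (a • v) (b • w) = a * b * colDet v w := by
  simp [colDet]; ring

theorem c11_eq (hm : StepProfile A₁ A₂ m) (hz : z ∈ closedUpper) (h1 : wave A₁ z ≠ 0)
    (h2 : wave A₂ z ≠ 0) : c11 A₁ A₂ m z = alpha A₁ z * alpha A₂ z * wronskian A₁ A₂ m z := by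
  rw [c11, jost_left_zero hm.left hz h1, jost_right_one hm.right hz h2, colDet_smul_smul]
  rfl

/-- The no-soliton hypothesis is needed only in the gap; outside, the height form decides, also at
±1/A₁. The points ±1/A₂ are left out because the Wronskian may vanish there. -/
theorem wronskian_ne_zero_of_solitonless (hm : StepProfile A₁ A₂ m)
    (hs : ∀ k : ℝ, |k| < 1 / A₂ → c11 A₁ A₂ m k ≠ 0) {s : ℝ} (h : |s| ≠ 1 / A₂) :
    wronskian A₁ A₂ m s ≠ 0 := by
  rcases lt_or_gt_of_ne h with h | h
  · have := hs s h
    rw [c11_eq hm (ofReal_mem_closedUpper s)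
      (wave_ne_zero_ofReal hm.left.pos (h.trans hm.inv_lt).ne)
      (wave_ne_zero_ofReal hm.right.pos h.ne)] at this
    exact right_ne_zero_of_mul this
  · exact wronskian_ne_zero_of_lt hm h

/-- The normalized left Jost column `Ψ₁⁽¹⁾`. -/
def colA (A₁ : ℝ) (m : ℝ → ℝ) (x : ℝ) (z : ℂ) : Fin 2 → ℂ := alpha A₁ z • jostL A₁ m x z

/-- The normalized right Jost column `Ψ₂⁽²⁾`. -/
def colB (A₂ : ℝ) (m : ℝ → ℝ) (x : ℝ) (z : ℂ) : Fin 2 → ℂ := alpha A₂ z • jostR A₂ m x z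

theorem colDet_star_self (b : Fin 2 → ℂ) :
    colDet (-Complex.I • star b) b = -2 * (heightForm b : ℂ) := by
  have h : (heightForm b : ℂ) = (b 0 * (starRingEnd ℂ) (b 1) -
      (starRingEnd ℂ) (b 0 * (starRingEnd ℂ) (b 1))) / (2 * Complex.I) := by
    rw [heightForm, Complex.im_eq_sub_conj]
  rw [h]
  have := Complex.I_ne_zero
  simp [colDet]
  field_simp
  linear_combination (b 0 * (starRingEnd ℂ) (b 1) - b 1 * (starRingEnd ℂ) (b 0)) * Complex.I_sq

/-- The constant α is chosen for this: the right column and its conjugate form a basis of solutions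
with Wronskian 1, in which the left column can be expanded. -/
theorem colDet_star_colB (hm : RightProfile A₂ m) {s : ℝ} (hs : 1 / A₂ < |s|) (x : ℝ) :
    colDet (-Complex.I • star (colB A₂ m x s)) (colB A₂ m x s) = 1 := by
  rw [colDet_star_self, colB, heightForm_smul, heightForm_jostR_neg_of_lt hm hs]
  have := two_mul_alpha_beta_im hm.pos hs
  push_cast
  have h : (2 * (‖alpha A₂ s‖ : ℂ) ^ 2 * ((beta A₂ s).im : ℂ)) = 1 := by exact_mod_cast this
  linear_combination h

theorem c11_eq_colDet (hm : StepProfile A₁ A₂ m) {s : ℝ} (h1 : |s| ≠ 1 / A₁) (h2 : |s| ≠ 1 / A₂)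
    (x : ℝ) : c11 A₁ A₂ m s = colDet (colA A₁ m x s) (colB A₂ m x s) := by
  have hz := ofReal_mem_closedUpper s
  rw [c11_eq hm hz (wave_ne_zero_ofReal hm.left.pos h1) (wave_ne_zero_ofReal hm.right.pos h2),
    colA, colB, colDet_smul_smul, wronskian_eq hm hz]

theorem c21_eq_colDet (hm : StepProfile A₁ A₂ m) {s : ℝ} (h1 : |s| ≠ 1 / A₁) (h2 : 1 / A₂ < |s|)
    (x : ℝ) : c21 A₁ A₂ m s =
      colDet (-Complex.I • star (colB A₂ m x s)) (colA A₁ m x s) := by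
  have hz := ofReal_mem_closedUpper s
  have hB := ((isLaxSol_jostR hm.right hz).const_smul (alpha A₂ s)).conj.const_smul (-Complex.I)
  have hA := (isLaxSol_jostL hm.left hz).const_smul (alpha A₁ s)
  rw [c21, jost_right_zero hm.right h2, jost_right_one hm.right hz
    (wave_ne_zero_ofReal hm.right.pos h2.ne'), jost_left_zero hm.left hz
    (wave_ne_zero_ofReal hm.left.pos h1)]
  exact hB.colDet_eq hA 0 x

/-- The scattering relation. -/
theorem colA_eq (hm : StepProfile A₁ A₂ m) {s : ℝ} (h1 : |s| ≠ 1 / A₁) (h2 : 1 / A₂ < |s|)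
    (x : ℝ) (i : Fin 2) : colA A₁ m x s i =
      c11 A₁ A₂ m s * (-Complex.I * (starRingEnd ℂ) (colB A₂ m x s i)) +
        c21 A₁ A₂ m s * colB A₂ m x s i := by
  have hd := colDet_star_colB hm.right h2 x
  rw [c11_eq_colDet hm h1 h2.ne' x, c21_eq_colDet hm h1 h2 x]
  simp only [colDet, Pi.smul_apply, Pi.star_apply, smul_eq_mul, RCLike.star_def] at hd ⊢
  fin_cases i
  · simp only [Fin.zero_eta]
    linear_combination -colA A₁ m x s 0 * hd
  · simp only [Fin.mk_one]
    linear_combination -colA A₁ m x s 1 * hd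

theorem c11_ne_zero (hm : StepProfile A₁ A₂ m)
    (hs : ∀ k : ℝ, |k| < 1 / A₂ → c11 A₁ A₂ m k ≠ 0) {s : ℝ} (h1 : |s| ≠ 1 / A₁)
    (h2 : |s| ≠ 1 / A₂) : c11 A₁ A₂ m s ≠ 0 := by
  have hz := ofReal_mem_closedUpper s
  rw [c11_eq hm hz (wave_ne_zero_ofReal hm.left.pos h1) (wave_ne_zero_ofReal hm.right.pos h2)]
  exact mul_ne_zero (mul_ne_zero (alpha_ne_zero (wave_im_nonneg hm.left.pos hz))
    (alpha_ne_zero (wave_im_nonneg hm.right.pos hz))) (wronskian_ne_zero_of_solitonless hm hs h2)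

theorem conj_colA_of_gt (hm : RightProfile A₁ fun y => m (-y)) {s : ℝ} (hs : |s| < 1 / A₁) (x : ℝ)
    (i : Fin 2) : (starRingEnd ℂ) (colA A₁ m x s i) = -colA A₁ m x s i := by
  have h := congrFun (star_jostL_of_gt hm hs x) i
  simp only [Pi.star_apply, RCLike.star_def] at h
  simp [colA, conj_alpha_of_gt hm.pos hs, h]

theorem conj_colB_of_gt (hm : RightProfile A₂ m) {s : ℝ} (hs : |s| < 1 / A₂) (x : ℝ)
    (i : Fin 2) : (starRingEnd ℂ) (colB A₂ m x s i) = -colB A₂ m x s i := by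
  have h := congrFun (star_jostR_of_gt hm hs x) i
  simp only [Pi.star_apply, RCLike.star_def] at h
  simp [colB, conj_alpha_of_gt hm.pos hs, h]

/-- Between the two branch points the left column is still purely imaginary, so the two Wronskians
defining c₁₁ and c₂₁ are conjugate up to a factor. In particular |r| = 1 there. -/
theorem c21_eq_of_gt (hm : StepProfile A₁ A₂ m) {s : ℝ} (h1 : |s| < 1 / A₁) (h2 : 1 / A₂ < |s|) :
    c21 A₁ A₂ m s = -Complex.I * (starRingEnd ℂ) (c11 A₁ A₂ m s) := by
  have h11 := c11_eq_colDet hm h1.ne h2.ne' 0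
  have h21 := c21_eq_colDet hm h1.ne h2 0
  rw [h11, h21]
  simp only [colDet, Pi.smul_apply, Pi.star_apply, smul_eq_mul, RCLike.star_def, map_sub, map_mul,
    conj_colA_of_gt hm.left h1]
  ring

end Wronskian

section Core

/-- The sectionally analytic matrix `(Ψ₁⁽¹⁾ / c₁₁, Ψ₂⁽²⁾) e^{f σ₃}`, with
`f` the right phase at parameter `y`. -/
def rhCore (A₁ A₂ : ℝ) (m : ℝ → ℝ) (x y : ℝ) (z : ℂ) : Matrix (Fin 2) (Fin 2) ℂ :=
  Matrix.of fun i => ![Complex.exp (fHat A₂ y 0 z) * jostL A₁ m x z i /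
      (alpha A₂ z * wronskian A₁ A₂ m z),
    Complex.exp (-fHat A₂ y 0 z) * (alpha A₂ z * jostR A₂ m x z i)]

variable {A₁ A₂ : ℝ} {m : ℝ → ℝ} {z : ℂ}

theorem rhCore_zero (x y : ℝ) (i : Fin 2) : rhCore A₁ A₂ m x y z i 0 =
    Complex.exp (fHat A₂ y 0 z) * jostL A₁ m x z i / (alpha A₂ z * wronskian A₁ A₂ m z) := rfl

theorem rhCore_one (x y : ℝ) (i : Fin 2) : rhCore A₁ A₂ m x y z i 1 =
    Complex.exp (-fHat A₂ y 0 z) * (alpha A₂ z * jostR A₂ m x z i) := rfl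

theorem fHat_zero (y : ℝ) : fHat A₂ y 0 z = Complex.I * wave A₂ z * y := by
  rw [fHat, wave]; push_cast; ring

theorem rhCore_zero_eq (hm : StepProfile A₁ A₂ m) {s : ℝ} (h1 : |s| ≠ 1 / A₁) (h2 : |s| ≠ 1 / A₂)
    (x y : ℝ) (i : Fin 2) : rhCore A₁ A₂ m x y s i 0 =
      Complex.exp (fHat A₂ y 0 s) * (colA A₁ m x s i / c11 A₁ A₂ m s) := by
  have hz := ofReal_mem_closedUpper s
  have := alpha_ne_zero (wave_im_nonneg hm.left.pos hz)
  rw [rhCore_zero, c11_eq hm hz (wave_ne_zero_ofReal hm.left.pos h1)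
    (wave_ne_zero_ofReal hm.right.pos h2), colA, mul_div_assoc]
  congr 1
  simp only [Pi.smul_apply, smul_eq_mul]
  rw [mul_assoc, mul_div_mul_left _ _ this]

theorem rhCore_one_eq (x y : ℝ) (i : Fin 2) : rhCore A₁ A₂ m x y z i 1 =
    Complex.exp (-fHat A₂ y 0 z) * colB A₂ m x z i := rfl

/-- Across the real line `rhCore` jumps, with respect to the symmetry
`M ↦ -i conj(M) σ₁`, by the jump matrix of the problem. -/
theorem rhCore_jump (hm : StepProfile A₁ A₂ m)
    (hs : ∀ k : ℝ, |k| < 1 / A₂ → c11 A₁ A₂ m k ≠ 0) {s : ℝ} (h1 : |s| ≠ 1 / A₁)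
    (h2 : |s| ≠ 1 / A₂) (x y : ℝ) :
    rhCore A₁ A₂ m x y s = (-Complex.I) • ((rhCore A₁ A₂ m x y s).map (starRingEnd ℂ) * sigma1) *
      jumpMatrix A₁ A₂ (reflection A₁ A₂ m) y 0 s := by
  have hc := c11_ne_zero hm hs h1 h2
  have hc' : (starRingEnd ℂ) (c11 A₁ A₂ m s) ≠ 0 := by simpa using hc
  have e0 := rhCore_zero_eq hm h1 h2 x y
  have e1 := rhCore_one_eq (A₁ := A₁) (A₂ := A₂) (m := m) (z := s) x y
  have hE := Complex.exp_ne_zero (fHat A₂ y 0 s)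
  have hEn : Complex.exp (-fHat A₂ y 0 s) = (Complex.exp (fHat A₂ y 0 s))⁻¹ := Complex.exp_neg _
  have hI := Complex.I_sq
  rcases lt_or_gt_of_ne h2 with h2' | h2'
  -- In the gap both columns are purely imaginary, while c₁₁ and the exponential are real; the
  -- matrix is the negative of its conjugate and the jump is -iσ₁.
  · have hW : (starRingEnd ℂ) (c11 A₁ A₂ m s) = c11 A₁ A₂ m s := by
      rw [c11_eq_colDet hm h1 h2 0]
      simp only [colDet, map_sub, map_mul, conj_colA_of_gt hm.left (h2'.trans hm.inv_lt),
        conj_colB_of_gt hm.right h2']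
      ring
    have hf : (starRingEnd ℂ) (Complex.exp (fHat A₂ y 0 s)) = Complex.exp (fHat A₂ y 0 s) := by
      rw [← Complex.exp_conj, fHat_zero]
      simp [conj_wave_of_gt hm.right.pos h2']
    rw [jumpMatrix, if_neg h2'.not_gt]
    ext i j
    fin_cases j
    · simp [Matrix.mul_apply, sigma1, e0, e1, hEn, hf, hW,
        conj_colA_of_gt hm.left (h2'.trans hm.inv_lt), conj_colB_of_gt hm.right h2']
      linear_combination (Complex.exp (fHat A₂ y 0 s) *
        (colA A₁ m x s i / c11 A₁ A₂ m s)) * hI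
    · simp [Matrix.mul_apply, sigma1, e0, e1, hEn, hf, hW,
        conj_colA_of_gt hm.left (h2'.trans hm.inv_lt), conj_colB_of_gt hm.right h2']
      linear_combination ((Complex.exp (fHat A₂ y 0 s))⁻¹ * colB A₂ m x s i) * hI
  · obtain ⟨κ, hκ, -⟩ := wave_ofReal_of_lt hm.right.pos h2'
    have hf : (starRingEnd ℂ) (Complex.exp (fHat A₂ y 0 s)) =
        (Complex.exp (fHat A₂ y 0 s))⁻¹ := by
      rw [← Complex.exp_conj, ← Complex.exp_neg, fHat_zero, hκ]
      simp
    have hA := colA_eq hm h1 h2' x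
    rw [jumpMatrix, if_pos h2', expSigma3, expSigma3, neg_neg, G0]
    rcases lt_or_gt_of_ne h1 with h1' | h1'
    -- Between the branch points only the left column is purely imaginary; the scattering relation
    -- with c₂₁ = -i c̄₁₁ gives the rest.
    · have h21 := c21_eq_of_gt hm h1' h2'
      have hcA := conj_colA_of_gt hm.left h1' x
      have hr : 1 / reflection A₁ A₂ m s =
          Complex.I * c11 A₁ A₂ m s / (starRingEnd ℂ) (c11 A₁ A₂ m s) := by
        rw [reflection, h21]
        field_simp
        linear_combination -hI
      rw [if_neg h1'.not_gt, hr, reflection, h21]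
      ext i j
      fin_cases j
      · simp [Matrix.mul_apply, sigma1, e0, e1, hEn, hf, hcA]
        field_simp
        linear_combination (colA A₁ m x s i) * hI
      · have h3 := hA i
        rw [h21] at h3
        simp [Matrix.mul_apply, sigma1, e0, e1, hEn, hf, hcA]
        rw [h3]
        field_simp
        ring_nf
        linear_combination ((colB A₂ m x s i) * (starRingEnd ℂ) (c11 A₁ A₂ m s)) * hI
    -- On the common continuous spectrum no column is imaginary; the scattering relation and its
    -- conjugate are used together.
    · have hcA : ∀ i, (starRingEnd ℂ) (colA A₁ m x s i) =
          (starRingEnd ℂ) (c11 A₁ A₂ m s) * (Complex.I * colB A₂ m x s i) +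
          (starRingEnd ℂ) (c21 A₁ A₂ m s) * (starRingEnd ℂ) (colB A₂ m x s i) := fun i => by
        rw [hA i]; simp
      have hr : ((‖reflection A₁ A₂ m s‖ : ℝ) : ℂ) ^ 2 =
          (c21 A₁ A₂ m s / c11 A₁ A₂ m s) * (starRingEnd ℂ) (c21 A₁ A₂ m s) /
            (starRingEnd ℂ) (c11 A₁ A₂ m s) := by
        rw [← Complex.mul_conj', reflection, map_div₀]; ring
      rw [if_pos h1', hr, reflection, map_div₀]
      ext i j
      fin_cases j
      · simp [Matrix.mul_apply, sigma1, e0, e1, hEn, hf, hcA]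
        rw [hA i]
        field_simp
        ring_nf
        linear_combination ((starRingEnd ℂ) (c11 A₁ A₂ m s) * c21 A₁ A₂ m s *
          colB A₂ m x s i) * hI
      · simp [Matrix.mul_apply, sigma1, e0, e1, hEn, hf, hcA]
        field_simp
        ring_nf
        linear_combination (colB A₂ m x s i * (starRingEnd ℂ) (c11 A₁ A₂ m s)) * hI

end Core

end MCH

end

/-! ### Functions without jump are constant; uniqueness for the Riemann–Hilbert problem. -/

noncomputable section

namespace MCH

section Rigidity

theorem mem_upper_union_lower {z : ℂ} : z ∈ upper ∪ lower ↔ z.im ≠ 0 := by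
  simp only [upper, lower, mem_union, mem_setOf_eq]
  exact ⟨fun h => h.elim ne_of_gt ne_of_lt, fun h => (lt_or_gt_of_ne h).symm⟩

theorem closure_upper : closure upper = closedUpper := Complex.closure_setOf_lt_im 0

theorem closure_upper_union_lower : closure (upper ∪ lower) = univ := by
  rw [closure_union, closure_upper, show lower = {z : ℂ | z.im < 0} from rfl,
    Complex.closure_setOf_im_lt, eq_univ_iff_forall]
  exact fun z => (le_total 0 z.im).elim Or.inl Or.inr

instance neBot_nhdsWithin_upper_union_lower (z : ℂ) : (𝓝[upper ∪ lower] z).NeBot :=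
  mem_closure_iff_nhdsWithin_neBot.1 (by rw [closure_upper_union_lower]; exact mem_univ z)

/-- A bound off the real line extends to the real line by continuity. -/
theorem norm_le_of_off_real {V : Set ℂ} (hV : IsOpen V) {G : ℂ → ℂ} {g : ℂ → ℝ}
    (hG : ContinuousOn G V) (hg : ContinuousOn g V)
    (h : ∀ z ∈ V, z ∈ upper ∪ lower → ‖G z‖ ≤ g z) : ∀ z ∈ V, ‖G z‖ ≤ g z := by
  intro z hz
  have h1 : Tendsto (fun w => ‖G w‖) (𝓝[upper ∪ lower] z) (𝓝 ‖G z‖) :=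
    ((hG.continuousAt (hV.mem_nhds hz)).norm.tendsto).mono_left nhdsWithin_le_nhds
  have h2 : Tendsto g (𝓝[upper ∪ lower] z) (𝓝 (g z)) :=
    ((hg.continuousAt (hV.mem_nhds hz)).tendsto).mono_left nhdsWithin_le_nhds
  refine le_of_tendsto_of_tendsto h1 h2 ?_
  filter_upwards [self_mem_nhdsWithin, nhdsWithin_le_nhds (hV.mem_nhds hz)] with w hw hwV
  exact h w hwV hw

/-- A function continuous on an open set and holomorphic off the real line is conservative. -/
theorem isConservativeOn_of_continuousOn {G : ℂ → ℂ} {B : Set ℂ} (hG : ContinuousOn G B)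
    (hd : DifferentiableOn ℂ G (upper ∪ lower)) : Complex.IsConservativeOn G B := by
  intro z w hzw
  rw [← add_eq_zero_iff_eq_neg, Complex.wedgeIntegral_add_wedgeIntegral_eq]
  have hc : ContinuousOn G (uIcc z.re w.re ×ℂ uIcc z.im w.im) := hG.mono hzw
  have key : ∀ z' w' : ℂ, uIcc z'.re w'.re ×ℂ uIcc z'.im w'.im ⊆
      uIcc z.re w.re ×ℂ uIcc z.im w.im →
      (0 : ℝ) ∉ Ioo (min z'.im w'.im) (max z'.im w'.im) →
      (∫ x : ℝ in z'.re..w'.re, G (x + z'.im * Complex.I)) -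
      (∫ x : ℝ in z'.re..w'.re, G (x + w'.im * Complex.I)) +
      Complex.I • (∫ y : ℝ in z'.im..w'.im, G (w'.re + y * Complex.I)) -
      Complex.I • (∫ y : ℝ in z'.im..w'.im, G (z'.re + y * Complex.I)) = 0 := by
    intro z' w' hs h0
    refine Complex.integral_boundary_rect_eq_zero_of_continuousOn_of_differentiableOn G z' w'
      (hc.mono hs) (hd.mono ?_)
    intro u hu
    rw [mem_upper_union_lower]
    intro h
    exact h0 (h ▸ (Complex.mem_reProdIm.1 hu).2)
  -- A rectangle crossing the real axis is cut along the axis; each half has a boundary integral of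
  -- zero, and the two contributions of the axis cancel.
  by_cases h0 : (0 : ℝ) ∈ Ioo (min z.im w.im) (max z.im w.im)
  · have h0' : (0 : ℝ) ∈ uIcc z.im w.im := ⟨h0.1.le, h0.2.le⟩
    have k1 := key z (w.re : ℂ) (by
        rintro u ⟨hu1, hu2⟩
        exact ⟨by simpa using hu1, uIcc_subset_uIcc left_mem_uIcc h0' (by simpa using hu2)⟩)
      (by
        simp only [Complex.ofReal_im]
        rintro ⟨h1, h2⟩
        rcases le_total z.im 0 with h | h
        · rw [max_eq_right h] at h2; exact lt_irrefl _ h2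
        · rw [min_eq_right h] at h1; exact lt_irrefl _ h1)
    have k2 := key (z.re : ℂ) w (by
        rintro u ⟨hu1, hu2⟩
        exact ⟨by simpa using hu1, uIcc_subset_uIcc h0' right_mem_uIcc (by simpa using hu2)⟩)
      (by
        simp only [Complex.ofReal_im]
        rintro ⟨h1, h2⟩
        rcases le_total w.im 0 with h | h
        · rw [max_eq_left h] at h2; exact lt_irrefl _ h2
        · rw [min_eq_left h] at h1; exact lt_irrefl _ h1)
    have hvert : ∀ a : ℝ, a ∈ uIcc z.re w.re → ∀ b c : ℝ, b ∈ uIcc z.im w.im →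
        c ∈ uIcc z.im w.im →
        IntervalIntegrable (fun y : ℝ => G (a + y * Complex.I)) volume b c := by
      intro a ha b c hb hcm
      refine ContinuousOn.intervalIntegrable ?_
      refine hc.comp (by fun_prop) fun y hy => ?_
      exact ⟨by simpa using ha, by simpa using uIcc_subset_uIcc hb hcm hy⟩
    have s1 := intervalIntegral.integral_add_adjacent_intervals
      (hvert w.re right_mem_uIcc z.im 0 left_mem_uIcc h0')
      (hvert w.re right_mem_uIcc 0 w.im h0' right_mem_uIcc)
    have s2 := intervalIntegral.integral_add_adjacent_intervals
      (hvert z.re left_mem_uIcc z.im 0 left_mem_uIcc h0')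
      (hvert z.re left_mem_uIcc 0 w.im h0' right_mem_uIcc)
    simp only [Complex.ofReal_re, Complex.ofReal_im, Complex.ofReal_zero, zero_mul, add_zero]
      at k1 k2
    rw [← s1, ← s2, smul_add, smul_add]
    linear_combination k1 + k2
  · exact key z w Subset.rfl h0

/-- Equal limits from both sides give a function continuous across the line, hence holomorphic by
Morera. Singularities of order o(1/(z - p)) are removable, and Liouville's theorem applies to the
resulting entire function with a limit at infinity. -/
theorem eq_const_of_no_jump {F : ℂ → ℂ} {S : Finset ℝ} {c : ℂ}
    (hd : DifferentiableOn ℂ F (upper ∪ lower))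
    (hj : ∀ s : ℝ, s ∉ S → ∃ L, Tendsto F (𝓝[upper] (s : ℂ)) (𝓝 L) ∧
      Tendsto F (𝓝[lower] (s : ℂ)) (𝓝 L))
    (hS : ∀ p ∈ S, F =o[𝓝[upper ∪ lower] ((p : ℝ) : ℂ)] fun z => (z - p)⁻¹)
    (hinf : Tendsto F (Bornology.cobounded ℂ ⊓ 𝓟 (upper ∪ lower)) (𝓝 c)) :
    ∀ z ∈ upper ∪ lower, F z = c := by
  set T : Set ℂ := (fun s : ℝ => (s : ℂ)) '' (S : Set ℝ) with hT
  have hTf : T.Finite := S.finite_toSet.image _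
  have hTreal : ∀ z ∈ T, z.im = 0 := by rintro _ ⟨s, -, rfl⟩; simp
  -- The values of F on the real line are arbitrary, so they are replaced by its limits from off the
  -- line.
  set G := extendFrom (upper ∪ lower) F with hGdef
  have hlim : ∀ z ∈ Tᶜ, ∃ L, Tendsto F (𝓝[upper ∪ lower] z) (𝓝 L) := by
    intro z hz
    by_cases h : z ∈ upper ∪ lower
    · exact ⟨F z, hd.continuousOn z h⟩
    · have him : z.im = 0 := by rw [mem_upper_union_lower] at h; simpa using h
      have hz' : z = (z.re : ℂ) := by apply Complex.ext <;> simp [him]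
      obtain ⟨L, h1, h2⟩ := hj z.re (fun hh => hz ⟨z.re, hh, hz'.symm⟩)
      refine ⟨L, ?_⟩
      rw [nhdsWithin_union, hz']
      exact h1.sup h2
  have hGF : ∀ z ∈ upper ∪ lower, G z = F z := fun z hz =>
    extendFrom_eq (subset_closure hz) (hd.continuousOn z hz)
  have hGc : ContinuousOn G Tᶜ :=
    continuousOn_extendFrom (by rw [closure_upper_union_lower]; exact subset_univ _) hlim
  have hTo : IsOpen Tᶜ := hTf.isClosed.isOpen_compl
  have hGd : DifferentiableOn ℂ G Tᶜ :=
    (Complex.isConservativeOn_and_continuousOn_iff_isDifferentiableOn hTo).1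
      ⟨isConservativeOn_of_continuousOn hGc (hd.congr hGF), hGc⟩
  -- Punctured limits fill in the finitely many exceptional points as well.
  set H : ℂ → ℂ := fun z => limUnder (𝓝[≠] z) G with hH
  have hHG : ∀ z ∈ Tᶜ, H z = G z := fun z hz =>
    ((hGc.continuousAt (hTo.mem_nhds hz)).tendsto.mono_left nhdsWithin_le_nhds).limUnder_eq
  have hpunc : ∀ p, ∃ V, IsOpen V ∧ p ∈ V ∧ V \ {p} ⊆ Tᶜ := fun p =>
    ⟨(T \ {p})ᶜ, (hTf.subset sdiff_subset).isClosed.isOpen_compl, by simp, by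
      rintro z ⟨h1, h2⟩ h3; exact h1 ⟨h3, h2⟩⟩
  have hHd : Differentiable ℂ H := by
    intro p
    by_cases hp : p ∈ Tᶜ
    · have h1 : H =ᶠ[𝓝 p] G := by filter_upwards [hTo.mem_nhds hp] with z hz using hHG z hz
      exact (hGd.differentiableAt (hTo.mem_nhds hp)).congr_of_eventuallyEq h1
    · obtain ⟨V, hVo, hpV, hV⟩ := hpunc p
      obtain ⟨s, hs, rfl⟩ := not_notMem.1 hp
      have hinv : Tendsto (fun z : ℂ => ‖(z - s)⁻¹‖) (𝓝[≠] (s : ℂ)) atTop := by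
        have h1 : Tendsto (fun z : ℂ => ‖z - s‖) (𝓝[≠] (s : ℂ)) (𝓝[>] 0) := by
          refine tendsto_nhdsWithin_iff.2 ⟨?_, ?_⟩
          · have : Continuous fun z : ℂ => ‖z - s‖ := by fun_prop
            have h2 := this.tendsto (s : ℂ)
            simp only [sub_self, norm_zero] at h2
            exact h2.mono_left nhdsWithin_le_nhds
          · filter_upwards [self_mem_nhdsWithin] with z hz
            exact norm_pos_iff.2 (sub_ne_zero.2 hz)
        simpa only [norm_inv, Function.comp_def] using tendsto_inv_nhdsGT_zero.comp h1
      have ho : (fun z => G z - G s) =o[𝓝[≠] (s : ℂ)] fun z => (z - s)⁻¹ := by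
        refine IsLittleO.sub ?_ (isLittleO_const_left.2 (Or.inr hinv))
        refine isLittleO_iff.2 fun ε hε => ?_
        obtain ⟨U, hUo, hsU, hU⟩ := mem_nhdsWithin.1 (isLittleO_iff.1 (hS s hs) hε)
        have hW : IsOpen ((U ∩ V) \ {(s : ℂ)}) := (hUo.inter hVo).sdiff isClosed_singleton
        have hb := norm_le_of_off_real (G := G) (g := fun z => ε * ‖(z - s)⁻¹‖) hW
          (hGc.mono fun z hz => hV ⟨hz.1.2, hz.2⟩)
          (continuousOn_const.mul (ContinuousOn.norm (ContinuousOn.inv₀ (by fun_prop)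
            fun z hz => sub_ne_zero.2 hz.2))) (fun z hz hz2 => by
            rw [hGF z hz2]; exact hU ⟨hz.1.1, hz2⟩)
        filter_upwards [self_mem_nhdsWithin,
          nhdsWithin_le_nhds ((hUo.inter hVo).mem_nhds ⟨hsU, hpV⟩)] with z hz hz2
        exact hb z ⟨hz2, hz⟩
      have h1 := Complex.differentiableOn_update_limUnder_of_isLittleO (hVo.mem_nhds hpV)
        (hGd.mono hV) ho
      refine (h1.differentiableAt (hVo.mem_nhds hpV)).congr_of_eventuallyEq ?_
      filter_upwards [hVo.mem_nhds hpV] with z hz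
      by_cases hzs : z = s
      · subst hzs; simp [hH]
      · rw [Function.update_of_ne hzs, hHG z (hV ⟨hz, hzs⟩)]
  have hHF : ∀ z ∈ upper ∪ lower, H z = F z := fun z hz => by
    rw [hHG z fun h => mem_upper_union_lower.1 hz (hTreal z h), hGF z hz]
  have hHinf : Tendsto H (cocompact ℂ) (𝓝 c) := by
    rw [← Metric.cobounded_eq_cocompact, Metric.tendsto_nhds]
    intro ε hε
    have h1 := (Metric.tendsto_nhds.1 hinf) (ε / 2) (by positivity)
    rw [eventually_inf_principal, Filter.Eventually,
      (Metric.hasBasis_cobounded_compl_closedBall (0 : ℂ)).mem_iff] at h1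
    obtain ⟨R, -, hR⟩ := h1
    have hb := norm_le_of_off_real (G := fun z => H z - c) (g := fun _ => ε / 2)
      (Metric.isClosed_closedBall (x := (0 : ℂ)) (ε := R)).isOpen_compl
      (hHd.continuous.sub continuous_const).continuousOn continuousOn_const (fun z hz hz2 => by
        have := hR hz hz2
        rw [← hHF z hz2, dist_eq_norm] at this
        exact this.le)
    have : (Metric.closedBall (0 : ℂ) R)ᶜ ∈ Bornology.cobounded ℂ :=
      (Metric.hasBasis_cobounded_compl_closedBall (0 : ℂ)).mem_of_mem trivial
    filter_upwards [this] with z hz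
    rw [dist_eq_norm]
    exact (hb z hz).trans_lt (by linarith)
  intro z hz
  rw [← hHF z hz]
  exact hHd.apply_eq_of_tendsto_cocompact z hHinf

end Rigidity

section Uniqueness

variable {A₁ A₂ : ℝ} {r : ℝ → ℂ} {y : ℝ} {N N' : ℂ → Matrix (Fin 2) (Fin 2) ℂ}

/-- Two fourth-root singularities multiply to an inverse square root, which is weaker than a pole.
This is how the singularity condition yields uniqueness. -/
theorem isLittleO_rpow_mul_rpow (p : ℝ) :
    (fun z : ℂ => ‖z - p‖ ^ (-(1 / 4) : ℝ) * ‖z - p‖ ^ (-(1 / 4) : ℝ))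
      =o[𝓝[upper ∪ lower] (p : ℂ)] fun z => (z - p)⁻¹ := by
  have h1 : Tendsto (fun z : ℂ => ‖z - p‖ ^ (1 / 2 : ℝ)) (𝓝[upper ∪ lower] (p : ℂ)) (𝓝 0) := by
    have : Continuous fun z : ℂ => ‖z - p‖ ^ (1 / 2 : ℝ) :=
      Continuous.rpow_const (by fun_prop) fun _ => Or.inr (by norm_num)
    have h2 := this.tendsto (p : ℂ)
    simp only [sub_self, norm_zero] at h2
    rw [Real.zero_rpow (by norm_num)] at h2
    exact h2.mono_left nhdsWithin_le_nhds
  refine isLittleO_iff.2 fun ε hε => ?_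
  filter_upwards [self_mem_nhdsWithin, h1.eventually (gt_mem_nhds hε)] with z hz hlt
  have hpos : 0 < ‖z - p‖ := norm_pos_iff.2 fun h => mem_upper_union_lower.1 hz (by
    rw [sub_eq_zero.1 h]; simp)
  rw [norm_inv, Real.norm_of_nonneg (by positivity), ← Real.rpow_add hpos]
  have h3 : ‖z - p‖⁻¹ * ‖z - p‖ ^ (1 / 2 : ℝ) = ‖z - p‖ ^ (-(1 / 4) + -(1 / 4) : ℝ) := by
    rw [← Real.rpow_neg_one, ← Real.rpow_add hpos]; norm_num
  rw [← h3, mul_comm]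
  gcongr

theorem IsRightRHSolution.tendsto_infinity (h : IsRightRHSolution A₁ A₂ r y 0 N) (i j : Fin 2) :
    Tendsto (fun z => N z i j) (Bornology.cobounded ℂ ⊓ 𝓟 (upper ∪ lower))
      (𝓝 ((1 : Matrix (Fin 2) (Fin 2) ℂ) i j)) := by
  have h1 : Tendsto (fun z : ℂ => z⁻¹) (Bornology.cobounded ℂ ⊓ 𝓟 (upper ∪ lower)) (𝓝 0) :=
    tendsto_inv₀_cobounded.mono_left inf_le_left
  simpa using ((h.normalization i j).trans_tendsto h1).add_const
    ((1 : Matrix (Fin 2) (Fin 2) ℂ) i j)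

/-- The exceptional points. -/
def branchPoints (A₁ A₂ : ℝ) : Finset ℝ := {1 / A₁, -(1 / A₁), 1 / A₂, -(1 / A₂)}

theorem abs_ne_of_notMem {s : ℝ} (hs : s ∉ branchPoints A₁ A₂) : |s| ≠ 1 / A₁ ∧ |s| ≠ 1 / A₂ := by
  simp only [branchPoints, Finset.mem_insert, Finset.mem_singleton, not_or] at hs
  obtain ⟨h1, h2, h3, h4⟩ := hs
  exact ⟨fun h => (abs_choice s).elim (fun e => h1 (e ▸ h)) fun e => h2 (by rw [← h, e]; ring),
    fun h => (abs_choice s).elim (fun e => h3 (e ▸ h)) fun e => h4 (by rw [← h, e]; ring)⟩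

theorem abs_eq_of_mem (hA₁ : 0 < A₁) (hA₂ : 0 < A₂) {s : ℝ} (hs : s ∈ branchPoints A₁ A₂) :
    |s| = 1 / A₁ ∨ |s| = 1 / A₂ := by
  simp only [branchPoints, Finset.mem_insert, Finset.mem_singleton] at hs
  have h1 : 0 < 1 / A₁ := by positivity
  have h2 : 0 < 1 / A₂ := by positivity
  rcases hs with rfl | rfl | rfl | rfl
  · exact Or.inl (abs_of_pos h1)
  · exact Or.inl (by rw [abs_neg, abs_of_pos h1])
  · exact Or.inr (abs_of_pos h2)
  · exact Or.inr (by rw [abs_neg, abs_of_pos h2])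

theorem tendsto_mul_adjugate_apply {l : Filter ℂ} {P P' : Matrix (Fin 2) (Fin 2) ℂ}
    (hP : Tendsto N l (𝓝 P)) (hP' : Tendsto N' l (𝓝 P')) (i j : Fin 2) :
    Tendsto (fun z => (N z * (N' z).adjugate) i j) l (𝓝 ((P * P'.adjugate) i j)) := by
  have h : ∀ (M : Matrix (Fin 2) (Fin 2) ℂ), M.adjugate = !![M 1 1, -M 0 1; -M 1 0, M 0 0] :=
    fun M => Matrix.adjugate_fin_two M
  have e := fun a b => tendsto_pi_nhds.1 (tendsto_pi_nhds.1 hP a) b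
  have e' := fun a b => tendsto_pi_nhds.1 (tendsto_pi_nhds.1 hP' a) b
  simp only [Matrix.mul_apply, h, Fin.sum_univ_two]
  fin_cases j
  · exact ((e i 0).mul (e' 1 1)).add ((e i 1).mul (e' 1 0).neg)
  · exact ((e i 0).mul (e' 0 1).neg).add ((e i 1).mul (e' 0 0))

/-- `N * adj N'` has no jump, for two solutions of the Riemann–Hilbert problem. -/
theorem IsRightRHSolution.mul_adjugate_eq_one (hA₁ : 0 < A₁) (hA₂ : 0 < A₂)
    (hJ : ∀ s : ℝ, |s| ≠ 1 / A₁ → |s| ≠ 1 / A₂ → (jumpMatrix A₁ A₂ r y 0 s).det = 1)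
    (h : IsRightRHSolution A₁ A₂ r y 0 N) (h' : IsRightRHSolution A₁ A₂ r y 0 N') :
    ∀ z ∈ upper ∪ lower, N z * (N' z).adjugate = 1 := by
  intro z hz
  have hadj : ∀ a b : Fin 2, ∃ (ε : ℂ) (c d : Fin 2),
      ∀ M : Matrix (Fin 2) (Fin 2) ℂ, M.adjugate a b = ε * M c d := by
    intro a b
    fin_cases a <;> fin_cases b
    · exact ⟨1, 1, 1, fun M => by simp [Matrix.adjugate_fin_two]⟩
    · exact ⟨-1, 0, 1, fun M => by simp [Matrix.adjugate_fin_two]⟩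
    · exact ⟨-1, 1, 0, fun M => by simp [Matrix.adjugate_fin_two]⟩
    · exact ⟨1, 0, 0, fun M => by simp [Matrix.adjugate_fin_two]⟩
  ext i j
  refine eq_const_of_no_jump (F := fun z => (N z * (N' z).adjugate) i j)
    (S := branchPoints A₁ A₂) ?_ ?_ ?_ ?_ z hz
  · simp only [Matrix.mul_apply]
    refine DifferentiableOn.fun_sum fun k _ => ?_
    obtain ⟨ε, c, d, hε⟩ := hadj k j
    simp only [hε]
    exact (h.analytic i k).mul ((h'.analytic c d).const_mul ε)
  · intro s hs
    obtain ⟨h1, h2⟩ := abs_ne_of_notMem hs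
    obtain ⟨P, M, hP, hM, hPM⟩ := h.jump s h1 h2
    obtain ⟨P', M', hP', hM', hPM'⟩ := h'.jump s h1 h2
    refine ⟨(M * M'.adjugate) i j, ?_, ?_⟩
    · have h3 := tendsto_mul_adjugate_apply hP hP' i j
      -- The jump matrices meet as J adj(J) = det J = 1 in the middle of the product.
      have h4 : P * P'.adjugate = M * M'.adjugate := by
        rw [hPM, hPM', Matrix.adjugate_mul_distrib, Matrix.mul_assoc, ← Matrix.mul_assoc _ _ M'.adjugate,
          Matrix.mul_adjugate, hJ s h1 h2, one_smul, Matrix.one_mul]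
      rw [← h4]
      exact h3
    · exact tendsto_mul_adjugate_apply hM hM' i j
  · intro p hp
    have hp' := abs_eq_of_mem hA₁ hA₂ hp
    have hk : ∀ k, (fun z => N z i k * (N' z).adjugate k j) =o[𝓝[upper ∪ lower] (p : ℂ)]
        fun z => (z - p)⁻¹ := by
      intro k
      obtain ⟨ε, c, d, hε⟩ := hadj k j
      simp only [hε]
      exact ((h.singularity p hp' i k).mul
        ((h'.singularity p hp' c d).const_mul_left ε)).trans_isLittleO (isLittleO_rpow_mul_rpow p)
    simp only [Matrix.mul_apply, Fin.sum_univ_two]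
    exact (hk 0).add (hk 1)
  · have t1 : Tendsto N (Bornology.cobounded ℂ ⊓ 𝓟 (upper ∪ lower)) (𝓝 1) :=
      tendsto_pi_nhds.2 fun a => tendsto_pi_nhds.2 fun b => h.tendsto_infinity a b
    have t2 : Tendsto N' (Bornology.cobounded ℂ ⊓ 𝓟 (upper ∪ lower)) (𝓝 1) :=
      tendsto_pi_nhds.2 fun a => tendsto_pi_nhds.2 fun b => h'.tendsto_infinity a b
    have := tendsto_mul_adjugate_apply t1 t2 i j
    rwa [Matrix.adjugate_one, Matrix.one_mul] at this

/-- The adjugate stands in for the inverse, so invertibility need not be known beforehand: the same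
statement applied to N' twice shows that adj(N') is the inverse of N'. -/
theorem IsRightRHSolution.unique (hA₁ : 0 < A₁) (hA₂ : 0 < A₂)
    (hJ : ∀ s : ℝ, |s| ≠ 1 / A₁ → |s| ≠ 1 / A₂ → (jumpMatrix A₁ A₂ r y 0 s).det = 1)
    (h : IsRightRHSolution A₁ A₂ r y 0 N) (h' : IsRightRHSolution A₁ A₂ r y 0 N') :
    ∀ z ∈ upper ∪ lower, N z = N' z := by
  intro z hz
  have h1 := h.mul_adjugate_eq_one hA₁ hA₂ hJ h' z hz
  have h2 := h'.mul_adjugate_eq_one hA₁ hA₂ hJ h' z hz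
  have h3 : (N' z).adjugate * N' z = 1 := mul_eq_one_comm.1 h2
  calc N z = N z * ((N' z).adjugate * N' z) := by rw [h3, Matrix.mul_one]
    _ = N' z := by rw [← Matrix.mul_assoc, h1, Matrix.one_mul]

end Uniqueness

end MCH

end

/-! ### Extension to the lower half-plane by symmetry. -/

noncomputable section

namespace MCH

section Extension

/-- The constant matrix normalizing the solution at infinity. -/
def rhPre : Matrix (Fin 2) (Fin 2) ℂ :=
  (Real.sqrt (1 / 2) : ℂ) • !![-1, -Complex.I; -Complex.I, -1]

/-- The inverse of `rhPre`, the limit of the unnormalized solution at infinity. -/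
def rhPost : Matrix (Fin 2) (Fin 2) ℂ :=
  (Real.sqrt (1 / 2) : ℂ) • !![-1, Complex.I; Complex.I, -1]

theorem rhPre_mul_rhPost : rhPre * rhPost = 1 := by
  have h := sqrt_half_sq
  have hI := Complex.I_sq
  rw [rhPre, rhPost]
  generalize (Real.sqrt (1 / 2) : ℂ) = c at *
  ext i j
  fin_cases i <;> fin_cases j <;> simp [Matrix.mul_apply]
  · linear_combination 2 * h - c ^ 2 * hI
  · ring
  · ring
  · linear_combination 2 * h - c ^ 2 * hI

/-- The extension of a matrix function from the upper half-plane, normalized by `rhPre`, to the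
lower half-plane by the symmetry `N(z) = σ₁ conj(N(conj z)) σ₁`. -/
def rhExtend (M : ℂ → Matrix (Fin 2) (Fin 2) ℂ) (z : ℂ) : Matrix (Fin 2) (Fin 2) ℂ :=
  Matrix.of fun i j => if 0 < z.im then (rhPre * M z) i j else
    (starRingEnd ℂ) ((rhPre * M ((starRingEnd ℂ) z)) i.rev j.rev)

variable {M : ℂ → Matrix (Fin 2) (Fin 2) ℂ} {z : ℂ}

theorem rhExtend_of_upper (hz : z ∈ upper) (i j : Fin 2) :
    rhExtend M z i j = (rhPre * M z) i j := if_pos hz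

theorem rhExtend_of_lower (hz : z ∈ lower) (i j : Fin 2) : rhExtend M z i j =
    (starRingEnd ℂ) ((rhPre * M ((starRingEnd ℂ) z)) i.rev j.rev) :=
  if_neg (not_lt.2 (le_of_lt (α := ℝ) hz))

theorem conj_mem_upper (hz : z ∈ lower) : (starRingEnd ℂ) z ∈ upper := by
  have : z.im < 0 := hz
  simp only [upper, mem_setOf_eq, Complex.conj_im]; linarith

theorem tendsto_conj_lower (s : ℝ) :
    Tendsto (starRingEnd ℂ) (𝓝[lower] (s : ℂ)) (𝓝[upper] (s : ℂ)) := by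
  refine tendsto_nhdsWithin_iff.2 ⟨?_, ?_⟩
  · have := Complex.continuous_conj.tendsto (s : ℂ)
    rw [Complex.conj_ofReal] at this
    exact this.mono_left nhdsWithin_le_nhds
  · filter_upwards [self_mem_nhdsWithin] with z hz using conj_mem_upper hz

theorem tendsto_conj_lower_infinity : Tendsto (starRingEnd ℂ)
    (Bornology.cobounded ℂ ⊓ 𝓟 lower) (Bornology.cobounded ℂ ⊓ 𝓟 upper) := by
  refine tendsto_inf.2 ⟨?_, tendsto_principal.2 ?_⟩
  · rw [← comap_norm_atTop (E := ℂ), tendsto_comap_iff]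
    have : (norm ∘ (starRingEnd ℂ) : ℂ → ℝ) = norm := by ext z; simp
    rw [this]
    exact tendsto_comap.mono_left inf_le_left
  · filter_upwards [mem_inf_of_right (mem_principal_self lower)] with z hz using conj_mem_upper hz

theorem rhPre_mul_apply (X : Matrix (Fin 2) (Fin 2) ℂ) (i j : Fin 2) :
    (rhPre * X) i j = rhPre i 0 * X 0 j + rhPre i 1 * X 1 j := by
  simp [Matrix.mul_apply]

theorem isBigO_conj_comp {l l' : Filter ℂ} {f : ℂ → ℂ} {g : ℂ → ℝ} {g' : ℂ → ℝ} (h : f =O[l] g)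
    (ht : Tendsto (starRingEnd ℂ) l' l) (hg : ∀ z, g ((starRingEnd ℂ) z) = g' z) :
    (fun z => (starRingEnd ℂ) (f ((starRingEnd ℂ) z))) =O[l'] g' := by
  have h1 := h.comp_tendsto ht
  refine IsBigO.congr_right ?_ (f := _) (g₁ := g ∘ (starRingEnd ℂ)) fun z => hg z
  refine IsBigO.of_norm_left ?_
  simpa [Function.comp_def] using h1.norm_left

/-- The matrix `rhPre` intertwines M ↦ -i conj(M)σ₁ with N ↦ σ₁ conj(N)σ₁. So the boundary value of
the extension from below is `rhPre` times the left factor in `hj`, and `hj` becomes the jump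
condition. Bounds and asymptotics are carried over by conjugation. -/
theorem isRightRHSolution_rhExtend {A₁ A₂ : ℝ} {r : ℝ → ℂ} {y : ℝ}
    (hd : ∀ i j, DifferentiableOn ℂ (fun z => M z i j) upper)
    (hc : ∀ s : ℝ, |s| ≠ 1 / A₁ → |s| ≠ 1 / A₂ → ∀ i j,
      Tendsto (fun z => M z i j) (𝓝[upper] (s : ℂ)) (𝓝 (M s i j)))
    (hj : ∀ s : ℝ, |s| ≠ 1 / A₁ → |s| ≠ 1 / A₂ →
      M s = (-Complex.I) • ((M s).map (starRingEnd ℂ) * sigma1) * jumpMatrix A₁ A₂ r y 0 s)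
    (hs : ∀ p : ℝ, (|p| = 1 / A₁ ∨ |p| = 1 / A₂) → ∀ i j,
      (fun z => M z i j) =O[𝓝[upper] (p : ℂ)] fun z => ‖z - p‖ ^ (-(1 / 4) : ℝ))
    (hinf : ∀ i j, (fun z => M z i j - rhPost i j)
      =O[Bornology.cobounded ℂ ⊓ 𝓟 upper] fun z => z⁻¹) :
    IsRightRHSolution A₁ A₂ r y 0 (rhExtend M) where
  analytic i j := by
    have hP : ∀ i j, DifferentiableOn ℂ (fun z => (rhPre * M z) i j) upper := fun i j => by
      simp only [rhPre_mul_apply]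
      exact ((hd 0 j).const_mul _).add ((hd 1 j).const_mul _)
    rintro z (hz | hz)
    · have h1 := (hP i j).differentiableAt (isOpen_upper.mem_nhds hz)
      refine (h1.congr_of_eventuallyEq ?_).differentiableWithinAt
      filter_upwards [isOpen_upper.mem_nhds hz] with w hw using rhExtend_of_upper hw i j
    · have h1 := ((hP i.rev j.rev).differentiableAt
        (isOpen_upper.mem_nhds (conj_mem_upper hz))).conj_conj
      rw [Complex.conj_conj] at h1
      refine (h1.congr_of_eventuallyEq ?_).differentiableWithinAt
      filter_upwards [isOpen_lower.mem_nhds hz] with w hw using rhExtend_of_lower hw i j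
  jump s h1 h2 := by
    have hP : ∀ i j, Tendsto (fun z => (rhPre * M z) i j) (𝓝[upper] (s : ℂ))
        (𝓝 ((rhPre * M s) i j)) := fun i j => by
      simp only [rhPre_mul_apply]
      exact ((hc s h1 h2 0 j).const_mul _).add ((hc s h1 h2 1 j).const_mul _)
    refine ⟨rhPre * M s, Matrix.of fun i j => (starRingEnd ℂ) ((rhPre * M s) i.rev j.rev),
      tendsto_pi_nhds.2 fun i => tendsto_pi_nhds.2 fun j => ?_,
      tendsto_pi_nhds.2 fun i => tendsto_pi_nhds.2 fun j => ?_, ?_⟩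
    · refine (hP i j).congr' ?_
      filter_upwards [self_mem_nhdsWithin] with z hz using (rhExtend_of_upper hz i j).symm
    · have h3 := (Complex.continuous_conj.tendsto _).comp
        ((hP i.rev j.rev).comp (tendsto_conj_lower s))
      refine h3.congr' ?_
      filter_upwards [self_mem_nhdsWithin] with z hz using (rhExtend_of_lower hz i j).symm
    · have h3 : (Matrix.of fun i j => (starRingEnd ℂ) ((rhPre * M s) i.rev j.rev) :
          Matrix (Fin 2) (Fin 2) ℂ) =
          rhPre * ((-Complex.I) • ((M s).map (starRingEnd ℂ) * sigma1)) := by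
        have hI := Complex.I_sq
        ext i j
        fin_cases i <;> fin_cases j <;>
          simp [rhPre, sigma1, Matrix.mul_apply, Matrix.vecHead, Matrix.vecTail]
        · linear_combination (-((Real.sqrt 2 : ℂ)⁻¹ * (starRingEnd ℂ) (M s 1 1))) * hI
        · linear_combination (-((Real.sqrt 2 : ℂ)⁻¹ * (starRingEnd ℂ) (M s 1 0))) * hI
        · linear_combination (-((Real.sqrt 2 : ℂ)⁻¹ * (starRingEnd ℂ) (M s 0 1))) * hI
        · linear_combination (-((Real.sqrt 2 : ℂ)⁻¹ * (starRingEnd ℂ) (M s 0 0))) * hI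
      rw [h3, Matrix.mul_assoc, ← hj s h1 h2]
  singularity p hp i j := by
    have hP : ∀ i j, (fun z => (rhPre * M z) i j) =O[𝓝[upper] (p : ℂ)]
        fun z => ‖z - p‖ ^ (-(1 / 4) : ℝ) := fun i j => by
      simp only [rhPre_mul_apply]
      exact ((hs p hp 0 j).const_mul_left _).add ((hs p hp 1 j).const_mul_left _)
    rw [nhdsWithin_union, isBigO_sup]
    constructor
    · refine (hP i j).congr' ?_ EventuallyEq.rfl
      filter_upwards [self_mem_nhdsWithin] with z hz using (rhExtend_of_upper hz i j).symm
    · refine (isBigO_conj_comp (hP i.rev j.rev) (tendsto_conj_lower p) (g' := fun z : ℂ =>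
        ‖z - p‖ ^ (-(1 / 4) : ℝ)) fun z => ?_).congr' ?_ EventuallyEq.rfl
      · rw [← Complex.norm_conj (z - p), map_sub, Complex.conj_ofReal]
      · filter_upwards [self_mem_nhdsWithin] with z hz using (rhExtend_of_lower hz i j).symm
  normalization i j := by
    have hP : ∀ i j, (fun z => (rhPre * M z) i j - (1 : Matrix (Fin 2) (Fin 2) ℂ) i j)
        =O[Bornology.cobounded ℂ ⊓ 𝓟 upper] fun z => ‖z⁻¹‖ := fun i j => by
      have h1 : ∀ z, (rhPre * M z) i j - (1 : Matrix (Fin 2) (Fin 2) ℂ) i j =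
          rhPre i 0 * (M z 0 j - rhPost 0 j) + rhPre i 1 * (M z 1 j - rhPost 1 j) := fun z => by
        rw [← rhPre_mul_rhPost, rhPre_mul_apply, rhPre_mul_apply]; ring
      simp only [h1]
      exact (((hinf 0 j).const_mul_left _).add ((hinf 1 j).const_mul_left _)).norm_right
    refine IsBigO.of_norm_right ?_
    rw [← Filter.sup_principal, inf_sup_left, isBigO_sup]
    constructor
    · refine (hP i j).congr' ?_ EventuallyEq.rfl
      filter_upwards [mem_inf_of_right (mem_principal_self upper)] with z hz
      rw [rhExtend_of_upper hz]
    · refine (isBigO_conj_comp (hP i.rev j.rev) tendsto_conj_lower_infinity (g' := fun z : ℂ =>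
        ‖z⁻¹‖) fun z => by simp).congr' ?_ EventuallyEq.rfl
      filter_upwards [mem_inf_of_right (mem_principal_self lower)] with z hz
      rw [rhExtend_of_lower hz, map_sub]
      congr 1
      fin_cases i <;> fin_cases j <;> simp

end Extension

end MCH

end

/-! ### The Jost amplitude near z = 0. -/

noncomputable section

namespace MCH

section ZeroExpansion

variable {A : ℝ} {m : ℝ → ℝ} {z : ℂ}

/-- Factor k² + 1/4 = A²z²/4 and use |k + i/2| ≥ 1/2, valid because Im k ≥ 0. -/
theorem norm_wave_sub_le (hA : 0 < A) (hz : z ∈ closedUpper) :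
    ‖wave A z - Complex.I / 2‖ ≤ A ^ 2 / 2 * ‖z‖ ^ 2 := by
  have h1 : (wave A z - Complex.I / 2) * (wave A z + Complex.I / 2) = A ^ 2 * z ^ 2 / 4 := by
    linear_combination (1 / 4 : ℂ) * wave_sq hA z - (1 / 4 : ℂ) * Complex.I_sq
  have h2 : 1 / 2 ≤ ‖wave A z + Complex.I / 2‖ := by
    have h3 := Complex.abs_im_le_norm (wave A z + Complex.I / 2)
    have h4 : (wave A z + Complex.I / 2).im = (wave A z).im + 1 / 2 := by simp
    rw [h4] at h3
    linarith [le_abs_self ((wave A z).im + 1 / 2), wave_im_nonneg hA hz]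
  have h5 := congrArg norm h1
  rw [norm_mul, norm_div, norm_mul, norm_pow, norm_pow, Complex.norm_real,
    Real.norm_of_nonneg hA.le, Complex.norm_ofNat] at h5
  nlinarith [norm_nonneg (wave A z - Complex.I / 2)]

theorem norm_beta_le (hA : 0 < A) (hz : z ∈ closedUpper) : ‖beta A z‖ ≤ A * ‖z‖ := by
  rw [beta_eq, norm_div, norm_mul, Complex.norm_real, Real.norm_of_nonneg hA.le, mul_comm]
  exact div_le_self (by positivity) (one_le_norm_one_sub_wave hA hz)

theorem norm_beta_sub_le (hA : 0 < A) (hz : z ∈ closedUpper) :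
    ‖beta A z - z * A / 2‖ ≤ A ^ 3 / 2 * ‖z‖ ^ 3 := by
  have h1 : beta A z - z * A / 2 = beta A z * (Complex.I * (wave A z - Complex.I / 2)) := by
    linear_combination (1 / 2 : ℂ) * beta_mul hA hz + beta A z / 2 * Complex.I_sq
  rw [h1, norm_mul, norm_mul, Complex.norm_I, one_mul]
  calc _ ≤ (A * ‖z‖) * (A ^ 2 / 2 * ‖z‖ ^ 2) := by
        gcongr
        · exact norm_beta_le hA hz
        · exact norm_wave_sub_le hA hz
    _ = _ := by ring

/-- The kernel carries a factor z. Applying the Volterra estimate on a half-disc whose radius 2‖z‖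
shrinks with z makes the kernel constant O(‖z‖), and so also `tailWeight` - 1. -/
theorem jostAmp_sub_le (hm : RightProfile A m) (x₀ : ℝ) : ∃ C, 0 ≤ C ∧ ∀ z ∈ upper, ‖z‖ ≤ 1 →
    ∀ x, x₀ ≤ x → ‖jostAmp A m x z - ![1, 0]‖ ≤ C * ‖z‖ := by
  have hA := hm.pos
  set P := ‖matCLM rotJ‖ + ((A * 2 + 1) * ‖matCLM rotJ‖ + 1 / 2 * ‖matCLM sigma1‖ +
    2 * A / 2 * ‖ContinuousLinearMap.id ℂ (Fin 2 → ℂ)‖) with hP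
  have hP0 : 0 ≤ P := by positivity
  set I := ∫ ξ in Ioi x₀, (1 + |ξ|) * |m ξ - A| with hI
  have hI0 : 0 ≤ I := setIntegral_nonneg measurableSet_Ioi fun ξ _ => by positivity
  set κ := 1 + max 0 (-x₀) with hκ
  have hκ0 : 0 ≤ κ := by positivity
  refine ⟨(1 + A * 2) * κ * (2 * P * I * Real.exp (2 * P * I)) + A, by positivity,
    fun z hz hz1 x hx => ?_⟩
  have hzc := upper_subset_closedUpper hz
  have hz0 : 0 < ‖z‖ := norm_pos_iff.2 fun h => by
    rw [h] at hz; exact lt_irrefl (0 : ℝ) (by simpa [upper] using hz)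
  have hR : 0 ≤ 2 * ‖z‖ := by positivity
  have hmem : z ∈ halfDisk (2 * ‖z‖) := ⟨hzc, by simp; linarith⟩
  have hK := isVolterraKernel_jostKernel hm hR
  have h1 := hK.norm_sol_sub_le (g := eigvec A) (fun z hz => norm_eigvec_le hm.pos hz)
    ((continuousOn_eigvec hm.pos).mono inter_subset_left) hmem x
  have h2 : tailWeight (fun ξ => kernelConst A (2 * ‖z‖) * (1 + |ξ|) * |m ξ - A|) x ≤
      Real.exp (2 * P * I * ‖z‖) := by
    refine (tailWeight_anti hK.majorant_nonneg hK.majorant_integrable hx).trans ?_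
    rw [tailWeight]
    simp_rw [mul_assoc (kernelConst A (2 * ‖z‖))]
    rw [integral_const_mul, ← hI]
    refine Real.exp_le_exp.2 ?_
    have h3 : kernelConst A (2 * ‖z‖) ≤ ‖z‖ * P := by
      rw [kernelConst, hP]
      have : 2 * ‖z‖ / 2 = ‖z‖ := by ring
      rw [this]
      gcongr <;> linarith
    nlinarith [mul_le_mul_of_nonneg_right h3 hI0]
  have h4 : Real.exp (2 * P * I * ‖z‖) - 1 ≤ 2 * P * I * Real.exp (2 * P * I) * ‖z‖ := by
    set t := 2 * P * I with ht
    have ht0 : 0 ≤ t := by positivity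
    have h5 : t * ‖z‖ ≤ t := mul_le_of_le_one_right ht0 hz1
    have h6 : Real.exp (t * ‖z‖) - 1 ≤ t * ‖z‖ * Real.exp (t * ‖z‖) := by
      have h7 := Real.add_one_le_exp (-(t * ‖z‖))
      have h8 : Real.exp (-(t * ‖z‖)) * Real.exp (t * ‖z‖) = 1 := by
        rw [← Real.exp_add]; simp
      nlinarith [Real.exp_pos (t * ‖z‖)]
    have h9 := Real.exp_le_exp.2 h5
    have : t * ‖z‖ * Real.exp (t * ‖z‖) ≤ t * ‖z‖ * Real.exp t := by gcongr
    linarith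
  have h10 : ‖jostAmp A m x z - eigvec A z‖ ≤
      (1 + A * 2) * κ * (2 * P * I * Real.exp (2 * P * I) * ‖z‖) := by
    refine h1.trans ?_
    have h11 : 1 + A * (2 * ‖z‖) ≤ 1 + A * 2 := by nlinarith
    have h12 : 1 + max 0 (-x) ≤ κ := by rw [hκ]; gcongr
    have h13 := hK.one_le_weight x
    have h14 := one_le_tailWeight hK.majorant_nonneg x
    gcongr
    linarith
  have h15 : ‖eigvec A z - ![1, 0]‖ ≤ A * ‖z‖ := by
    have : eigvec A z - ![1, 0] = ![0, beta A z] := by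
      ext i; fin_cases i <;> simp [eigvec]
    rw [this]
    refine (pi_norm_le_iff_of_nonneg (by positivity)).2 fun i => ?_
    fin_cases i
    · simp; positivity
    · exact norm_beta_le hA hzc
  calc ‖jostAmp A m x z - ![1, 0]‖ = ‖(jostAmp A m x z - eigvec A z) + (eigvec A z - ![1, 0])‖ := by
        congr 1; abel
    _ ≤ _ := (norm_add_le _ _).trans (by linarith)

theorem jostAmp_apply_eq (hm : RightProfile A m) (hz : z ∈ closedUpper) (x : ℝ) (i : Fin 2) :
    IntegrableOn (fun ξ => jostKernel A m x ξ z (jostAmp A m ξ z) i) (Ioi x) ∧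
    jostAmp A m x z i = eigvec A z i +
      ∫ ξ in Ioi x, jostKernel A m x ξ z (jostAmp A m ξ z) i := by
  have hR : 0 ≤ ‖z‖ + 1 := by positivity
  have hK := isVolterraKernel_jostKernel hm hR
  have hint := hK.integrableOn_apply (mem_halfDisk hz) x (continuous_jostAmp hm hz)
    (fun ξ => hK.norm_sol_le (fun z hz => norm_eigvec_le hm.pos hz) (mem_halfDisk hz) ξ)
  have hint' : ∀ i, IntegrableOn (fun ξ => jostKernel A m x ξ z (jostAmp A m ξ z) i) (Ioi x) :=
    fun i => (ContinuousLinearMap.proj (R := ℂ) (φ := fun _ : Fin 2 => ℂ) i).integrable_comp hint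
  refine ⟨hint' i, ?_⟩
  conv_lhs => rw [jostAmp_eq hm hz]
  rw [Pi.add_apply]
  congr 1
  exact ((ContinuousLinearMap.proj (R := ℂ) (φ := fun _ : Fin 2 => ℂ) i).integral_comp_comm
    hint).symm

theorem jostKernel_apply_zero (x ξ : ℝ) (w : Fin 2 → ℂ) : jostKernel A m x ξ z w 0 =
    -(z * ((m ξ - A : ℝ) : ℂ) / 2) * (w 1 + osc (wave A z) (ξ - x) *
      (Complex.I * wave A z * w 1 + w 1 / 2 + z * A / 2 * w 0)) := by
  simp [jostKernel, projCLM, matCLM_apply, rotJ, sigma1, Matrix.vecHead, Matrix.vecTail]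
  ring

theorem jostKernel_apply_one (x ξ : ℝ) (w : Fin 2 → ℂ) : jostKernel A m x ξ z w 1 =
    -(z * ((m ξ - A : ℝ) : ℂ) / 2) * (-w 0 + osc (wave A z) (ξ - x) *
      (-(Complex.I * wave A z * w 0) + w 0 / 2 + z * A / 2 * w 1)) := by
  simp [jostKernel, projCLM, matCLM_apply, rotJ, sigma1, Matrix.vecHead, Matrix.vecTail]
  ring

theorem osc_half (t : ℝ) : osc (Complex.I / 2) t = 1 - Complex.exp (-t) := by
  have h : 2 * Complex.I * (Complex.I / 2) = -1 := by linear_combination Complex.I_sq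
  rw [osc_eq (by simp), h, neg_one_mul]
  ring

theorem integrableOn_exp_mul (hm : RightProfile A m) (x : ℝ) :
    IntegrableOn (fun ξ => (m ξ - A) * Real.exp (-ξ)) (Ioi x) ∧
    IntegrableOn (fun ξ => m ξ * Real.exp (-ξ)) (Ioi x) := by
  have hc := hm.continuous
  have h1 : IntegrableOn (fun ξ => (m ξ - A) * Real.exp (-ξ)) (Ioi x) := by
    refine Integrable.mono' ((hm.integrableOn_sub x).norm.mul_const (Real.exp (-x)))
      (Continuous.aestronglyMeasurable (by fun_prop))
      ((ae_restrict_iff' measurableSet_Ioi).2 (ae_of_all _ fun ξ hξ => ?_))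
    rw [norm_mul, Real.norm_of_nonneg (Real.exp_pos _).le]
    have : Real.exp (-ξ) ≤ Real.exp (-x) := Real.exp_le_exp.2 (neg_le_neg (le_of_lt hξ))
    gcongr
  refine ⟨h1, (h1.add ((integrableOn_exp_neg_Ioi x).const_mul A)).congr_fun (fun ξ _ => ?_)
    measurableSet_Ioi⟩
  simp only [Pi.add_apply]
  ring

/-- The weighted tail `∫_x^∞ m e^{-ξ}`. -/
def expTail (m : ℝ → ℝ) (x : ℝ) : ℝ := ∫ ξ in Ioi x, m ξ * Real.exp (-ξ)

theorem integral_sub_mul_exp (hm : RightProfile A m) (x : ℝ) :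
    ∫ ξ in Ioi x, (m ξ - A) * Real.exp (-(ξ - x)) = Real.exp x * expTail m x - A := by
  obtain ⟨h1, h2⟩ := integrableOn_exp_mul hm x
  have h3 : ∫ ξ in Ioi x, (m ξ - A) * Real.exp (-ξ) = expTail m x - A * Real.exp (-x) := by
    rw [expTail, ← integral_exp_neg_Ioi x, ← integral_const_mul,
      ← integral_sub h2 ((integrableOn_exp_neg_Ioi x).const_mul A)]
    refine integral_congr_ae (ae_of_all _ fun ξ => ?_)
    simp only; ring
  have h4 : ∀ ξ, (m ξ - A) * Real.exp (-(ξ - x)) = Real.exp x * ((m ξ - A) * Real.exp (-ξ)) :=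
    fun ξ => by rw [show -(ξ - x) = x + -ξ by ring, Real.exp_add]; ring
  simp_rw [h4]
  rw [integral_const_mul, h3, mul_sub, mul_left_comm, ← Real.exp_add]
  simp

theorem integrableOn_shift (hm : RightProfile A m) (x : ℝ) :
    IntegrableOn (fun ξ => (1 + (ξ - x)) ^ 2 * |m ξ - A|) (Ioi x) := by
  refine hm.integrableOn_weighted (by fun_prop) (C := (1 + |x|) ^ 2) (fun ξ => ?_) x
  rw [abs_of_nonneg (sq_nonneg _), ← mul_pow]
  refine sq_le_sq' ?_ ?_
  · nlinarith [abs_nonneg x, abs_nonneg ξ, neg_abs_le ξ, le_abs_self x]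
  · nlinarith [abs_nonneg x, abs_nonneg ξ, le_abs_self ξ, neg_abs_le x]

/-- There is no linear term: in the first row of the kernel the entry meeting the first component
has an additional factor z, and the second component is itself O(z). -/
theorem jostAmp_zero_sub_le (hm : RightProfile A m) (x : ℝ) : ∃ C, ∀ z ∈ upper, ‖z‖ ≤ 1 →
    ‖jostAmp A m x z 0 - 1‖ ≤ C * ‖z‖ ^ 2 := by
  have hA := hm.pos
  obtain ⟨C, hC0, hC⟩ := jostAmp_sub_le hm x
  refine ⟨(C + (A + 1) * C + C + A * (C + 1)) * ∫ ξ in Ioi x, (1 + (ξ - x)) ^ 2 * |m ξ - A|,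
    fun z hz hz1 => ?_⟩
  have hzc := upper_subset_closedUpper hz
  obtain ⟨-, h2⟩ := jostAmp_apply_eq hm hzc x 0
  have h3 : jostAmp A m x z 0 - 1 = ∫ ξ in Ioi x, jostKernel A m x ξ z (jostAmp A m ξ z) 0 := by
    rw [h2, show eigvec A z 0 = 1 from rfl]; ring
  rw [h3, mul_right_comm, ← integral_const_mul]
  refine norm_integral_le_of_norm_le ((integrableOn_shift hm x).const_mul _)
    ((ae_restrict_iff' measurableSet_Ioi).2 (ae_of_all _ fun ξ hξ => ?_))
  have ht : 0 ≤ ξ - x := sub_nonneg.2 (le_of_lt hξ)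
  have hb := hC z hz hz1 ξ (le_of_lt hξ)
  have hb0 : ‖jostAmp A m ξ z 0 - 1‖ ≤ C * ‖z‖ := (norm_le_pi_norm (jostAmp A m ξ z - ![1, 0]) 0).trans hb
  have hb1 : ‖jostAmp A m ξ z 1‖ ≤ C * ‖z‖ := by
    simpa using (norm_le_pi_norm (jostAmp A m ξ z - ![1, 0]) 1).trans hb
  have hb0' : ‖jostAmp A m ξ z 0‖ ≤ C + 1 := by
    calc ‖jostAmp A m ξ z 0‖ = ‖(jostAmp A m ξ z 0 - 1) + 1‖ := by congr 1; ring
      _ ≤ C * ‖z‖ + 1 := (norm_add_le _ _).trans (by rw [norm_one]; linarith)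
      _ ≤ C + 1 := by nlinarith
  have hw := norm_wave_le hA hz1
  rw [mul_one] at hw
  have ho := norm_osc_le (wave_im_nonneg hA hzc) ht
  rw [jostKernel_apply_zero, norm_mul, norm_neg, norm_div, norm_mul, Complex.norm_real,
    Complex.norm_ofNat, Real.norm_eq_abs]
  have hin : ‖Complex.I * wave A z * jostAmp A m ξ z 1 + jostAmp A m ξ z 1 / 2 +
      z * A / 2 * jostAmp A m ξ z 0‖ ≤ ((A + 1) * C + C + A * (C + 1)) * ‖z‖ := by
    refine (norm_add₃_le).trans ?_
    rw [norm_mul, norm_mul, norm_mul, norm_div, norm_div, norm_mul, Complex.norm_I, one_mul,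
      Complex.norm_ofNat, Complex.norm_real, Real.norm_of_nonneg hA.le]
    have e1 : ‖wave A z‖ * ‖jostAmp A m ξ z 1‖ ≤ (A + 1) * (C * ‖z‖) := by gcongr
    have e2 : ‖z‖ * A / 2 * ‖jostAmp A m ξ z 0‖ ≤ ‖z‖ * A * (C + 1) := by
      gcongr
      linarith [mul_nonneg (norm_nonneg z) hA.le]
    linarith [norm_nonneg (jostAmp A m ξ z 1)]
  have hD : 0 ≤ (A + 1) * C + C + A * (C + 1) := by positivity
  have hout : ‖jostAmp A m ξ z 1 + osc (wave A z) (ξ - x) * (Complex.I * wave A z *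
      jostAmp A m ξ z 1 + jostAmp A m ξ z 1 / 2 + z * A / 2 * jostAmp A m ξ z 0)‖ ≤
      (C + (A + 1) * C + C + A * (C + 1)) * ‖z‖ * (1 + (ξ - x)) ^ 2 := by
    refine (norm_add_le _ _).trans ?_
    rw [norm_mul]
    have e1 := mul_le_mul ho hin (norm_nonneg _) ht
    have e2 : 0 ≤ ((A + 1) * C + C + A * (C + 1)) * ‖z‖ := by positivity
    have e3 : 0 ≤ C * ‖z‖ := by positivity
    nlinarith [mul_nonneg e3 ht, mul_nonneg e3 (sq_nonneg (ξ - x)), mul_nonneg e2 ht,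
      mul_nonneg e2 (sq_nonneg (ξ - x))]
  calc _ ≤ ‖z‖ * |m ξ - A| * ((C + (A + 1) * C + C + A * (C + 1)) * ‖z‖ *
        (1 + (ξ - x)) ^ 2) := by
        refine mul_le_mul ?_ hout (norm_nonneg _) (by positivity)
        linarith [mul_nonneg (norm_nonneg z) (abs_nonneg (m ξ - A))]
    _ = _ := by ring

/-- To first order the kernel is evaluated at k = i/2 on (1, 0), where its second row collapses to
(z/2)(m - A)e^{-(ξ-x)}. The inhomogeneous term β ≈ zA/2 cancels the contribution of -A, and the tail
of m e^{-ξ} remains. The error in `osc` is quadratic in ξ - x, hence the second moment. -/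
theorem jostAmp_one_sub_le (hm : RightProfile A m) (x : ℝ) : ∃ C, ∀ z ∈ upper, ‖z‖ ≤ 1 →
    ‖jostAmp A m x z 1 - z / 2 * (Real.exp x * expTail m x : ℝ)‖ ≤ C * ‖z‖ ^ 2 := by
  have hA := hm.pos
  have hc := hm.continuous
  obtain ⟨C, hC0, hC⟩ := jostAmp_sub_le hm x
  set D := A ^ 2 * (C + 1) + C + A * C with hD
  have hD0 : 0 ≤ D := by positivity
  refine ⟨A ^ 3 / 2 + (C + D + A ^ 2) * ∫ ξ in Ioi x, (1 + (ξ - x)) ^ 2 * |m ξ - A|,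
    fun z hz hz1 => ?_⟩
  have hzc := upper_subset_closedUpper hz
  obtain ⟨h1, h2⟩ := jostAmp_apply_eq hm hzc x 1
  have hE : IntegrableOn (fun ξ => z / 2 * (((m ξ - A) * Real.exp (-(ξ - x)) : ℝ) : ℂ))
      (Ioi x) := by
    have h4 : IntegrableOn (fun ξ => Real.exp x * ((m ξ - A) * Real.exp (-ξ))) (Ioi x) :=
      (integrableOn_exp_mul hm x).1.const_mul (Real.exp x)
    have h5 : IntegrableOn (fun ξ => (m ξ - A) * Real.exp (-(ξ - x))) (Ioi x) := by
      refine h4.congr_fun (fun ξ _ => ?_) measurableSet_Ioi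
      change Real.exp x * ((m ξ - A) * Real.exp (-ξ)) = (m ξ - A) * Real.exp (-(ξ - x))
      rw [show -(ξ - x) = x + -ξ by ring, Real.exp_add]; ring
    exact Integrable.const_mul h5.ofReal _
  have h3 : jostAmp A m x z 1 - z / 2 * (Real.exp x * expTail m x : ℝ) =
      (beta A z - z * A / 2) + ∫ ξ in Ioi x, (jostKernel A m x ξ z (jostAmp A m ξ z) 1 -
        z / 2 * (((m ξ - A) * Real.exp (-(ξ - x)) : ℝ) : ℂ)) := by
    have h4 : ∫ ξ in Ioi x, (((m ξ - A) * Real.exp (-(ξ - x)) : ℝ) : ℂ) =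
        ((Real.exp x * expTail m x - A : ℝ) : ℂ) := by
      rw [← integral_sub_mul_exp hm]
      exact integral_complex_ofReal
    rw [integral_sub h1 hE, integral_const_mul, h4, h2, show eigvec A z 1 = beta A z from rfl]
    push_cast; ring
  rw [h3]
  refine (norm_add_le _ _).trans ?_
  rw [add_mul, mul_right_comm (C + D + A ^ 2), ← integral_const_mul]
  refine add_le_add ((norm_beta_sub_le hA hzc).trans ?_)
    (norm_integral_le_of_norm_le ((integrableOn_shift hm x).const_mul _)
    ((ae_restrict_iff' measurableSet_Ioi).2 (ae_of_all _ fun ξ hξ => ?_)))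
  · have : ‖z‖ ^ 3 ≤ ‖z‖ ^ 2 := pow_le_pow_of_le_one (norm_nonneg z) hz1 (by norm_num)
    gcongr
  have ht : 0 ≤ ξ - x := sub_nonneg.2 (le_of_lt hξ)
  have hb := hC z hz hz1 ξ (le_of_lt hξ)
  have hb0 : ‖jostAmp A m ξ z 0 - 1‖ ≤ C * ‖z‖ := (norm_le_pi_norm (jostAmp A m ξ z - ![1, 0]) 0).trans hb
  have hb1 : ‖jostAmp A m ξ z 1‖ ≤ C * ‖z‖ := by
    simpa using (norm_le_pi_norm (jostAmp A m ξ z - ![1, 0]) 1).trans hb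
  have hb0' : ‖jostAmp A m ξ z 0‖ ≤ C + 1 := by
    calc ‖jostAmp A m ξ z 0‖ = ‖(jostAmp A m ξ z 0 - 1) + 1‖ := by congr 1; ring
      _ ≤ C * ‖z‖ + 1 := (norm_add_le _ _).trans (by rw [norm_one]; linarith)
      _ ≤ C + 1 := by nlinarith
  have hb1' : ‖jostAmp A m ξ z 1‖ ≤ C := hb1.trans (by nlinarith)
  have hz2 : ‖z‖ ^ 2 ≤ ‖z‖ := by nlinarith [norm_nonneg z]
  have hk := norm_wave_sub_le hA hzc
  have ho := norm_osc_le (wave_im_nonneg hA hzc) ht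
  have hos := norm_osc_sub_le (wave_im_nonneg hA hzc)
    (k' := Complex.I / 2) (by simp) ht
  rw [osc_half] at hos
  set q := -(Complex.I * wave A z * jostAmp A m ξ z 0) + jostAmp A m ξ z 0 / 2 +
    z * A / 2 * jostAmp A m ξ z 1 with hq
  have hq1 : ‖q - 1‖ ≤ D * ‖z‖ := by
    have : q - 1 = -(Complex.I * ((wave A z - Complex.I / 2) * jostAmp A m ξ z 0)) +
        (jostAmp A m ξ z 0 - 1) + z * A / 2 * jostAmp A m ξ z 1 := by
      rw [hq]; linear_combination (-(jostAmp A m ξ z 0) / 2) * Complex.I_sq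
    rw [this]
    refine (norm_add₃_le).trans ?_
    rw [norm_neg, norm_mul, norm_mul, norm_mul, norm_div, norm_mul, Complex.norm_I, one_mul,
      Complex.norm_ofNat, Complex.norm_real, Real.norm_of_nonneg hA.le]
    have e1 : ‖wave A z - Complex.I / 2‖ * ‖jostAmp A m ξ z 0‖ ≤
        A ^ 2 / 2 * ‖z‖ ^ 2 * (C + 1) := by gcongr
    have e2 : ‖z‖ * A / 2 * ‖jostAmp A m ξ z 1‖ ≤ ‖z‖ * A / 2 * C := by gcongr
    have e3 : A ^ 2 / 2 * ‖z‖ ^ 2 * (C + 1) ≤ A ^ 2 * ‖z‖ * (C + 1) := by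
      gcongr; linarith [sq_nonneg A]
    have e4 : 0 ≤ ‖z‖ * A * C := by positivity
    rw [hD]
    nlinarith
  -- The bracket of the kernel minus its limit -e^{-(ξ-x)}; its three error sources are the first
  -- component, the factor q and the change of `osc` with k.
  have hbr : ‖-jostAmp A m ξ z 0 + osc (wave A z) (ξ - x) * q + Complex.exp (-(ξ - x : ℝ))‖ ≤
      (C + D + A ^ 2) * ‖z‖ * (1 + (ξ - x)) ^ 2 := by
    have : -jostAmp A m ξ z 0 + osc (wave A z) (ξ - x) * q + Complex.exp (-(ξ - x : ℝ)) =
        -(jostAmp A m ξ z 0 - 1) + osc (wave A z) (ξ - x) * (q - 1) +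
        (osc (wave A z) (ξ - x) - (1 - Complex.exp (-(ξ - x : ℝ)))) := by ring
    rw [this]
    refine (norm_add₃_le).trans ?_
    rw [norm_neg, norm_mul]
    have e1 := mul_le_mul ho hq1 (norm_nonneg _) ht
    have e2 : 2 * ‖wave A z - Complex.I / 2‖ * (ξ - x) ^ 2 ≤ A ^ 2 * ‖z‖ * (ξ - x) ^ 2 := by
      have : 2 * ‖wave A z - Complex.I / 2‖ ≤ A ^ 2 * ‖z‖ := by nlinarith [sq_nonneg A]
      gcongr
    have e3 : 0 ≤ D * ‖z‖ := by positivity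
    have e4 : 0 ≤ C * ‖z‖ := by positivity
    have e5 : 0 ≤ A ^ 2 * ‖z‖ := by positivity
    nlinarith [mul_nonneg e3 ht, mul_nonneg e3 (sq_nonneg (ξ - x)), mul_nonneg e4 ht,
      mul_nonneg e4 (sq_nonneg (ξ - x)), mul_nonneg e5 ht]
  have hfin : jostKernel A m x ξ z (jostAmp A m ξ z) 1 -
      z / 2 * (((m ξ - A) * Real.exp (-(ξ - x)) : ℝ) : ℂ) =
      -(z * ((m ξ - A : ℝ) : ℂ) / 2) * (-jostAmp A m ξ z 0 + osc (wave A z) (ξ - x) * q +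
        Complex.exp (-(ξ - x : ℝ))) := by
    rw [jostKernel_apply_one, ← hq]
    push_cast
    ring
  rw [hfin, norm_mul, norm_neg, norm_div, norm_mul, Complex.norm_real, Complex.norm_ofNat,
    Real.norm_eq_abs]
  calc _ ≤ ‖z‖ * |m ξ - A| * ((C + D + A ^ 2) * ‖z‖ * (1 + (ξ - x)) ^ 2) := by
        refine mul_le_mul ?_ hbr (norm_nonneg _) (by positivity)
        linarith [mul_nonneg (norm_nonneg z) (abs_nonneg (m ξ - A))]
    _ = _ := by ring

end ZeroExpansion

end MCH

end

/-! ### Expansion of the Riemann–Hilbert solution at zero. -/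

noncomputable section

namespace MCH

section CloseAtZero

/-- `f` and `g` agree up to `O(z²)` as `z → 0` in the upper half-plane. -/
def CloseAtZero (f g : ℂ → ℂ) : Prop :=
  (fun z => f z - g z) =O[𝓝[upper] (0 : ℂ)] fun z => z ^ 2

variable {f g f' g' : ℂ → ℂ}

theorem sq_isBigO_one : (fun z : ℂ => z ^ 2) =O[𝓝[upper] (0 : ℂ)] fun _ => (1 : ℂ) := by
  have : Continuous fun z : ℂ => z ^ 2 := by fun_prop
  exact ((this.tendsto 0).isBigO_one ℂ).mono nhdsWithin_le_nhds

theorem isBigO_one_of_continuous (hf : Continuous f) :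
    f =O[𝓝[upper] (0 : ℂ)] fun _ => (1 : ℂ) :=
  ((hf.tendsto 0).isBigO_one ℂ).mono nhdsWithin_le_nhds

theorem CloseAtZero.trans (h : CloseAtZero f g) (h' : CloseAtZero g g') : CloseAtZero f g' := by
  refine (IsBigO.add h h').congr_left fun z => ?_
  ring

theorem CloseAtZero.congr_right (h : CloseAtZero f g) (e : ∀ z, g z = g' z) :
    CloseAtZero f g' := by
  rwa [← funext e]

theorem CloseAtZero.sub (h : CloseAtZero f g) (h' : CloseAtZero f' g') :
    CloseAtZero (fun z => f z - f' z) fun z => g z - g' z := by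
  refine (IsBigO.sub h h').congr_left fun z => ?_
  ring

theorem CloseAtZero.add (h : CloseAtZero f g) (h' : CloseAtZero f' g') :
    CloseAtZero (fun z => f z + f' z) fun z => g z + g' z := by
  refine (IsBigO.add h h').congr_left fun z => ?_
  ring

theorem CloseAtZero.isBigO_one (h : CloseAtZero f g) (hg : Continuous g) :
    f =O[𝓝[upper] (0 : ℂ)] fun _ => (1 : ℂ) :=
  ((IsBigO.trans h sq_isBigO_one).add (isBigO_one_of_continuous hg)).congr_left fun z => by ring

theorem CloseAtZero.mul (h : CloseAtZero f g) (h' : CloseAtZero f' g') (hg : Continuous g)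
    (hg' : Continuous g') : CloseAtZero (fun z => f z * f' z) fun z => g z * g' z := by
  have h1 : (fun z => (f z - g z) * f' z) =O[𝓝[upper] (0 : ℂ)] fun z => z ^ 2 := by
    simpa using IsBigO.mul h (h'.isBigO_one hg')
  have h2 : (fun z => g z * (f' z - g' z)) =O[𝓝[upper] (0 : ℂ)] fun z => z ^ 2 := by
    simpa using (isBigO_one_of_continuous hg).mul h'
  exact (h1.add h2).congr_left fun z => by ring

theorem CloseAtZero.const_mul (h : CloseAtZero f g) (c : ℂ) :
    CloseAtZero (fun z => c * f z) fun z => c * g z :=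
  (IsBigO.const_mul_left h c).congr_left fun z => by ring

theorem CloseAtZero.tendsto {c : ℂ} (h : CloseAtZero f fun _ => c) :
    Tendsto f (𝓝[upper] (0 : ℂ)) (𝓝 c) := by
  have h1 : Tendsto (fun z : ℂ => z ^ 2) (𝓝[upper] (0 : ℂ)) (𝓝 0) := by
    have : Continuous fun z : ℂ => z ^ 2 := by fun_prop
    have h2 := this.tendsto 0
    simp only [ne_eq, OfNat.ofNat_ne_zero, not_false_eq_true, zero_pow] at h2
    exact h2.mono_left nhdsWithin_le_nhds
  simpa using (IsBigO.trans_tendsto h h1).add_const c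

theorem CloseAtZero.inv {c : ℂ} (h : CloseAtZero f fun _ => c) (hc : c ≠ 0) :
    CloseAtZero (fun z => (f z)⁻¹) fun _ => c⁻¹ := by
  have ht := h.tendsto
  have h1 : (fun z => (f z)⁻¹ * c⁻¹) =O[𝓝[upper] (0 : ℂ)] fun _ => (1 : ℂ) :=
    ((ht.inv₀ hc).mul_const c⁻¹).isBigO_one ℂ
  have h2 : (fun z => -(f z - c) * ((f z)⁻¹ * c⁻¹)) =O[𝓝[upper] (0 : ℂ)] fun z => z ^ 2 := by
    simpa using (IsBigO.neg_left h).mul h1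
  refine h2.congr' ?_ EventuallyEq.rfl
  filter_upwards [ht.eventually_ne hc] with z hz
  field_simp
  ring

theorem CloseAtZero.exp {c : ℂ} (h : CloseAtZero f fun _ => c) :
    CloseAtZero (fun z => Complex.exp (f z)) fun _ => Complex.exp c := by
  have ht := h.tendsto
  have h1 : ∀ᶠ z in 𝓝[upper] (0 : ℂ), ‖f z - c‖ ≤ 1 := by
    have : Tendsto (fun z => ‖f z - c‖) (𝓝[upper] (0 : ℂ)) (𝓝 0) := by
      rw [← tendsto_iff_norm_sub_tendsto_zero]; exact ht
    exact (this.eventually (gt_mem_nhds one_pos)).mono fun _ => le_of_lt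
  have h2 : (fun z => Complex.exp (f z) - Complex.exp c) =O[𝓝[upper] (0 : ℂ)]
      fun z => f z - c := by
    refine IsBigO.of_bound (2 * ‖Complex.exp c‖) ?_
    filter_upwards [h1] with z hz
    have e : Complex.exp (f z) - Complex.exp c = Complex.exp c * (Complex.exp (f z - c) - 1) := by
      rw [mul_sub, ← Complex.exp_add]; congr 2 <;> ring
    rw [e, norm_mul]
    have := Complex.norm_exp_sub_one_le hz
    nlinarith [norm_nonneg (Complex.exp c)]
  exact h2.trans h

theorem closeAtZero_of_bound {C : ℝ} (h : ∀ z ∈ upper, ‖z‖ ≤ 1 → ‖f z - g z‖ ≤ C * ‖z‖ ^ 2) :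
    CloseAtZero f g := by
  refine IsBigO.of_bound C ?_
  filter_upwards [self_mem_nhdsWithin,
    nhdsWithin_le_nhds (Metric.closedBall_mem_nhds (0 : ℂ) one_pos)] with z hz hz1
  rw [norm_pow]
  exact h z hz (by simpa using hz1)

/-- An affine function that is `O(z²)` vanishes. -/
theorem affine_eq_zero_of_isBigO {a b : ℂ}
    (h : (fun z : ℂ => a + b * z) =O[𝓝[upper] (0 : ℂ)] fun z => z ^ 2) : a = 0 ∧ b = 0 := by
  have : (𝓝[upper] (0 : ℂ)).NeBot := by
    rw [← mem_closure_iff_nhdsWithin_neBot, closure_upper]; simp [closedUpper]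
  have hz0 : Tendsto (fun z : ℂ => z) (𝓝[upper] (0 : ℂ)) (𝓝 0) := nhdsWithin_le_nhds
  have ha : a = 0 := by
    have h1 : CloseAtZero (fun z => a + b * z) fun _ => 0 := by simpa [CloseAtZero] using h
    have h2 : Tendsto (fun z : ℂ => a + b * z) (𝓝[upper] (0 : ℂ)) (𝓝 a) := by
      simpa using (hz0.const_mul b).const_add a
    exact tendsto_nhds_unique h2 h1.tendsto
  refine ⟨ha, ?_⟩
  have hne : ∀ᶠ z in 𝓝[upper] (0 : ℂ), z ≠ 0 := by
    filter_upwards [self_mem_nhdsWithin] with z hz h0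
    rw [h0] at hz; exact lt_irrefl (0 : ℝ) (by simp [upper] at hz)
  have h3 : (fun _ : ℂ => b) =O[𝓝[upper] (0 : ℂ)] fun z => z := by
    have h4 : (fun z : ℂ => b * z) =O[𝓝[upper] (0 : ℂ)] fun z => z ^ 2 := by
      simpa [ha] using h
    have h5 := h4.mul (isBigO_refl (fun z : ℂ => z⁻¹) (𝓝[upper] (0 : ℂ)))
    refine h5.congr' ?_ ?_
    · filter_upwards [hne] with z hz; field_simp
    · filter_upwards [hne] with z hz; field_simp
  have h6 := h3.trans_tendsto hz0
  exact tendsto_nhds_unique tendsto_const_nhds h6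

end CloseAtZero

section CoreAtZero

variable {A : ℝ} {m : ℝ → ℝ}

theorem closeAtZero_wave (hA : 0 < A) : CloseAtZero (wave A) fun _ => Complex.I / 2 :=
  closeAtZero_of_bound fun _ hz _ => norm_wave_sub_le hA (upper_subset_closedUpper hz)

theorem closeAtZero_exp_wave (hA : 0 < A) (x : ℝ) :
    CloseAtZero (fun z => Complex.exp (Complex.I * wave A z * x))
      fun _ => (Real.exp (-x / 2) : ℂ) := by
  have h := ((closeAtZero_wave hA).const_mul (Complex.I * x)).exp
  have e : Complex.exp (Complex.I * x * (Complex.I / 2)) = (Real.exp (-x / 2) : ℂ) := by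
    push_cast; congr 1; linear_combination (x / 2 : ℂ) * Complex.I_sq
  rw [e] at h
  convert h using 3
  ring

theorem closeAtZero_jostR_zero (hm : RightProfile A m) (x : ℝ) :
    CloseAtZero (fun z => jostR A m x z 0) fun _ => (Real.exp (-x / 2) : ℂ) := by
  obtain ⟨C, hC⟩ := jostAmp_zero_sub_le hm x
  have h := (closeAtZero_exp_wave hm.pos x).mul (closeAtZero_of_bound hC) continuous_const
    continuous_const
  simp only [mul_one] at h
  exact h

theorem closeAtZero_jostR_one (hm : RightProfile A m) (x : ℝ) :
    CloseAtZero (fun z => jostR A m x z 1)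
      fun z => ((Real.exp (x / 2) * expTail m x / 2 : ℝ) : ℂ) * z := by
  obtain ⟨C, hC⟩ := jostAmp_one_sub_le hm x
  have h := (closeAtZero_exp_wave hm.pos x).mul (closeAtZero_of_bound hC) continuous_const
    (by fun_prop)
  refine h.congr_right fun z => ?_
  have e : Real.exp (x / 2) = Real.exp (-x / 2) * Real.exp x := by
    rw [← Real.exp_add]; congr 1; ring
  rw [e]; push_cast; ring

theorem alpha_at_zero (hA : 0 < A) : alpha A 0 = Complex.I := by
  have h0 : |(0 : ℝ)| < 1 / A := by simpa using hA
  have hw := wave_ofReal_of_gt hA h0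
  have hw2 : wave A 0 = Complex.I / 2 := by
    rw [Complex.ofReal_zero] at hw
    rw [hw]; simp; ring
  have h1 : alphaRoot A 0 = (Real.sqrt 2 : ℂ) := by
    rw [alphaRoot, hw2]
    have : 1 + Complex.I / (2 * (Complex.I / 2)) = ((2 : ℝ) : ℂ) := by
      have := Complex.I_ne_zero
      push_cast
      field_simp
      norm_num
    rw [this, cpow_half_ofReal_of_nonneg (by norm_num)]
  rw [alpha_eq, h1]
  have h2 : (Real.sqrt (1 / 2) : ℂ) * (Real.sqrt 2 : ℂ) = 1 := by
    rw [← Complex.ofReal_mul, ← Real.sqrt_mul (by norm_num)]; norm_num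
  linear_combination Complex.I * h2

/-- From the formula for α² one gets 2k(α² + 1) = k - i/2, which is O(z²). Continuity with α(0) = i
keeps α + i away from zero, so that it can be divided out. -/
theorem closeAtZero_alpha (hA : 0 < A) : CloseAtZero (alpha A) fun _ => Complex.I := by
  have hw := closeAtZero_wave hA
  have h0w : wave A 0 ≠ 0 := by
    have h := wave_ne_zero_ofReal hA (x := 0) (by simpa using hA.ne)
    simpa using h
  have hcont : Tendsto (alpha A) (𝓝[upper] (0 : ℂ)) (𝓝 Complex.I) := by
    have h1 := continuousOn_alpha hA 0 ⟨by simp [closedUpper], h0w⟩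
    rw [ContinuousWithinAt, alpha_at_zero hA] at h1
    refine h1.mono_left (nhdsWithin_mono _ fun z hz => ⟨upper_subset_closedUpper hz, ?_⟩)
    exact wave_ne_zero_of_upper hA hz
  have h1 : (fun z => (wave A z - Complex.I / 2) *
      (1 / (2 * wave A z) * (alpha A z + Complex.I)⁻¹))
      =O[𝓝[upper] (0 : ℂ)] fun z => z ^ 2 := by
    have h2 : (fun z => 1 / (2 * wave A z) * (alpha A z + Complex.I)⁻¹)
        =O[𝓝[upper] (0 : ℂ)] fun _ => (1 : ℂ) := by
      refine Tendsto.isBigO_one ℂ (c := 1 / (2 * (Complex.I / 2)) *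
        (Complex.I + Complex.I)⁻¹) ?_
      refine Tendsto.mul (Tendsto.div tendsto_const_nhds (hw.tendsto.const_mul 2) ?_)
        ((hcont.add_const _).inv₀ ?_)
      · simp
      · rw [← two_mul]; simp
    simpa using IsBigO.mul hw h2
  refine h1.congr' ?_ EventuallyEq.rfl
  have hne : Complex.I + Complex.I ≠ 0 := by rw [← two_mul]; simp
  filter_upwards [self_mem_nhdsWithin, (hcont.add_const Complex.I).eventually_ne hne] with z hz hz2
  have hk := wave_ne_zero_of_upper hA hz
  have hsq := alpha_sq hk
  have hI := Complex.I_sq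
  field_simp
  have h3 : 4 * Complex.I * wave A z * (alpha A z ^ 2 + 1) =
      2 * Complex.I * (wave A z - Complex.I / 2) := by linear_combination hsq + hI
  have h4 : 2 * wave A z * (alpha A z ^ 2 + 1) = wave A z - Complex.I / 2 := by
    have : (2 * Complex.I) * (2 * wave A z * (alpha A z ^ 2 + 1)) =
        (2 * Complex.I) * (wave A z - Complex.I / 2) := by linear_combination h3
    exact mul_left_cancel₀ (by simp) this
  linear_combination (-2 : ℂ) * h4 + 4 * wave A z * hI

variable {A₁ A₂ : ℝ}

/-- One product in the determinant pairs two components that are both O(z), so only the other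
product contributes. -/
theorem closeAtZero_wronskian (hm : StepProfile A₁ A₂ m) :
    CloseAtZero (wronskian A₁ A₂ m) fun _ => -1 := by
  have a0 := closeAtZero_jostR_one hm.left (-0)
  have a1 := closeAtZero_jostR_zero hm.left (-0)
  have b0 := closeAtZero_jostR_zero hm.right 0
  have b1 := closeAtZero_jostR_one hm.right 0
  have h1 := (a0.mul b1 (by fun_prop) (by fun_prop)).sub
    (b0.mul a1 continuous_const continuous_const)
  refine CloseAtZero.trans h1 ?_
  simp only [CloseAtZero]
  refine IsBigO.of_bound (‖((Real.exp (-0 / 2) * expTail (fun y => m (-y)) (-0) / 2 : ℝ) : ℂ) *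
    ((Real.exp (0 / 2) * expTail m 0 / 2 : ℝ) : ℂ)‖) (Eventually.of_forall fun z => ?_)
  rw [← norm_mul]
  refine le_of_eq (congrArg norm ?_)
  simp
  ring

theorem closeAtZero_rhCore (hm : StepProfile A₁ A₂ m) (x y : ℝ) :
    CloseAtZero (fun z => rhCore A₁ A₂ m x y z 0 0) (fun z => Complex.I * z *
      ((Real.exp (-(x + y) / 2) * expTail (fun y => m (-y)) (-x) / 2 : ℝ) : ℂ)) ∧
    CloseAtZero (fun z => rhCore A₁ A₂ m x y z 1 0)
      (fun _ => Complex.I * ((Real.exp ((x - y) / 2) : ℝ) : ℂ)) ∧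
    CloseAtZero (fun z => rhCore A₁ A₂ m x y z 0 1)
      (fun _ => Complex.I * ((Real.exp ((y - x) / 2) : ℝ) : ℂ)) ∧
    CloseAtZero (fun z => rhCore A₁ A₂ m x y z 1 1) (fun z => Complex.I * z *
      ((Real.exp ((x + y) / 2) * expTail m x / 2 : ℝ) : ℂ)) := by
  have hA := hm.right.pos
  have he : CloseAtZero (fun z => Complex.exp (fHat A₂ y 0 z))
      fun _ => (Real.exp (-y / 2) : ℂ) := by
    simp only [fHat_zero]; exact closeAtZero_exp_wave hA y
  have he' : CloseAtZero (fun z => Complex.exp (-fHat A₂ y 0 z))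
      fun _ => (Real.exp (y / 2) : ℂ) := by
    have h := closeAtZero_exp_wave hA (-y)
    simp only [fHat_zero]
    simpa using h
  have hα := closeAtZero_alpha hA
  have hW : CloseAtZero (fun z => (alpha A₂ z * wronskian A₁ A₂ m z)⁻¹) fun _ => Complex.I := by
    have := (hα.mul (closeAtZero_wronskian hm) continuous_const continuous_const).inv (by simp)
    refine this.congr_right fun z => ?_
    rw [mul_neg_one, inv_neg, Complex.inv_I, neg_neg]
  have a0 : CloseAtZero (fun z => jostL A₁ m x z 0) _ := closeAtZero_jostR_one hm.left (-x)
  have a1 : CloseAtZero (fun z => jostL A₁ m x z 1) _ := closeAtZero_jostR_zero hm.left (-x)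
  have b0 := closeAtZero_jostR_zero hm.right x
  have b1 := closeAtZero_jostR_one hm.right x
  simp only [rhCore_zero, rhCore_one, div_eq_mul_inv]
  refine ⟨?_, ?_, ?_, ?_⟩
  · refine ((he.mul a0 continuous_const (by fun_prop)).mul hW (by fun_prop)
      continuous_const).congr_right fun z => ?_
    have e : Real.exp (-(x + y) * 2⁻¹) = Real.exp (-y / 2) * Real.exp (-x / 2) := by
      rw [← Real.exp_add]; congr 1; ring
    rw [e]; push_cast; ring
  · refine ((he.mul a1 continuous_const (by fun_prop)).mul hW (by fun_prop)
      continuous_const).congr_right fun z => ?_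
    have e : Real.exp ((x - y) * 2⁻¹) = Real.exp (-y / 2) * Real.exp (-(-x) / 2) := by
      rw [← Real.exp_add]; congr 1; ring
    rw [e]; push_cast; ring
  · refine (he'.mul (hα.mul b0 continuous_const (by fun_prop)) continuous_const
      (by fun_prop)).congr_right fun z => ?_
    have e : Real.exp ((y - x) * 2⁻¹) = Real.exp (y / 2) * Real.exp (-x / 2) := by
      rw [← Real.exp_add]; congr 1; ring
    rw [e]; push_cast; ring
  · refine (he'.mul (hα.mul b1 continuous_const (by fun_prop)) continuous_const
      (by fun_prop)).congr_right fun z => ?_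
    have e : Real.exp ((x + y) * 2⁻¹) = Real.exp (y / 2) * Real.exp (x / 2) := by
      rw [← Real.exp_add]; congr 1; ring
    rw [e]; push_cast; ring

/-- Up to O(z²) the diagonal entries of `rhCore` are linear in z and the off-diagonal ones constant;
multiplication by `rhPre` mixes the rows into the required pattern. -/
theorem hasExpansionAtZero_rhExtend (hm : StepProfile A₁ A₂ m) (x y : ℝ) :
    HasExpansionAtZero (rhExtend (rhCore A₁ A₂ m x y)) (Real.exp ((y - x) / 2))
      (Real.exp (-(x + y) / 2) * expTail (fun y => m (-y)) (-x) / 2)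
      (Real.exp ((x + y) / 2) * expTail m x / 2) := by
  obtain ⟨h00, h10, h01, h11⟩ := closeAtZero_rhCore hm x y
  have hinv : ((Real.exp ((y - x) / 2) : ℝ) : ℂ)⁻¹ = ((Real.exp ((x - y) / 2) : ℝ) : ℂ) := by
    rw [← Complex.ofReal_inv, ← Real.exp_neg]; congr 2; ring
  generalize Real.exp (-(x + y) / 2) * expTail (fun y => m (-y)) (-x) / 2 = b at *
  generalize Real.exp ((x + y) / 2) * expTail m x / 2 = c at *
  generalize Real.exp ((x - y) / 2) = a' at *
  generalize Real.exp ((y - x) / 2) = a at *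
  intro i j
  rw [hinv]
  have key : ∀ g : ℂ → ℂ, CloseAtZero (fun z => (rhPre * rhCore A₁ A₂ m x y z) i j) g →
      (fun z => rhExtend (rhCore A₁ A₂ m x y) z i j - g z) =O[𝓝[upper] (0 : ℂ)]
        fun z => z ^ 2 := fun g hg => by
    refine IsBigO.congr' hg ?_ EventuallyEq.rfl
    filter_upwards [self_mem_nhdsWithin] with z hz
    rw [rhExtend_of_upper hz]
  apply key
  simp only [rhPre_mul_apply]
  have hI := Complex.I_sq
  fin_cases i <;> fin_cases j
  · refine ((h00.const_mul (rhPre 0 0)).add (h10.const_mul (rhPre 0 1))).congr_right fun z => ?_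
    simp [rhPre]; ring
  · refine ((h01.const_mul (rhPre 0 0)).add (h11.const_mul (rhPre 0 1))).congr_right fun z => ?_
    simp [rhPre]; ring
  · refine ((h00.const_mul (rhPre 1 0)).add (h10.const_mul (rhPre 1 1))).congr_right fun z => ?_
    simp [rhPre]; ring
  · refine ((h01.const_mul (rhPre 1 0)).add (h11.const_mul (rhPre 1 1))).congr_right fun z => ?_
    simp [rhPre]; ring

/-- The coefficients of the expansion at zero are unique. -/
theorem HasExpansionAtZero.unique {N N' : ℂ → Matrix (Fin 2) (Fin 2) ℂ} {a b c a' b' c' : ℝ}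
    (hN : ∀ z ∈ upper, N z = N' z) (h : HasExpansionAtZero N a b c)
    (h' : HasExpansionAtZero N' a' b' c') : a = a' ∧ b = b' ∧ c = c' := by
  have hs : (Real.sqrt (1 / 2) : ℂ) ≠ 0 := by
    intro h0
    have := sqrt_half_sq
    rw [h0] at this; norm_num at this
  have hd : ∀ i j, (fun z : ℂ => ((-(Real.sqrt (1 / 2) : ℂ)) •
        (Complex.I • !![Complex.I * (a : ℂ)⁻¹, (a : ℂ); (a : ℂ)⁻¹, Complex.I * a] +
          (Complex.I * z) • !![(b : ℂ), Complex.I * c; Complex.I * b, (c : ℂ)])) i j -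
      ((-(Real.sqrt (1 / 2) : ℂ)) •
        (Complex.I • !![Complex.I * (a' : ℂ)⁻¹, (a' : ℂ); (a' : ℂ)⁻¹, Complex.I * a'] +
          (Complex.I * z) • !![(b' : ℂ), Complex.I * c'; Complex.I * b', (c' : ℂ)])) i j)
      =O[𝓝[upper] (0 : ℂ)] fun z => z ^ 2 := fun i j => by
    refine ((h' i j).sub (h i j)).congr' ?_ EventuallyEq.rfl
    filter_upwards [self_mem_nhdsWithin] with z hz
    rw [hN z hz]; ring
  -- The off-diagonal entries suffice: (0,1) determines the first coefficient by its constant term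
  -- and the third by its linear term; the linear term of (1,0) determines the second.
  have e01 := affine_eq_zero_of_isBigO ((hd 0 1).congr_left (f₂ := fun z : ℂ =>
    (-(Real.sqrt (1 / 2) : ℂ)) * Complex.I * (a - a') +
      (-(Real.sqrt (1 / 2) : ℂ)) * (Complex.I * Complex.I) * (c - c') * z) fun z => by
        simp
        linear_combination (-((Real.sqrt 2 : ℂ)⁻¹ * z * (c - c'))) * Complex.I_sq)
  have e10 := affine_eq_zero_of_isBigO ((hd 1 0).congr_left (f₂ := fun z : ℂ =>
    (-(Real.sqrt (1 / 2) : ℂ)) * Complex.I * ((a : ℂ)⁻¹ - (a' : ℂ)⁻¹) +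
      (-(Real.sqrt (1 / 2) : ℂ)) * (Complex.I * Complex.I) * (b - b') * z) fun z => by
        simp
        linear_combination (-((Real.sqrt 2 : ℂ)⁻¹ * z * (b - b'))) * Complex.I_sq)
  have hI := Complex.I_ne_zero
  refine ⟨?_, ?_, ?_⟩
  · exact Complex.ofReal_injective (sub_eq_zero.1
      ((mul_eq_zero.1 e01.1).resolve_left (mul_ne_zero (neg_ne_zero.2 hs) hI)))
  · exact Complex.ofReal_injective (sub_eq_zero.1 ((mul_eq_zero.1 e10.2).resolve_left
      (mul_ne_zero (neg_ne_zero.2 hs) (mul_ne_zero hI hI))))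
  · exact Complex.ofReal_injective (sub_eq_zero.1 ((mul_eq_zero.1 e01.2).resolve_left
      (mul_ne_zero (neg_ne_zero.2 hs) (mul_ne_zero hI hI))))

end CoreAtZero

end MCH

end

/-! ### The momentum profile, the change of variable y(x) and the recovery of u. -/

noncomputable section

namespace MCH

section Profile

variable {A₁ A₂ : ℝ} {m u : ℝ → ℝ}

theorem exists_bounds_of_tendsto {f : ℝ → ℝ} (hf : Continuous f) (hpos : ∀ x, 0 < f x) {a b : ℝ}
    (ha : 0 < a) (hb : 0 < b) (hbot : Tendsto f atBot (𝓝 a)) (htop : Tendsto f atTop (𝓝 b)) :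
    (∃ c, 0 < c ∧ ∀ x, c ≤ f x) ∧ ∃ C, ∀ x, f x ≤ C := by
  obtain ⟨X, hX⟩ := eventually_atTop.1 ((htop.eventually (lt_mem_nhds (half_lt_self hb))).and
    (htop.eventually (gt_mem_nhds (lt_add_one b))))
  obtain ⟨Y, hY⟩ := eventually_atBot.1 ((hbot.eventually (lt_mem_nhds (half_lt_self ha))).and
    (hbot.eventually (gt_mem_nhds (lt_add_one a))))
  have hne : (Icc (min Y X) X).Nonempty := ⟨X, min_le_right _ _, le_rfl⟩
  obtain ⟨p, -, hp⟩ := isCompact_Icc.exists_isMinOn hne hf.continuousOn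
  obtain ⟨q, -, hq⟩ := isCompact_Icc.exists_isMaxOn hne hf.continuousOn
  refine ⟨⟨min (f p) (min (a / 2) (b / 2)), ?_, fun x => ?_⟩,
    ⟨max (f q) (max (a + 1) (b + 1)), fun x => ?_⟩⟩
  · have := hpos p
    positivity
  · rcases le_total X x with h | h
    · exact ((min_le_right _ _).trans (min_le_right _ _)).trans (hX x h).1.le
    rcases le_total x Y with h' | h'
    · exact ((min_le_right _ _).trans (min_le_left _ _)).trans (hY x h').1.le
    · exact (min_le_left _ _).trans (hp ⟨(min_le_left _ _).trans h', h⟩)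
  · rcases le_total X x with h | h
    · exact (hX x h).2.le.trans ((le_max_right _ _).trans (le_max_right _ _))
    rcases le_total x Y with h' | h'
    · exact (hY x h').2.le.trans ((le_max_left _ _).trans (le_max_right _ _))
    · exact (hq ⟨(min_le_left _ _).trans h', h⟩ : f x ≤ f q).trans (le_max_left _ _)

theorem hasDerivAt_reflect {f : ℝ → ℝ} {f' x : ℝ} (h : HasDerivAt f f' (-x)) :
    HasDerivAt (fun y => f (-y)) (-f') x := by
  have := h.scomp x (hasDerivAt_neg x)
  rwa [neg_one_smul] at this

theorem contDiff_momentum (hu : ContDiff ℝ 4 u) : ContDiff ℝ 2 (momentum u) := by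
  have h1 : ContDiff ℝ 2 (iteratedDeriv 2 u) := by
    rw [iteratedDeriv_eq_iterate]; exact hu.iterate_deriv' 2 2
  exact (hu.of_le (by norm_num)).sub h1

/-- Integrability of m' and of m - A_j near the two ends forces m to tend to A_j; together with m >
0 and continuity this bounds m between positive constants. -/
theorem stepProfile_momentum (hA₁ : 0 < A₁) (hA₁₂ : A₁ < A₂) (hu : ContDiff ℝ 4 u)
    (hpos : ∀ x, 0 < momentum u x)
    (hleft : ∀ n : ℕ, n ≤ 2 → IntegrableOn (fun x => x ^ n * (momentum u x - A₁)) (Iic 0))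
    (hright : ∀ n : ℕ, n ≤ 2 → IntegrableOn (fun x => x ^ n * (momentum u x - A₂)) (Ici 0))
    (hderiv : Integrable (deriv (momentum u))) :
    StepProfile A₁ A₂ (momentum u) := by
  have hC := contDiff_momentum hu
  have hA₂ := hA₁.trans hA₁₂
  set m := momentum u with hm
  have hd : Differentiable ℝ m := hC.differentiable (by norm_num)
  have hdc : Continuous (deriv m) := hC.continuous_deriv (by norm_num)
  have htop : Tendsto m atTop (𝓝 A₂) := by
    have h1 : Tendsto (fun x => m x - A₂) atTop (𝓝 0) :=
      tendsto_zero_of_hasDerivAt_of_integrableOn_Ioi (a := 0) (f' := deriv m)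
        (fun x _ => (hd x).hasDerivAt.sub_const A₂) hderiv.integrableOn
        (by simpa using (hright 0 (by norm_num)).mono_set Ioi_subset_Ici_self)
    simpa using h1.add_const A₂
  have hbot : Tendsto m atBot (𝓝 A₁) := by
    have h1 : Tendsto (fun x => m x - A₁) atBot (𝓝 0) :=
      tendsto_zero_of_hasDerivAt_of_integrableOn_Iic (a := 0) (f' := deriv m)
        (fun x _ => (hd x).hasDerivAt.sub_const A₁) hderiv.integrableOn
        (by simpa using hleft 0 (by norm_num))
    simpa using h1.add_const A₁
  obtain ⟨⟨c, hc, hcm⟩, C, hCm⟩ := exists_bounds_of_tendsto hd.continuous hpos hA₁ hA₂ hbot htop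
  refine ⟨hA₁₂, ?_, ?_⟩
  · have hdn : ∀ x, HasDerivAt (fun y => m (-y)) (-deriv m (-x)) x := fun x => 
      hasDerivAt_reflect (hd (-x)).hasDerivAt
    have hde : deriv (fun y => m (-y)) = fun x => -deriv m (-x) := funext fun x => (hdn x).deriv
    refine ⟨hA₁, fun x => (hdn x).differentiableAt, ?_, ?_, fun n hn => ?_,
      ⟨c, hc, fun x => hcm _⟩, ⟨C, fun x => hCm _⟩⟩
    · rw [hde]; exact (hdc.comp continuous_neg).neg
    · rw [hde]; exact hderiv.comp_neg.neg
    -- Reflecting the moment x^n produces the sign (-1)^n, inserted beforehand.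
    · have h1 : IntegrableOn (fun x => (-1) ^ n * (x ^ n * (m x - A₁))) (Iio 0) :=
        Integrable.const_mul ((hleft n hn).mono_set Iio_subset_Iic_self) _
      have h2 := (integrable_indicator_iff measurableSet_Iio).2 h1
      have h3 := (integrable_indicator_iff (measurableSet_Ioi (a := (0 : ℝ)))
        (f := fun x => x ^ n * (m (-x) - A₁)) (μ := volume)).1 ?_
      · exact h3
      · refine h2.comp_neg.congr (ae_of_all _ fun x => ?_)
        simp only [indicator, mem_Iio, mem_Ioi, Left.neg_neg_iff]
        split_ifs
        · rw [neg_pow x n, ← mul_assoc, ← mul_assoc, ← mul_pow]; simp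
        · rfl
  · exact ⟨hA₂, hd, hdc, hderiv, fun n hn => (hright n hn).mono_set Ioi_subset_Ici_self,
      ⟨c, hc, hcm⟩, ⟨C, hCm⟩⟩

theorem hasDerivAt_yOfX (hm : RightProfile A₂ m) (x : ℝ) :
    HasDerivAt (yOfX A₂ m) (m x / A₂) x := by
  have h1 : HasDerivAt (fun x => ∫ ξ in Ioi x, (m ξ - A₂)) (-(m x - A₂)) x :=
    hasDerivAt_integral_Ioi (by have := hm.continuous; fun_prop) hm.integrableOn_sub x
  have h2 := (hasDerivAt_id x).sub (h1.const_mul (1 / A₂))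
  have := hm.pos
  refine h2.congr_deriv ?_
  field_simp
  ring

/-- With c a positive lower bound of m, the derivative m/A₂ of y is at least c/A₂, so y grows at
least linearly in both directions. -/
theorem surjective_yOfX (hm : RightProfile A₂ m) : Function.Surjective (yOfX A₂ m) := by
  have hA := hm.pos
  obtain ⟨c, hc, hcm⟩ := hm.lower
  have hmono : Monotone fun x => yOfX A₂ m x - c / A₂ * x := by
    have hd : ∀ x, HasDerivAt (fun x => yOfX A₂ m x - c / A₂ * x) (m x / A₂ - c / A₂ * 1) x :=
      fun x => (hasDerivAt_yOfX hm x).sub ((hasDerivAt_id x).const_mul _)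
    refine monotone_of_deriv_nonneg (fun x => (hd x).differentiableAt) fun x => ?_
    rw [(hd x).deriv, mul_one, ← sub_div]
    exact div_nonneg (sub_nonneg.2 (hcm x)) hA.le
  have hcA : 0 < c / A₂ := by positivity
  refine Continuous.surjective
    (continuous_iff_continuousAt.2 fun x => (hasDerivAt_yOfX hm x).continuousAt) ?_ ?_
  · refine tendsto_atTop_mono' _ ?_ (tendsto_atTop_add_const_left _ (yOfX A₂ m 0)
      (tendsto_id.const_mul_atTop hcA))
    filter_upwards [eventually_ge_atTop 0] with x hx
    have := hmono hx
    simp only [mul_zero, sub_zero] at this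
    simp only [id]; linarith
  · refine tendsto_atBot_mono' _ ?_ (tendsto_atBot_add_const_left _ (yOfX A₂ m 0)
      (tendsto_id.const_mul_atBot hcA))
    filter_upwards [eventually_le_atBot 0] with x hx
    have := hmono hx
    simp only [mul_zero, sub_zero] at this
    simp only [id]; linarith

theorem yOfX_xOfY (hm : RightProfile A₂ m) (y : ℝ) : yOfX A₂ m (xOfY A₂ m y) = y :=
  Function.rightInverse_invFun (surjective_yOfX hm) y

theorem exists_abs_le_linear {v : ℝ → ℝ} {C : ℝ} {v' : ℝ → ℝ} (hv : ∀ x, HasDerivAt v (v' x) x)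
    (hC : ∀ x, |v' x| ≤ C) (x : ℝ) : |v x| ≤ |v 0| + C * |x| := by
  have h := Convex.norm_image_sub_le_of_norm_hasDerivWithin_le (f := v) (f' := v') (s := univ)
    (fun x _ => (hv x).hasDerivWithinAt) (fun x _ => hC x) convex_univ (mem_univ 0) (mem_univ x)
  simp only [Real.norm_eq_abs, sub_zero] at h
  have := abs_sub_abs_le_abs_sub (v x) (v 0)
  linarith

theorem tendsto_exp_neg_mul_of_linear {v : ℝ → ℝ} {a C : ℝ} (h : ∀ x, |v x| ≤ a + C * |x|) :
    Tendsto (fun x => Real.exp (-x) * v x) atTop (𝓝 0) := by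
  have h1 : Tendsto (fun x => a * Real.exp (-x) + C * (x ^ 1 * Real.exp (-x))) atTop (𝓝 0) := by
    have := (Real.tendsto_exp_neg_atTop_nhds_zero.const_mul a).add
      ((Real.tendsto_pow_mul_exp_neg_atTop_nhds_zero 1).const_mul C)
    simpa using this
  refine squeeze_zero_norm' ?_ h1
  filter_upwards [eventually_ge_atTop 0] with x hx
  rw [norm_mul, Real.norm_of_nonneg (Real.exp_pos _).le, Real.norm_eq_abs]
  have := h x
  rw [abs_of_nonneg hx] at this
  calc _ ≤ Real.exp (-x) * (a + C * x) := by gcongr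
    _ = _ := by ring

/-- The tail integral of the momentum recovers `u + u'`. -/
theorem expTail_eq {v w : ℝ → ℝ} {A : ℝ} (hm : RightProfile A m) {a C : ℝ}
    (hv : ∀ x, HasDerivAt v (w x) x) (hw : ∀ x, HasDerivAt w (v x - m x) x)
    (hb : ∀ x, |v x + w x| ≤ a + C * |x|) (x : ℝ) :
    expTail m x = Real.exp (-x) * (v x + w x) := by
  have hd : ∀ ξ ∈ Ici x, HasDerivAt (fun ξ => Real.exp (-ξ) * (v ξ + w ξ))
      (-(m ξ * Real.exp (-ξ))) ξ := fun ξ _ => by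
    have h1 : HasDerivAt (fun ξ : ℝ => Real.exp (-ξ)) (-Real.exp (-ξ)) ξ := by
      simpa using (hasDerivAt_neg ξ).exp
    refine (h1.mul ((hv ξ).add (hw ξ))).congr_deriv ?_
    simp only [Pi.add_apply]; ring
  have := integral_Ioi_of_hasDerivAt_of_tendsto' hd (integrableOn_exp_mul hm x).2.neg
    (tendsto_exp_neg_mul_of_linear hb)
  rw [integral_neg, zero_sub, neg_inj] at this
  exact this

/-- Recovery of `u` from the two exponential tails of its momentum. -/
theorem expTail_add_expTail (hm : StepProfile A₁ A₂ (momentum u)) (hu : ContDiff ℝ 4 u)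
    (hbot : Tendsto u atBot (𝓝 A₁)) (htop : Tendsto u atTop (𝓝 A₂)) (x : ℝ) :
    Real.exp (-x) * expTail (fun y => momentum u (-y)) (-x) +
      Real.exp x * expTail (momentum u) x = 2 * u x := by
  obtain ⟨C, hC⟩ : ∃ C, ∀ x, |u x| ≤ C := by
    obtain ⟨X, hX⟩ := eventually_atTop.1 (htop.abs.eventually (gt_mem_nhds (lt_add_one |A₂|)))
    obtain ⟨Y, hY⟩ := eventually_atBot.1 (hbot.abs.eventually (gt_mem_nhds (lt_add_one |A₁|)))
    obtain ⟨D, hD⟩ := isCompact_Icc.exists_bound_of_continuousOn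
      (hu.continuous.continuousOn (s := Icc Y X))
    refine ⟨max D (max (|A₁| + 1) (|A₂| + 1)), fun x => ?_⟩
    rcases le_total X x with h | h
    · exact (hX x h).le.trans ((le_max_right _ _).trans (le_max_right _ _))
    rcases le_total x Y with h' | h'
    · exact (hY x h').le.trans ((le_max_left _ _).trans (le_max_right _ _))
    · exact (hD x ⟨h', h⟩).trans (le_max_left _ _)
  obtain ⟨B, hB⟩ := hm.right.abs_le
  have h1 : ∀ x, HasDerivAt u (deriv u x) x := fun x =>
    (hu.differentiable (by norm_num) x).hasDerivAt
  have hu1 : ContDiff ℝ 3 (deriv u) := hu.iterate_deriv' 3 1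
  have h2 : ∀ x, HasDerivAt (deriv u) (u x - momentum u x) x := fun x => by
    have h3 := (hu1.differentiable (by norm_num) x).hasDerivAt
    refine h3.congr_deriv ?_
    rw [momentum, iteratedDeriv_succ, iteratedDeriv_one]; ring
  -- No bound on u' is assumed; u'' = u - m is bounded, so u' grows at most linearly, which e^{-x}
  -- absorbs.
  have hlin := exists_abs_le_linear h2 (C := C + B) fun x =>
    (abs_sub _ _).trans (add_le_add (hC x) (hB x))
  have e1 := expTail_eq hm.right h1 h2 (a := C + |deriv u 0|) (C := C + B) (fun x =>
    (abs_add_le _ _).trans (by linarith [hC x, hlin x])) x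
  have h1n : ∀ x, HasDerivAt (fun x => u (-x)) (-deriv u (-x)) x := fun x => 
    hasDerivAt_reflect (h1 (-x))
  have h2n : ∀ x, HasDerivAt (fun x => -deriv u (-x)) (u (-x) - momentum u (-x)) x := fun x => 
    (hasDerivAt_reflect (h2 (-x))).fun_neg.congr_deriv (neg_neg _)
  have e2 := expTail_eq hm.left h1n h2n (a := C + |deriv u 0|) (C := C + B) (fun x =>
    (abs_add_le _ _).trans (by
      have := hlin (-x)
      rw [abs_neg] at this ⊢
      linarith [hC (-x)])) (-x)
  rw [e1, e2, neg_neg, ← mul_assoc, ← mul_assoc, ← Real.exp_add, ← Real.exp_add]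
  simp
  ring

end Profile

end MCH

end

/-! ### Lipschitz dependence of the Jost amplitude on (z, k). -/

noncomputable section

namespace MCH

section Lipschitz

variable {A : ℝ} {m : ℝ → ℝ} {z p : ℂ}

theorem norm_projCLM_sub_le (hA : 0 < A) (z p : ℂ) : ‖projCLM A z - projCLM A p‖ ≤
    (‖matCLM rotJ‖ + A / 2 * ‖ContinuousLinearMap.id ℂ (Fin 2 → ℂ)‖) *
      (‖z - p‖ + ‖wave A z - wave A p‖) := by
  have e : projCLM A z - projCLM A p = (Complex.I * (wave A z - wave A p)) • matCLM rotJ +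
      ((z - p) * A / 2) • ContinuousLinearMap.id ℂ (Fin 2 → ℂ) := by
    simp only [projCLM]; module
  rw [e]
  refine (norm_add_le _ _).trans ?_
  rw [norm_smul, norm_smul, norm_mul, Complex.norm_I, one_mul, norm_div, norm_mul,
    Complex.norm_real, Complex.norm_ofNat, Real.norm_of_nonneg hA.le]
  have h1 := mul_nonneg (norm_nonneg (z - p)) (norm_nonneg (matCLM rotJ))
  have h2 := mul_nonneg (mul_nonneg hA.le (norm_nonneg (wave A z - wave A p)))
    (norm_nonneg (ContinuousLinearMap.id ℂ (Fin 2 → ℂ)))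
  linarith

theorem jostKernel_sub (x ξ : ℝ) : jostKernel A m x ξ z - jostKernel A m x ξ p =
    (-((z - p) * ((m ξ - A : ℝ) : ℂ) / 2)) •
      (matCLM rotJ + osc (wave A z) (ξ - x) • projCLM A z) +
    (-(p * ((m ξ - A : ℝ) : ℂ) / 2)) •
      ((osc (wave A z) (ξ - x) - osc (wave A p) (ξ - x)) • projCLM A z +
        osc (wave A p) (ξ - x) • (projCLM A z - projCLM A p)) := by
  simp only [jostKernel]
  module

theorem one_le_one_add_sq {t : ℝ} (ht : 0 ≤ t) : 1 ≤ (1 + t) ^ 2 := by nlinarith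

theorem le_one_add_sq {t : ℝ} (ht : 0 ≤ t) : t ≤ (1 + t) ^ 2 := by nlinarith

theorem sq_le_one_add_sq {t : ℝ} (ht : 0 ≤ t) : t ^ 2 ≤ (1 + t) ^ 2 := by nlinarith

/-- The increment of k is measured separately from that of z, because k behaves like a square root
of z at the branch points; in the pair the kernel is Lipschitz at the cost of a second moment. -/
theorem norm_jostKernel_sub_le (hA : 0 < A) {R : ℝ} (hR : 0 ≤ R) : ∃ L, 0 ≤ L ∧
    ∀ (m : ℝ → ℝ), ∀ z ∈ halfDisk R, ∀ p ∈ halfDisk R, ∀ x ξ : ℝ, x ≤ ξ →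
      ‖jostKernel A m x ξ z - jostKernel A m x ξ p‖ ≤
        L * (‖z - p‖ + ‖wave A z - wave A p‖) * (1 + (ξ - x)) ^ 2 * |m ξ - A| := by
  set P := (A * R + 1) * ‖matCLM rotJ‖ + 1 / 2 * ‖matCLM sigma1‖ +
      R * A / 2 * ‖ContinuousLinearMap.id ℂ (Fin 2 → ℂ)‖ with hP
  set Q := ‖matCLM rotJ‖ + A / 2 * ‖ContinuousLinearMap.id ℂ (Fin 2 → ℂ)‖ with hQ
  have hP0 : 0 ≤ P := by positivity
  have hQ0 : 0 ≤ Q := by positivity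
  refine ⟨(‖matCLM rotJ‖ + P) + R * (2 * P + Q), by positivity, fun m z hz p hp x ξ hx => ?_⟩
  have hzR : ‖z‖ ≤ R := by
    have := hz.2; rw [Metric.mem_ball, dist_zero_right] at this; exact this.le
  have hpR : ‖p‖ ≤ R := by
    have := hp.2; rw [Metric.mem_ball, dist_zero_right] at this; exact this.le
  have ht : 0 ≤ ξ - x := sub_nonneg.2 hx
  set t := ξ - x with htdef
  set δ := ‖z - p‖ + ‖wave A z - wave A p‖ with hδ
  have hδ0 : 0 ≤ δ := by positivity
  have hδ1 : ‖z - p‖ ≤ δ := by rw [hδ]; linarith [norm_nonneg (wave A z - wave A p)]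
  have hδ2 : ‖wave A z - wave A p‖ ≤ δ := by rw [hδ]; linarith [norm_nonneg (z - p)]
  have hkz := wave_im_nonneg hA hz.1
  have hkp := wave_im_nonneg hA hp.1
  have hPz : ‖projCLM A z‖ ≤ P := norm_projCLM_le hA hzR
  have hPd : ‖projCLM A z - projCLM A p‖ ≤ Q * δ := norm_projCLM_sub_le hA z p
  have ho := norm_osc_le hkz ht
  have hop := norm_osc_le hkp ht
  have hos := norm_osc_sub_le hkz hkp ht
  have h1 : ‖matCLM rotJ + osc (wave A z) t • projCLM A z‖ ≤
      (‖matCLM rotJ‖ + P) * (1 + t) ^ 2 := by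
    refine (norm_add_le _ _).trans ?_
    rw [norm_smul]
    have h2 : ‖osc (wave A z) t‖ * ‖projCLM A z‖ ≤ t * P := by gcongr
    have h7 := mul_le_mul_of_nonneg_left (one_le_one_add_sq ht)
      (norm_nonneg (matCLM rotJ))
    have h8 := mul_le_mul_of_nonneg_left (le_one_add_sq ht) hP0
    linarith
  have h2 : ‖(osc (wave A z) t - osc (wave A p) t) • projCLM A z +
      osc (wave A p) t • (projCLM A z - projCLM A p)‖ ≤ (2 * P + Q) * δ * (1 + t) ^ 2 := by
    refine (norm_add_le _ _).trans ?_
    rw [norm_smul, norm_smul]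
    have h3 : ‖osc (wave A z) t - osc (wave A p) t‖ * ‖projCLM A z‖ ≤ 2 * δ * t ^ 2 * P := by
      gcongr
      exact hos.trans (by gcongr)
    have h4 : ‖osc (wave A p) t‖ * ‖projCLM A z - projCLM A p‖ ≤ t * (Q * δ) := by gcongr
    have h5 : 0 ≤ P * δ := by positivity
    have h6 : 0 ≤ Q * δ := by positivity
    have h7 := mul_le_mul_of_nonneg_left (sq_le_one_add_sq ht) h5
    have h8 := mul_le_mul_of_nonneg_left (le_one_add_sq ht) h6
    linarith
  rw [jostKernel_sub]
  refine (norm_add_le _ _).trans ?_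
  rw [norm_smul, norm_smul, norm_neg, norm_neg, norm_div, norm_div, norm_mul, norm_mul,
    Complex.norm_real, Complex.norm_ofNat, Real.norm_eq_abs]
  have h7 : ‖z - p‖ * |m ξ - A| / 2 * ‖matCLM rotJ + osc (wave A z) t • projCLM A z‖ ≤
      δ * |m ξ - A| * ((‖matCLM rotJ‖ + P) * (1 + t) ^ 2) := by
    refine mul_le_mul ?_ h1 (norm_nonneg _) (by positivity)
    have := mul_le_mul_of_nonneg_right hδ1 (abs_nonneg (m ξ - A))
    linarith [mul_nonneg (norm_nonneg (z - p)) (abs_nonneg (m ξ - A))]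
  have h8 := mul_le_mul (a := ‖p‖ * |m ξ - A| / 2) (b := R * |m ξ - A|) (by
    have := mul_le_mul_of_nonneg_right hpR (abs_nonneg (m ξ - A))
    linarith [mul_nonneg (norm_nonneg p) (abs_nonneg (m ξ - A))]) h2 (norm_nonneg _)
    (by positivity)
  calc _ ≤ _ := add_le_add h7 h8
    _ = _ := by ring

theorem norm_eigvec_sub_le (hA : 0 < A) {R : ℝ} (hz : z ∈ closedUpper) (hp : p ∈ halfDisk R) :
    ‖eigvec A z - eigvec A p‖ ≤ (A + 2 * (A * R)) * (‖z - p‖ + ‖wave A z - wave A p‖) := by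
  have hpR : ‖p‖ ≤ R := by
    have := hp.2; rw [Metric.mem_ball, dist_zero_right] at this; exact this.le
  have hR : 0 ≤ R := (norm_nonneg p).trans hpR
  have h1 : (beta A z - beta A p) * (1 - 2 * Complex.I * wave A z) =
      A * (z - p) + 2 * Complex.I * beta A p * (wave A z - wave A p) := by
    linear_combination beta_mul hA hz - beta_mul hA hp.1
  have hβ : ‖beta A p‖ ≤ A * R := (norm_beta_le hA hp.1).trans (by gcongr)
  have h2 : ‖beta A z - beta A p‖ ≤ A * ‖z - p‖ + 2 * (A * R) * ‖wave A z - wave A p‖ := by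
    have h3 := congrArg norm h1
    rw [norm_mul] at h3
    have h4 := one_le_norm_one_sub_wave hA hz
    have h5 : ‖(A : ℂ) * (z - p) + 2 * Complex.I * beta A p * (wave A z - wave A p)‖ ≤
        A * ‖z - p‖ + 2 * (A * R) * ‖wave A z - wave A p‖ := by
      refine (norm_add_le _ _).trans ?_
      rw [norm_mul, norm_mul, norm_mul, norm_mul, Complex.norm_real, Complex.norm_I,
        Complex.norm_ofNat, Real.norm_of_nonneg hA.le, mul_one]
      gcongr
    nlinarith [norm_nonneg (beta A z - beta A p)]
  have h6 : eigvec A z - eigvec A p = ![0, beta A z - beta A p] := by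
    ext i; fin_cases i <;> simp [eigvec]
  have h7 : ‖eigvec A z - eigvec A p‖ ≤ ‖beta A z - beta A p‖ := by
    rw [h6]
    refine (pi_norm_le_iff_of_nonneg (norm_nonneg _)).2 fun i => ?_
    fin_cases i <;> simp
  refine h7.trans (h2.trans ?_)
  have e1 : 0 ≤ A * R := by positivity
  nlinarith [mul_nonneg hA.le (norm_nonneg (wave A z - wave A p)), mul_nonneg e1 (norm_nonneg (z - p))]

/-- The Jost amplitude is Lipschitz in the pair `(z, k)`, with the part beyond its boundary value
controlled by the tail of the second moment. -/
theorem norm_jostAmp_sub_le (hm : RightProfile A m) {R : ℝ} (hR : 0 ≤ R) (x₀ : ℝ) :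
    ∃ C, 0 ≤ C ∧ ∀ z ∈ halfDisk R, ∀ p ∈ halfDisk R, ∀ x, x₀ ≤ x →
      ‖jostAmp A m x z - jostAmp A m x p - (eigvec A z - eigvec A p)‖ ≤
        C * (‖z - p‖ + ‖wave A z - wave A p‖) * ∫ ξ in Ioi x, (1 + |ξ|) ^ 2 * |m ξ - A| := by
  have hA := hm.pos
  have hc := hm.continuous
  obtain ⟨L, hL0, hL⟩ := norm_jostKernel_sub_le hA hR
  obtain ⟨H, hH0, hH⟩ := norm_jostAmp_le hm hR x₀
  set w : ℝ → ℝ := fun ξ => (1 + |ξ|) ^ 2 * |m ξ - A| with hw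
  have hw0 : ∀ ξ, 0 ≤ w ξ := fun ξ => by positivity
  have hwc : Continuous w := by fun_prop
  have hwi : ∀ x, IntegrableOn w (Ioi x) := hm.integrableOn_sq
  set B := (1 + |x₀|) ^ 2 with hB
  have hB0 : 0 ≤ B := by positivity
  have hK0 := kernelConst_nonneg hA hR
  set ρ : ℝ → ℝ := fun ξ => kernelConst A R * B * w ξ with hρ
  have hρ0 : ∀ ξ, 0 ≤ ρ ξ := fun ξ => by have := hw0 ξ; positivity
  have hρc : Continuous ρ := by fun_prop
  have hρi : ∀ x, IntegrableOn ρ (Ioi x) := fun x => (hwi x).const_mul _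
  set W := ∫ ξ in Ioi x₀, w ξ with hWdef
  have hW0 : 0 ≤ W := setIntegral_nonneg measurableSet_Ioi fun ξ _ => hw0 ξ
  set a₀ := (A + 2 * (A * R)) + L * B * H * W with ha₀
  have ha₀0 : 0 ≤ a₀ := by positivity
  have hT := one_le_tailWeight hρ0 x₀
  refine ⟨kernelConst A R * B * (2 * a₀ * tailWeight ρ x₀) + L * B * H, by positivity,
    fun z hz p hp => ?_⟩
  set δ := ‖z - p‖ + ‖wave A z - wave A p‖ with hδ
  have hδ0 : 0 ≤ δ := by positivity
  set D : ℝ → Fin 2 → ℂ := fun x => jostAmp A m x z - jostAmp A m x p with hD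
  have hDc : Continuous D := (continuous_jostAmp hm hz.1).sub (continuous_jostAmp hm hp.1)
  have hDb : ∀ x, x₀ ≤ x → ‖D x‖ ≤ 2 * H := fun x hx =>
    (norm_sub_le _ _).trans (by linarith [hH z hz x hx, hH p hp x hx])
  have hgeom : ∀ x ξ, x₀ ≤ x → x ≤ ξ → (1 + (ξ - x)) ^ 2 ≤ B * (1 + |ξ|) ^ 2 := by
    intro x ξ hx hξ
    rw [hB, ← mul_pow]
    refine pow_le_pow_left₀ (by linarith) ?_ 2
    nlinarith [abs_nonneg x₀, abs_nonneg ξ, le_abs_self ξ, neg_abs_le x₀]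
  have hgeom' : ∀ x ξ, x₀ ≤ x → x ≤ ξ → 1 + (ξ - x) ≤ B * (1 + |ξ|) ^ 2 := fun x ξ hx hξ =>
    le_trans (by nlinarith [sub_nonneg.2 hξ]) (hgeom x ξ hx hξ)
  have hIf : ∀ x, x₀ ≤ x → IntegrableOn (fun ξ => ρ ξ * ‖D ξ‖) (Ioi x) := fun x hx =>
    Integrable.mono' ((hρi x).mul_const (2 * H)) (Continuous.aestronglyMeasurable (by fun_prop))
      ((ae_restrict_iff' measurableSet_Ioi).2 (ae_of_all _ fun ξ hξ => by
        rw [Real.norm_of_nonneg (mul_nonneg (hρ0 ξ) (norm_nonneg _))]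
        exact mul_le_mul_of_nonneg_left (hDb ξ (hx.trans (le_of_lt hξ))) (hρ0 ξ)))
  -- The two integral equations are subtracted, and the difference of the integrands is split into
  -- the kernel at z applied to the difference D and the difference of kernels applied to the
  -- solution at p.
  have hstar : ∀ x, x₀ ≤ x → ‖D x - (eigvec A z - eigvec A p)‖ ≤
      (∫ ξ in Ioi x, ρ ξ * ‖D ξ‖) + L * δ * B * H * ∫ ξ in Ioi x, w ξ := by
    intro x hx
    have hint : ∀ q ∈ halfDisk R,
        IntegrableOn (fun ξ => jostKernel A m x ξ q (jostAmp A m ξ q)) (Ioi x) := fun q hq => by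
      have hK := isVolterraKernel_jostKernel hm hR
      exact hK.integrableOn_apply hq x (continuous_jostAmp hm hq.1)
        (fun ξ => hK.norm_sol_le (fun z hz => norm_eigvec_le hm.pos hz) hq ξ)
    have e : D x - (eigvec A z - eigvec A p) = ∫ ξ in Ioi x,
        (jostKernel A m x ξ z (jostAmp A m ξ z) - jostKernel A m x ξ p (jostAmp A m ξ p)) := by
      rw [integral_sub (hint z hz) (hint p hp), hD]
      simp only
      rw [jostAmp_eq hm hz.1 x, jostAmp_eq hm hp.1 x]
      abel
    rw [e, ← integral_const_mul, ← integral_add (hIf x hx) ((hwi x).const_mul _)]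
    refine norm_integral_le_of_norm_le ((hIf x hx).add ((hwi x).const_mul _))
      ((ae_restrict_iff' measurableSet_Ioi).2 (ae_of_all _ fun ξ hξ => ?_))
    have hxξ : x ≤ ξ := le_of_lt hξ
    have e2 : jostKernel A m x ξ z (jostAmp A m ξ z) - jostKernel A m x ξ p (jostAmp A m ξ p) =
        jostKernel A m x ξ z (D ξ) +
          (jostKernel A m x ξ z - jostKernel A m x ξ p) (jostAmp A m ξ p) := by
      simp only [hD, map_sub, _root_.sub_apply]; abel
    rw [e2]
    refine (norm_add_le _ _).trans (add_le_add ?_ ?_)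
    · refine (ContinuousLinearMap.le_opNorm _ _).trans
        (mul_le_mul_of_nonneg_right ?_ (norm_nonneg _))
      refine (norm_jostKernel_le hA m hz hxξ).trans ?_
      rw [hρ, hw]
      have := mul_le_mul_of_nonneg_left (hgeom' x ξ hx hxξ) hK0
      have := mul_le_mul_of_nonneg_right this (abs_nonneg (m ξ - A))
      linarith
    · refine (ContinuousLinearMap.le_opNorm _ _).trans ?_
      have h1 := hL m z hz p hp x ξ hxξ
      have h2 : L * δ * (1 + (ξ - x)) ^ 2 * |m ξ - A| ≤ L * δ * B * w ξ := by
        have := mul_le_mul_of_nonneg_left (hgeom x ξ hx hxξ) (mul_nonneg hL0 hδ0)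
        have := mul_le_mul_of_nonneg_right this (abs_nonneg (m ξ - A))
        rw [hw]; linarith
      have := hw0 ξ
      calc _ ≤ (L * δ * B * w ξ) * H :=
            mul_le_mul (h1.trans h2) (hH p hp ξ (hx.trans hxξ)) (norm_nonneg _) (by positivity)
        _ = _ := by ring
  have hWx : ∀ x, x₀ ≤ x → ∫ ξ in Ioi x, w ξ ≤ W := fun x hx =>
    setIntegral_mono_set (hwi x₀) (ae_of_all _ hw0) (Ioi_subset_Ioi hx).eventuallyLE
  -- Gronwall bounds D by a multiple of δ; inserting this into `hstar` below shows that, beyond the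
  -- eigenvectors, the difference is also small with the tail of the second moment.
  have hDle : ∀ x, x₀ ≤ x → ‖D x‖ ≤ 2 * (a₀ * δ) * tailWeight ρ x := by
    intro x hx
    refine gronwall_Ioi (f := fun x => ‖D x‖) hρ0 hρc hρi hDc.norm (fun _ => norm_nonneg _)
      (by positivity) hDb (fun x hx => ?_) x hx
    have h1 := norm_eigvec_sub_le hA hz.1 hp
    have h2 := hstar x hx
    have h3 : ‖D x‖ ≤ ‖D x - (eigvec A z - eigvec A p)‖ + ‖eigvec A z - eigvec A p‖ := by
      simpa using norm_add_le (D x - (eigvec A z - eigvec A p)) (eigvec A z - eigvec A p)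
    have h4 : L * δ * B * H * ∫ ξ in Ioi x, w ξ ≤ L * δ * B * H * W :=
      mul_le_mul_of_nonneg_left (hWx x hx) (by positivity)
    rw [ha₀]
    linarith
  intro x hx
  refine (hstar x hx).trans ?_
  have h5 : ∫ ξ in Ioi x, ρ ξ * ‖D ξ‖ ≤
      ∫ ξ in Ioi x, (2 * (a₀ * δ) * tailWeight ρ x₀ * (kernelConst A R * B)) * w ξ := by
    refine setIntegral_mono_on (hIf x hx) ((hwi x).const_mul _) measurableSet_Ioi fun ξ hξ => ?_
    have hξ0 : x₀ ≤ ξ := hx.trans (le_of_lt hξ)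
    have h6 : ‖D ξ‖ ≤ 2 * (a₀ * δ) * tailWeight ρ x₀ := (hDle ξ hξ0).trans
      (mul_le_mul_of_nonneg_left (tailWeight_anti hρ0 hρi hξ0) (by positivity))
    have := mul_le_mul_of_nonneg_left h6 (hρ0 ξ)
    rw [hρ] at this ⊢
    linarith
  rw [integral_const_mul] at h5
  calc _ ≤ _ := add_le_add_left h5 _
    _ = _ := by ring

end Lipschitz

end MCH

end

/-! ### Behaviour at the branch points. -/

noncomputable section

namespace MCH

section Regular

variable {A : ℝ} {m : ℝ → ℝ} {p : ℝ}

theorem isBigO_sub_of_continuousOn {E : Type*} [NormedAddCommGroup E] {f : ℂ → E}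
    (hf : ContinuousOn f closedUpper) (p : ℝ) :
    f =O[𝓝[upper] (p : ℂ)] fun _ => (1 : ℝ) :=
  ((hf _ (ofReal_mem_closedUpper p)).mono upper_subset_closedUpper).tendsto.isBigO_one ℝ

theorem wave_sub_mul (hA : 0 < A) (z w : ℂ) :
    (wave A z - wave A w) * (wave A z + wave A w) = A ^ 2 / 4 * ((z - w) * (z + w)) := by
  linear_combination (wave_sq hA z - wave_sq hA w) / 4

/-- Inside the gap k is Lipschitz in z: (k_z - k_p)(k_z + k_p) is a multiple of z² - p², and k_z +
k_p stays away from zero because Im k_p > 0. This is applied to the left background at ±1/A₂, which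
lie in its gap. -/
theorem isBigO_wave_sub (hA : 0 < A) (hp : |p| < 1 / A) :
    (fun z => wave A z - wave A p) =O[𝓝[upper] (p : ℂ)] fun z => z - p := by
  have hk := wave_im_pos_of_gt hA hp
  have h1 : (fun z : ℂ => A ^ 2 / 4 * ((z - p) * (z + p)) / (wave A z + wave A p))
      =O[𝓝[upper] (p : ℂ)] fun z => z - p := by
    have h2 : (fun z : ℂ => A ^ 2 / 4 * (z + p) / (wave A z + wave A p)) =O[𝓝[upper] (p : ℂ)]
        fun _ => (1 : ℂ) := by
      have hne : wave A (p : ℂ) + wave A p ≠ 0 := fun h => by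
        have := congrArg Complex.im h
        simp only [Complex.add_im, Complex.zero_im] at this
        linarith
      have hc := ((continuousOn_wave A) _ (ofReal_mem_closedUpper p)).mono upper_subset_closedUpper
      have h3 : ContinuousWithinAt (fun z : ℂ => A ^ 2 / 4 * (z + p) / (wave A z + wave A p))
          upper p := by
        refine ContinuousWithinAt.div ?_ (hc.add continuousWithinAt_const) hne
        fun_prop
      exact h3.tendsto.isBigO_one ℂ
    refine (h2.mul (isBigO_refl (fun z : ℂ => z - p) _)).congr (fun z => ?_) fun z => one_mul _
    ring
  refine h1.congr' ?_ EventuallyEq.rfl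
  filter_upwards [self_mem_nhdsWithin] with z hz
  have hz' := wave_im_pos hA hz
  have hne : wave A z + wave A (p : ℂ) ≠ 0 := fun h => by
    have := congrArg Complex.im h
    simp only [Complex.add_im, Complex.zero_im] at this
    linarith
  rw [← wave_sub_mul hA, mul_div_cancel_right₀ _ hne]

theorem eventually_mem_halfDisk (p : ℝ) : ∀ᶠ z in 𝓝[upper] (p : ℂ), z ∈ halfDisk (|p| + 1) := by
  have h : Metric.ball (0 : ℂ) (|p| + 1) ∈ 𝓝 (p : ℂ) := Metric.isOpen_ball.mem_nhds (by simp)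
  filter_upwards [nhdsWithin_le_nhds h, self_mem_nhdsWithin] with z h1 h2
  exact ⟨upper_subset_closedUpper h2, h1⟩

theorem ofReal_mem_halfDisk (p : ℝ) : (p : ℂ) ∈ halfDisk (|p| + 1) :=
  ⟨ofReal_mem_closedUpper p, by simp⟩

theorem isBigO_jostAmp_sub (hm : RightProfile A m) (hp : |p| < 1 / A) (x : ℝ) :
    (fun z => jostAmp A m x z - jostAmp A m x p) =O[𝓝[upper] (p : ℂ)] fun z => z - p := by
  have hR : 0 ≤ |p| + 1 := by positivity
  obtain ⟨C, hC0, hC⟩ := norm_jostAmp_sub_le hm hR x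
  have h1 : (fun z : ℂ => ‖z - p‖ + ‖wave A z - wave A p‖) =O[𝓝[upper] (p : ℂ)]
      fun z => z - p :=
    (isBigO_refl (fun z : ℂ => z - p) _).norm_left.add (isBigO_wave_sub hm.pos hp).norm_left
  refine IsBigO.trans (IsBigO.of_bound (C * (∫ ξ in Ioi x, (1 + |ξ|) ^ 2 * |m ξ - A|) +
    (A + 2 * (A * (|p| + 1)))) ?_) h1
  filter_upwards [eventually_mem_halfDisk p] with z hz
  have h2 := hC z hz p (ofReal_mem_halfDisk p) x le_rfl
  have h3 := norm_eigvec_sub_le hm.pos hz.1 (ofReal_mem_halfDisk p)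
  have h4 := norm_add_le (jostAmp A m x z - jostAmp A m x p - (eigvec A z - eigvec A p))
    (eigvec A z - eigvec A p)
  rw [sub_add_cancel] at h4
  rw [Real.norm_of_nonneg (by positivity)]
  linarith

theorem isBigO_jostR_sub (hm : RightProfile A m) (hp : |p| < 1 / A) (x : ℝ) :
    (fun z => jostR A m x z - jostR A m x p) =O[𝓝[upper] (p : ℂ)] fun z => z - p := by
  have hc := ((continuousOn_wave A) _ (ofReal_mem_closedUpper p)).mono upper_subset_closedUpper
  have hw : Tendsto (fun z => Complex.I * wave A z * x) (𝓝[upper] (p : ℂ))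
      (𝓝 (Complex.I * wave A p * x)) := (hc.tendsto.const_mul Complex.I).mul_const _
  have he : (fun z => Complex.exp (Complex.I * wave A z * x) -
      Complex.exp (Complex.I * wave A p * x)) =O[𝓝[upper] (p : ℂ)] fun z => z - p := by
    have h1 := (Complex.hasDerivAt_exp (Complex.I * wave A p * x)).isBigO_sub.comp_tendsto hw
    refine h1.trans ?_
    have h2 := (isBigO_wave_sub hm.pos hp).const_mul_left (Complex.I * x)
    refine h2.congr_left fun z => ?_
    simp only [Function.comp]; ring
  have h1 : (fun z => Complex.exp (Complex.I * wave A z * x) •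
      (jostAmp A m x z - jostAmp A m x p)) =O[𝓝[upper] (p : ℂ)] fun z => z - p := by
    have := (hw.cexp.isBigO_one ℂ).smul (isBigO_jostAmp_sub hm hp x)
    exact this.congr_right fun z => by simp
  have h2 : (fun z => (Complex.exp (Complex.I * wave A z * x) -
      Complex.exp (Complex.I * wave A p * x)) • jostAmp A m x p) =O[𝓝[upper] (p : ℂ)]
        fun z => z - p := by
    have := he.smul (isBigO_refl (fun _ : ℂ => jostAmp A m x p) (𝓝[upper] (p : ℂ)))
    refine this.trans ?_
    refine IsBigO.of_bound ‖jostAmp A m x p‖ (Eventually.of_forall fun z => ?_)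
    rw [norm_smul, mul_comm]
  refine (h1.add h2).congr_left fun z => ?_
  simp only [jostR]
  module

theorem isBigO_jostL_sub (hm : RightProfile A fun y => m (-y)) (hp : |p| < 1 / A) (x : ℝ) :
    (fun z => jostL A m x z - jostL A m x p) =O[𝓝[upper] (p : ℂ)] fun z => z - p := by
  refine IsBigO.trans (IsBigO.of_bound 1 (Eventually.of_forall fun z => ?_))
    (isBigO_jostR_sub hm hp (-x))
  rw [jostL, jostL, ← swapCLM_apply, ← swapCLM_apply, ← map_sub, swapCLM_apply, norm_swapVec,
    one_mul]

end Regular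

section Branch

variable {A : ℝ} {m : ℝ → ℝ} {p : ℝ}

theorem wave_branch (hA : 0 < A) (hp : |p| = 1 / A) : wave A p = 0 := by
  rw [wave_eq_zero_iff hA]
  rcases abs_choice p with h | h
  · left; rw [h] at hp; rw [hp]; push_cast; rfl
  · right; rw [h] at hp; rw [← neg_neg p, hp]; push_cast; rfl

theorem tendsto_wave_branch (hA : 0 < A) (hp : |p| = 1 / A) :
    Tendsto (wave A) (𝓝[upper] (p : ℂ)) (𝓝 0) := by
  have hc := ((continuousOn_wave A) _ (ofReal_mem_closedUpper p)).mono upper_subset_closedUpper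
  have := hc.tendsto
  rwa [wave_branch hA hp] at this

/-- Near a branch point `‖k‖²` is comparable with the distance to it. -/
theorem eventually_norm_sub_le (hA : 0 < A) (hp : |p| = 1 / A) :
    ∀ᶠ z : ℂ in 𝓝[upper] (p : ℂ), A / 4 * ‖z - p‖ ≤ ‖wave A z‖ ^ 2 := by
  have hb : Metric.ball (p : ℂ) (1 / A) ∈ 𝓝 (p : ℂ) := Metric.ball_mem_nhds _ (by positivity)
  filter_upwards [nhdsWithin_le_nhds hb] with z hz
  have h1 := wave_sub_mul hA z p
  rw [wave_branch hA hp, sub_zero, add_zero] at h1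
  have h2 := congrArg norm h1
  rw [norm_mul, norm_mul, norm_mul, norm_div, norm_pow, Complex.norm_real,
    Real.norm_of_nonneg hA.le, Complex.norm_ofNat] at h2
  rw [sq, h2]
  have h3 : 1 / A ≤ ‖z + p‖ := by
    have h4 : ‖(2 * p : ℂ)‖ ≤ ‖z + p‖ + ‖z - p‖ := by
      have := norm_sub_le (z + p) (z - p)
      rwa [show z + p - (z - p) = 2 * p by ring] at this
    rw [norm_mul, Complex.norm_ofNat, Complex.norm_real, Real.norm_eq_abs, hp] at h4
    rw [mem_ball_iff_norm] at hz
    linarith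
  calc A / 4 * ‖z - p‖ = A ^ 2 / 4 * (‖z - p‖ * (1 / A)) := by field_simp
    _ ≤ _ := by gcongr

theorem isLittleO_sub_wave (hA : 0 < A) (hp : |p| = 1 / A) :
    (fun z : ℂ => z - p) =o[𝓝[upper] (p : ℂ)] wave A := by
  have h1 : (fun z : ℂ => z - p) =O[𝓝[upper] (p : ℂ)] fun z => wave A z * wave A z := by
    refine IsBigO.of_bound (4 / A) ?_
    filter_upwards [eventually_norm_sub_le hA hp] with z hz
    rw [norm_mul, ← sq]
    calc ‖z - p‖ = 4 / A * (A / 4 * ‖z - p‖) := by field_simp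
      _ ≤ _ := by gcongr
  refine h1.trans_isLittleO ?_
  have h2 : wave A =o[𝓝[upper] (p : ℂ)] fun _ => (1 : ℂ) :=
    (isLittleO_one_iff ℂ).2 (tendsto_wave_branch hA hp)
  exact (h2.mul_isBigO (isBigO_refl (wave A) _)).congr_right fun z => one_mul _

/-- To first order β moves with k: (β_z - β_p)(1 - 2ik) = 2i(pA)k + A(z - p), where |pA| = 1 and A|z
- p| ≤ 4|k|² is negligible. -/
theorem eventually_norm_wave_le (hA : 0 < A) (hp : |p| = 1 / A) :
    ∀ᶠ z in 𝓝[upper] (p : ℂ), ‖wave A z‖ ≤ ‖beta A z - beta A p‖ := by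
  have hβ : beta A (p : ℂ) = p * A := by rw [beta_eq, wave_branch hA hp]; simp
  have hpA : ‖(p : ℂ) * A‖ = 1 := by
    rw [norm_mul, Complex.norm_real, Complex.norm_real, Real.norm_eq_abs, hp,
      Real.norm_of_nonneg hA.le]
    field_simp
  have hsmall : ∀ᶠ z in 𝓝[upper] (p : ℂ), ‖wave A z‖ < 1 / 8 := by
    have := (tendsto_wave_branch hA hp).norm
    rw [norm_zero] at this
    exact this.eventually (gt_mem_nhds (by norm_num))
  filter_upwards [eventually_norm_sub_le hA hp, hsmall, self_mem_nhdsWithin] with z h1 h2 hz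
  have h3 : (beta A z - beta A p) * (1 - 2 * Complex.I * wave A z) =
      2 * Complex.I * (p * A) * wave A z + A * (z - p) := by
    rw [hβ]
    linear_combination beta_mul hA (upper_subset_closedUpper hz)
  have h4 := congrArg norm h3
  rw [norm_mul] at h4
  have h5 : ‖2 * Complex.I * (p * A) * wave A z‖ = 2 * ‖wave A z‖ := by
    rw [norm_mul, norm_mul, norm_mul, hpA, Complex.norm_I, Complex.norm_ofNat]; ring
  have h6 : ‖(A : ℂ) * (z - p)‖ = A * ‖z - p‖ := by
    rw [norm_mul, Complex.norm_real, Real.norm_of_nonneg hA.le]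
  have h7 := norm_sub_le_norm_add (2 * Complex.I * (p * A) * wave A z) ((A : ℂ) * (z - p))
  have h8 : ‖1 - 2 * Complex.I * wave A z‖ ≤ 5 / 4 := by
    refine (norm_sub_le _ _).trans ?_
    rw [norm_mul, norm_mul, Complex.norm_I, Complex.norm_ofNat, norm_one]
    linarith
  have h9 := mul_le_mul_of_nonneg_left h8 (norm_nonneg (beta A z - beta A p))
  have h10 : ‖wave A z‖ ^ 2 ≤ ‖wave A z‖ * (1 / 8) := by
    rw [sq]; exact mul_le_mul_of_nonneg_left h2.le (norm_nonneg _)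
  linarith [norm_nonneg (wave A z)]

theorem norm_colDet_le (v w : Fin 2 → ℂ) : ‖colDet v w‖ ≤ 2 * ‖v‖ * ‖w‖ := by
  rw [colDet]
  refine (norm_sub_le _ _).trans ?_
  rw [norm_mul, norm_mul]
  have h1 := mul_le_mul (norm_le_pi_norm v 0) (norm_le_pi_norm w 1) (norm_nonneg _) (norm_nonneg _)
  have h2 := mul_le_mul (norm_le_pi_norm w 0) (norm_le_pi_norm v 1) (norm_nonneg _) (norm_nonneg _)
  linarith

/-- Far to the right the Jost amplitudes at a branch point and next to it are independent, with a
determinant of the order of `k`. -/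
theorem exists_isBigO_colDet_jostAmp (hm : RightProfile A m) (hp : |p| = 1 / A) :
    ∃ x, wave A =O[𝓝[upper] (p : ℂ)] fun z => colDet (jostAmp A m x p) (jostAmp A m x z) := by
  have hA := hm.pos
  have hR : 0 ≤ |p| + 1 := by positivity
  obtain ⟨C, hC0, hC⟩ := norm_jostAmp_sub_le hm hR 0
  obtain ⟨H, hH0, hH⟩ := norm_jostAmp_le hm hR 0
  have hε := tendsto_integral_Ioi_atTop (fun x => hm.integrableOn_sq x)
  have h0 : Tendsto (fun x => ‖jostAmp A m x (p : ℂ) 0‖) atTop (𝓝 1) := by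
    have := ((tendsto_pi_nhds.1 (tendsto_jostAmp hm (ofReal_mem_closedUpper p))) 0).norm
    simpa [eigvec] using this
  have hε2 := hε.const_mul (2 * H * (C * 2))
  rw [mul_zero] at hε2
  -- The point x is taken so far right that the main term is at least |k|/2 and the error,
  -- controlled by the tail of the second moment, at most |k|/4.
  obtain ⟨x, hx0, hx1, hx2⟩ := ((eventually_ge_atTop (0 : ℝ)).and
    ((h0.eventually (lt_mem_nhds (show (1 / 2 : ℝ) < 1 by norm_num))).and
      (hε2.eventually (gt_mem_nhds (show (0 : ℝ) < 1 / 4 by norm_num))))).exists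
  refine ⟨x, IsBigO.of_bound 4 ?_⟩
  filter_upwards [eventually_mem_halfDisk p, eventually_norm_wave_le hA hp,
    (isLittleO_sub_wave hA hp).bound one_pos] with z hz h1 h2
  have h3 := hC z hz p (ofReal_mem_halfDisk p) x hx0
  have h4 := hH p (ofReal_mem_halfDisk p) x hx0
  rw [wave_branch hA hp, sub_zero] at h3
  set E := jostAmp A m x z - jostAmp A m x p - (eigvec A z - eigvec A p) with hE
  set ε := ∫ ξ in Ioi x, (1 + |ξ|) ^ 2 * |m ξ - A| with hεdef
  have hε0 : 0 ≤ ε := setIntegral_nonneg measurableSet_Ioi fun ξ _ => by positivity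
  have e : colDet (jostAmp A m x p) (jostAmp A m x z) =
      jostAmp A m x p 0 * (beta A z - beta A p) + colDet (jostAmp A m x p) E := by
    have hE0 : E 0 = jostAmp A m x z 0 - jostAmp A m x p 0 - (1 - 1) := rfl
    have hE1 : E 1 = jostAmp A m x z 1 - jostAmp A m x p 1 - (beta A z - beta A p) := rfl
    rw [colDet, colDet, hE0, hE1]; ring
  have h5 := norm_colDet_le (jostAmp A m x p) E
  have h6 : 2 * ‖jostAmp A m x (p : ℂ)‖ * ‖E‖ ≤ 1 / 4 * ‖wave A z‖ := by
    have h7 : ‖E‖ ≤ C * (2 * ‖wave A z‖) * ε := h3.trans (by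
      have : ‖z - p‖ + ‖wave A z‖ ≤ 2 * ‖wave A z‖ := by linarith
      gcongr)
    calc 2 * ‖jostAmp A m x (p : ℂ)‖ * ‖E‖ ≤ 2 * H * (C * (2 * ‖wave A z‖) * ε) := by gcongr
      _ = 2 * H * (C * 2) * ε * ‖wave A z‖ := by ring
      _ ≤ _ := mul_le_mul_of_nonneg_right hx2.le (norm_nonneg _)
  have h8 := norm_sub_le_norm_add (jostAmp A m x p 0 * (beta A z - beta A p))
    (colDet (jostAmp A m x p) E)
  rw [← e, norm_mul] at h8
  have h9 := mul_le_mul hx1.le h1 (norm_nonneg _) (norm_nonneg _)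
  linarith

/-- The Wronskian vanishes at most like `k` at the branch points of the right background. -/
theorem isBigO_wave_wronskian {A₁ A₂ : ℝ} (hm : StepProfile A₁ A₂ m) (hp : |p| = 1 / A₂) :
    wave A₂ =O[𝓝[upper] (p : ℂ)] wronskian A₁ A₂ m := by
  have hz := ofReal_mem_closedUpper p
  have hA := hm.right.pos
  by_cases hW : wronskian A₁ A₂ m p = 0
  swap
  · have hc := ((continuousOn_wronskian hm) _ hz).mono upper_subset_closedUpper
    have h1 : (fun z => wave A₂ z / wronskian A₁ A₂ m z) =O[𝓝[upper] (p : ℂ)]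
        fun _ => (1 : ℂ) :=
      ((tendsto_wave_branch hA hp).div hc.tendsto hW).isBigO_one ℂ
    refine (h1.mul (isBigO_refl (wronskian A₁ A₂ m) _)).congr' ?_ (Eventually.of_forall fun z =>
      one_mul _)
    filter_upwards [self_mem_nhdsWithin] with z hz
    exact div_mul_cancel₀ _ (wronskian_ne_zero_of_upper hm hz)
  -- At a zero of the Wronskian the left solution at p is a multiple of the right one. Freezing the
  -- left solution at p gives a determinant of order at least k, and the correction is O(z - p) =
  -- o(k), since p is a regular point of the left background.
  · obtain ⟨x, hx⟩ := exists_isBigO_colDet_jostAmp hm.right hp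
    obtain ⟨c, hc⟩ := exists_smul_of_colDet_eq_zero (jostR_ne_zero hm.right hz x)
      ((wronskian_eq hm hz x).trans hW)
    have hc0 : c ≠ 0 := fun h => jostL_ne_zero hm.left hz x (by rw [hc, h, zero_smul])
    have hχ : jostR A₂ m x p = jostAmp A₂ m x p := by
      rw [jostR, wave_branch hA hp]; simp
    have hw : Tendsto (fun z => Complex.exp (-(Complex.I * wave A₂ z * x))) (𝓝[upper] (p : ℂ))
        (𝓝 (Complex.exp (-(Complex.I * 0 * x)))) :=
      ((((tendsto_wave_branch hA hp).const_mul Complex.I).mul_const _).neg).cexp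
    have h1 : wave A₂ =O[𝓝[upper] (p : ℂ)] fun z => colDet (jostL A₁ m x p) (jostR A₂ m x z) := by
      refine hx.trans ?_
      have h2 := (hw.isBigO_one ℂ).mul (isBigO_refl
        (fun z => colDet (jostL A₁ m x p) (jostR A₂ m x z)) (𝓝[upper] (p : ℂ)))
      refine (h2.const_mul_left c⁻¹).congr (fun z => ?_) fun z => one_mul _
      have he : Complex.exp (-(Complex.I * wave A₂ z * x)) *
          Complex.exp (Complex.I * wave A₂ z * x) = 1 := by rw [← Complex.exp_add]; simp
      rw [hc, hχ, jostR, colDet_smul_smul]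
      field_simp
      linear_combination colDet (jostAmp A₂ m x p) (jostAmp A₂ m x z) * he
    have h3 : (fun z => colDet (jostL A₁ m x z - jostL A₁ m x p) (jostR A₂ m x z))
        =o[𝓝[upper] (p : ℂ)] wave A₂ := by
      refine IsBigO.trans_isLittleO ?_ (isLittleO_sub_wave hA hp)
      have h4 := isBigO_jostL_sub hm.left (hp.trans_lt hm.inv_lt) x
      have h5 := isBigO_sub_of_continuousOn (continuousOn_jostR hm.right x) p
      have h6 : (fun z => ‖jostL A₁ m x z - jostL A₁ m x p‖ * ‖jostR A₂ m x z‖)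
          =O[𝓝[upper] (p : ℂ)] fun z => z - p :=
        ((h4.norm_norm.mul h5.norm_norm).congr_right fun z => by simp).of_norm_right
      refine IsBigO.trans (IsBigO.of_bound 2 (Eventually.of_forall fun z => ?_)) h6
      rw [Real.norm_of_nonneg (by positivity), ← mul_assoc]
      exact norm_colDet_le _ _
    have h6 : (fun z => colDet (jostL A₁ m x p) (jostR A₂ m x z)) =O[𝓝[upper] (p : ℂ)]
        wronskian A₁ A₂ m := by
      refine ((h3.trans_isBigO h1).right_isBigO_add).congr' EventuallyEq.rfl ?_
      filter_upwards [self_mem_nhdsWithin] with z hz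
      rw [← wronskian_eq hm (upper_subset_closedUpper hz) x]
      simp [colDet]; ring
    exact h1.trans h6

theorem isBigO_rpow_of_pow_four {f : ℂ → ℂ} {l : Filter ℂ} {q : ℂ} {C : ℝ}
    (hl : ∀ᶠ z in l, z ≠ q) (h : ∀ᶠ z in l, ‖f z‖ ^ 4 * ‖z - q‖ ≤ C) :
    f =O[l] fun z => ‖z - q‖ ^ (-(1 / 4) : ℝ) := by
  refine IsBigO.of_bound (1 + |C|) ?_
  filter_upwards [hl, h] with z h1 h2
  have hd : 0 < ‖z - q‖ := norm_pos_iff.2 (sub_ne_zero.2 h1)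
  rw [Real.norm_of_nonneg (by positivity)]
  refine le_of_pow_le_pow_left₀ (n := 4) (by norm_num) (by positivity) ?_
  have h3 : (‖z - q‖ ^ (-(1 / 4) : ℝ)) ^ 4 = ‖z - q‖⁻¹ := by
    rw [← Real.rpow_natCast, ← Real.rpow_mul hd.le, ← Real.rpow_neg_one]; norm_num
  rw [mul_pow, h3, ← div_eq_mul_inv, le_div_iff₀ hd]
  have h4 : (1 : ℝ) + |C| ≤ (1 + |C|) ^ 4 := le_self_pow₀ (by linarith [abs_nonneg C]) (by norm_num)
  linarith [le_abs_self C]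

theorem eventually_ne_of_upper (p : ℝ) : ∀ᶠ z : ℂ in 𝓝[upper] (p : ℂ), z ≠ p := by
  filter_upwards [self_mem_nhdsWithin] with z hz h
  rw [h] at hz
  exact lt_irrefl (0 : ℝ) (by simpa [upper] using hz)

theorem norm_alpha_sq {z : ℂ} (hk : wave A z ≠ 0) :
    4 * ‖wave A z‖ * ‖alpha A z‖ ^ 2 = ‖1 - 2 * Complex.I * wave A z‖ := by
  have h := congrArg norm (alpha_sq hk)
  rw [norm_mul, norm_mul, norm_mul, Complex.norm_I, Complex.norm_ofNat, norm_pow] at h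
  linarith

theorem isBigO_one_rpow (p : ℝ) :
    (fun _ : ℂ => (1 : ℝ)) =O[𝓝[upper] (p : ℂ)] fun z => ‖z - p‖ ^ (-(1 / 4) : ℝ) := by
  have h : Metric.ball (p : ℂ) 1 ∈ 𝓝 (p : ℂ) := Metric.ball_mem_nhds _ one_pos
  refine IsBigO.of_bound 1 ?_
  filter_upwards [eventually_ne_of_upper p, nhdsWithin_le_nhds h] with z h1 h2
  rw [mem_ball_iff_norm] at h2
  have hd : 0 < ‖z - p‖ := norm_pos_iff.2 (sub_ne_zero.2 h1)
  rw [norm_one, Real.norm_of_nonneg (by positivity), one_mul]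
  exact Real.one_le_rpow_of_pos_of_le_one_of_nonpos hd h2.le (by norm_num)

/-- By `alpha_sq` the product kα² stays bounded, and |k|² is at least a multiple of |z - p|;
together these give the fourth root. -/
theorem isBigO_alpha (hA : 0 < A) (hp : |p| = 1 / A) :
    alpha A =O[𝓝[upper] (p : ℂ)] fun z => ‖z - p‖ ^ (-(1 / 4) : ℝ) := by
  have hsmall : ∀ᶠ z in 𝓝[upper] (p : ℂ), ‖wave A z‖ < 1 := by
    have := (tendsto_wave_branch hA hp).norm
    rw [norm_zero] at this
    exact this.eventually (gt_mem_nhds (by norm_num))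
  refine isBigO_rpow_of_pow_four (C := 4 / A) (eventually_ne_of_upper p) ?_
  filter_upwards [eventually_norm_sub_le hA hp, hsmall, self_mem_nhdsWithin] with z h1 h2 hz
  have hk := wave_ne_zero_of_upper hA hz
  have h3 := norm_alpha_sq hk
  have h4 : ‖1 - 2 * Complex.I * wave A z‖ ≤ 4 := by
    refine (norm_sub_le _ _).trans ?_
    rw [norm_mul, norm_mul, Complex.norm_I, Complex.norm_ofNat, norm_one]
    linarith
  rw [le_div_iff₀ hA]
  have h5 : (‖wave A z‖ * ‖alpha A z‖ ^ 2) ^ 2 ≤ 1 := by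
    rw [sq_le_one_iff₀ (by positivity)]; linarith
  calc ‖alpha A z‖ ^ 4 * ‖z - p‖ * A = 4 * (‖alpha A z‖ ^ 4 * (A / 4 * ‖z - p‖)) := by ring
    _ ≤ 4 * (‖alpha A z‖ ^ 4 * ‖wave A z‖ ^ 2) := by gcongr
    _ = 4 * (‖wave A z‖ * ‖alpha A z‖ ^ 2) ^ 2 := by ring
    _ ≤ 4 := by linarith

/-- The product kα² is also bounded below, so |αk| is at least a multiple of |k|^{1/2}. With the
lower bound on the Wronskian this controls 1/(αW). -/
theorem isBigO_inv_alpha_mul_wave (hA : 0 < A) (hp : |p| = 1 / A) :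
    (fun z => (alpha A z * wave A z)⁻¹) =O[𝓝[upper] (p : ℂ)]
      fun z => ‖z - p‖ ^ (-(1 / 4) : ℝ) := by
  refine isBigO_rpow_of_pow_four (C := 64 / A) (eventually_ne_of_upper p) ?_
  filter_upwards [eventually_norm_sub_le hA hp, self_mem_nhdsWithin] with z h1 hz
  have hk := wave_ne_zero_of_upper hA hz
  have h3 := norm_alpha_sq hk
  have h4 := one_le_norm_one_sub_wave hA (upper_subset_closedUpper hz)
  have hk0 : 0 < ‖wave A z‖ := norm_pos_iff.2 hk
  have ha0 : 0 < ‖alpha A z‖ := norm_pos_iff.2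
    (alpha_ne_zero (wave_im_nonneg hA (upper_subset_closedUpper hz)))
  rw [norm_inv, norm_mul, inv_pow, inv_mul_le_iff₀ (by positivity), mul_comm, mul_comm (64 / A)]
  have h5 : (1 / 4 : ℝ) ^ 2 ≤ (‖wave A z‖ * ‖alpha A z‖ ^ 2) ^ 2 :=
    pow_le_pow_left₀ (by norm_num) (by linarith) 2
  have h6 : ‖z - p‖ ≤ 4 / A * ‖wave A z‖ ^ 2 := by
    calc ‖z - p‖ = 4 / A * (A / 4 * ‖z - p‖) := by field_simp
      _ ≤ _ := by gcongr
  refine h6.trans ?_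
  calc 4 / A * ‖wave A z‖ ^ 2 = (1 / 4 : ℝ) ^ 2 * (‖wave A z‖ ^ 2 * (64 / A)) := by ring
    _ ≤ (‖wave A z‖ * ‖alpha A z‖ ^ 2) ^ 2 * (‖wave A z‖ ^ 2 * (64 / A)) := by gcongr
    _ = _ := by ring

/-- `rhCore` has at most fourth-root singularities. -/
theorem isBigO_rhCore_branch {A₁ A₂ : ℝ} (hm : StepProfile A₁ A₂ m)
    (hp : |p| = 1 / A₁ ∨ |p| = 1 / A₂) (x y : ℝ) (i j : Fin 2) :
    (fun z => rhCore A₁ A₂ m x y z i j) =O[𝓝[upper] (p : ℂ)]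
      fun z => ‖z - p‖ ^ (-(1 / 4) : ℝ) := by
  have hz := ofReal_mem_closedUpper p
  have hA := hm.right.pos
  have hf : ContinuousOn (fun z => fHat A₂ y 0 z) closedUpper := by
    simp only [fHat_zero]
    have := continuousOn_wave A₂
    fun_prop
  have hL := isBigO_sub_of_continuousOn (hf.cexp.mul
    ((continuousOn_pi.1 (continuousOn_jostL hm.left x)) i)) p
  have hRt := isBigO_sub_of_continuousOn (hf.neg.cexp.mul
    ((continuousOn_pi.1 (continuousOn_jostR hm.right x)) i)) p
  have hα : (alpha A₂ =O[𝓝[upper] (p : ℂ)] fun z => ‖z - p‖ ^ (-(1 / 4) : ℝ)) ∧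
      (fun z => (alpha A₂ z * wronskian A₁ A₂ m z)⁻¹) =O[𝓝[upper] (p : ℂ)]
        fun z => ‖z - p‖ ^ (-(1 / 4) : ℝ) := by
    rcases hp with hp | hp
    -- At ±1/A₁ `rhCore` stays bounded: the factor α of the left background has cancelled between
    -- Ψ₁⁽¹⁾ and c₁₁, and the rest is continuous with nonvanishing Wronskian.
    · have h2 : 1 / A₂ < |p| := hp ▸ hm.inv_lt
      have hk := wave_ne_zero_ofReal hA h2.ne'
      have hα := ((continuousOn_alpha hA) _ ⟨hz, hk⟩).mono
        (s := upper) fun z hz => ⟨upper_subset_closedUpper hz, wave_ne_zero_of_upper hA hz⟩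
      have hW := ((continuousOn_wronskian hm) _ hz).mono upper_subset_closedUpper
      refine ⟨(hα.tendsto.isBigO_one ℝ).trans (isBigO_one_rpow p),
        (((hα.mul hW).inv₀ (mul_ne_zero (alpha_ne_zero (wave_im_nonneg hA hz))
          (wronskian_ne_zero_of_lt hm h2))).tendsto.isBigO_one ℝ).trans (isBigO_one_rpow p)⟩
    · refine ⟨isBigO_alpha hA hp, ?_⟩
      have h1 : (fun z => wave A₂ z / wronskian A₁ A₂ m z) =O[𝓝[upper] (p : ℂ)]
          fun _ => (1 : ℝ) := by
        obtain ⟨c, hc⟩ := (isBigO_wave_wronskian hm hp).bound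
        refine IsBigO.of_bound c ?_
        filter_upwards [hc, self_mem_nhdsWithin] with z h1 h2
        have := norm_pos_iff.2 (wronskian_ne_zero_of_upper hm h2)
        rw [norm_div, norm_one, mul_one, div_le_iff₀ this]
        exact h1
      refine (h1.mul (isBigO_inv_alpha_mul_wave hA hp)).congr' ?_
        (Eventually.of_forall fun z => one_mul _)
      filter_upwards [self_mem_nhdsWithin] with z h2
      have := wave_ne_zero_of_upper hA h2
      rw [mul_inv, mul_inv]
      field_simp
  fin_cases j
  · refine (hL.mul hα.2).congr (fun z => ?_) fun z => one_mul _
    rw [← div_eq_mul_inv]; rfl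
  · refine (hRt.mul hα.1).congr (fun z => ?_) fun z => one_mul _
    change Complex.exp (-fHat A₂ y 0 z) * jostR A₂ m x z i * alpha A₂ z =
      Complex.exp (-fHat A₂ y 0 z) * (alpha A₂ z * jostR A₂ m x z i)
    ring

end Branch

end MCH

end

/-! ### The local wave number, and estimates for large z. -/

noncomputable section

namespace MCH

section LocalWave

variable {A : ℝ} {m : ℝ → ℝ} {z : ℂ}

theorem RightProfile.tendsto_atTop (hm : RightProfile A m) : Tendsto m atTop (𝓝 A) := by
  have h := tendsto_zero_of_hasDerivAt_of_integrableOn_Ioi (a := 0) (f := fun x => m x - A)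
    (f' := deriv m) (fun x _ => (hm.differentiable x).hasDerivAt.sub_const A)
    hm.integrable_deriv.integrableOn (hm.integrableOn_sub 0)
  simpa using h.add_const A

theorem RightProfile.exists_lower (hm : RightProfile A m) : ∃ c, 0 < c ∧ c ≤ A ∧ ∀ x, c ≤ m x := by
  obtain ⟨c, hc, hl⟩ := hm.lower
  exact ⟨c, hc, ge_of_tendsto' hm.tendsto_atTop hl, hl⟩

/-- The wave number depends continuously on the background. -/
theorem continuousAt_wave_left {b : ℝ} (hb : 0 < b) (hz : z ∈ upper) :
    ContinuousAt (fun a : ℝ => wave a z) b := by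
  have hk := wave_im_pos hb hz
  have hlim : Tendsto (fun a : ℝ => |a ^ 2 - b ^ 2| * ‖z‖ ^ 2 / 4 / (wave b z).im) (𝓝 b) (𝓝 0) := by
    have : ContinuousAt (fun a : ℝ => |a ^ 2 - b ^ 2| * ‖z‖ ^ 2 / 4 / (wave b z).im) b := by
      fun_prop
    simpa [ContinuousAt] using this
  rw [ContinuousAt, tendsto_iff_norm_sub_tendsto_zero]
  refine squeeze_zero' (Eventually.of_forall fun a => norm_nonneg _) ?_ hlim
  filter_upwards [lt_mem_nhds hb] with a ha
  have hka := wave_im_pos ha hz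
  have h1 : (wave a z - wave b z) * (wave a z + wave b z) =
      ((a ^ 2 - b ^ 2 : ℝ) : ℂ) * z ^ 2 / 4 := by
    push_cast
    linear_combination (wave_sq ha z - wave_sq hb z) / 4
  have h2 := congrArg norm h1
  rw [norm_mul, norm_div, norm_mul, norm_pow, Complex.norm_real, Complex.norm_ofNat,
    Real.norm_eq_abs] at h2
  rw [le_div_iff₀ hk, ← h2]
  refine mul_le_mul_of_nonneg_left ?_ (norm_nonneg _)
  refine le_trans ?_ (Complex.im_le_norm _)
  rw [Complex.add_im]; linarith

/-- The slope of f is that of f² divided by f(y) + f(x), so a continuous square root is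
differentiable wherever it does not vanish; no branch has to be differentiated in A. -/
theorem hasDerivAt_of_sq {f g : ℝ → ℂ} {g' : ℂ} {x : ℝ} (hf : ContinuousAt f x)
    (hfg : ∀ y, f y ^ 2 = g y) (hg : HasDerivAt g g' x) (h0 : f x ≠ 0) :
    HasDerivAt f (g' / (2 * f x)) x := by
  rw [hasDerivAt_iff_tendsto_slope] at hg ⊢
  have h1 : Tendsto (fun y => f y + f x) (𝓝[≠] x) (𝓝 (2 * f x)) := by
    rw [two_mul]
    exact (hf.tendsto.mono_left nhdsWithin_le_nhds).add_const _
  have h2 : (2 * f x) ≠ 0 := by simpa using h0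
  refine (hg.div h1 h2).congr' ?_
  filter_upwards [h1.eventually_ne h2] with y hy
  rw [Pi.div_apply, slope_def_module, slope_def_module, ← hfg, ← hfg, div_eq_iff hy,
    Complex.real_smul, Complex.real_smul]
  ring

theorem continuous_localWave (hm : RightProfile A m) (hz : z ∈ upper) :
    Continuous fun x => wave (m x) z :=
  continuous_iff_continuousAt.2 fun x => ContinuousAt.comp (f := m)
    (continuousAt_wave_left (hm.pos_apply x) hz) hm.continuous.continuousAt

theorem hasDerivAt_localWave (hm : RightProfile A m) (hz : z ∈ upper) (x : ℝ) :
    HasDerivAt (fun x => wave (m x) z) (m x * deriv m x * z ^ 2 / (4 * wave (m x) z)) x := by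
  have hd := (hm.differentiable x).hasDerivAt.ofReal_comp
  have hg : HasDerivAt (fun x => ((m x : ℂ) ^ 2 * z ^ 2 - 1) / 4)
      (m x * deriv m x * z ^ 2 / 2) x := by
    refine ((((hd.pow 2).mul_const (z ^ 2)).sub_const 1).div_const 4).congr_deriv ?_
    push_cast; ring
  refine (hasDerivAt_of_sq (f := fun x => wave (m x) z)
    (continuous_localWave hm hz).continuousAt (fun y => ?_) hg
    (wave_ne_zero_of_upper (hm.pos_apply x) hz)).congr_deriv ?_
  · linear_combination wave_sq (hm.pos_apply y) z / 4
  · rw [div_div]; ring_nf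

/-- The factor 1/k is essential: the local eigenvector turns at a rate O(|m'|/|z|), integrable in x
and small for large z. -/
theorem hasDerivAt_localBeta (hm : RightProfile A m) (hz : z ∈ upper) (x : ℝ) :
    HasDerivAt (fun x => beta (m x) z)
      (Complex.I * beta (m x) z * deriv m x / (2 * wave (m x) z * m x)) x := by
  have hd := (hm.differentiable x).hasDerivAt.ofReal_comp
  have hk := hasDerivAt_localWave hm hz x
  have hp := hm.pos_apply x
  have hk0 := wave_ne_zero_of_upper hp hz
  have h0 := one_sub_wave_ne_zero hp (upper_subset_closedUpper hz)
  have hm0 : (m x : ℂ) ≠ 0 := Complex.ofReal_ne_zero.2 hp.ne'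
  have e : (fun x => beta (m x) z) = fun x => z * m x / (1 - 2 * Complex.I * wave (m x) z) :=
    funext fun x => beta_eq _ _
  have hs := wave_sq hp z
  rw [e, beta_eq]
  refine ((hd.const_mul z).div ((hk.const_mul (2 * Complex.I)).const_sub 1) h0).congr_deriv ?_
  field_simp
  linear_combination (-(4 * z * ((deriv m x : ℝ) : ℂ) * Complex.I)) * hs +
    (8 * z * ((deriv m x : ℝ) : ℂ) * wave (m x) z) * Complex.I_sq

end LocalWave

section LargeSpectral

variable {a c : ℝ} {z : ℂ}

/-- The threshold 32 ≤ c‖z‖, with c a common lower bound of the backgrounds, is shared by all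
large-z estimates and makes them uniform in x when a = m(x). -/
theorem norm_lRoot_sub_le_of_le (hc : 0 < c) (ha : c ≤ a) (hz : z ∈ upper)
    (hR : 32 ≤ c * ‖z‖) : ‖lRoot a z - z‖ ≤ ‖z‖ / 2 := by
  have hz0 : 0 < ‖z‖ := pos_of_mul_pos_right (by linarith) hc.le
  have ha0 := hc.trans_le ha
  refine (norm_lRoot_sub_le ha0 hz).trans ?_
  rw [div_le_iff₀ (by positivity)]
  have h1 : 32 ≤ a * ‖z‖ := hR.trans (by gcongr)
  nlinarith

theorem le_norm_wave (hc : 0 < c) (ha : c ≤ a) (hz : z ∈ upper) (hR : 32 ≤ c * ‖z‖) :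
    c * ‖z‖ / 4 ≤ ‖wave a z‖ := by
  have h1 := norm_lRoot_sub_le_of_le hc ha hz hR
  have h2 : ‖z‖ / 2 ≤ ‖lRoot a z‖ := by
    have := norm_sub_norm_le z (lRoot a z)
    rw [norm_sub_rev] at this
    linarith
  have ha0 := hc.trans_le ha
  rw [wave, norm_div, norm_mul, Complex.norm_real, Real.norm_of_nonneg ha0.le, Complex.norm_ofNat]
  have := mul_le_mul ha h2 (by positivity) ha0.le
  linarith

theorem norm_beta_sub_I_le (hc : 0 < c) (ha : c ≤ a) (hz : z ∈ upper) (hR : 32 ≤ c * ‖z‖) :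
    ‖beta a z - Complex.I‖ ≤ 8 / (c * ‖z‖) := by
  have ha0 := hc.trans_le ha
  have hz0 : 0 < ‖z‖ := pos_of_mul_pos_right (by linarith) hc.le
  have h1 := le_norm_wave hc ha hz hR
  have h2 : (beta a z - Complex.I) * (1 - 2 * Complex.I * wave a z) =
      -(a * (lRoot a z - z)) - Complex.I := by
    have h3 : 2 * wave a z = a * lRoot a z := by rw [wave]; ring
    linear_combination beta_mul ha0 (upper_subset_closedUpper hz) - h3 +
      2 * wave a z * Complex.I_sq
  have h4 : ‖-((a : ℂ) * (lRoot a z - z)) - Complex.I‖ ≤ 2 := by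
    refine (norm_sub_le _ _).trans ?_
    rw [norm_neg, norm_mul, Complex.norm_I, Complex.norm_real, Real.norm_of_nonneg ha0.le]
    have h5 := mul_le_mul_of_nonneg_left (norm_lRoot_sub_le ha0 hz) ha0.le
    have h6 : a * (1 / (a ^ 2 * ‖z‖)) = 1 / (a * ‖z‖) := by field_simp
    have h7 : 1 / (a * ‖z‖) ≤ 1 := by
      rw [div_le_one (by positivity)]
      have : c * ‖z‖ ≤ a * ‖z‖ := by gcongr
      linarith
    linarith
  have h8 : c * ‖z‖ / 4 ≤ ‖1 - 2 * Complex.I * wave a z‖ := by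
    have h9 := norm_sub_norm_le (2 * Complex.I * wave a z) 1
    rw [norm_mul, norm_mul, Complex.norm_I, Complex.norm_ofNat, norm_one, norm_sub_rev] at h9
    linarith
  have h10 := congrArg norm h2
  rw [norm_mul] at h10
  rw [le_div_iff₀ (by positivity)]
  have h11 := mul_le_mul_of_nonneg_left h8 (norm_nonneg (beta a z - Complex.I))
  linarith

theorem norm_beta_le_two (hc : 0 < c) (ha : c ≤ a) (hz : z ∈ upper) (hR : 32 ≤ c * ‖z‖) :
    ‖beta a z - Complex.I‖ ≤ 1 / 4 ∧ ‖beta a z‖ ≤ 2 ∧ 1 ≤ ‖beta a z ^ 2 - 1‖ := by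
  have h1 : ‖beta a z - Complex.I‖ ≤ 1 / 4 := by
    refine (norm_beta_sub_I_le hc ha hz hR).trans ?_
    rw [div_le_div_iff₀ (by linarith) (by norm_num)]; linarith
  have h2 : ‖beta a z + Complex.I‖ ≤ 9 / 4 := by
    have := norm_add_le (beta a z - Complex.I) (2 * Complex.I)
    rw [norm_mul, Complex.norm_I, Complex.norm_ofNat,
      show beta a z - Complex.I + 2 * Complex.I = beta a z + Complex.I by ring] at this
    linarith
  refine ⟨h1, ?_, ?_⟩
  · have := norm_add_le (beta a z - Complex.I) Complex.I
    rw [Complex.norm_I, sub_add_cancel] at this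
    linarith
  · have h3 := norm_sub_norm_le (2 : ℂ) ((beta a z - Complex.I) * (beta a z + Complex.I))
    have h4 : (2 : ℂ) - (beta a z - Complex.I) * (beta a z + Complex.I) = -(beta a z ^ 2 - 1) := by
      linear_combination Complex.I_sq
    rw [h4, norm_neg, norm_mul, Complex.norm_ofNat] at h3
    have h5 := mul_le_mul h1 h2 (norm_nonneg _) (by norm_num)
    linarith

/-- Both terms have the same leading part az/2; the difference is (a/2)(l_a - l_A), and (l_a -
l_A)(l_a + l_A) = 1/A² - 1/a² with |l_a + l_A| ≥ |z|. Hence the local phase is k·y(x) up to an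
integrable O(1/z) error. -/
theorem norm_wave_sub_mul_le {A : ℝ} (hc : 0 < c) (ha : c ≤ a) (hA : c ≤ A) (hz : z ∈ upper)
    (hR : 32 ≤ c * ‖z‖) :
    ‖wave a z - wave A z * a / A‖ ≤ 1 / (c ^ 2 * ‖z‖) * |a - A| := by
  have ha0 := hc.trans_le ha
  have hA0 := hc.trans_le hA
  have hz0 : 0 < ‖z‖ := pos_of_mul_pos_right (by linarith) hc.le
  have hAc : (A : ℂ) ≠ 0 := Complex.ofReal_ne_zero.2 hA0.ne'
  have hac : (a : ℂ) ≠ 0 := Complex.ofReal_ne_zero.2 ha0.ne'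
  have h1 : (wave a z - wave A z * a / A) * (lRoot a z + lRoot A z) =
      (((a - A) * (a + A) / (2 * A ^ 2 * a) : ℝ) : ℂ) := by
    have h3 : wave a z - wave A z * a / A = a / 2 * (lRoot a z - lRoot A z) := by
      rw [wave, wave]; field_simp
    rw [h3]
    have h4 : ((a - A) * (a + A) / (2 * A ^ 2 * a) : ℝ) =
        (a : ℂ) / 2 * (1 / (A : ℂ) ^ 2 - 1 / (a : ℂ) ^ 2) := by
      push_cast; field_simp; ring
    rw [h4]
    linear_combination (a : ℂ) / 2 * (lRoot_sq a z - lRoot_sq A z)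
  have h5 : ‖z‖ ≤ ‖lRoot a z + lRoot A z‖ := by
    have h6 := norm_lRoot_sub_le_of_le hc ha hz hR
    have h7 := norm_lRoot_sub_le_of_le hc hA hz hR
    have h8 := norm_sub_norm_le (2 * z) (-((lRoot a z - z) + (lRoot A z - z)))
    rw [norm_neg, norm_mul, Complex.norm_ofNat, show 2 * z - -((lRoot a z - z) + (lRoot A z - z)) =
      lRoot a z + lRoot A z by ring] at h8
    linarith [norm_add_le (lRoot a z - z) (lRoot A z - z)]
  have h9 := congrArg norm h1
  rw [norm_mul, Complex.norm_real, Real.norm_eq_abs, abs_div, abs_mul,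
    abs_of_pos (show 0 < a + A by positivity),
    abs_of_pos (show 0 < 2 * A ^ 2 * a by positivity)] at h9
  have h10 := mul_le_mul_of_nonneg_left h5 (norm_nonneg (wave a z - wave A z * a / A))
  have h11 : (a + A) / (2 * A ^ 2 * a) ≤ 1 / c ^ 2 := by
    rw [div_le_div_iff₀ (by positivity) (by positivity)]
    have e1 : c ^ 2 ≤ A ^ 2 := pow_le_pow_left₀ hc.le hA 2
    have e2 : A * c ^ 2 ≤ A * (A * a) := by
      rw [sq]; gcongr
    have e3 := mul_le_mul_of_nonneg_left e1 ha0.le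
    linarith
  have h12 : |a - A| * (a + A) / (2 * A ^ 2 * a) ≤ 1 / c ^ 2 * |a - A| := by
    rw [mul_div_assoc, mul_comm]
    exact mul_le_mul_of_nonneg_right h11 (abs_nonneg _)
  have h13 : 1 / (c ^ 2 * ‖z‖) * |a - A| = 1 / c ^ 2 * |a - A| / ‖z‖ := by field_simp
  rw [h13, le_div_iff₀ hz0]
  linarith

theorem cpow_half_re_nonneg (w : ℂ) : 0 ≤ (w ^ (1 / 2 : ℂ)).re := by
  rcases eq_or_ne w 0 with rfl | h
  · simp
  have ha := Complex.neg_pi_lt_arg w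
  have hb := Complex.arg_le_pi w
  rw [Complex.cpow_def_of_ne_zero h, Complex.exp_re]
  have h2 : (Complex.log w * (1 / 2)).im = w.arg / 2 := by
    rw [show Complex.log w * (1 / 2) = ((1 / 2 : ℝ) : ℂ) * Complex.log w by push_cast; ring,
      Complex.im_ofReal_mul, Complex.log_im]
    ring
  rw [h2]
  exact mul_nonneg (Real.exp_pos _).le (Real.cos_nonneg_of_mem_Icc ⟨by linarith, by linarith⟩)

theorem norm_alpha_sub_le {A : ℝ} (hA : 0 < A) (hz : z ∈ upper) (hR : 32 ≤ A * ‖z‖) :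
    ‖alpha A z - Real.sqrt (1 / 2) * Complex.I‖ ≤ 2 / (A * ‖z‖) := by
  have hk := (wave_im_pos hA hz).le
  have hz0 : 0 < ‖z‖ := pos_of_mul_pos_right (by linarith) hA.le
  have h1 := le_norm_wave hA le_rfl hz hR
  have h2 : (alphaRoot A z - 1) * (alphaRoot A z + 1) = Complex.I / (2 * wave A z) := by
    linear_combination alphaRoot_sq A z
  have h3 : 1 ≤ ‖alphaRoot A z + 1‖ := by
    refine le_trans ?_ (Complex.re_le_norm _)
    rw [Complex.add_re, Complex.one_re]
    have : 0 ≤ (alphaRoot A z).re := cpow_half_re_nonneg _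
    linarith
  have h4 := congrArg norm h2
  rw [norm_mul, norm_div, norm_mul, Complex.norm_I, Complex.norm_ofNat] at h4
  have h5 : ‖alphaRoot A z - 1‖ ≤ 2 / (A * ‖z‖) := by
    have h6 := mul_le_mul_of_nonneg_left h3 (norm_nonneg (alphaRoot A z - 1))
    have h7 : 1 / (2 * ‖wave A z‖) ≤ 2 / (A * ‖z‖) := by
      rw [div_le_div_iff₀ (by linarith) (by linarith)]; linarith
    linarith
  have e : alpha A z - Real.sqrt (1 / 2) * Complex.I =
      Real.sqrt (1 / 2) * Complex.I * (alphaRoot A z - 1) := by rw [alpha_eq]; ring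
  rw [e, norm_mul, norm_mul, Complex.norm_I, Complex.norm_real,
    Real.norm_of_nonneg (Real.sqrt_nonneg _), mul_one]
  have h8 : Real.sqrt (1 / 2) ≤ 1 := Real.sqrt_le_one.2 (by norm_num)
  exact (mul_le_of_le_one_left (norm_nonneg _) h8).trans h5

end LargeSpectral

end MCH

end

/-! ### Geometrical optics for the right Jost solution. -/

noncomputable section

namespace MCH

section LocalPhase

variable {A : ℝ} {m : ℝ → ℝ} {z : ℂ}

/-- The antiderivative of the local wave number that is asymptotic to `k x` at `+∞`. -/
def localPhase (A : ℝ) (m : ℝ → ℝ) (z : ℂ) (x : ℝ) : ℂ :=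
  wave A z * yOfX A m x - ∫ ξ in Ioi x, (wave (m ξ) z - wave A z * m ξ / A)

theorem continuous_phaseDefect (hm : RightProfile A m) (hz : z ∈ upper) :
    Continuous fun ξ => wave (m ξ) z - wave A z * m ξ / A := by
  have h1 := continuous_localWave hm hz
  have h2 := hm.continuous
  fun_prop

theorem integrableOn_phaseDefect (hm : RightProfile A m) {c : ℝ} (hc : 0 < c) (hA : c ≤ A)
    (hcm : ∀ x, c ≤ m x) (hz : z ∈ upper) (hR : 32 ≤ c * ‖z‖) (x : ℝ) :
    IntegrableOn (fun ξ => wave (m ξ) z - wave A z * m ξ / A) (Ioi x) :=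
  Integrable.mono' ((hm.integrableOn_sub x).norm.const_mul (1 / (c ^ 2 * ‖z‖)))
    (continuous_phaseDefect hm hz).aestronglyMeasurable
    (ae_of_all _ fun ξ => norm_wave_sub_mul_le hc (hcm ξ) hA hz hR)

theorem norm_integral_phaseDefect_le (hm : RightProfile A m) {c : ℝ} (hc : 0 < c) (hA : c ≤ A)
    (hcm : ∀ x, c ≤ m x) (hz : z ∈ upper) (hR : 32 ≤ c * ‖z‖) (x : ℝ) :
    ‖∫ ξ in Ioi x, (wave (m ξ) z - wave A z * m ξ / A)‖ ≤
      1 / (c ^ 2 * ‖z‖) * ∫ ξ in Ioi x, |m ξ - A| := by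
  rw [← integral_const_mul]
  exact norm_integral_le_of_norm_le ((hm.integrableOn_sub x).norm.const_mul _)
    (ae_of_all _ fun ξ => norm_wave_sub_mul_le hc (hcm ξ) hA hz hR)

theorem hasDerivAt_localPhase (hm : RightProfile A m) {c : ℝ} (hc : 0 < c) (hA : c ≤ A)
    (hcm : ∀ x, c ≤ m x) (hz : z ∈ upper) (hR : 32 ≤ c * ‖z‖) (x : ℝ) :
    HasDerivAt (localPhase A m z) (wave (m x) z) x := by
  have h1 := ((hasDerivAt_yOfX hm x).ofReal_comp).const_mul (wave A z)
  have h2 := hasDerivAt_integral_Ioi (continuous_phaseDefect hm hz)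
    (integrableOn_phaseDefect hm hc hA hcm hz hR) x
  refine (h1.sub h2).congr_deriv ?_
  push_cast; ring

theorem tendsto_localPhase_sub (hm : RightProfile A m) {c : ℝ} (hc : 0 < c) (hA : c ≤ A)
    (hcm : ∀ x, c ≤ m x) (hz : z ∈ upper) (hR : 32 ≤ c * ‖z‖) :
    Tendsto (fun x => localPhase A m z x - wave A z * x) atTop (𝓝 0) := by
  have h1 := tendsto_integral_Ioi_atTop (integrableOn_phaseDefect hm hc hA hcm hz hR)
  have h2 := (tendsto_integral_Ioi_atTop hm.integrableOn_sub).const_mul (1 / A)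
  have h3 := (((Complex.continuous_ofReal.tendsto _).comp h2).const_mul (-wave A z)).sub h1
  simp only [mul_zero, Complex.ofReal_zero, sub_zero] at h3
  refine h3.congr fun x => ?_
  simp only [localPhase, yOfX, Function.comp]
  push_cast; ring

/-- The derivative of the local phase is the local wave number, which has positive imaginary part.
This monotonicity controls the component that oscillates against the extracted phase. -/
theorem antitone_localPhase (hm : RightProfile A m) {c : ℝ} (hc : 0 < c) (hA : c ≤ A)
    (hcm : ∀ x, c ≤ m x) (hz : z ∈ upper) (hR : 32 ≤ c * ‖z‖) :
    Antitone fun x => ‖Complex.exp (2 * Complex.I * localPhase A m z x)‖ := by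
  have hd := hasDerivAt_localPhase hm hc hA hcm hz hR
  have hmono : Monotone fun x => (localPhase A m z x).im := by
    have hd2 : ∀ x, HasDerivAt (fun x => (localPhase A m z x).im) (wave (m x) z).im x := fun x =>
      Complex.imCLM.hasFDerivAt.comp_hasDerivAt x (hd x)
    refine monotone_of_deriv_nonneg (fun x => (hd2 x).differentiableAt) fun x => ?_
    rw [(hd2 x).deriv]
    exact (wave_im_pos (hm.pos_apply x) hz).le
  intro x y hxy
  simp only [Complex.norm_exp]
  refine Real.exp_le_exp.2 ?_
  have := hmono hxy
  simp
  exact this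

/-- The right Jost solution with the oscillating factor of geometrical optics removed. -/
def localAmp (A : ℝ) (m : ℝ → ℝ) (z : ℂ) (x : ℝ) : Fin 2 → ℂ :=
  Complex.exp (-(Complex.I * localPhase A m z x)) • jostR A m x z

theorem tendsto_localAmp (hm : RightProfile A m) {c : ℝ} (hc : 0 < c) (hA : c ≤ A)
    (hcm : ∀ x, c ≤ m x) (hz : z ∈ upper) (hR : 32 ≤ c * ‖z‖) :
    Tendsto (localAmp A m z) atTop (𝓝 (eigvec A z)) := by
  have h1 := ((tendsto_localPhase_sub hm hc hA hcm hz hR).const_mul Complex.I).neg.cexp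
  have h2 := h1.smul (tendsto_jostAmp hm (upper_subset_closedUpper hz))
  simp only [mul_zero, neg_zero, Complex.exp_zero, one_smul] at h2
  refine h2.congr fun x => ?_
  rw [localAmp, jostR, smul_smul, ← Complex.exp_add]
  congr 2
  ring

theorem hasDerivAt_localAmp (hm : RightProfile A m) {c : ℝ} (hc : 0 < c) (hA : c ≤ A)
    (hcm : ∀ x, c ≤ m x) (hz : z ∈ upper) (hR : 32 ≤ c * ‖z‖) (x : ℝ) :
    HasDerivAt (fun x => localAmp A m z x 0) (-(Complex.I * wave (m x) z * localAmp A m z x 0) +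
      (-(localAmp A m z x 0) + z * m x * localAmp A m z x 1) / 2) x ∧
    HasDerivAt (fun x => localAmp A m z x 1) (-(Complex.I * wave (m x) z * localAmp A m z x 1) +
      (-(z * m x * localAmp A m z x 0) + localAmp A m z x 1) / 2) x := by
  have hE : HasDerivAt (fun x => Complex.exp (-(Complex.I * localPhase A m z x)))
      (Complex.exp (-(Complex.I * localPhase A m z x)) * -(Complex.I * wave (m x) z)) x :=
    ((hasDerivAt_localPhase hm hc hA hcm hz hR x).const_mul Complex.I).neg.cexp
  have hL := isLaxSol_jostR hm (upper_subset_closedUpper hz)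
  constructor
  · refine (hE.mul (hL.hasDerivAt_zero x)).congr_deriv ?_
    simp only [localAmp, Pi.smul_apply, smul_eq_mul]
    ring
  · refine (hE.mul (hL.hasDerivAt_one x)).congr_deriv ?_
    simp only [localAmp, Pi.smul_apply, smul_eq_mul]
    ring

theorem continuous_localAmp (hm : RightProfile A m) {c : ℝ} (hc : 0 < c) (hA : c ≤ A)
    (hcm : ∀ x, c ≤ m x) (hz : z ∈ upper) (hR : 32 ≤ c * ‖z‖) : Continuous (localAmp A m z) := by
  have h := hasDerivAt_localAmp hm hc hA hcm hz hR
  refine continuous_pi fun i => ?_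
  fin_cases i
  · exact continuous_iff_continuousAt.2 fun x => (h x).1.continuousAt
  · exact continuous_iff_continuousAt.2 fun x => (h x).2.continuousAt

theorem norm_deriv_localBeta_le (hm : RightProfile A m) {c : ℝ} (hc : 0 < c)
    (hcm : ∀ x, c ≤ m x) (hz : z ∈ upper) (hR : 32 ≤ c * ‖z‖) (x : ℝ) :
    ‖Complex.I * beta (m x) z * deriv m x / (2 * wave (m x) z * m x)‖ ≤
      4 / (c ^ 2 * ‖z‖) * |deriv m x| := by
  have hz0 : 0 < ‖z‖ := pos_of_mul_pos_right (by linarith) hc.le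
  have h1 := (norm_beta_le_two hc (hcm x) hz hR).2.1
  have h2 := le_norm_wave hc (hcm x) hz hR
  rw [norm_div, norm_mul, norm_mul, norm_mul, norm_mul, Complex.norm_I, Complex.norm_ofNat,
    Complex.norm_real, Complex.norm_real, Real.norm_eq_abs, Real.norm_of_nonneg
    (hm.pos_apply x).le, one_mul]
  have h3 : 2 * (c * ‖z‖ / 4) * c ≤ 2 * ‖wave (m x) z‖ * m x := by
    have := hcm x
    gcongr
  calc ‖beta (m x) z‖ * |deriv m x| / (2 * ‖wave (m x) z‖ * m x)
      ≤ 2 * |deriv m x| / (2 * (c * ‖z‖ / 4) * c) := by gcongr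
    _ = _ := by field_simp

/-- Uniform asymptotics of the right Jost solution for large spectral parameter. -/
theorem exists_norm_localAmp_sub_le (hm : RightProfile A m) {c : ℝ} (hc : 0 < c) (hA : c ≤ A)
    (hcm : ∀ x, c ≤ m x) (x₀ : ℝ) : ∃ C, ∀ z ∈ upper, 32 ≤ c * ‖z‖ →
      ‖localAmp A m z x₀ 0 - 1‖ ≤ C * ‖z‖⁻¹ ∧ ‖localAmp A m z x₀ 1 - Complex.I‖ ≤ C * ‖z‖⁻¹ := by
  set V := ∫ ξ in Ioi x₀, |deriv m ξ| with hV
  have hV0 : 0 ≤ V := integral_nonneg fun ξ => abs_nonneg _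
  set T := Real.exp (V / c) with hT
  have hT0 : 0 < T := Real.exp_pos _
  -- Here 20T bounds the amplitude by Gronwall, 8/c measures β - i, 80TV/c² bounds the integrated
  -- rotation of the eigenvectors, and 24/c measures β² + 1.
  refine ⟨8 / c * (20 * T) * 2 + 80 * T * V / c ^ 2 * 2 + 24 / c, fun z hz hR => ?_⟩
  have hz0 : 0 < ‖z‖ := pos_of_mul_pos_right (by linarith) hc.le
  set w := localAmp A m z with hw
  have hwd := hasDerivAt_localAmp hm hc hA hcm hz hR
  have hwc : Continuous w := continuous_localAmp hm hc hA hcm hz hR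
  have hwl : Tendsto w atTop (𝓝 (eigvec A z)) := tendsto_localAmp hm hc hA hcm hz hR
  obtain ⟨C, hC⟩ := bounded_of_tendsto hwc hwl x₀
  set b : ℝ → ℝ := fun ξ => 4 / (c ^ 2 * ‖z‖) * |deriv m ξ| with hb
  have hb0 : ∀ ξ, 0 ≤ b ξ := fun ξ => by positivity
  have hbc : Continuous b := hm.continuous_deriv.abs.const_mul _
  have hbi : ∀ x, IntegrableOn b (Ioi x) := fun x =>
    (hm.integrable_deriv.norm.const_mul _).integrableOn
  set β' : ℝ → ℂ := fun x => Complex.I * beta (m x) z * deriv m x / (2 * wave (m x) z * m x)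
    with hβ'
  have hβd : ∀ x, HasDerivAt (fun x => beta (m x) z) (β' x) x := hasDerivAt_localBeta hm hz
  have hβ'b : ∀ x, ‖β' x‖ ≤ b x := norm_deriv_localBeta_le hm hc hcm hz hR
  have hβc : Continuous fun x => beta (m x) z :=
    continuous_iff_continuousAt.2 fun x => (hβd x).continuousAt
  have hkc := continuous_localWave hm hz
  have hβ'c : Continuous β' := by
    have h1 := hm.continuous
    have h2 := hm.continuous_deriv
    refine Continuous.div (by fun_prop) (by fun_prop) fun x => ?_
    have := wave_ne_zero_of_upper (hm.pos_apply x) hz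
    have h3 : (m x : ℂ) ≠ 0 := Complex.ofReal_ne_zero.2 (hm.pos_apply x).ne'
    simp [this, h3]
  have hβl : Tendsto (fun x => beta (m x) z) atTop (𝓝 (beta A z)) := by
    have h1 : Tendsto (fun x => wave (m x) z) atTop (𝓝 (wave A z)) :=
      (continuousAt_wave_left hm.pos hz).tendsto.comp hm.tendsto_atTop
    have h2 : Tendsto (fun x => (m x : ℂ)) atTop (𝓝 (A : ℂ)) :=
      (Complex.continuous_ofReal.tendsto _).comp hm.tendsto_atTop
    simp only [beta_eq]
    exact (h2.const_mul z).div ((h1.const_mul _).const_sub 1)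
      (one_sub_wave_ne_zero hm.pos (upper_subset_closedUpper hz))
  have hw0l : Tendsto (fun x => w x 0) atTop (𝓝 1) := (tendsto_pi_nhds.1 hwl) 0
  have hw1l : Tendsto (fun x => w x 1) atTop (𝓝 (beta A z)) := (tendsto_pi_nhds.1 hwl) 1
  have hw0c : Continuous fun x => w x 0 := (continuous_apply 0).comp hwc
  have hw1c : Continuous fun x => w x 1 := (continuous_apply 1).comp hwc
  have hzc := upper_subset_closedUpper hz
  -- the two components along the local eigenvectors
  set q : ℝ → ℂ := fun x => beta (m x) z * w x 1 - w x 0 with hq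
  set p : ℝ → ℂ := fun x => beta (m x) z * w x 0 - w x 1 with hp
  -- Up to the factor β² - 1, q and p are the coefficients along (1, β) and (β, 1). With the phase
  -- removed, q is driven by β' alone.
  have hqd : ∀ x, HasDerivAt q (β' x * w x 1) x := fun x => by
    refine (((hβd x).mul (hwd x).2).sub (hwd x).1).congr_deriv ?_
    have h1 := mul_beta (hm.pos_apply x) hzc
    have h2 := beta_mul (hm.pos_apply x) hzc
    linear_combination (-(w x 0) / 2) * h1 + (w x 1 / 2) * h2
  have hpd : ∀ x, HasDerivAt p (β' x * w x 0 - 2 * Complex.I * wave (m x) z * p x) x := fun x => by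
    refine (((hβd x).mul (hwd x).1).sub (hwd x).2).congr_deriv ?_
    have h1 := mul_beta (hm.pos_apply x) hzc
    have h2 := beta_mul (hm.pos_apply x) hzc
    simp only [hp]
    linear_combination (w x 1 / 2) * h1 - (w x 0 / 2) * h2
  -- The integrating factor e^{2iφ} removes the large term from the equation of p; since its modulus
  -- decreases, it can be cancelled after integrating from x to +∞.
  set e : ℝ → ℂ := fun x => Complex.exp (2 * Complex.I * localPhase A m z x) with he
  have hea : Antitone fun x => ‖e x‖ := antitone_localPhase hm hc hA hcm hz hR
  have hed : ∀ x, HasDerivAt e (e x * (2 * Complex.I * wave (m x) z)) x := fun x =>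
    ((hasDerivAt_localPhase hm hc hA hcm hz hR x).const_mul (2 * Complex.I)).cexp
  have hec : Continuous e := continuous_iff_continuousAt.2 fun x => (hed x).continuousAt
  have hepd : ∀ x, HasDerivAt (fun x => e x * p x) (e x * (β' x * w x 0)) x := fun x => by
    refine ((hed x).mul (hpd x)).congr_deriv ?_
    ring
  have hbw : ∀ x, x₀ ≤ x → IntegrableOn (fun ξ => b ξ * ‖w ξ‖) (Ioi x) := fun x hx =>
    Integrable.mono' ((hbi x).mul_const C) (hbc.mul hwc.norm).aestronglyMeasurable
      ((ae_restrict_iff' measurableSet_Ioi).2 (ae_of_all _ fun ξ hξ => by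
        rw [Real.norm_of_nonneg (mul_nonneg (hb0 ξ) (norm_nonneg _))]
        exact mul_le_mul_of_nonneg_left (hC ξ (hx.trans (le_of_lt hξ))) (hb0 ξ)))
  have hβw : ∀ i ξ, ‖β' ξ * w ξ i‖ ≤ b ξ * ‖w ξ‖ := fun i ξ => by
    rw [norm_mul]
    exact mul_le_mul (hβ'b ξ) (norm_le_pi_norm (w ξ) i) (norm_nonneg _) (hb0 ξ)
  have hql : Tendsto q atTop (𝓝 (beta A z * beta A z - 1)) := (hβl.mul hw1l).sub hw0l
  have hpl : Tendsto p atTop (𝓝 0) := by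
    have := (hβl.mul hw0l).sub hw1l
    rwa [mul_one, sub_self] at this
  have hqle : ∀ x, x₀ ≤ x → ‖q x - (beta A z * beta A z - 1)‖ ≤ ∫ ξ in Ioi x, b ξ * ‖w ξ‖ := by
    intro x hx
    have hint : IntegrableOn (fun ξ => β' ξ * w ξ 1) (Ioi x) :=
      Integrable.mono' (hbw x hx) (hβ'c.mul hw1c).aestronglyMeasurable (ae_of_all _ (hβw 1))
    have := integral_Ioi_of_hasDerivAt_of_tendsto' (fun y _ => hqd y) hint hql
    rw [norm_sub_rev, ← this]
    exact norm_integral_le_of_norm_le (hbw x hx) (ae_of_all _ (hβw 1))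
  have hple : ∀ x, x₀ ≤ x → ‖p x‖ ≤ ∫ ξ in Ioi x, b ξ * ‖w ξ‖ := by
    intro x hx
    have hle : ∀ᵐ ξ ∂volume.restrict (Ioi x), ‖e ξ * (β' ξ * w ξ 0)‖ ≤
        ‖e x‖ * (b ξ * ‖w ξ‖) :=
      (ae_restrict_iff' measurableSet_Ioi).2 (ae_of_all _ fun ξ hξ => by
        rw [norm_mul]
        exact mul_le_mul (hea (le_of_lt hξ)) (hβw 0 ξ) (norm_nonneg _) (norm_nonneg _))
    have hint : IntegrableOn (fun ξ => e ξ * (β' ξ * w ξ 0)) (Ioi x) :=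
      Integrable.mono' ((hbw x hx).const_mul ‖e x‖)
        (hec.mul (hβ'c.mul hw0c)).aestronglyMeasurable hle
    have hlim : Tendsto (fun y => e y * p y) atTop (𝓝 0) := by
      rw [tendsto_zero_iff_norm_tendsto_zero]
      have h1 := (hpl.norm).const_mul ‖e x‖
      rw [norm_zero, mul_zero] at h1
      refine squeeze_zero' (Eventually.of_forall fun y => norm_nonneg _) ?_ h1
      filter_upwards [eventually_ge_atTop x] with y hy
      rw [norm_mul]
      exact mul_le_mul_of_nonneg_right (hea hy) (norm_nonneg _)
    have h2 := integral_Ioi_of_hasDerivAt_of_tendsto' (fun y _ => hepd y) hint hlim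
    have h3 := norm_integral_le_of_norm_le ((hbw x hx).const_mul ‖e x‖) hle
    rw [h2, zero_sub, norm_neg, norm_mul, integral_const_mul] at h3
    exact le_of_mul_le_mul_left h3 (norm_pos_iff.2 (Complex.exp_ne_zero _))
  have hβA := norm_beta_le_two hc hA hz hR
  have hq_lim : ‖beta A z * beta A z - 1‖ ≤ 5 := by
    refine (norm_sub_le _ _).trans ?_
    rw [norm_mul, norm_one]
    have := mul_le_mul hβA.2.1 hβA.2.1 (norm_nonneg _) (by norm_num)
    linarith
  have hwle : ∀ x, ‖w x‖ ≤ 2 * (‖p x‖ + ‖q x‖) := by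
    intro x
    obtain ⟨-, h1, h2⟩ := norm_beta_le_two hc (hcm x) hz hR
    have e0 : w x 0 * (beta (m x) z ^ 2 - 1) = beta (m x) z * p x + q x := by
      simp only [hp, hq]; ring
    have e1 : w x 1 * (beta (m x) z ^ 2 - 1) = p x + beta (m x) z * q x := by
      simp only [hp, hq]; ring
    refine (pi_norm_le_iff_of_nonneg (by positivity)).2 fun i => ?_
    have h3 : ∀ i, ‖w x i‖ ≤ ‖w x i * (beta (m x) z ^ 2 - 1)‖ := fun i => by
      rw [norm_mul]; exact le_mul_of_one_le_right (norm_nonneg _) h2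
    have h4 := mul_le_mul_of_nonneg_right h1 (norm_nonneg (p x))
    have h5 := mul_le_mul_of_nonneg_right h1 (norm_nonneg (q x))
    have h6 := norm_nonneg (p x)
    have h7 := norm_nonneg (q x)
    refine (h3 i).trans ?_
    fin_cases i
    · change ‖w x 0 * (beta (m x) z ^ 2 - 1)‖ ≤ _
      rw [e0]
      refine (norm_add_le _ _).trans ?_
      rw [norm_mul]; linarith
    · change ‖w x 1 * (beta (m x) z ^ 2 - 1)‖ ≤ _
      rw [e1]
      refine (norm_add_le _ _).trans ?_
      rw [norm_mul]; linarith
  -- Gronwall with majorant 4b. Its weight exp(8∫b) = exp(32V/(c²‖z‖)) is at most T exactly because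
  -- 32 ≤ c‖z‖; the constant 10 is twice the bound 5 for β² - 1.
  have hgr : ∀ x, x₀ ≤ x → ‖w x‖ ≤ 20 * T := by
    intro x hx
    have h1 := gronwall_Ioi (ρ := fun ξ => 4 * b ξ) (f := fun x => ‖w x‖) (a := 10)
      (fun ξ => mul_nonneg (by norm_num) (hb0 ξ)) (hbc.const_mul 4) (fun x => (hbi x).const_mul 4)
      hwc.norm (fun x => norm_nonneg _) (by norm_num) hC (fun x hx => by
        have h2 := hqle x hx
        have h3 := hple x hx
        have h4 : ‖q x‖ ≤ ‖q x - (beta A z * beta A z - 1)‖ + ‖beta A z * beta A z - 1‖ := by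
          simpa using norm_add_le (q x - (beta A z * beta A z - 1)) (beta A z * beta A z - 1)
        have h5 : ∫ ξ in Ioi x, 4 * b ξ * ‖w ξ‖ = 4 * ∫ ξ in Ioi x, b ξ * ‖w ξ‖ := by
          rw [← integral_const_mul]; congr 1; ext ξ; ring
        rw [h5]
        linarith [hwle x]) x hx
    have h2 : tailWeight (fun ξ => 4 * b ξ) x ≤ T := by
      refine (tailWeight_anti (fun ξ => mul_nonneg (by norm_num) (hb0 ξ))
        (fun x => (hbi x).const_mul 4) hx).trans ?_
      rw [tailWeight, hT, integral_const_mul, hb, integral_const_mul]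
      refine Real.exp_le_exp.2 ?_
      rw [← hV]
      have h3 : 2 * (4 * (4 / (c ^ 2 * ‖z‖) * V)) = 32 / (c * ‖z‖) * (V / c) := by
        field_simp; ring
      rw [h3]
      refine mul_le_of_le_one_left (by positivity) ?_
      rw [div_le_one (by positivity)]; exact hR
    linarith
  have hI : ∫ ξ in Ioi x₀, b ξ * ‖w ξ‖ ≤ 80 * T * V / c ^ 2 * ‖z‖⁻¹ := by
    have h1 : ∫ ξ in Ioi x₀, b ξ * ‖w ξ‖ ≤ ∫ ξ in Ioi x₀, b ξ * (20 * T) :=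
      setIntegral_mono_on (hbw x₀ le_rfl) ((hbi x₀).mul_const _) measurableSet_Ioi fun ξ hξ =>
        mul_le_mul_of_nonneg_left (hgr ξ (le_of_lt hξ)) (hb0 ξ)
    refine h1.trans (le_of_eq ?_)
    rw [integral_mul_const, hb, integral_const_mul, ← hV]
    field_simp; ring
  have hβm : ‖beta (m x₀) z - Complex.I‖ ≤ 8 / c * ‖z‖⁻¹ :=
    (norm_beta_sub_I_le hc (hcm x₀) hz hR).trans (le_of_eq (by field_simp))
  have hβA' : ‖beta A z - Complex.I‖ ≤ 8 / c * ‖z‖⁻¹ :=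
    (norm_beta_sub_I_le hc hA hz hR).trans (le_of_eq (by field_simp))
  have hw0 := (norm_le_pi_norm (w x₀) 0).trans (hgr x₀ le_rfl)
  have hw1 := (norm_le_pi_norm (w x₀) 1).trans (hgr x₀ le_rfl)
  have hp0 := (hple x₀ le_rfl).trans hI
  -- As β tends to i, the limit β² - 1 of q tends to -2.
  have hq0 : ‖q x₀ + 2‖ ≤ 80 * T * V / c ^ 2 * ‖z‖⁻¹ + 24 / c * ‖z‖⁻¹ := by
    have h1 : q x₀ + 2 = (q x₀ - (beta A z * beta A z - 1)) +
        (beta A z - Complex.I) * (beta A z + Complex.I) := by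
      linear_combination Complex.I_sq
    rw [h1]
    refine (norm_add_le _ _).trans (add_le_add ((hqle x₀ le_rfl).trans hI) ?_)
    rw [norm_mul]
    have h2 : ‖beta A z + Complex.I‖ ≤ 3 := by
      refine (norm_add_le _ _).trans ?_
      rw [Complex.norm_I]; linarith [hβA.2.1]
    calc _ ≤ 8 / c * ‖z‖⁻¹ * 3 := mul_le_mul hβA' h2 (norm_nonneg _) (by positivity)
      _ = _ := by ring
  have hd1 : ‖w x₀ 1 - Complex.I * w x₀ 0‖ ≤
      8 / c * (20 * T) * ‖z‖⁻¹ + 80 * T * V / c ^ 2 * ‖z‖⁻¹ := by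
    have h1 : w x₀ 1 - Complex.I * w x₀ 0 = (beta (m x₀) z - Complex.I) * w x₀ 0 - p x₀ := by
      simp only [hp]; ring
    rw [h1]
    refine (norm_sub_le _ _).trans (add_le_add ?_ hp0)
    rw [norm_mul]
    calc _ ≤ 8 / c * ‖z‖⁻¹ * (20 * T) := mul_le_mul hβm hw0 (norm_nonneg _) (by positivity)
      _ = _ := by ring
  have hd0 : ‖w x₀ 0 - 1‖ ≤ 8 / c * (20 * T) * ‖z‖⁻¹ + 80 * T * V / c ^ 2 * ‖z‖⁻¹ +
      12 / c * ‖z‖⁻¹ := by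
    have h1 : w x₀ 0 - 1 = (1 / 2 : ℂ) * ((beta (m x₀) z - Complex.I) * w x₀ 1 +
        Complex.I * (w x₀ 1 - Complex.I * w x₀ 0) - (q x₀ + 2)) := by
      simp only [hq]
      linear_combination (w x₀ 0 / 2) * Complex.I_sq
    rw [h1, norm_mul]
    have h2 : ‖(beta (m x₀) z - Complex.I) * w x₀ 1‖ ≤ 8 / c * (20 * T) * ‖z‖⁻¹ := by
      rw [norm_mul]
      calc _ ≤ 8 / c * ‖z‖⁻¹ * (20 * T) := mul_le_mul hβm hw1 (norm_nonneg _) (by positivity)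
        _ = _ := by ring
    have h3 := norm_sub_le ((beta (m x₀) z - Complex.I) * w x₀ 1 +
        Complex.I * (w x₀ 1 - Complex.I * w x₀ 0)) (q x₀ + 2)
    have h4 := norm_add_le ((beta (m x₀) z - Complex.I) * w x₀ 1)
        (Complex.I * (w x₀ 1 - Complex.I * w x₀ 0))
    rw [norm_mul Complex.I, Complex.norm_I, one_mul] at h4
    have h5 : ‖(1 / 2 : ℂ)‖ = 1 / 2 := by norm_num
    rw [h5]
    have h6 : 24 / c * ‖z‖⁻¹ = 2 * (12 / c * ‖z‖⁻¹) := by ring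
    linarith
  have hpos1 : 0 ≤ 12 / c * ‖z‖⁻¹ := by positivity
  have hpos2 : 0 ≤ 8 / c * (20 * T) * ‖z‖⁻¹ := by positivity
  have hpos3 : 0 ≤ 80 * T * V / c ^ 2 * ‖z‖⁻¹ := by positivity
  have hfin : (8 / c * (20 * T) * 2 + 80 * T * V / c ^ 2 * 2 + 24 / c) * ‖z‖⁻¹ =
      2 * (8 / c * (20 * T) * ‖z‖⁻¹) + 2 * (80 * T * V / c ^ 2 * ‖z‖⁻¹) +
        2 * (12 / c * ‖z‖⁻¹) := by ring
  rw [hfin]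
  refine ⟨by linarith, ?_⟩
  have h1 : w x₀ 1 - Complex.I = (w x₀ 1 - Complex.I * w x₀ 0) + Complex.I * (w x₀ 0 - 1) := by
    ring
  rw [h1]
  refine (norm_add_le _ _).trans ?_
  rw [norm_mul Complex.I, Complex.norm_I, one_mul]
  linarith

end LocalPhase

end MCH

end

/-! ### Normalization at infinity. -/

noncomputable section

namespace MCH

section AtInfinity

/-- `f = a + O(1/z)` at infinity in the upper half-plane. -/
def CloseAtInfinity (f : ℂ → ℂ) (a : ℂ) : Prop :=
  (fun z => f z - a) =O[Bornology.cobounded ℂ ⊓ 𝓟 upper] fun z => z⁻¹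

namespace CloseAtInfinity

variable {f g : ℂ → ℂ} {a b : ℂ}

theorem tendsto_inv : Tendsto (fun z : ℂ => z⁻¹) (Bornology.cobounded ℂ ⊓ 𝓟 upper) (𝓝 0) :=
  tendsto_inv₀_cobounded.mono_left inf_le_left

theorem eventually_mem : ∀ᶠ z in Bornology.cobounded ℂ ⊓ 𝓟 upper, z ∈ upper :=
  eventually_inf_principal.2 (Eventually.of_forall fun _ h => h)

theorem eventually_le {c : ℝ} (hc : 0 < c) (B : ℝ) :
    ∀ᶠ z in Bornology.cobounded ℂ ⊓ 𝓟 upper, B ≤ c * ‖z‖ :=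
  ((tendsto_norm_cobounded_atTop.const_mul_atTop hc).eventually_ge_atTop B).filter_mono inf_le_left

theorem tendsto (h : CloseAtInfinity f a) :
    Tendsto f (Bornology.cobounded ℂ ⊓ 𝓟 upper) (𝓝 a) := by
  have := (IsBigO.trans_tendsto h tendsto_inv).add_const a
  simpa using this

theorem congr (h : CloseAtInfinity f a) (hfg : ∀ z ∈ upper, f z = g z) : CloseAtInfinity g a :=
  IsBigO.congr' h (by filter_upwards [eventually_mem] with z hz; rw [hfg z hz]) EventuallyEq.rfl

theorem of_bound {C c : ℝ} (hc : 0 < c)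
    (h : ∀ z ∈ upper, 32 ≤ c * ‖z‖ → ‖f z - a‖ ≤ C * ‖z‖⁻¹) : CloseAtInfinity f a := by
  refine IsBigO.of_bound C ?_
  filter_upwards [eventually_mem, eventually_le hc 32] with z h1 h2
  rw [norm_inv]
  exact h z h1 h2

theorem mul (hf : CloseAtInfinity f a) (hg : CloseAtInfinity g b) :
    CloseAtInfinity (fun z => f z * g z) (a * b) := by
  have h1 := (IsBigO.mul hf (hg.tendsto.isBigO_one ℂ)).congr_right fun z => mul_one _
  have h2 := IsBigO.const_mul_left hg a
  refine (h1.add h2).congr_left fun z => ?_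
  ring

theorem sub (hf : CloseAtInfinity f a) (hg : CloseAtInfinity g b) :
    CloseAtInfinity (fun z => f z - g z) (a - b) := by
  refine (IsBigO.sub hf hg).congr_left fun z => ?_
  ring

theorem inv (hf : CloseAtInfinity f a) (ha : a ≠ 0) :
    CloseAtInfinity (fun z => (f z)⁻¹) a⁻¹ := by
  have h1 := (IsBigO.mul hf ((hf.tendsto.inv₀ ha).isBigO_one ℂ)).congr_right fun z => mul_one _
  refine (h1.const_mul_left (-a⁻¹)).congr' ?_ EventuallyEq.rfl
  filter_upwards [hf.tendsto.eventually_ne ha] with z hz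
  field_simp
  ring

theorem exp (hf : CloseAtInfinity f 0) : CloseAtInfinity (fun z => Complex.exp (f z)) 1 := by
  have h1 := (Complex.hasDerivAt_exp 0).isBigO_sub.comp_tendsto hf.tendsto
  simp only [Function.comp_def, Complex.exp_zero] at h1
  exact h1.trans hf

end CloseAtInfinity

variable {A : ℝ} {m : ℝ → ℝ}

/-- The local phase differs from k·y(x) by an O(1/z) integral, whose exponential is 1 + O(1/z). This
is how y(x) becomes the parameter of the Riemann–Hilbert problem. -/
theorem closeAtInfinity_jostR (hm : RightProfile A m) (x : ℝ) (i : Fin 2) : CloseAtInfinity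
    (fun z => Complex.exp (-(Complex.I * wave A z * yOfX A m x)) * jostR A m x z i)
    ((![1, Complex.I] : Fin 2 → ℂ) i) := by
  obtain ⟨c, hc, hA, hcm⟩ := hm.exists_lower
  obtain ⟨C, hC⟩ := exists_norm_localAmp_sub_le hm hc hA hcm x
  have h1 : CloseAtInfinity (fun z => localAmp A m z x i) ((![1, Complex.I] : Fin 2 → ℂ) i) := by
    refine CloseAtInfinity.of_bound (C := C) hc fun z hz hR => ?_
    fin_cases i
    · exact (hC z hz hR).1
    · exact (hC z hz hR).2
  have h2 : CloseAtInfinity (fun z => -(Complex.I *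
      ∫ ξ in Ioi x, (wave (m ξ) z - wave A z * m ξ / A))) 0 := by
    refine CloseAtInfinity.of_bound (C := 1 / c ^ 2 * ∫ ξ in Ioi x, |m ξ - A|) hc
      fun z hz hR => ?_
    rw [sub_zero, norm_neg, norm_mul, Complex.norm_I, one_mul]
    refine (norm_integral_phaseDefect_le hm hc hA hcm hz hR x).trans (le_of_eq ?_)
    rw [one_div, mul_inv]; ring
  have h3 := h2.exp.mul h1
  rw [one_mul] at h3
  refine h3.congr fun z _ => ?_
  rw [localAmp, Pi.smul_apply, smul_eq_mul, ← mul_assoc, ← Complex.exp_add, localPhase]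
  congr 2
  ring

theorem closeAtInfinity_alpha (hA : 0 < A) :
    CloseAtInfinity (alpha A) (Real.sqrt (1 / 2) * Complex.I) := by
  refine CloseAtInfinity.of_bound (C := 2 / A) hA fun z hz hR => ?_
  refine (norm_alpha_sub_le hA hz hR).trans (le_of_eq ?_)
  rw [div_mul_eq_div_div, div_eq_mul_inv _ ‖z‖]

/-- `rhCore` is normalized at infinity. -/
theorem closeAtInfinity_rhCore {A₁ A₂ : ℝ} (hm : StepProfile A₁ A₂ m) (x : ℝ) (i j : Fin 2) :
    CloseAtInfinity (fun z => rhCore A₁ A₂ m x (yOfX A₂ m x) z i j) (rhPost i j) := by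
  have hR := closeAtInfinity_jostR hm.right x
  have hL := closeAtInfinity_jostR hm.left (-x)
  have hα := closeAtInfinity_alpha hm.right.pos
  have hI := Complex.I_sq
  have hs2 := sqrt_half_sq
  fin_cases j
  · have hW := ((hL 1).mul (hR 1)).sub ((hR 0).mul (hL 0))
    have hne : (Real.sqrt (1 / 2) * Complex.I) * (Complex.I * Complex.I - 1 * 1) ≠ 0 := by
      rw [Complex.I_mul_I]
      have := Complex.I_ne_zero
      simp [this]
      norm_num
    have h := (hL i.rev).mul ((hα.mul hW).inv hne)
    have e : (![1, Complex.I] : Fin 2 → ℂ) i.rev *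
        (Real.sqrt (1 / 2) * Complex.I * (Complex.I * Complex.I - 1 * 1))⁻¹ = rhPost i 0 := by
      have e1 : (Real.sqrt (1 / 2) * Complex.I * (Complex.I * Complex.I - 1 * 1))⁻¹ =
          Real.sqrt (1 / 2) * Complex.I := by
        refine inv_eq_of_mul_eq_one_left ?_
        linear_combination (Real.sqrt (1 / 2) : ℂ) ^ 2 * (Complex.I ^ 2 - 2) * hI + 2 * hs2
      rw [e1, rhPost]
      generalize (Real.sqrt (1 / 2) : ℂ) = t
      fin_cases i
      · simp
        linear_combination t * hI
      · simp
    simp only [Matrix.cons_val_zero, Matrix.cons_val_one] at h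
    rw [show rhPost i ⟨0, by norm_num⟩ = rhPost i 0 from rfl, ← e]
    refine h.congr fun z hz => ?_
    have hzc := upper_subset_closedUpper hz
    have hα0 := alpha_ne_zero (wave_im_nonneg hm.right.pos hzc)
    have hW0 := wronskian_ne_zero_of_upper hm hz
    change _ = rhCore A₁ A₂ m x (yOfX A₂ m x) z i 0
    have hψ : jostR A₁ (fun y => m (-y)) (-x) z i.rev = jostL A₁ m x z i := by
      fin_cases i <;> rfl
    rw [rhCore_zero, fHat_zero, hψ, Complex.exp_neg, Complex.exp_neg]
    have h1 := Complex.exp_ne_zero (Complex.I * wave A₁ z * yOfX A₁ (fun y => m (-y)) (-x))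
    have h2 := Complex.exp_ne_zero (Complex.I * wave A₂ z * yOfX A₂ m x)
    have hw : jostR A₁ (fun y => m (-y)) (-x) z 1 * jostR A₂ m x z 1 -
        jostR A₂ m x z 0 * jostR A₁ (fun y => m (-y)) (-x) z 0 = wronskian A₁ A₂ m z :=
      wronskian_eq hm hzc x
    rw [← hw] at hW0 ⊢
    generalize Complex.exp (Complex.I * wave A₁ z * yOfX A₁ (fun y => m (-y)) (-x)) = E₁ at *
    generalize Complex.exp (Complex.I * wave A₂ z * yOfX A₂ m x) = E₂ at *
    -- The left exponential E₁ occurs both in the left column and in the Wronskian and cancels; what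
    -- is left is the right exponential e^{f} of the first column.
    have e2 : ∀ a b c d : ℂ, E₁⁻¹ * a * (E₂⁻¹ * b) - E₂⁻¹ * c * (E₁⁻¹ * d) =
        E₁⁻¹ * E₂⁻¹ * (a * b - c * d) := fun a b c d => by ring
    rw [e2]
    field_simp
  · have h := hα.mul (hR i)
    have e : Real.sqrt (1 / 2) * Complex.I * (![1, Complex.I] : Fin 2 → ℂ) i = rhPost i 1 := by
      rw [rhPost]
      generalize (Real.sqrt (1 / 2) : ℂ) = t
      fin_cases i
      · simp
      · simp
        linear_combination t * hI
    rw [show rhPost i ⟨1, by norm_num⟩ = rhPost i 1 from rfl, ← e]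
    refine h.congr fun z hz => ?_
    change _ = rhCore A₁ A₂ m x (yOfX A₂ m x) z i 1
    rw [rhCore_one, fHat_zero]
    ring

end AtInfinity

end MCH

end

/-! ### Solvability of the Riemann–Hilbert problem. -/

noncomputable section

namespace MCH

section Solvability

variable {A₁ A₂ : ℝ} {m : ℝ → ℝ}

theorem continuousOn_fHat (A y : ℝ) : ContinuousOn (fHat A y 0) closedUpper := by
  have : fHat A y 0 = fun z => Complex.I * wave A z * y := funext fun z => fHat_zero y
  rw [this]
  have := continuousOn_wave A
  fun_prop

theorem differentiableOn_rhCore (hm : StepProfile A₁ A₂ m) (x y : ℝ) (i j : Fin 2) :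
    DifferentiableOn ℂ (fun z => rhCore A₁ A₂ m x y z i j) upper := by
  have hf : DifferentiableOn ℂ (fHat A₂ y 0) upper := by
    have : fHat A₂ y 0 = fun z => Complex.I * wave A₂ z * y := funext fun z => fHat_zero y
    rw [this]
    have := differentiableOn_wave A₂
    fun_prop
  have hα := differentiableOn_alpha hm.right.pos
  fin_cases j
  · exact (hf.cexp.mul ((differentiableOn_pi.1 (differentiableOn_jostL hm.left x)) i)).div
      (hα.mul (differentiableOn_wronskian hm)) fun z hz => mul_ne_zero
        (alpha_ne_zero (wave_im_nonneg hm.right.pos (upper_subset_closedUpper hz)))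
        (wronskian_ne_zero_of_upper hm hz)
  · exact hf.neg.cexp.mul
      (hα.mul ((differentiableOn_pi.1 (differentiableOn_jostR hm.right x)) i))

theorem tendsto_rhCore (hm : StepProfile A₁ A₂ m)
    (hs : ∀ k : ℝ, |k| < 1 / A₂ → c11 A₁ A₂ m k ≠ 0) {s : ℝ} (h2 : |s| ≠ 1 / A₂)
    (x y : ℝ) (i j : Fin 2) :
    Tendsto (fun z => rhCore A₁ A₂ m x y z i j) (𝓝[upper] (s : ℂ))
      (𝓝 (rhCore A₁ A₂ m x y s i j)) := by
  have hz := ofReal_mem_closedUpper s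
  have hA := hm.right.pos
  have hk := wave_ne_zero_ofReal hA h2
  have hf := ((continuousOn_fHat A₂ y) _ hz).mono upper_subset_closedUpper
  have hα := ((continuousOn_alpha hA) _ ⟨hz, hk⟩).mono
    (s := upper) fun z hz => ⟨upper_subset_closedUpper hz, wave_ne_zero_of_upper hA hz⟩
  have hW := ((continuousOn_wronskian hm) _ hz).mono upper_subset_closedUpper
  have hL := (((continuousOn_pi.1 (continuousOn_jostL hm.left x)) i) _ hz).mono
    upper_subset_closedUpper
  have hR := (((continuousOn_pi.1 (continuousOn_jostR hm.right x)) i) _ hz).mono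
    upper_subset_closedUpper
  fin_cases j
  · exact (hf.cexp.mul hL).div (hα.mul hW) (mul_ne_zero (alpha_ne_zero (wave_im_nonneg hA hz))
      (wronskian_ne_zero_of_solitonless hm hs h2))
  · exact hf.neg.cexp.mul (hα.mul hR)

/-- The point x is frozen: the problem with parameter y = y(x) is solved by the Jost data at this
single point. -/
theorem isRightRHSolution_rhExtend_rhCore (hm : StepProfile A₁ A₂ m)
    (hs : ∀ k : ℝ, |k| < 1 / A₂ → c11 A₁ A₂ m k ≠ 0) (x : ℝ) :
    IsRightRHSolution A₁ A₂ (reflection A₁ A₂ m) (yOfX A₂ m x) 0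
      (rhExtend (rhCore A₁ A₂ m x (yOfX A₂ m x))) :=
  isRightRHSolution_rhExtend (differentiableOn_rhCore hm x _)
    (fun _ _ h2 => tendsto_rhCore hm hs h2 x _)
    (fun _ h1 h2 => rhCore_jump hm hs h1 h2 x _)
    (fun _ hp => isBigO_rhCore_branch hm hp x _) (closeAtInfinity_rhCore hm x)

theorem det_jumpMatrix (hm : StepProfile A₁ A₂ m)
    (hs : ∀ k : ℝ, |k| < 1 / A₂ → c11 A₁ A₂ m k ≠ 0) (y : ℝ) {s : ℝ} (h1 : |s| ≠ 1 / A₁)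
    (h2 : |s| ≠ 1 / A₂) : (jumpMatrix A₁ A₂ (reflection A₁ A₂ m) y 0 s).det = 1 := by
  have hE : ∀ θ, (expSigma3 θ).det = 1 := fun θ => by
    rw [expSigma3, Matrix.det_fin_two_of, ← Complex.exp_add]; simp
  rcases lt_or_gt_of_ne h2 with h2' | h2'
  · rw [jumpMatrix, if_neg h2'.not_gt, sigma1, Matrix.det_smul, Matrix.det_fin_two_of]
    simp
  · rw [jumpMatrix, if_pos h2', Matrix.det_mul, Matrix.det_mul, hE, hE, one_mul, mul_one, G0]
    rcases lt_or_gt_of_ne h1 with h1' | h1'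
    · have hc := c11_ne_zero hm hs h1 h2
      have hr : reflection A₁ A₂ m s ≠ 0 := by
        rw [reflection, c21_eq_of_gt hm h1' h2']
        simp [hc]
      rw [if_neg h1'.not_gt, Matrix.det_fin_two_of]
      field_simp
      ring
    · rw [if_pos h1', Matrix.det_fin_two_of, ← Complex.mul_conj']
      ring

end Solvability

end MCH

end

/-! ### Conclusion. -/

namespace MCH

theorem HasExpansionAtZero.congr {N N' : ℂ → Matrix (Fin 2) (Fin 2) ℂ} {a b c : ℝ}
    (h : HasExpansionAtZero N a b c) (hN : ∀ z ∈ upper, N z = N' z) :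
    HasExpansionAtZero N' a b c := fun i j =>
  (h i j).congr' (by filter_upwards [self_mem_nhdsWithin] with z hz; rw [hN z hz])
    EventuallyEq.rfl

end MCH

theorem mainTheorem7 (A₁ A₂ : ℝ) (hA₁ : 0 < A₁) (hA₁₂ : A₁ < A₂)
    (u₀ : ℝ → ℝ) (hu₀ : ContDiff ℝ 4 u₀)
    (hbot : Tendsto u₀ atBot (𝓝 A₁)) (htop : Tendsto u₀ atTop (𝓝 A₂))
    (hpos : ∀ x, 0 < MCH.momentum u₀ x)
    (hleft : ∀ n : ℕ, n ≤ 2 →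
      IntegrableOn (fun x => x ^ n * (MCH.momentum u₀ x - A₁)) (Iic 0))
    (hright : ∀ n : ℕ, n ≤ 2 →
      IntegrableOn (fun x => x ^ n * (MCH.momentum u₀ x - A₂)) (Ici 0))
    (hderiv : ∀ n l : ℕ, n ≤ 2 → 1 ≤ l → l ≤ 2 →
      Integrable (fun x => x ^ n * iteratedDeriv l (MCH.momentum u₀) x))
    (hsolitonless : ∀ k : ℝ, |k| < 1 / A₂ → MCH.c11 A₁ A₂ (MCH.momentum u₀) k ≠ 0)
    (y : ℝ) :
    (∃ N : ℂ → Matrix (Fin 2) (Fin 2) ℂ, MCH.IsRightRHSolution A₁ A₂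
      (MCH.reflection A₁ A₂ (MCH.momentum u₀)) y 0 N) ∧
    ∀ N : ℂ → Matrix (Fin 2) (Fin 2) ℂ,
      MCH.IsRightRHSolution A₁ A₂ (MCH.reflection A₁ A₂ (MCH.momentum u₀)) y 0 N →
      (∃ a₁ a₂ a₃ : ℝ, a₁ ≠ 0 ∧ MCH.HasExpansionAtZero N a₁ a₂ a₃) ∧
      ∀ a₁ a₂ a₃ : ℝ, MCH.HasExpansionAtZero N a₁ a₂ a₃ →
        a₁ * a₂ + a₁⁻¹ * a₃ = u₀ (MCH.xOfY A₂ (MCH.momentum u₀) y) := by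
  have hm : MCH.StepProfile A₁ A₂ (MCH.momentum u₀) :=
    MCH.stepProfile_momentum hA₁ hA₁₂ hu₀ hpos hleft hright
      (by simpa [iteratedDeriv_one] using hderiv 0 1 (by norm_num) le_rfl (by norm_num))
  set m := MCH.momentum u₀ with hmdef
  set x := MCH.xOfY A₂ m y with hx
  -- Every y is attained as y(x), so the explicit solution is available for each parameter.
  have hyx : MCH.yOfX A₂ m x = y := MCH.yOfX_xOfY hm.right y
  have hsol := MCH.isRightRHSolution_rhExtend_rhCore hm hsolitonless x
  have hexp := MCH.hasExpansionAtZero_rhExtend hm x (MCH.yOfX A₂ m x)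
  rw [hyx] at hsol hexp
  refine ⟨⟨_, hsol⟩, fun N hN => ?_⟩
  -- By uniqueness any solution agrees off the real line with the explicit one, and therefore has
  -- its expansion at zero.
  have heq := hN.unique hA₁ hm.right.pos
    (fun s h1 h2 => MCH.det_jumpMatrix hm hsolitonless y h1 h2) hsol
  refine ⟨⟨_, _, _, (Real.exp_pos _).ne', hexp.congr fun z hz => (heq z (Or.inl hz)).symm⟩,
    fun a₁ a₂ a₃ h => ?_⟩
  obtain ⟨rfl, rfl, rfl⟩ := h.unique (fun z hz => heq z (Or.inl hz)) hexp
  have htail := MCH.expTail_add_expTail hm hu₀ hbot htop x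
  -- The exponentials in y cancel in the two products, leaving e^{-x} and e^{x} in front of the two
  -- tails.
  have e1 : Real.exp ((y - x) / 2) * Real.exp (-(x + y) / 2) = Real.exp (-x) := by
    rw [← Real.exp_add]; congr 1; ring
  have e2 : (Real.exp ((y - x) / 2))⁻¹ * Real.exp ((x + y) / 2) = Real.exp x := by
    rw [← Real.exp_neg, ← Real.exp_add]; congr 1; ring
  linear_combination htail / 2 +
    MCH.expTail (fun y => m (-y)) (-x) / 2 * e1 + MCH.expTail m x / 2 * e2
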